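/- Let $s\ge 1$ be an integer, $\beta\neq 0$ and $\gamma\in\mathbb R$. For $t\ge 0$ let $T(t)*$ be the Fourier multiplier operator on $L^2(\mathbb R)$ with symbol $\exp\!\left(\frac{-t\xi^2+i\gamma t\xi^3}{1+\xi^2}\right)$ , where $\partial_x$ has symbol $i\xi$; then $(\partial_xT(t))*$ and $(1-\partial_x^2)^{-1}$ denote the Fourier multipliers with $i\xi$ times that symbol and with $1/(1+\xi^2)$. A global mild solution in $C^0([0,\infty);H^s(\mathbb R))$ of the Cauchy problem for the BBM–Burgers equation $$u_t-u_{xxt}-u_{xx}+\gamma u_{xxx}+\beta uu_x=0\quad (x\in\mathbb R,\ t>0),\qquad u(x,0)=u_0(x),$$ is a real-valued $u\in C^0([0,\infty);H^s(\mathbb R))$ such that for all $t\ge 0$ $$u(t)=T(t)*u_0-\frac{\beta}{2}\int_0^t(\partial_xT(t-\tau))*\bigl((1-\partial_x^2)^{-1}(u^2)\bigr)(\tau)\,d\tau .$$ For $M\in\mathbb R$ let $$\chi(x,t)=\frac1{\sqrt{1+t}}\,\chi_*\!\left(\frac{x}{\sqrt{1+t}}\right),\qquad \chi_*(x)=\frac1\beta\,\frac{(e^{\beta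 M/2}-1)e^{-x^2/4}}{\sqrt\pi+(e^{\beta M/2}-1)\int_{x/2}^\infty e^{-y^2}dy}$$ be the nonlinear diffusion wave of mass $M$ (with $\chi=0$ if $M=0$). **Theorem.** There is $\delta>0$, depending only on $s,\beta,\gamma$, such that the following holds. Let $\alpha>1$ and $K>0$, and let $u_0:\mathbb R\to\mathbb R$ be continuous with $|u_0(x)|\le K(1+|x|)^{-\alpha}$ for all $x\in\mathbb R$, $u_0\in H^s(\mathbb R)$ and $\|u_0\|_{H^s}+\|u_0\|_{L^1}\le\delta$. Put $M=\int_{\mathbb R}u_0(x)\,dx$. Then the Cauchy problem has a global mild solution $u\in C^0([0,\infty);H^s(\mathbb R))$, and it is the only one in this class. Moreover, for every $\varepsilon>0$ there is a constant $C$, depending only on $s,\beta,\gamma,\alpha,K,\varepsilon$, such that for all $t\ge0$ $$\|\partial_x^l(u(\cdot,t)-\chi(\cdot,t))\|_{L^2}\le C\begin{cases}(1+t)^{-\frac\alpha2+\frac14-\frac l2},&1<\alpha<2,\\(1+t)^{-\frac34-\frac l2+\varepsilon},&\alpha\ge2,\end{cases}\qquad 0\le l\le s,$$ $$\|\partial_x^l(u(\cdot,t)-\chi(\cdot,t))\|_{L^\infty}\le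 C\begin{cases}(1+t)^{-\frac\alpha2-\frac l2},&1<\alpha<2,\\(1+t)^{-1-\frac l2+\varepsilon},&\alpha\ge2,\end{cases}\qquad 0\le l\le s-1.$$ -/

import Mathlib

open MeasureTheory Filter Topology FourierTransform
open scoped ENNReal

noncomputable section

namespace BBMBurgers

/-- `g` is the `l`-th weak derivative of the locally integrable function `f` on the real line. -/
def IsWeakDeriv (l : ℕ) (f g : ℝ → ℝ) : Prop :=
  LocallyIntegrable f volume ∧ LocallyIntegrable g volume ∧
    ∀ φ : ℝ → ℝ, ContDiff ℝ ((⊤ : ℕ∞) : WithTop ℕ∞) φ → HasCompactSupport φ →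
      ∫ x, f x * iteratedDeriv l φ x = (-1) ^ l * ∫ x, g x * φ x

/-- `‖∂ₓˡ f‖_{Lᵖ}`, with value in `[0, ∞]`. The weak derivative is unique almost everywhere, so the
infimum is over the representatives of one function; it is `∞` if there is no weak derivative. -/
def derivNorm (l : ℕ) (p : ℝ≥0∞) (f : ℝ → ℝ) : ℝ≥0∞ :=
  ⨅ (g : ℝ → ℝ) (_ : IsWeakDeriv l f g), eLpNorm g p volume

/-- The norm `‖f‖_{Hˢ} = (∑_{n ≤ s} ‖∂ₓⁿ f‖_{L²}²)^{1/2}`, with value in `[0, ∞]`. -/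
def sobolevNorm (s : ℕ) (f : ℝ → ℝ) : ℝ≥0∞ :=
  (∑ n ∈ Finset.range (s + 1), derivNorm n 2 f ^ 2) ^ (1 / 2 : ℝ)

/-- `f ∈ Hˢ(ℝ)`. -/
def MemH (s : ℕ) (f : ℝ → ℝ) : Prop := MemLp f 2 volume ∧ sobolevNorm s f < ∞

/-- The real space `L²(ℝ)`. -/
abbrev L2 : Type := Lp ℝ 2 (volume : Measure ℝ)

/-- The complex space `L²(ℝ; ℂ)`, on which the Fourier transform acts. -/
abbrev L2C : Type := Lp ℂ 2 (volume : Measure ℝ)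

open scoped Classical in
/-- A square integrable function as an element of `L²(ℝ; ℂ)` (zero if not square integrable). -/
def toL2C (f : ℝ → ℂ) : L2C := if h : MemLp f 2 volume then h.toLp f else 0

/-- A real function as an element of `L²(ℝ; ℂ)`. -/
def cplx (f : ℝ → ℝ) : L2C := toL2C fun x => (f x : ℂ)

/-- The Fourier multiplier on `L²` with symbol `m(ξ)`, where `∂ₓ` has the symbol `iξ`; its domain
consists of the `f` for which the product below is square integrable.
The Fourier transform of Mathlib has the kernel `exp(-2πi x ξ)`, hence the argument `2πξ`. -/
def multiplier (m : ℝ → ℂ) (f : L2C) : L2C :=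
  𝓕⁻ (toL2C fun ξ => m (2 * Real.pi * ξ) * (𝓕 f : L2C) ξ)

/-- The symbol `exp((-tξ² + iγtξ³) / (1 + ξ²))` of the linearized evolution. -/
def symbolT (γ t ξ : ℝ) : ℂ :=
  Complex.exp ((-(t * ξ ^ 2) + Complex.I * (γ * t * ξ ^ 3)) / (1 + ξ ^ 2))

/-- `f ↦ T(t) * f`. -/
def convT (γ t : ℝ) : L2C → L2C := multiplier (symbolT γ t)

/-- `f ↦ (∂ₓT(t)) * f`, defined for `f ∈ H¹`. -/
def convDxT (γ t : ℝ) : L2C → L2C :=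
  multiplier fun ξ => Complex.I * ξ * symbolT γ t ξ

/-- `(1 - ∂ₓ²)⁻¹`. -/
def resolvent : L2C → L2C := multiplier fun ξ => 1 / (1 + (ξ : ℂ) ^ 2)

/-- `u ∈ C⁰([0, ∞); Hˢ)`; the values of `u` at negative times play no role. -/
def MemCH (s : ℕ) (u : ℝ → L2) : Prop :=
  (∀ t, 0 ≤ t → MemH s (u t)) ∧
    ∀ t₀, 0 ≤ t₀ → Tendsto (fun t => sobolevNorm s (u t - u t₀ : L2)) (𝓝[Set.Ici 0] t₀) (𝓝 0)

/-- `u` is a global mild solution in `C⁰([0, ∞); Hˢ)` of the BBM–Burgers equation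
`u_t - u_xxt - u_xx + γ u_xxx + β u u_x = 0` with initial value `u₀`, that is
`u(t) = T(t) * u₀ - (β/2) ∫₀ᵗ (∂ₓT(t-τ)) * ((1 - ∂ₓ²)⁻¹ (u²))(τ) dτ` for all `t ≥ 0`. -/
def IsGlobalMildSolution (β γ : ℝ) (s : ℕ) (u₀ : ℝ → ℝ) (u : ℝ → L2) : Prop :=
  MemCH s u ∧
    ∀ t, 0 ≤ t →
      cplx (u t) = convT γ t (cplx u₀) -
        ((β / 2 : ℝ) : ℂ) •
          ∫ τ in (0 : ℝ)..t, convDxT γ (t - τ) (resolvent (cplx fun x => u τ x ^ 2))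

/-- The profile `χ_*` of the nonlinear diffusion wave of mass `M`. -/
def chiStar (β M x : ℝ) : ℝ :=
  1 / β * (((Real.exp (β * M / 2) - 1) * Real.exp (-x ^ 2 / 4)) /
    (√Real.pi + (Real.exp (β * M / 2) - 1) * ∫ y in Set.Ioi (x / 2), Real.exp (-y ^ 2)))

/-- The nonlinear diffusion wave `χ(x, t)` of mass `M`. -/
def chi (β M t x : ℝ) : ℝ := 1 / √(1 + t) * chiStar β M (x / √(1 + t))

end BBMBurgers

end

/-!
# Decay towards the nonlinear diffusion wave for the BBM–Burgers equation

The whole argument takes place on the Fourier side. With `f(t) = 𝓕 u(t)` the mild formulation is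
`f(t, ξ) = a(t, ξ) f₀(ξ) - (β/2) ∫₀ᵗ b(ξ) a(t - τ, ξ) (f(τ) ⋆ f(τ))(ξ) dτ`, where
`|a(t, ξ)| = exp(-4π²ξ² t / (1 + 4π²ξ²))` and `|b(ξ)| ≤ |ξ| / (1 + ξ²)` up to a constant. All
estimates use the parabolic weight `wt t ξ = 1 + |ξ| √(1 + t)`: a bound of `wt^s f(t)` in `L²` gives
the decay of `∂ₓˡ u` in `L²` for `l ≤ s`, and, by the Cauchy–Schwarz inequality with
`‖wt⁻¹‖ ≤ 2 (1 + t)^(-1/4)`, in `L^∞` for `l ≤ s - 1`. The weight is submultiplicative, so a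
convolution of two such functions is pointwise bounded by `wt^(-s)`, and the Duhamel integral maps
such pointwise bounds back to weighted `L²` bounds. For small data the contraction principle yields
a solution with `‖wt^s f(t)‖ ≤ Λ (1 + t)^(-1/4)` (`exists_isFourierSol`); its inverse Fourier
transform is a mild solution (`exists_mild`), and uniqueness is a Grönwall argument
(`mild_unique`).

The diffusion wave solves the viscous Burgers equation `χ_t = χ_xx - β χ χ_x`. Its Fourier
transform is self-similar and decays faster than any power of the weight, and it solves the
BBM–Burgers equation up to an error which is smaller by the factor `(1 + t)⁻¹`
(`exists_norm_chiErr_le`). Let `w = f - 𝓕 χ`. The datum of `w` has mean zero and decays like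
`(1 + |x|)^(-(1 + a))` with `a = α - 1`, so its Fourier transform is `a`-Hölder continuous and
vanishes at `0`, i.e. it is bounded by `|ξ|^a`. The smallness of `f` and `χ` makes the quadratic
terms absorbable. For `a ≤ 1/2` this alone gives the rate `(1 + t)^(-1/4 - a/2)`
(`Setting.l2Bd_wdiff_of_le_half`).

For `a > 1/2` the term `χ w` can no longer be absorbed. There the antiderivative `W` of `w` is
square integrable, and the Hopf–Cole factor `θ` of the wave turns the linearization
`W_t = W_xx - β χ W_x` into the heat equation for `θ W`. The rate already obtained for `a = 1/2`
controls the remaining terms of the equation for `θ W`, and the Fourier transform of its datum is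
bounded by `|ξ|^(a-1)` near `0`; this bounds `W` in `L²` (`Setting.norm_antid_le`). A bound of `W`
controls the low frequencies of `w`, the high ones are damped, and the full rate follows
(`Setting.l2Bd_wdiff_of_antideriv`, `Setting.exists_l2Bd_wdiff`).

A datum with `α ≥ 2` also satisfies the hypothesis with each `α' < 2`; this is the loss of `ε`.
-/

open MeasureTheory Filter Topology FourierTransform
open scoped ENNReal

noncomputable section

namespace BBMBurgers

/-! ### The Fourier transform on square integrable functions -/

lemma coeFn_toL2C {f : ℝ → ℂ} (h : MemLp f 2 volume) : toL2C f =ᵐ[volume] f := by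
  rw [toL2C, dif_pos h]
  exact h.coeFn_toLp

lemma toL2C_congr {f g : ℝ → ℂ} (h : f =ᵐ[volume] g) : toL2C f = toL2C g := by
  unfold toL2C
  by_cases hf : MemLp f 2 volume
  · have hg : MemLp g 2 volume := (memLp_congr_ae h).1 hf
    rw [dif_pos hf, dif_pos hg]
    exact (MemLp.toLp_eq_toLp_iff hf hg).2 h
  · have hg : ¬ MemLp g 2 volume := fun hg => hf ((memLp_congr_ae h).2 hg)
    rw [dif_neg hf, dif_neg hg]

lemma toL2C_coeFn (F : L2C) : toL2C F = F := by
  rw [toL2C, dif_pos (Lp.memLp F)]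
  exact Lp.toLp_coeFn F _

lemma norm_toL2C_le {f : ℝ → ℂ} {A : ℝ} (hA : 0 ≤ A)
    (h : eLpNorm f 2 volume ≤ ENNReal.ofReal A) : ‖toL2C f‖ ≤ A := by
  unfold toL2C
  split_ifs with hf
  · rw [Lp.norm_toLp]
    exact ENNReal.toReal_le_of_le_ofReal hA h
  · simpa using hA

lemma toL2C_sub {f g : ℝ → ℂ} (hf : MemLp f 2 volume) (hg : MemLp g 2 volume) :
    toL2C (fun x => f x - g x) = toL2C f - toL2C g := by
  have : MemLp (fun x => f x - g x) 2 volume := hf.sub hg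
  rw [toL2C, toL2C, toL2C, dif_pos hf, dif_pos hg, dif_pos this]
  rfl

lemma toL2C_add {f g : ℝ → ℂ} (hf : MemLp f 2 volume) (hg : MemLp g 2 volume) :
    toL2C (fun x => f x + g x) = toL2C f + toL2C g := by
  have : MemLp (fun x => f x + g x) 2 volume := hf.add hg
  rw [toL2C, toL2C, toL2C, dif_pos hf, dif_pos hg, dif_pos this]
  rfl

lemma toL2C_const_mul {f : ℝ → ℂ} (c : ℂ) (hf : MemLp f 2 volume) :
    toL2C (fun x => c * f x) = c • toL2C f := by
  have : MemLp (fun x => c * f x) 2 volume := hf.const_mul c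
  rw [toL2C, toL2C, dif_pos hf, dif_pos this]
  rfl

lemma locallyIntegrable_of_memLp {f : ℝ → ℂ} (h : MemLp f 2 volume) :
    LocallyIntegrable f volume :=
  h.locallyIntegrable (by norm_num)

lemma continuous_fourier {f : ℝ → ℂ} (hf : Integrable f volume) : Continuous (𝓕 f) :=
  VectorFourier.fourierIntegral_continuous Real.continuous_fourierChar
    (by exact continuous_inner) hf

lemma continuous_fourierInv {f : ℝ → ℂ} (hf : Integrable f volume) : Continuous (𝓕⁻ f) := by
  have : 𝓕⁻ f = fun x => 𝓕 f (-x) := by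
    ext x
    exact Real.fourierInv_eq_fourier_neg f x
  rw [this]
  exact (continuous_fourier hf).comp continuous_neg

lemma norm_fourier_le {f : ℝ → ℂ} (ξ : ℝ) : ‖𝓕 f ξ‖ ≤ ∫ x, ‖f x‖ :=
  VectorFourier.norm_fourierIntegral_le_integral_norm _ _ _ _ _

lemma norm_fourierInv_le {f : ℝ → ℂ} (ξ : ℝ) : ‖𝓕⁻ f ξ‖ ≤ ∫ x, ‖f x‖ := by
  rw [Real.fourierInv_eq_fourier_neg]
  exact norm_fourier_le _

lemma integral_fourier_mul {f g : ℝ → ℂ} (hf : Integrable f volume) (hg : Integrable g volume) :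
    ∫ x, 𝓕 f x * g x = ∫ x, f x * 𝓕 g x := by
  have := VectorFourier.integral_fourierIntegral_smul_eq_flip (L := innerₗ ℝ)
    Real.continuous_fourierChar (by exact continuous_inner) hf hg
  rw [flip_innerₗ] at this
  exact this

lemma integral_fourierInv_mul {f g : ℝ → ℂ} (hf : Integrable f volume)
    (hg : Integrable g volume) : ∫ x, 𝓕⁻ f x * g x = ∫ x, f x * 𝓕⁻ g x := by
  have h1 : ∀ x, 𝓕⁻ f x = 𝓕 f (-x) := fun x => Real.fourierInv_eq_fourier_neg f x
  have h2 : ∀ x, 𝓕⁻ g x = 𝓕 (fun y => g (-y)) x := by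
    intro x
    rw [Real.fourierInv_eq_fourier_comp_neg]
  simp_rw [h1, h2]
  rw [← integral_fourier_mul hf hg.comp_neg, ← integral_neg_eq_self]
  simp

/-- On `L¹ ∩ L²` the Fourier transform of `L²` is given by the Fourier integral. -/
theorem fourier_toL2C {h : ℝ → ℂ} (h1 : Integrable h volume) (h2 : MemLp h 2 volume) :
    (𝓕 (toL2C h) : L2C) =ᵐ[volume] 𝓕 h := by
  refine ae_eq_of_integral_contDiff_smul_eq (locallyIntegrable_of_memLp (Lp.memLp _))
    (continuous_fourier h1).locallyIntegrable fun g hg hgc => ?_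
  have hgc' : HasCompactSupport (fun x => (g x : ℂ)) := hgc.comp_left (g := Complex.ofReal) rfl
  have hg' : ContDiff ℝ ((⊤ : ℕ∞) : WithTop ℕ∞) (fun x => (g x : ℂ)) :=
    Complex.ofRealCLM.contDiff.comp hg
  set G : SchwartzMap ℝ ℂ := hgc'.toSchwartzMap hg' with hG
  have hGc : ∀ x, G x = (g x : ℂ) := fun x => rfl
  have e1 := Lp.fourier_toTemperedDistribution_eq (toL2C h)
  have e2 := congrArg (fun T => T G) e1
  simp only [TemperedDistribution.fourier_apply, Lp.toTemperedDistribution_apply] at e2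
  have e3 : ∫ x, (𝓕 G) x • (toL2C h) x = ∫ x, 𝓕 (G : ℝ → ℂ) x * h x := by
    refine integral_congr_ae ?_
    filter_upwards [coeFn_toL2C h2] with x hx
    rw [hx, SchwartzMap.fourier_coe, smul_eq_mul]
  rw [e3, integral_fourier_mul G.integrable h1] at e2
  simp only [hGc, smul_eq_mul] at e2
  simp only [Complex.real_smul]
  exact e2.symm

/-- On `L¹ ∩ L²` the inverse Fourier transform of `L²` is given by the Fourier integral. -/
theorem fourierInv_toL2C {h : ℝ → ℂ} (h1 : Integrable h volume) (h2 : MemLp h 2 volume) :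
    (𝓕⁻ (toL2C h) : L2C) =ᵐ[volume] 𝓕⁻ h := by
  refine ae_eq_of_integral_contDiff_smul_eq (locallyIntegrable_of_memLp (Lp.memLp _))
    (continuous_fourierInv h1).locallyIntegrable fun g hg hgc => ?_
  have hgc' : HasCompactSupport (fun x => (g x : ℂ)) := hgc.comp_left (g := Complex.ofReal) rfl
  have hg' : ContDiff ℝ ((⊤ : ℕ∞) : WithTop ℕ∞) (fun x => (g x : ℂ)) :=
    Complex.ofRealCLM.contDiff.comp hg
  set G : SchwartzMap ℝ ℂ := hgc'.toSchwartzMap hg' with hG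
  have hGc : ∀ x, G x = (g x : ℂ) := fun x => rfl
  have e1 := Lp.fourierInv_toTemperedDistribution_eq (toL2C h)
  have e2 := congrArg (fun T => T G) e1
  simp only [TemperedDistribution.fourierInv_apply, Lp.toTemperedDistribution_apply] at e2
  have e3 : ∫ x, (𝓕⁻ G) x • (toL2C h) x = ∫ x, 𝓕⁻ (G : ℝ → ℂ) x * h x := by
    refine integral_congr_ae ?_
    filter_upwards [coeFn_toL2C h2] with x hx
    rw [hx, SchwartzMap.fourierInv_coe, smul_eq_mul]
  rw [e3, integral_fourierInv_mul G.integrable h1] at e2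
  simp only [hGc, smul_eq_mul] at e2
  simp only [Complex.real_smul]
  exact e2.symm

lemma memLp_fourierInv {h : ℝ → ℂ} (h1 : Integrable h volume) (h2 : MemLp h 2 volume) :
    MemLp (𝓕⁻ h) 2 volume :=
  (memLp_congr_ae (fourierInv_toL2C h1 h2)).1 (Lp.memLp _)

lemma toL2C_fourierInv {h : ℝ → ℂ} (h1 : Integrable h volume) (h2 : MemLp h 2 volume) :
    toL2C (𝓕⁻ h) = 𝓕⁻ (toL2C h) := by
  rw [← toL2C_congr (fourierInv_toL2C h1 h2), toL2C_coeFn]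

lemma toL2C_fourier {h : ℝ → ℂ} (h1 : Integrable h volume) (h2 : MemLp h 2 volume) :
    toL2C (𝓕 h) = 𝓕 (toL2C h) := by
  rw [← toL2C_congr (fourier_toL2C h1 h2), toL2C_coeFn]

/-! ### Weak derivatives and the Fourier transform -/

lemma integral_mul_schwartz (F : L2C) (φ : SchwartzMap ℝ ℂ) :
    ∫ x, F x * φ x = ∫ ξ, (𝓕 F : L2C) ξ * 𝓕⁻ (φ : ℝ → ℂ) ξ := by
  have e2 := congrArg (fun T => T (𝓕⁻ φ)) (Lp.fourier_toTemperedDistribution_eq F)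
  simp only [TemperedDistribution.fourier_apply, Lp.toTemperedDistribution_apply,
    fourier_fourierInv_eq, SchwartzMap.fourierInv_coe, smul_eq_mul] at e2
  simpa only [mul_comm] using e2

lemma hasCompactSupport_iteratedDeriv {φ : ℝ → ℂ} (h : HasCompactSupport φ) (l : ℕ) :
    HasCompactSupport (iteratedDeriv l φ) := by
  induction l with
  | zero => simpa using h
  | succ n ih => rw [iteratedDeriv_succ]; exact ih.deriv

lemma contDiff_iteratedDeriv {φ : ℝ → ℂ} (h : ContDiff ℝ ((⊤ : ℕ∞) : WithTop ℕ∞) φ) (l : ℕ) :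
    ContDiff ℝ ((⊤ : ℕ∞) : WithTop ℕ∞) (iteratedDeriv l φ) := by
  rw [iteratedDeriv_eq_iterate]
  exact h.iterate_deriv l

lemma fourierInv_iteratedDeriv {φ : ℝ → ℂ} (h : ContDiff ℝ ((⊤ : ℕ∞) : WithTop ℕ∞) φ)
    (hc : HasCompactSupport φ) (l : ℕ) (ξ : ℝ) :
    𝓕⁻ (iteratedDeriv l φ) ξ = (-1) ^ l * ((2 * Real.pi * Complex.I * ξ) ^ l * 𝓕⁻ φ ξ) := by
  rw [Real.fourierInv_eq_fourier_neg, Real.fourierInv_eq_fourier_neg,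
    Real.fourier_iteratedDeriv (N := ⊤) h (fun n _ =>
      (contDiff_iteratedDeriv h n).continuous.integrable_of_hasCompactSupport
        (hasCompactSupport_iteratedDeriv hc n)) le_top]
  simp only [smul_eq_mul, Complex.ofReal_neg, mul_neg]
  rw [neg_pow]
  ring

lemma fourierInv_comp_sub (φ : ℝ → ℂ) (y ξ : ℝ) :
    𝓕⁻ (fun x => φ (x - y)) ξ = Complex.exp (2 * Real.pi * Complex.I * (y * ξ)) * 𝓕⁻ φ ξ := by
  rw [Real.fourierInv_eq', Real.fourierInv_eq']
  simp only [smul_eq_mul]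
  rw [← integral_add_right_eq_self _ y, ← integral_const_mul]
  congr 1
  ext x
  rw [← mul_assoc, ← Complex.exp_add]
  simp only [add_sub_cancel_right, RCLike.inner_apply, conj_trivial]
  congr 2
  push_cast
  ring

/-- The Fourier integral is injective on `L¹`. -/
lemma ae_eq_zero_of_fourierInv_eq_zero {H : ℝ → ℂ} (hH : Integrable H volume)
    (h0 : ∀ y, 𝓕⁻ H y = 0) : ∀ᵐ ξ, H ξ = 0 := by
  refine ae_eq_zero_of_integral_contDiff_smul_eq_zero hH.locallyIntegrable fun g hg hgc => ?_
  have hgc' : HasCompactSupport (fun x => (g x : ℂ)) := hgc.comp_left (g := Complex.ofReal) rfl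
  have hg' : ContDiff ℝ ((⊤ : ℕ∞) : WithTop ℕ∞) (fun x => (g x : ℂ)) :=
    Complex.ofRealCLM.contDiff.comp hg
  set G : SchwartzMap ℝ ℂ := hgc'.toSchwartzMap hg' with hG
  have e : ∫ x, 𝓕⁻ H x * (𝓕 G) x = ∫ x, H x * 𝓕⁻ ((𝓕 G : SchwartzMap ℝ ℂ) : ℝ → ℂ) x :=
    integral_fourierInv_mul hH (𝓕 G : SchwartzMap ℝ ℂ).integrable
  rw [← SchwartzMap.fourierInv_coe, fourierInv_fourier_eq] at e
  simp only [h0, zero_mul, integral_zero] at e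
  rw [e]
  refine integral_congr_ae (Eventually.of_forall fun x => ?_)
  simp only [Complex.real_smul]
  rw [mul_comm]
  rfl

/-- A function that annihilates the inverse Fourier transforms of all test functions vanishes:
by translation of the test function `φ` the product `h 𝓕⁻φ` has vanishing Fourier transform, and
for each frequency there is a `φ` with `𝓕⁻φ ≠ 0` there. -/
lemma ae_eq_zero_of_integral_mul_fourierInv {h : ℝ → ℂ}
    (hi : ∀ φ : ℝ → ℂ, ContDiff ℝ ((⊤ : ℕ∞) : WithTop ℕ∞) φ → HasCompactSupport φ →
      Integrable (fun ξ => h ξ * 𝓕⁻ φ ξ) volume)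
    (h0 : ∀ φ : ℝ → ℂ, ContDiff ℝ ((⊤ : ℕ∞) : WithTop ℕ∞) φ → HasCompactSupport φ →
      ∫ ξ, h ξ * 𝓕⁻ φ ξ = 0) : ∀ᵐ ξ, h ξ = 0 := by
  have key : ∀ φ : ℝ → ℂ, ContDiff ℝ ((⊤ : ℕ∞) : WithTop ℕ∞) φ → HasCompactSupport φ →
      ∀ᵐ ξ, h ξ * 𝓕⁻ φ ξ = 0 := by
    intro φ hφ hφc
    refine ae_eq_zero_of_fourierInv_eq_zero (hi φ hφ hφc) fun y => ?_
    have := h0 (fun x => φ (x - y)) (hφ.comp (contDiff_id.sub contDiff_const))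
      (hφc.comp_homeomorph (Homeomorph.subRight y))
    rw [← this, Real.fourierInv_eq']
    congr 1
    ext ξ
    rw [fourierInv_comp_sub]
    simp only [RCLike.inner_apply, conj_trivial, smul_eq_mul]
    rw [mul_left_comm]
    congr 2
    push_cast
    ring_nf
  refine measure_null_of_locally_null _ fun ξ₀ _ => ?_
  let B : ContDiffBump (0 : ℝ) := ⟨1, 2, by norm_num, by norm_num⟩
  set φ : ℝ → ℂ := fun x => (B x : ℂ) * Complex.exp (-(2 * Real.pi * Complex.I * (x * ξ₀)))
    with hφ
  have hφs : ContDiff ℝ ((⊤ : ℕ∞) : WithTop ℕ∞) φ := by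
    refine (Complex.ofRealCLM.contDiff.comp B.contDiff).mul ?_
    refine ContDiff.cexp (ContDiff.neg ?_)
    exact contDiff_const.mul (Complex.ofRealCLM.contDiff.mul contDiff_const)
  have hφc : HasCompactSupport φ :=
    HasCompactSupport.mul_right (f := fun x => (B x : ℂ))
      (B.hasCompactSupport.comp_left (g := Complex.ofReal) rfl)
  have hne : 𝓕⁻ φ ξ₀ ≠ 0 := by
    have : 𝓕⁻ φ ξ₀ = ((∫ x, B x : ℝ) : ℂ) := by
      rw [Real.fourierInv_eq', ← integral_complex_ofReal]
      congr 1
      ext x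
      simp only [hφ, RCLike.inner_apply, conj_trivial, smul_eq_mul]
      rw [mul_left_comm, ← Complex.exp_add]
      have : ((2 * Real.pi * (ξ₀ * x) : ℝ) : ℂ) * Complex.I
          + -(2 * Real.pi * Complex.I * (x * ξ₀)) = 0 := by push_cast; ring
      rw [this, Complex.exp_zero, mul_one]
    rw [this]
    exact_mod_cast (B.integral_pos (μ := volume)).ne'
  have hcont : Continuous (𝓕⁻ φ) :=
    continuous_fourierInv (hφs.continuous.integrable_of_hasCompactSupport hφc)
  have hU : ∀ᶠ ξ in 𝓝 ξ₀, 𝓕⁻ φ ξ ≠ 0 := hcont.continuousAt.eventually_ne hne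
  refine ⟨{ξ | h ξ ≠ 0} ∩ {ξ | 𝓕⁻ φ ξ ≠ 0}, inter_mem_nhdsWithin _ hU, ?_⟩
  refine measure_mono_null ?_ (key φ hφs hφc)
  rintro ξ ⟨h1, h2⟩
  exact mul_ne_zero h1 h2

lemma schwartz_memLp (φ : SchwartzMap ℝ ℂ) : MemLp (φ : ℝ → ℂ) 2 volume := φ.memLp 2 volume

lemma integral_mul_testFunction {u φ : ℝ → ℂ} (hu : MemLp u 2 volume)
    (hφ : ContDiff ℝ ((⊤ : ℕ∞) : WithTop ℕ∞) φ) (hc : HasCompactSupport φ) :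
    ∫ x, u x * φ x = ∫ ξ, (𝓕 (toL2C u) : L2C) ξ * 𝓕⁻ φ ξ := by
  refine Eq.trans ?_ (integral_mul_schwartz (toL2C u) (hc.toSchwartzMap hφ))
  refine integral_congr_ae ?_
  filter_upwards [coeFn_toL2C hu] with x hx
  rw [hx]; rfl

lemma neg_one_pow_mul_self (l : ℕ) (z : ℂ) : (-1) ^ l * ((-1) ^ l * z) = z := by
  rw [← mul_assoc, ← mul_pow]; simp

/-- A weak derivative in `L²` acts on the Fourier side as multiplication by `(2πiξ)ˡ`. -/
theorem fourier_eq_of_weak {f g : ℝ → ℂ} (hf : MemLp f 2 volume) (hg : MemLp g 2 volume) (l : ℕ)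
    (h : ∀ φ : ℝ → ℂ, ContDiff ℝ ((⊤ : ℕ∞) : WithTop ℕ∞) φ → HasCompactSupport φ →
      ∫ x, f x * iteratedDeriv l φ x = (-1) ^ l * ∫ x, g x * φ x) :
    ∀ᵐ ξ, (𝓕 (toL2C g) : L2C) ξ
      = (2 * Real.pi * Complex.I * ξ) ^ l * (𝓕 (toL2C f) : L2C) ξ := by
  have hint : ∀ φ : ℝ → ℂ, ∀ (hφ : ContDiff ℝ ((⊤ : ℕ∞) : WithTop ℕ∞) φ)
      (hc : HasCompactSupport φ), ∀ F : L2C,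
      Integrable (fun ξ => F ξ * 𝓕⁻ φ ξ) volume := by
    intro φ hφ hc F
    have : 𝓕⁻ φ = (𝓕⁻ (hc.toSchwartzMap hφ) : SchwartzMap ℝ ℂ) := by
      rw [SchwartzMap.fourierInv_coe]; rfl
    rw [this]
    exact (Lp.memLp F).integrable_mul (schwartz_memLp _)
  have hi1 : ∀ φ : ℝ → ℂ, ∀ (hφ : ContDiff ℝ ((⊤ : ℕ∞) : WithTop ℕ∞) φ)
      (hc : HasCompactSupport φ), Integrable (fun ξ =>
        (2 * Real.pi * Complex.I * ξ) ^ l * (𝓕 (toL2C f) : L2C) ξ * 𝓕⁻ φ ξ) volume := by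
    intro φ hφ hc
    have := (hint _ (contDiff_iteratedDeriv hφ l) (hasCompactSupport_iteratedDeriv hc l)
      (𝓕 (toL2C f))).const_mul ((-1) ^ l)
    refine this.congr (Eventually.of_forall fun ξ => ?_)
    simp only [fourierInv_iteratedDeriv hφ hc]
    rw [mul_left_comm, neg_one_pow_mul_self]
    ring
  have hz := ae_eq_zero_of_integral_mul_fourierInv
    (h := fun ξ => (𝓕 (toL2C g) : L2C) ξ
      - (2 * Real.pi * Complex.I * ξ) ^ l * (𝓕 (toL2C f) : L2C) ξ)
    (fun φ hφ hc => by
      simp only [sub_mul]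
      exact (hint φ hφ hc _).sub (hi1 φ hφ hc))
    (fun φ hφ hc => by
      simp only [sub_mul]
      rw [integral_sub (hint φ hφ hc _) (hi1 φ hφ hc), ← integral_mul_testFunction hg hφ hc, sub_eq_zero]
      have e := h φ hφ hc
      rw [integral_mul_testFunction hf (contDiff_iteratedDeriv hφ l)
      (hasCompactSupport_iteratedDeriv hc l)] at e
      rw [← neg_one_pow_mul_self l (∫ x, g x * φ x), ← e, ← integral_const_mul]
      congr 1
      ext ξ
      rw [fourierInv_iteratedDeriv hφ hc, mul_left_comm, neg_one_pow_mul_self]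
      ring)
  filter_upwards [hz] with ξ hξ
  exact sub_eq_zero.1 hξ

/-- Multiplication by `(2πiξ)ˡ` on the Fourier side is a weak derivative. -/
theorem weak_of_fourier_eq {f g : ℝ → ℂ} (hf : MemLp f 2 volume) (hg : MemLp g 2 volume) (l : ℕ)
    (h : ∀ᵐ ξ, (𝓕 (toL2C g) : L2C) ξ
      = (2 * Real.pi * Complex.I * ξ) ^ l * (𝓕 (toL2C f) : L2C) ξ)
    (φ : ℝ → ℂ) (hφ : ContDiff ℝ ((⊤ : ℕ∞) : WithTop ℕ∞) φ) (hc : HasCompactSupport φ) :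
    ∫ x, f x * iteratedDeriv l φ x = (-1) ^ l * ∫ x, g x * φ x := by
  rw [integral_mul_testFunction hf (contDiff_iteratedDeriv hφ l)
      (hasCompactSupport_iteratedDeriv hc l),
    integral_mul_testFunction hg hφ hc, ← integral_const_mul]
  refine integral_congr_ae ?_
  filter_upwards [h] with ξ hξ
  rw [hξ, fourierInv_iteratedDeriv hφ hc]
  ring

/-- The product rule on the Fourier side: if `f'` is the weak derivative of `f` in `L²` and `θ` is
smooth, then `θ' f + θ f'` is the weak derivative of `θ f`. -/
theorem fourier_mul_deriv {f f' θ : ℝ → ℂ} (hf : MemLp f 2 volume) (hf' : MemLp f' 2 volume)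
    (h : ∀ᵐ ξ, (𝓕 (toL2C f') : L2C) ξ = 2 * Real.pi * Complex.I * ξ * (𝓕 (toL2C f) : L2C) ξ)
    (hθ : ContDiff ℝ ((⊤ : ℕ∞) : WithTop ℕ∞) θ) (h0 : MemLp (fun x => θ x * f x) 2 volume)
    (h1 : MemLp (fun x => deriv θ x * f x + θ x * f' x) 2 volume) :
    ∀ᵐ ξ, (𝓕 (toL2C fun x => deriv θ x * f x + θ x * f' x) : L2C) ξ
      = 2 * Real.pi * Complex.I * ξ * (𝓕 (toL2C fun x => θ x * f x) : L2C) ξ := by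
  have := fourier_eq_of_weak h0 h1 1 (fun φ hφ hc => ?_)
  · simpa using this
  have hd : ContDiff ℝ ((⊤ : ℕ∞) : WithTop ℕ∞) (deriv θ) := by
    have := contDiff_iteratedDeriv hθ 1
    rwa [iteratedDeriv_one] at this
  have hdφ : ContDiff ℝ ((⊤ : ℕ∞) : WithTop ℕ∞) (deriv φ) := by
    have := contDiff_iteratedDeriv hφ 1
    rwa [iteratedDeriv_one] at this
  have e := weak_of_fourier_eq hf hf' 1 (by simpa using h) (fun x => θ x * φ x) (hθ.mul hφ)
    hc.mul_left
  have hder : ∀ x, deriv (fun x => θ x * φ x) x = deriv θ x * φ x + θ x * deriv φ x := fun x =>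
    deriv_fun_mul (hθ.differentiable (by simp) x) (hφ.differentiable (by simp) x)
  have hi : ∀ {u ψ : ℝ → ℂ}, MemLp u 2 volume → Continuous ψ → HasCompactSupport ψ →
      Integrable (fun x => u x * ψ x) volume := fun hu hψ hψc =>
    hu.integrable_mul (hψ.memLp_of_hasCompactSupport (p := 2) hψc)
  have i1 : Integrable (fun x => f x * (deriv θ x * φ x)) volume := hi hf (hd.continuous.mul hφ.continuous) hc.mul_left
  have i2 : Integrable (fun x => f x * (θ x * deriv φ x)) volume := hi hf (hθ.continuous.mul hdφ.continuous) hc.deriv.mul_left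
  have i3 : Integrable (fun x => f' x * (θ x * φ x)) volume := hi hf' (hθ.continuous.mul hφ.continuous) hc.mul_left
  simp only [iteratedDeriv_one, pow_one, hder, mul_add] at e ⊢
  have e1 : ∫ x, f x * (deriv θ x * φ x) + f x * (θ x * deriv φ x)
      = (∫ x, f x * (deriv θ x * φ x)) + ∫ x, f x * (θ x * deriv φ x) := integral_add i1 i2
  have e2 : ∫ x, (deriv θ x * f x + θ x * f' x) * φ x
      = (∫ x, f x * (deriv θ x * φ x)) + ∫ x, f' x * (θ x * φ x) := by
    rw [← integral_add i1 i3]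
    congr 1
    ext x
    ring
  have e3 : ∫ x, θ x * f x * deriv φ x = ∫ x, f x * (θ x * deriv φ x) := by
    congr 1
    ext x
    ring
  rw [e1] at e
  rw [e2, e3]
  linear_combination e

/-! ### Convolution of Fourier transforms -/

/-- The convolution `(f ∗ g)(ξ) = ∫ f(η) g(ξ - η) dη`, the Fourier side of a product. -/
def conv (f g : ℝ → ℂ) (ξ : ℝ) : ℂ := ∫ η, f η * g (ξ - η)

lemma conv_eq_convolution (f g : ℝ → ℂ) :
    conv f g = convolution f g (ContinuousLinearMap.mul ℂ ℂ) volume := rfl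

lemma conv_comm (f g : ℝ → ℂ) (ξ : ℝ) : conv f g ξ = conv g f ξ := by
  unfold conv
  rw [← integral_sub_left_eq_self _ volume ξ]
  congr 1
  ext η
  rw [sub_sub_cancel, mul_comm]

lemma integrable_conv {f g : ℝ → ℂ} (hf : Integrable f volume) (hg : Integrable g volume) :
    Integrable (conv f g) volume := by
  rw [conv_eq_convolution]
  exact hf.integrable_convolution _ hg

lemma fourierInv_conv {f g : ℝ → ℂ} (hf : Integrable f volume) (hg : Integrable g volume)
    (x : ℝ) : 𝓕⁻ (conv f g) x = 𝓕⁻ f x * 𝓕⁻ g x := by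
  simp only [Real.fourierInv_eq_fourier_neg]
  rw [conv_eq_convolution, Real.fourier_mul_convolution_eq hf hg]

/-- The Fourier transform turns a product of two functions with Fourier transforms in `L¹ ∩ L²`
into a convolution. -/
lemma fourier_mul_eq_conv {f g : ℝ → ℂ} (hf : Integrable f volume)
    (hg : Integrable g volume) (h : MemLp (conv f g) 2 volume) :
    toL2C (fun x => 𝓕⁻ f x * 𝓕⁻ g x) = 𝓕⁻ (toL2C (conv f g)) := by
  rw [← toL2C_fourierInv (integrable_conv hf hg) h]
  congr 1
  ext x
  rw [fourierInv_conv hf hg]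

/-! ### Sobolev norms on the Fourier side -/

lemma memLp_ofReal {f : ℝ → ℝ} {p : ℝ≥0∞} (hf : MemLp f p volume) :
    MemLp (fun x => (f x : ℂ)) p volume := hf.ofReal

lemma eLpNorm_ofReal (f : ℝ → ℝ) (p : ℝ≥0∞) :
    eLpNorm (fun x => (f x : ℂ)) p volume = eLpNorm f p volume :=
  eLpNorm_congr_norm_ae (Eventually.of_forall fun x => by simp)

lemma eLpNorm_coe_eq_of_norm_eq {F G : L2C} (h : ‖F‖ = ‖G‖) :
    eLpNorm F 2 volume = eLpNorm G 2 volume := by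
  rw [← Lp.enorm_def, ← Lp.enorm_def, ← ofReal_norm, ← ofReal_norm, h]

lemma iteratedDeriv_ofReal {φ : ℝ → ℝ} (hφ : ContDiff ℝ ((⊤ : ℕ∞) : WithTop ℕ∞) φ) (l : ℕ)
    (x : ℝ) : iteratedDeriv l (fun x => (φ x : ℂ)) x = ((iteratedDeriv l φ x : ℝ) : ℂ) := by
  induction l generalizing x with
  | zero => simp
  | succ n ih =>
    have h : iteratedDeriv n (fun x => (φ x : ℂ)) = fun x => ((iteratedDeriv n φ x : ℝ) : ℂ) :=
      funext ih
    rw [iteratedDeriv_succ, h, iteratedDeriv_succ]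
    have hd : DifferentiableAt ℝ (iteratedDeriv n φ) x := by
      have h1 : ContDiff ℝ ((⊤ : ℕ∞) : WithTop ℕ∞) (iteratedDeriv n φ) := by
        rw [iteratedDeriv_eq_iterate]; exact hφ.iterate_deriv n
      exact h1.differentiable (by simp) x
    exact hd.hasDerivAt.ofReal_comp.deriv

/-- If the Fourier transform of the real function `f`, multiplied by `(2πiξ)ˡ`, is square
integrable, then the real part of its inverse Fourier transform is the weak derivative of `f`. -/
lemma isWeakDeriv_of_fourier {f : ℝ → ℝ} (hf : MemLp f 2 volume) (l : ℕ) {G : L2C}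
    (hG : ∀ᵐ ξ, (𝓕 G : L2C) ξ = (2 * Real.pi * Complex.I * ξ) ^ l * (𝓕 (cplx f) : L2C) ξ) :
    IsWeakDeriv l f fun x => (G x).re := by
  have hGm : MemLp (G : ℝ → ℂ) 2 volume := Lp.memLp G
  refine ⟨hf.locallyIntegrable (by norm_num),
    (hGm.re).locallyIntegrable (by norm_num), fun φ hφ hc => ?_⟩
  have hc' : HasCompactSupport (fun x => (φ x : ℂ)) := hc.comp_left (g := Complex.ofReal) rfl
  have hφ' : ContDiff ℝ ((⊤ : ℕ∞) : WithTop ℕ∞) (fun x => (φ x : ℂ)) :=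
    Complex.ofRealCLM.contDiff.comp hφ
  have e := weak_of_fourier_eq (memLp_ofReal hf) hGm l
    (by rw [toL2C_coeFn]; exact hG) _ hφ' hc'
  have e1 : ∫ x, (f x : ℂ) * iteratedDeriv l (fun x => (φ x : ℂ)) x
      = ((∫ x, f x * iteratedDeriv l φ x : ℝ) : ℂ) := by
    rw [← integral_complex_ofReal]
    congr 1
    ext x
    rw [iteratedDeriv_ofReal hφ]
    push_cast
    rfl
  have hi : Integrable (fun x => G x * (φ x : ℂ)) volume :=
    hGm.integrable_mul (hφ'.continuous.memLp_of_hasCompactSupport (p := 2) hc')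
  have e2 : (∫ x, G x * (φ x : ℂ)).re = ∫ x, (G x).re * φ x := by
    have := integral_re hi
    simp only [RCLike.re_to_complex] at this
    rw [← this]
    congr 1
    ext x
    simp
  rw [e1] at e
  have e3 := congrArg Complex.re e
  rw [Complex.ofReal_re] at e3
  rw [e3, ← e2]
  have : ((-1 : ℂ)) ^ l = (((-1 : ℝ) ^ l : ℝ) : ℂ) := by push_cast; rfl
  rw [this, Complex.re_ofReal_mul]

lemma norm_two_pi_I_mul_pow (ξ : ℝ) (l : ℕ) :
    ‖(2 * Real.pi * Complex.I * ξ : ℂ) ^ l‖ = (2 * Real.pi * |ξ|) ^ l := by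
  rw [norm_pow]
  congr 1
  simp [abs_of_pos Real.pi_pos]

lemma derivNorm_two_le {f : ℝ → ℝ} (hf : MemLp f 2 volume) (l : ℕ)
    (h : MemLp (fun ξ : ℝ => (2 * Real.pi * Complex.I * ξ) ^ l * (𝓕 (cplx f) : L2C) ξ) 2 volume) :
    derivNorm l 2 f
      ≤ eLpNorm (fun ξ : ℝ => (2 * Real.pi * Complex.I * ξ) ^ l * (𝓕 (cplx f) : L2C) ξ) 2
        volume := by
  set H : L2C := toL2C fun ξ : ℝ => (2 * Real.pi * Complex.I * ξ) ^ l * (𝓕 (cplx f) : L2C) ξ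
  have hH := coeFn_toL2C h
  have hw := isWeakDeriv_of_fourier hf l (G := 𝓕⁻ H)
    (by rw [fourier_fourierInv_eq]; exact hH)
  refine (iInf₂_le _ hw).trans ?_
  calc eLpNorm (fun x => ((𝓕⁻ H : L2C) x).re) 2 volume ≤ eLpNorm (𝓕⁻ H : L2C) 2 volume :=
        eLpNorm_mono fun x => by simpa using Complex.abs_re_le_norm _
    _ = eLpNorm H 2 volume := eLpNorm_coe_eq_of_norm_eq (by
        rw [← Lp.norm_fourier_eq (𝓕⁻ H), fourier_fourierInv_eq])
    _ = _ := eLpNorm_congr_ae hH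

lemma derivNorm_top_le {f : ℝ → ℝ} (hf : MemLp f 2 volume) (l : ℕ)
    (h : MemLp (fun ξ : ℝ => (2 * Real.pi * Complex.I * ξ) ^ l * (𝓕 (cplx f) : L2C) ξ) 2 volume)
    (h1 : Integrable (fun ξ : ℝ => (2 * Real.pi * Complex.I * ξ) ^ l * (𝓕 (cplx f) : L2C) ξ)
      volume) :
    derivNorm l ∞ f ≤ ENNReal.ofReal
      (∫ ξ : ℝ, ‖(2 * Real.pi * Complex.I * ξ) ^ l * (𝓕 (cplx f) : L2C) ξ‖) := by
  set H : L2C := toL2C fun ξ : ℝ => (2 * Real.pi * Complex.I * ξ) ^ l * (𝓕 (cplx f) : L2C) ξ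
  have hw := isWeakDeriv_of_fourier hf l (G := 𝓕⁻ H)
    (by rw [fourier_fourierInv_eq]; exact coeFn_toL2C h)
  refine (iInf₂_le _ hw).trans ?_
  rw [eLpNorm_exponent_top]
  refine eLpNormEssSup_le_of_ae_bound ?_
  filter_upwards [fourierInv_toL2C h1 h] with x hx
  rw [hx, Real.norm_eq_abs]
  exact (Complex.abs_re_le_norm _).trans (norm_fourierInv_le _)

/-- A Sobolev seminorm bounds the corresponding weighted `L²` norm of the Fourier
transform. -/
lemma eLpNorm_fourier_le_derivNorm {f : ℝ → ℝ} (hf : MemLp f 2 volume) (l : ℕ) :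
    eLpNorm (fun ξ : ℝ => (2 * Real.pi * Complex.I * ξ) ^ l * (𝓕 (cplx f) : L2C) ξ) 2 volume
      ≤ derivNorm l 2 f := by
  refine le_iInf₂ fun g hg => ?_
  by_cases hgm : eLpNorm g 2 volume < ∞
  swap
  · rw [not_lt, top_le_iff] at hgm
    rw [hgm]; exact le_top
  have hg2 : MemLp g 2 volume := ⟨hg.2.1.aestronglyMeasurable, hgm⟩
  have key : ∀ᵐ ξ, (𝓕 (toL2C fun x => (g x : ℂ)) : L2C) ξ
      = (2 * Real.pi * Complex.I * ξ) ^ l * (𝓕 (cplx f) : L2C) ξ :=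
    fourier_eq_of_weak (memLp_ofReal hf) (memLp_ofReal hg2) l (fun φ hφ hc => ?_)
  · rw [← eLpNorm_congr_ae key, eLpNorm_coe_eq_of_norm_eq (Lp.norm_fourier_eq _),
      eLpNorm_congr_ae (coeFn_toL2C (memLp_ofReal hg2)), eLpNorm_ofReal]
  -- the identity for a complex test function follows from its real and imaginary parts
  have hre : ContDiff ℝ ((⊤ : ℕ∞) : WithTop ℕ∞) (fun x => (φ x).re) :=
    Complex.reCLM.contDiff.comp hφ
  have him : ContDiff ℝ ((⊤ : ℕ∞) : WithTop ℕ∞) (fun x => (φ x).im) :=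
    Complex.imCLM.contDiff.comp hφ
  have hrec : HasCompactSupport (fun x => (φ x).re) := hc.comp_left (g := Complex.re) rfl
  have himc : HasCompactSupport (fun x => (φ x).im) := hc.comp_left (g := Complex.im) rfl
  have c : ∀ {ψ : ℝ → ℝ}, ContDiff ℝ ((⊤ : ℕ∞) : WithTop ℕ∞) ψ → HasCompactSupport ψ →
      ContDiff ℝ ((⊤ : ℕ∞) : WithTop ℕ∞) (fun x => (ψ x : ℂ)) ∧
        HasCompactSupport (fun x => (ψ x : ℂ)) := fun hψ hψc =>
    ⟨Complex.ofRealCLM.contDiff.comp hψ, hψc.comp_left (g := Complex.ofReal) rfl⟩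
  have real : ∀ ψ : ℝ → ℝ, ContDiff ℝ ((⊤ : ℕ∞) : WithTop ℕ∞) ψ → HasCompactSupport ψ →
      ∫ x, (f x : ℂ) * iteratedDeriv l (fun x => (ψ x : ℂ)) x
        = (-1) ^ l * ∫ x, (g x : ℂ) * (ψ x : ℂ) := by
    intro ψ hψ hψc
    have e := congrArg (fun r : ℝ => (r : ℂ)) (hg.2.2 ψ hψ hψc)
    simp only [Complex.ofReal_mul, Complex.ofReal_pow, Complex.ofReal_neg,
      Complex.ofReal_one] at e
    rw [← integral_complex_ofReal, ← integral_complex_ofReal] at e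
    simp only [iteratedDeriv_ofReal hψ]
    simpa only [Complex.ofReal_mul] using e
  have hsplit : φ = fun x => ((φ x).re : ℂ) + Complex.I * ((φ x).im : ℂ) := by
    ext x
    rw [mul_comm, Complex.re_add_im]
  have hdsplit : ∀ x, iteratedDeriv l φ x = iteratedDeriv l (fun x => ((φ x).re : ℂ)) x
      + Complex.I * iteratedDeriv l (fun x => ((φ x).im : ℂ)) x := by
    intro x
    conv_lhs => rw [hsplit]
    rw [iteratedDeriv_fun_add, iteratedDeriv_const_mul_field]
    · exact ((c hre hrec).1.of_le (by exact_mod_cast le_top)).contDiffAt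
    · exact ((contDiff_const.mul (c him himc).1).of_le (by exact_mod_cast le_top)).contDiffAt
  have hi : ∀ {u : ℝ → ℝ} {ψ : ℝ → ℂ}, MemLp u 2 volume → Continuous ψ → HasCompactSupport ψ →
      Integrable (fun x => (u x : ℂ) * ψ x) volume := fun hu hψ hψc =>
    (memLp_ofReal hu).integrable_mul (hψ.memLp_of_hasCompactSupport (p := 2) hψc)
  have i1 := hi hf (contDiff_iteratedDeriv (c hre hrec).1 l).continuous
    (hasCompactSupport_iteratedDeriv (c hre hrec).2 l)
  have i2 := (hi hf (contDiff_iteratedDeriv (c him himc).1 l).continuous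
    (hasCompactSupport_iteratedDeriv (c him himc).2 l)).const_mul Complex.I
  have j1 := hi hg2 (c hre hrec).1.continuous (c hre hrec).2
  have j2 := (hi hg2 (c him himc).1.continuous (c him himc).2).const_mul Complex.I
  have e1 : ∫ x, (f x : ℂ) * iteratedDeriv l φ x
      = (∫ x, (f x : ℂ) * iteratedDeriv l (fun x => ((φ x).re : ℂ)) x)
        + Complex.I * ∫ x, (f x : ℂ) * iteratedDeriv l (fun x => ((φ x).im : ℂ)) x := by
    rw [← integral_const_mul, ← integral_add i1 i2]
    congr 1
    ext x
    rw [hdsplit]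
    ring
  have e2 : ∫ x, (g x : ℂ) * φ x
      = (∫ x, (g x : ℂ) * ((φ x).re : ℂ)) + Complex.I * ∫ x, (g x : ℂ) * ((φ x).im : ℂ) := by
    rw [← integral_const_mul, ← integral_add j1 j2]
    congr 1
    ext x
    conv_lhs => rw [hsplit]
    ring
  rw [e1, e2, real _ hre hrec, real _ him himc]
  ring

lemma derivNorm_le_sobolevNorm {s n : ℕ} (hn : n ≤ s) (f : ℝ → ℝ) :
    derivNorm n 2 f ≤ sobolevNorm s f := by
  have h : derivNorm n 2 f ^ 2 ≤ ∑ n ∈ Finset.range (s + 1), derivNorm n 2 f ^ 2 :=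
    Finset.single_le_sum (f := fun n => derivNorm n 2 f ^ 2) (fun _ _ => zero_le)
      (Finset.mem_range.2 (by omega))
  have := ENNReal.rpow_le_rpow h (z := 1 / 2) (by norm_num)
  rwa [← ENNReal.rpow_natCast, ← ENNReal.rpow_mul, Nat.cast_ofNat, mul_one_div_cancel two_ne_zero,
    ENNReal.rpow_one] at this

lemma sobolevNorm_le {s : ℕ} {f : ℝ → ℝ} {A : ℝ≥0∞} (h : ∀ n ≤ s, derivNorm n 2 f ≤ A) :
    sobolevNorm s f ≤ ((s + 1 : ℕ) * A ^ 2) ^ (1 / 2 : ℝ) := by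
  refine ENNReal.rpow_le_rpow ?_ (by norm_num)
  calc ∑ n ∈ Finset.range (s + 1), derivNorm n 2 f ^ 2
      ≤ ∑ _n ∈ Finset.range (s + 1), A ^ 2 := Finset.sum_le_sum fun n hn =>
        pow_le_pow_left' (h n (by have := Finset.mem_range.1 hn; omega)) 2
    _ = _ := by simp

/-- The Fourier transform of a function in `Hˢ` with the weight `(1 + |ξ|)ˢ`. -/
lemma eLpNorm_weight_fourier_le {s : ℕ} {f : ℝ → ℝ} (hf : MemH s f) :
    eLpNorm (fun ξ : ℝ => (((1 + |ξ|) ^ s : ℝ) : ℂ) * (𝓕 (cplx f) : L2C) ξ) 2 volume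
      ≤ ENNReal.ofReal (2 ^ (s + 1)) * sobolevNorm s f := by
  have h0 := eLpNorm_fourier_le_derivNorm hf.1 0
  have hs := eLpNorm_fourier_le_derivNorm hf.1 s
  set F : ℝ → ℂ := fun ξ => (𝓕 (cplx f) : L2C) ξ
  have hF : AEStronglyMeasurable F volume := (Lp.memLp (𝓕 (cplx f) : L2C)).1
  have hm : AEStronglyMeasurable (fun ξ : ℝ => (2 * Real.pi * Complex.I * ξ) ^ s * F ξ) volume :=
    ((by fun_prop : Continuous fun ξ : ℝ => (2 * Real.pi * Complex.I * ξ : ℂ) ^ s)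
      ).aestronglyMeasurable.mul hF
  have hpt : ∀ ξ : ℝ, ‖(((1 + |ξ|) ^ s : ℝ) : ℂ) * F ξ‖
      ≤ 2 ^ s * ‖‖F ξ‖ + ‖(2 * Real.pi * Complex.I * ξ) ^ s * F ξ‖‖ := by
    intro ξ
    have h1 : (1 + |ξ|) ^ s ≤ 2 ^ s * (1 + (2 * Real.pi * |ξ|) ^ s) := by
      have hx := abs_nonneg ξ
      have hpi := Real.pi_gt_three
      have hpx : |ξ| ≤ 2 * Real.pi * |ξ| := by nlinarith
      rcases le_total |ξ| 1 with h | h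
      · calc (1 + |ξ|) ^ s ≤ 2 ^ s := pow_le_pow_left₀ (by positivity) (by linarith) s
          _ ≤ _ := le_mul_of_one_le_right (by positivity) (by
            have : 0 ≤ (2 * Real.pi * |ξ|) ^ s := by positivity
            linarith)
      · calc (1 + |ξ|) ^ s ≤ (2 * (2 * Real.pi * |ξ|)) ^ s :=
              pow_le_pow_left₀ (by positivity) (by linarith) s
          _ = 2 ^ s * (2 * Real.pi * |ξ|) ^ s := mul_pow _ _ _
          _ ≤ _ := by gcongr; linarith
    rw [norm_mul, Complex.norm_real, Real.norm_of_nonneg (by positivity),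
      Real.norm_of_nonneg (by positivity), norm_mul, norm_two_pi_I_mul_pow]
    calc (1 + |ξ|) ^ s * ‖F ξ‖ ≤ (2 ^ s * (1 + (2 * Real.pi * |ξ|) ^ s)) * ‖F ξ‖ := by gcongr
      _ = _ := by ring
  calc _ ≤ ENNReal.ofReal (2 ^ s) * eLpNorm (fun ξ : ℝ => ‖F ξ‖
        + ‖(2 * Real.pi * Complex.I * ξ) ^ s * F ξ‖) 2 volume :=
        eLpNorm_le_mul_eLpNorm_of_ae_le_mul (Eventually.of_forall hpt) 2
    _ ≤ ENNReal.ofReal (2 ^ s) * (eLpNorm (fun ξ : ℝ => ‖F ξ‖) 2 volume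
        + eLpNorm (fun ξ : ℝ => ‖(2 * Real.pi * Complex.I * ξ) ^ s * F ξ‖) 2 volume) := by
        gcongr
        exact eLpNorm_add_le hF.norm hm.norm (by norm_num)
    _ ≤ ENNReal.ofReal (2 ^ s) * (sobolevNorm s f + sobolevNorm s f) := by
        rw [eLpNorm_norm, eLpNorm_norm]
        gcongr
        · simp only [pow_zero, one_mul] at h0
          exact h0.trans (derivNorm_le_sobolevNorm (Nat.zero_le s) f)
        · exact hs.trans (derivNorm_le_sobolevNorm le_rfl f)
    _ = _ := by
        rw [← two_mul, ← mul_assoc, pow_succ, ENNReal.ofReal_mul (by positivity)]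
        norm_num

/-! ### Weights and `L²` bounds -/

/-- `F` is measurable with `‖F‖_{L²} ≤ A`. -/
def L2Bd (F : ℝ → ℂ) (A : ℝ) : Prop :=
  AEStronglyMeasurable F volume ∧ eLpNorm F 2 volume ≤ ENNReal.ofReal A

namespace L2Bd

variable {F G : ℝ → ℂ} {A B : ℝ}

lemma memLp (h : L2Bd F A) : MemLp F 2 volume := ⟨h.1, h.2.trans_lt ENNReal.ofReal_lt_top⟩

lemma le (h : L2Bd F A) (hAB : A ≤ B) : L2Bd F B :=
  ⟨h.1, h.2.trans (ENNReal.ofReal_le_ofReal hAB)⟩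

lemma mono (h : L2Bd F A) (hG : AEStronglyMeasurable G volume) (hFG : ∀ ξ, ‖G ξ‖ ≤ ‖F ξ‖) :
    L2Bd G A :=
  ⟨hG, (eLpNorm_mono hFG).trans h.2⟩

lemma mono_mul (h : L2Bd F A) {c : ℝ} (hc : 0 ≤ c) (hG : AEStronglyMeasurable G volume)
    (hFG : ∀ ξ, ‖G ξ‖ ≤ c * ‖F ξ‖) : L2Bd G (c * A) := by
  refine ⟨hG, (eLpNorm_le_mul_eLpNorm_of_ae_le_mul (Eventually.of_forall hFG) 2).trans ?_⟩
  rw [ENNReal.ofReal_mul hc]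
  gcongr
  exact h.2

lemma add (hF : L2Bd F A) (hG : L2Bd G B) (hA : 0 ≤ A) (hB : 0 ≤ B) :
    L2Bd (fun ξ => F ξ + G ξ) (A + B) := by
  refine ⟨hF.1.add hG.1, (eLpNorm_add_le hF.1 hG.1 (by norm_num)).trans ?_⟩
  rw [ENNReal.ofReal_add hA hB]
  exact add_le_add hF.2 hG.2

lemma norm (h : L2Bd F A) : L2Bd (fun ξ => (‖F ξ‖ : ℂ)) A :=
  h.mono (Complex.continuous_ofReal.comp_aestronglyMeasurable h.1.norm) fun ξ => by simp

lemma const_mul (h : L2Bd F A) (c : ℂ) : L2Bd (fun ξ => c * F ξ) (‖c‖ * A) :=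
  h.mono_mul (norm_nonneg c) (h.1.const_mul c) fun ξ => by rw [norm_mul]

/-- A function dominated by the sum of two square integrable functions. -/
lemma of_le_add {H : ℝ → ℂ} (hF : L2Bd F A) (hG : L2Bd G B) (hA : 0 ≤ A) (hB : 0 ≤ B)
    (hH : AEStronglyMeasurable H volume) (h : ∀ ξ, ‖H ξ‖ ≤ ‖F ξ‖ + ‖G ξ‖) : L2Bd H (A + B) := by
  refine (hF.norm.add hG.norm hA hB).mono hH fun ξ => (h ξ).trans ?_
  rw [← Complex.ofReal_add, Complex.norm_real]
  exact le_abs_self _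

lemma norm_toL2C_le (h : L2Bd F A) (hA : 0 ≤ A) : ‖toL2C F‖ ≤ A := BBMBurgers.norm_toL2C_le hA h.2

lemma comp_sub_left (h : L2Bd F A) (ξ : ℝ) : L2Bd (fun η => F (ξ - η)) A := by
  have hm := Measure.measurePreserving_sub_left (volume : Measure ℝ) ξ
  refine ⟨h.1.comp_measurePreserving hm, ?_⟩
  rw [show (fun η => F (ξ - η)) = F ∘ fun η => ξ - η from rfl,
    eLpNorm_comp_measurePreserving h.1 hm]
  exact h.2

/-- The Cauchy–Schwarz inequality. -/
lemma integral_mul_le (hF : L2Bd F A) (hG : L2Bd G B) (hA : 0 ≤ A) (hB : 0 ≤ B) :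
    ∫ ξ, ‖F ξ‖ * ‖G ξ‖ ≤ A * B := by
  have h1 : eLpNorm (fun ξ => ‖F ξ‖ * ‖G ξ‖) 1 volume ≤ ENNReal.ofReal (A * B) := by
    have := eLpNorm_smul_le_mul_eLpNorm (p := 2) (q := 2) (r := 1) hG.norm.1 hF.norm.1
    have e : eLpNorm (fun ξ => ‖F ξ‖ * ‖G ξ‖) 1 volume
        = eLpNorm ((fun ξ => (‖F ξ‖ : ℂ)) • fun ξ => (‖G ξ‖ : ℂ)) 1 volume :=
      eLpNorm_congr_norm_ae (Eventually.of_forall fun ξ => by simp)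
    rw [e, ENNReal.ofReal_mul hA]
    exact this.trans (mul_le_mul' hF.norm.2 hG.norm.2)
  have h2 : ∫ ξ, ‖F ξ‖ * ‖G ξ‖ = (eLpNorm (fun ξ => ‖F ξ‖ * ‖G ξ‖) 1 volume).toReal := by
    have hn : ∀ ξ, 0 ≤ ‖F ξ‖ * ‖G ξ‖ := fun ξ => by positivity
    have hm : AEStronglyMeasurable (fun ξ => ‖F ξ‖ * ‖G ξ‖) volume := hF.1.norm.mul hG.1.norm
    rw [eLpNorm_one_eq_lintegral_enorm,
      integral_eq_lintegral_of_nonneg_ae (Eventually.of_forall hn) hm]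
    congr 2
    ext ξ
    rw [Real.enorm_of_nonneg (hn ξ)]
  rw [h2]
  exact ENNReal.toReal_le_of_le_ofReal (by positivity) h1

lemma integrable_mul (hF : L2Bd F A) (hG : L2Bd G B) :
    Integrable (fun ξ => ‖F ξ‖ * ‖G ξ‖) volume :=
  hF.memLp.norm.integrable_mul hG.memLp.norm

end L2Bd

lemma l2Bd_of_integral {F : ℝ → ℂ} {A : ℝ} (hF : AEStronglyMeasurable F volume) (hA : 0 ≤ A)
    (hi : Integrable (fun ξ => ‖F ξ‖ ^ 2) volume) (h : ∫ ξ, ‖F ξ‖ ^ 2 ≤ A ^ 2) : L2Bd F A := by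
  have hm : MemLp F 2 volume := (memLp_two_iff_integrable_sq_norm hF).2 hi
  refine ⟨hF, ?_⟩
  rw [hm.eLpNorm_eq_integral_rpow_norm (by norm_num) (by norm_num)]
  refine ENNReal.ofReal_le_ofReal ?_
  have e : ∫ ξ, ‖F ξ‖ ^ (2 : ℝ≥0∞).toReal = ∫ ξ, ‖F ξ‖ ^ 2 := by
    congr 1; ext ξ; simp
  rw [e]
  calc (∫ ξ, ‖F ξ‖ ^ 2) ^ ((2 : ℝ≥0∞).toReal)⁻¹ ≤ (A ^ 2) ^ ((2 : ℝ≥0∞).toReal)⁻¹ :=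
        Real.rpow_le_rpow (integral_nonneg fun _ => by positivity) h (by positivity)
    _ = A := by
      rw [← Real.rpow_natCast A 2, ← Real.rpow_mul hA]
      norm_num

/-- The parabolic weight `1 + |ξ| √(1 + t)`. -/
def wt (t ξ : ℝ) : ℝ := 1 + |ξ| * √(1 + t)

lemma one_le_wt (t ξ : ℝ) : 1 ≤ wt t ξ := by
  have : 0 ≤ |ξ| * √(1 + t) := by positivity
  unfold wt; linarith

lemma wt_pos (t ξ : ℝ) : 0 < wt t ξ := zero_lt_one.trans_le (one_le_wt t ξ)

lemma wt_zero (ξ : ℝ) : wt 0 ξ = 1 + |ξ| := by simp [wt]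

lemma wt_mono {τ t : ℝ} (h : τ ≤ t) (ξ : ℝ) : wt τ ξ ≤ wt t ξ := by
  unfold wt; gcongr

lemma one_add_abs_le_wt {t : ℝ} (ht : 0 ≤ t) (ξ : ℝ) : 1 + |ξ| ≤ wt t ξ :=
  wt_zero ξ ▸ wt_mono ht ξ

lemma wt_neg (t ξ : ℝ) : wt t (-ξ) = wt t ξ := by simp [wt]

lemma wt_le_mul (t ξ η : ℝ) : wt t ξ ≤ wt t η * wt t (ξ - η) := by
  unfold wt
  have h : |ξ| ≤ |η| + |ξ - η| := by
    calc |ξ| = |η + (ξ - η)| := by ring_nf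
      _ ≤ _ := abs_add_le _ _
  have hr := Real.sqrt_nonneg (1 + t)
  have h1 := abs_nonneg η
  have h2 := abs_nonneg (ξ - η)
  have h3 := mul_nonneg (mul_nonneg h1 hr) (mul_nonneg h2 hr)
  nlinarith [mul_le_mul_of_nonneg_right h hr]

@[fun_prop]
lemma continuous_wt : Continuous fun p : ℝ × ℝ => wt p.1 p.2 := by
  unfold wt; fun_prop

lemma continuous_wt_right (t : ℝ) : Continuous (wt t) := by
  unfold wt; fun_prop

lemma abs_mul_sqrt_le_wt (t ξ : ℝ) : |ξ| * √(1 + t) ≤ wt t ξ := by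
  unfold wt; linarith

lemma norm_wt_pow (t ξ : ℝ) (s : ℕ) : ‖((wt t ξ ^ s : ℝ) : ℂ)‖ = wt t ξ ^ s := by
  rw [Complex.norm_real, Real.norm_of_nonneg (pow_nonneg (wt_pos t ξ).le s)]

lemma continuous_wt_pow (t : ℝ) (s : ℕ) : Continuous fun ξ => ((wt t ξ ^ s : ℝ) : ℂ) :=
  Complex.continuous_ofReal.comp ((continuous_wt_right t).pow s)

/-- The reciprocal of the weight is square integrable, with the decay of the heat kernel. -/
lemma l2Bd_inv_wt {t : ℝ} (ht : 0 ≤ t) :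
    L2Bd (fun ξ => (((wt t ξ)⁻¹ : ℝ) : ℂ)) (2 * (1 + t) ^ (-(1 / 4) : ℝ)) := by
  have h1 : 0 < 1 + t := by linarith
  have hr : 0 < √(1 + t) := Real.sqrt_pos.2 h1
  have hc : Continuous fun ξ => (wt t ξ)⁻¹ :=
    (continuous_wt_right t).inv₀ fun ξ => (wt_pos t ξ).ne'
  have hbd : ∀ ξ, ‖(((wt t ξ)⁻¹ : ℝ) : ℂ)‖ ^ 2 ≤ (1 + (ξ * √(1 + t)) ^ 2)⁻¹ := by
    intro ξ
    rw [Complex.norm_real, Real.norm_of_nonneg (inv_nonneg.2 (wt_pos t ξ).le), inv_pow]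
    refine inv_anti₀ (by positivity) ?_
    unfold wt
    have : (ξ * √(1 + t)) ^ 2 = (|ξ| * √(1 + t)) ^ 2 := by rw [mul_pow, mul_pow, sq_abs]
    rw [this]
    have : 0 ≤ |ξ| * √(1 + t) := by positivity
    nlinarith
  have hint : Integrable (fun ξ => (1 + (ξ * √(1 + t)) ^ 2)⁻¹) volume :=
    integrable_inv_one_add_sq.comp_mul_right' hr.ne'
  have hm : Integrable (fun ξ => ‖(((wt t ξ)⁻¹ : ℝ) : ℂ)‖ ^ 2) volume :=
    hint.mono' ((Complex.continuous_ofReal.comp hc).norm.pow 2).aestronglyMeasurable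
      (Eventually.of_forall fun ξ => by
        rw [Real.norm_of_nonneg (by positivity)]; exact hbd ξ)
  refine l2Bd_of_integral (Complex.continuous_ofReal.comp hc).aestronglyMeasurable
    (by positivity) hm ?_
  calc ∫ ξ, ‖(((wt t ξ)⁻¹ : ℝ) : ℂ)‖ ^ 2 ≤ ∫ ξ, (1 + (ξ * √(1 + t)) ^ 2)⁻¹ :=
        integral_mono hm hint hbd
    _ = (√(1 + t))⁻¹ * Real.pi := by
        rw [Measure.integral_comp_mul_right (fun x : ℝ => (1 + x ^ 2)⁻¹),
          integral_univ_inv_one_add_sq, abs_of_pos (inv_pos.2 hr), smul_eq_mul]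
    _ ≤ (√(1 + t))⁻¹ * 4 := by
        have := Real.pi_le_four
        gcongr
    _ = (2 * (1 + t) ^ (-(1 / 4) : ℝ)) ^ 2 := by
        rw [mul_pow, ← Real.rpow_natCast ((1 + t) ^ (-(1 / 4) : ℝ)), ← Real.rpow_mul h1.le,
          Real.sqrt_eq_rpow, ← Real.rpow_neg h1.le]
        norm_num
        ring

lemma l2Bd_of_le_inv_wt {G : ℝ → ℂ} {t c : ℝ} (ht : 0 ≤ t) (hc : 0 ≤ c)
    (hG : AEStronglyMeasurable G volume) (h : ∀ ξ, ‖G ξ‖ ≤ c / wt t ξ) :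
    L2Bd G (c * (2 * (1 + t) ^ (-(1 / 4) : ℝ))) :=
  (l2Bd_inv_wt ht).mono_mul hc hG fun ξ => (h ξ).trans_eq (by
    rw [Complex.norm_real, Real.norm_of_nonneg (inv_nonneg.2 (wt_pos t ξ).le), div_eq_mul_inv])

/-- The weight is submultiplicative, so a convolution inherits the weight of its factors. -/
lemma norm_conv_le {f g : ℝ → ℂ} {A B t : ℝ} {s : ℕ} (hA : 0 ≤ A) (hB : 0 ≤ B)
    (hf : L2Bd (fun ξ => ((wt t ξ ^ s : ℝ) : ℂ) * f ξ) A)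
    (hg : L2Bd (fun ξ => ((wt t ξ ^ s : ℝ) : ℂ) * g ξ) B) (ξ : ℝ) :
    ‖conv f g ξ‖ ≤ A * B / wt t ξ ^ s := by
  have hg' := hg.comp_sub_left ξ
  have hp := wt_pos t ξ
  have h1 : ∀ η, ‖f η * g (ξ - η)‖ ≤ (wt t ξ ^ s)⁻¹
      * (‖((wt t η ^ s : ℝ) : ℂ) * f η‖
        * ‖((wt t (ξ - η) ^ s : ℝ) : ℂ) * g (ξ - η)‖) := by
    intro η
    rw [norm_mul, norm_mul, norm_mul, norm_wt_pow, norm_wt_pow]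
    have h2 : wt t ξ ^ s ≤ wt t η ^ s * wt t (ξ - η) ^ s := by
      rw [← mul_pow]
      exact pow_le_pow_left₀ hp.le (wt_le_mul t ξ η) s
    rw [inv_mul_eq_div, le_div_iff₀ (pow_pos hp s)]
    calc ‖f η‖ * ‖g (ξ - η)‖ * wt t ξ ^ s
        ≤ ‖f η‖ * ‖g (ξ - η)‖ * (wt t η ^ s * wt t (ξ - η) ^ s) := by gcongr
      _ = _ := by ring
  calc ‖conv f g ξ‖ ≤ ∫ η, (wt t ξ ^ s)⁻¹ * (‖((wt t η ^ s : ℝ) : ℂ) * f η‖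
        * ‖((wt t (ξ - η) ^ s : ℝ) : ℂ) * g (ξ - η)‖) :=
        norm_integral_le_of_norm_le ((hf.integrable_mul hg').const_mul _)
          (Eventually.of_forall h1)
    _ ≤ (wt t ξ ^ s)⁻¹ * (A * B) := by
        rw [integral_const_mul]
        gcongr
        exact hf.integral_mul_le hg' hA hB
    _ = _ := by rw [div_eq_mul_inv, mul_comm]

/-! ### The symbols -/

/-- The dissipation rate `ξ² / (1 + ξ²)`. -/
def kap (ξ : ℝ) : ℝ := ξ ^ 2 / (1 + ξ ^ 2)

lemma kap_nonneg (ξ : ℝ) : 0 ≤ kap ξ := by unfold kap; positivity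

lemma kap_le_one (ξ : ℝ) : kap ξ ≤ 1 := by
  unfold kap
  rw [div_le_one (by positivity)]
  linarith

lemma kap_le_kap_mul {c : ℝ} (hc : 1 ≤ c) (ξ : ℝ) : kap ξ ≤ kap (c * ξ) := by
  unfold kap
  rw [div_le_div_iff₀ (by positivity) (by positivity)]
  have : ξ ^ 2 ≤ c ^ 2 * ξ ^ 2 := le_mul_of_one_le_left (sq_nonneg ξ) (one_le_pow₀ hc)
  nlinarith

/-- The symbol of `∂ₓ (1 - ∂ₓ²)⁻¹` in the frequency variable of Mathlib. -/
def bsym (ξ : ℝ) : ℂ :=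
  Complex.I * (2 * Real.pi * ξ : ℝ) * (1 / (1 + ((2 * Real.pi * ξ : ℝ) : ℂ) ^ 2))

lemma one_add_sq_ne_zero (x : ℝ) : (1 + (x : ℂ) ^ 2) ≠ 0 := by
  have : (1 + (x : ℂ) ^ 2) = ((1 + x ^ 2 : ℝ) : ℂ) := by push_cast; rfl
  rw [this, Complex.ofReal_ne_zero]
  positivity

lemma norm_one_add_sq (x : ℝ) : ‖(1 + (x : ℂ) ^ 2)‖ = 1 + x ^ 2 := by
  have : (1 + (x : ℂ) ^ 2) = ((1 + x ^ 2 : ℝ) : ℂ) := by push_cast; rfl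
  rw [this, Complex.norm_real, Real.norm_of_nonneg (by positivity)]

lemma continuous_bsym : Continuous bsym := by
  unfold bsym
  refine Continuous.mul (by fun_prop) (continuous_const.div (by fun_prop) fun ξ => ?_)
  exact one_add_sq_ne_zero _

lemma sq_le_two_pi_mul_sq (ξ : ℝ) : ξ ^ 2 ≤ (2 * Real.pi * ξ) ^ 2 := by
  have := Real.pi_gt_three
  rw [mul_pow]
  exact le_mul_of_one_le_left (sq_nonneg ξ) (one_le_pow₀ (by linarith))

lemma norm_bsym_le (ξ : ℝ) : ‖bsym ξ‖ ≤ 2 * Real.pi * (|ξ| / (1 + ξ ^ 2)) := by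
  unfold bsym
  rw [norm_mul, norm_mul, Complex.norm_I, one_mul, Complex.norm_real, norm_div, norm_one,
    norm_one_add_sq, Real.norm_eq_abs, abs_mul, abs_of_pos Real.two_pi_pos, mul_one_div,
    mul_div_assoc]
  refine mul_le_mul_of_nonneg_left (div_le_div_of_nonneg_left (abs_nonneg ξ) (by positivity) ?_)
    (by positivity)
  linarith [sq_le_two_pi_mul_sq ξ]

/-- The exponent of `symbolT`, that is `symbolT γ t (2πξ) = exp (t · Lsym γ ξ)`. -/
def Lsym (γ ξ : ℝ) : ℂ :=
  (-((2 * Real.pi * ξ : ℝ) : ℂ) ^ 2 + Complex.I * (γ * ((2 * Real.pi * ξ : ℝ) : ℂ) ^ 3))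
    / (1 + ((2 * Real.pi * ξ : ℝ) : ℂ) ^ 2)

lemma symbolT_eq (γ t ξ : ℝ) :
    symbolT γ t (2 * Real.pi * ξ) = Complex.exp (t * Lsym γ ξ) := by
  unfold symbolT Lsym
  congr 1
  rw [← mul_div_assoc]
  congr 1
  ring

lemma continuous_Lsym (γ : ℝ) : Continuous (Lsym γ) := by
  unfold Lsym
  exact Continuous.div (by fun_prop) (by fun_prop) fun ξ => one_add_sq_ne_zero _

lemma re_Lsym (γ ξ : ℝ) : (Lsym γ ξ).re = -kap (2 * Real.pi * ξ) := by
  unfold Lsym kap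
  have : (1 + ((2 * Real.pi * ξ : ℝ) : ℂ) ^ 2) = ((1 + (2 * Real.pi * ξ) ^ 2 : ℝ) : ℂ) := by
    push_cast; rfl
  rw [this, Complex.div_ofReal_re, ← neg_div]
  congr 1
  rw [← Complex.ofReal_pow, ← Complex.ofReal_pow, ← Complex.ofReal_mul]
  simp [-Complex.ofReal_pow, -Complex.ofReal_mul]

/-- The multiplier `T(t)` in the frequency variable of Mathlib. -/
def asym (γ t ξ : ℝ) : ℂ := symbolT γ t (2 * Real.pi * ξ)

lemma asym_eq (γ t ξ : ℝ) : asym γ t ξ = Complex.exp (t * Lsym γ ξ) := symbolT_eq γ t ξ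

lemma norm_asym (γ t ξ : ℝ) : ‖asym γ t ξ‖ = Real.exp (-(kap (2 * Real.pi * ξ) * t)) := by
  rw [asym_eq, Complex.norm_exp, Complex.re_ofReal_mul, re_Lsym]
  congr 1
  ring

lemma norm_asym_le {t : ℝ} (ht : 0 ≤ t) (γ ξ : ℝ) :
    ‖asym γ t ξ‖ ≤ Real.exp (-(kap ξ * t)) := by
  rw [norm_asym]
  refine Real.exp_le_exp.2 (neg_le_neg ?_)
  have := Real.pi_gt_three
  exact mul_le_mul_of_nonneg_right (kap_le_kap_mul (by linarith) ξ) ht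

lemma norm_asym_le_one {t : ℝ} (ht : 0 ≤ t) (γ ξ : ℝ) : ‖asym γ t ξ‖ ≤ 1 := by
  refine (norm_asym_le ht γ ξ).trans (Real.exp_le_one_iff.2 ?_)
  have := mul_nonneg (kap_nonneg ξ) ht
  linarith

lemma continuous_asym (γ : ℝ) : Continuous fun p : ℝ × ℝ => asym γ p.1 p.2 := by
  simp only [asym_eq]
  have := (continuous_Lsym γ).comp (continuous_snd (X := ℝ))
  exact Complex.continuous_exp.comp
    ((Complex.continuous_ofReal.comp continuous_fst).mul this)

lemma asym_add (γ t τ ξ : ℝ) : asym γ (t + τ) ξ = asym γ t ξ * asym γ τ ξ := by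
  rw [asym_eq, asym_eq, asym_eq, ← Complex.exp_add]
  congr 1
  push_cast
  ring

lemma asym_zero (γ ξ : ℝ) : asym γ 0 ξ = 1 := by simp [asym_eq]

lemma hasDerivAt_asym (γ t ξ : ℝ) :
    HasDerivAt (fun t => asym γ t ξ) (Lsym γ ξ * asym γ t ξ) t := by
  have h : HasDerivAt (fun t : ℝ => (t : ℂ) * Lsym γ ξ) (Lsym γ ξ) t := by
    simpa using (Complex.ofRealCLM.hasDerivAt (x := t)).mul_const (Lsym γ ξ)
  have := h.cexp
  simp only [asym_eq]
  rwa [mul_comm] at this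

/-! ### Pointwise bounds for the Duhamel integral -/

lemma one_add_pow_mul_exp_le (m : ℕ) {z : ℝ} (hz : 0 ≤ z) :
    (1 + z) ^ m * Real.exp (-(z ^ 2 / 4)) ≤ Real.exp 2 * m.factorial := by
  have h1 := Real.pow_div_factorial_le_exp (1 + z) (by positivity) m
  rw [div_le_iff₀ (by positivity)] at h1
  calc (1 + z) ^ m * Real.exp (-(z ^ 2 / 4))
      ≤ (Real.exp (1 + z) * m.factorial) * Real.exp (-(z ^ 2 / 4)) := by gcongr
    _ = Real.exp (1 + z - z ^ 2 / 4) * m.factorial := by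
        rw [sub_eq_add_neg, Real.exp_add (1 + z)]; ring
    _ ≤ _ := by
        gcongr
        nlinarith [sq_nonneg (z - 2)]

/-- The diffusive variable `√(κ(ξ) (1 + t))`. -/
def zz (t ξ : ℝ) : ℝ := √(kap ξ * (1 + t))

lemma zz_nonneg (t ξ : ℝ) : 0 ≤ zz t ξ := Real.sqrt_nonneg _

lemma zz_sq {t : ℝ} (ht : 0 ≤ t) (ξ : ℝ) : zz t ξ ^ 2 = kap ξ * (1 + t) :=
  Real.sq_sqrt (mul_nonneg (kap_nonneg ξ) (by linarith))

lemma abs_mul_sqrt_eq {t : ℝ} (ht : 0 ≤ t) (ξ : ℝ) :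
    |ξ| * √(1 + t) = zz t ξ * √(1 + ξ ^ 2) := by
  unfold zz kap
  rw [← Real.sqrt_mul (by positivity), ← Real.sqrt_sq_eq_abs, ← Real.sqrt_mul (by positivity)]
  congr 1
  field_simp

lemma sqrt_one_add_sq_le (ξ : ℝ) : √(1 + ξ ^ 2) ≤ 1 + |ξ| := by
  refine Real.sqrt_le_iff.2 ⟨by positivity, ?_⟩
  have := abs_nonneg ξ
  nlinarith [sq_abs ξ]

lemma wt_le_zz {t : ℝ} (ht : 0 ≤ t) (ξ : ℝ) : wt t ξ ≤ (1 + |ξ|) * (1 + zz t ξ) := by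
  unfold wt
  rw [abs_mul_sqrt_eq ht]
  have h1 := mul_le_mul_of_nonneg_left (sqrt_one_add_sq_le ξ) (zz_nonneg t ξ)
  have := abs_nonneg ξ
  nlinarith

lemma wt_le_zz_low {t ξ : ℝ} (ht : 0 ≤ t) (h : |ξ| ≤ 1) : wt t ξ ≤ 2 * (1 + zz t ξ) := by
  unfold wt
  rw [abs_mul_sqrt_eq ht]
  have h1 := mul_le_mul_of_nonneg_left (sqrt_one_add_sq_le ξ) (zz_nonneg t ξ)
  have := zz_nonneg t ξ
  nlinarith

lemma sqrt_le_zz_high {t ξ : ℝ} (ht : 0 ≤ t) (h : 1 ≤ |ξ|) : 1 + t ≤ 2 * (1 + zz t ξ) ^ 2 := by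
  have h1 : 1 ≤ ξ ^ 2 := by rw [← sq_abs]; nlinarith
  have h2 : 1 / 2 ≤ kap ξ := by
    unfold kap
    rw [div_le_div_iff₀ (by norm_num) (by positivity)]
    linarith
  have := zz_sq ht ξ
  have := zz_nonneg t ξ
  nlinarith

lemma zz_pow_mul_exp_le (m : ℕ) {t : ℝ} (ht : 0 ≤ t) (ξ : ℝ) :
    (1 + zz t ξ) ^ m * Real.exp (-(kap ξ * t / 4)) ≤ Real.exp 3 * m.factorial := by
  have h1 := one_add_pow_mul_exp_le m (zz_nonneg t ξ)
  have h2 : Real.exp (-(kap ξ * t / 4)) ≤ Real.exp 1 * Real.exp (-(zz t ξ ^ 2 / 4)) := by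
    rw [← Real.exp_add, zz_sq ht]
    refine Real.exp_le_exp.2 ?_
    have := kap_le_one ξ
    have := kap_nonneg ξ
    nlinarith
  have hz := zz_nonneg t ξ
  calc (1 + zz t ξ) ^ m * Real.exp (-(kap ξ * t / 4))
      ≤ (1 + zz t ξ) ^ m * (Real.exp 1 * Real.exp (-(zz t ξ ^ 2 / 4))) := by gcongr
    _ = Real.exp 1 * ((1 + zz t ξ) ^ m * Real.exp (-(zz t ξ ^ 2 / 4))) := by ring
    _ ≤ Real.exp 1 * (Real.exp 2 * m.factorial) := by gcongr
    _ = _ := by rw [← mul_assoc, ← Real.exp_add]; norm_num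

lemma integral_one_add_rpow_le {p t : ℝ} (hp : p < 1) (ht : 0 ≤ t) :
    IntervalIntegrable (fun τ => (1 + τ) ^ (-p)) volume 0 t ∧
      ∫ τ in (0 : ℝ)..t, (1 + τ) ^ (-p) ≤ (1 + t) ^ (1 - p) / (1 - p) := by
  have hcont : ContinuousOn (fun τ : ℝ => (1 + τ) ^ (-p)) (Set.uIcc 0 t) := by
    refine ContinuousOn.rpow_const (by fun_prop) fun τ hτ => Or.inl ?_
    rw [Set.uIcc_of_le ht] at hτ
    have := hτ.1
    positivity
  have hi := hcont.intervalIntegrable (μ := volume)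
  refine ⟨hi, ?_⟩
  have hd : ∀ τ ∈ Set.uIcc 0 t, HasDerivAt (fun τ : ℝ => (1 + τ) ^ (1 - p) / (1 - p))
      ((1 + τ) ^ (-p)) τ := by
    intro τ hτ
    rw [Set.uIcc_of_le ht] at hτ
    have h0 : (1 + τ) ≠ 0 := by have := hτ.1; positivity
    have h1 := ((hasDerivAt_id τ).const_add 1).rpow_const (p := 1 - p) (Or.inl h0)
    have h2 := h1.div_const (1 - p)
    refine h2.congr_deriv ?_
    have : 1 - p ≠ 0 := by linarith
    rw [show 1 - p - 1 = -p by ring]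
    simp only [id]
    field_simp
  rw [intervalIntegral.integral_eq_sub_of_hasDerivAt hd hi]
  simp only [add_zero, Real.one_rpow]
  have : 0 < 1 - p := by linarith
  have : 0 ≤ 1 / (1 - p) := by positivity
  linarith

lemma integral_exp_kap {κ t t₁ : ℝ} :
    κ * ∫ τ in t₁..t, Real.exp (-(κ * (t - τ))) = 1 - Real.exp (-(κ * (t - t₁))) := by
  have hd : ∀ τ ∈ Set.uIcc t₁ t, HasDerivAt (fun τ => Real.exp (-(κ * (t - τ))))
      (κ * Real.exp (-(κ * (t - τ)))) τ := by
    intro τ _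
    have h1 : HasDerivAt (fun τ => -(κ * (t - τ))) κ τ := by
      have := (((hasDerivAt_id' τ).const_sub t).const_mul κ).fun_neg
      simpa using this
    simpa [mul_comm] using h1.exp
  rw [← intervalIntegral.integral_const_mul, intervalIntegral.integral_eq_sub_of_hasDerivAt hd
    (Continuous.intervalIntegrable (by fun_prop) _ _)]
  simp

/-- The constant of `norm_duhamel_early_le`. -/
def Cearly (s : ℕ) : ℝ := 8 * (Real.exp 3 * (s + 2).factorial)

lemma Cearly_pos (s : ℕ) : 0 < Cearly s := by unfold Cearly; positivity

lemma wt_mul_exp_le {t ξ : ℝ} (s : ℕ) (ht : 0 ≤ t) :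
    wt t ξ ^ (s + 1) * ((|ξ| / (1 + ξ ^ 2)) * √(1 + t) * Real.exp (-(kap ξ * t / 2)))
      ≤ 2 * (Real.exp 3 * (s + 2).factorial) * (1 + |ξ|) ^ s := by
  have hz := zz_nonneg t ξ
  have hq : 0 < 1 + ξ ^ 2 := by positivity
  have hsq : 0 < √(1 + ξ ^ 2) := Real.sqrt_pos.2 hq
  have h1 : (|ξ| / (1 + ξ ^ 2)) * √(1 + t) = zz t ξ / √(1 + ξ ^ 2) := by
    rw [div_mul_eq_mul_div, abs_mul_sqrt_eq ht, div_eq_div_iff hq.ne' hsq.ne', mul_assoc,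
      Real.mul_self_sqrt hq.le]
  have h2 : (1 + |ξ|) / √(1 + ξ ^ 2) ≤ 2 := by
    rw [div_le_iff₀ hsq]
    have a1 : |ξ| ≤ √(1 + ξ ^ 2) := Real.abs_le_sqrt (by linarith)
    have a2 : 1 ≤ √(1 + ξ ^ 2) := Real.one_le_sqrt.2 (by nlinarith)
    linarith
  have h3 : Real.exp (-(kap ξ * t / 2)) ≤ Real.exp (-(kap ξ * t / 4)) := by
    refine Real.exp_le_exp.2 ?_
    have := mul_nonneg (kap_nonneg ξ) ht
    linarith
  have h4 := zz_pow_mul_exp_le (s + 2) ht ξ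
  have hwt := (wt_pos t ξ).le
  rw [h1]
  calc wt t ξ ^ (s + 1) * (zz t ξ / √(1 + ξ ^ 2) * Real.exp (-(kap ξ * t / 2)))
      ≤ ((1 + |ξ|) * (1 + zz t ξ)) ^ (s + 1)
        * ((1 + zz t ξ) / √(1 + ξ ^ 2) * Real.exp (-(kap ξ * t / 4))) := by
        gcongr
        · exact wt_le_zz ht ξ
        · linarith
    _ = (1 + |ξ|) ^ s * ((1 + |ξ|) / √(1 + ξ ^ 2))
        * ((1 + zz t ξ) ^ (s + 2) * Real.exp (-(kap ξ * t / 4))) := by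
        rw [mul_pow]; ring
    _ ≤ (1 + |ξ|) ^ s * 2 * (Real.exp 3 * (s + 2).factorial) := by gcongr
    _ = _ := by ring

/-- The contribution of the times `τ ≤ t / 2` to the Duhamel integral. The heat kernel is not
singular there, and the decay in `τ` is not integrable, whence the condition on `b`. -/
lemma norm_duhamel_early_le {s : ℕ} {A b t ξ : ℝ} (hA : 0 ≤ A) (hb : b ≤ 1 / 4) (ht : 0 ≤ t)
    {H : ℝ → ℂ}
    (hH : ∀ τ, 0 ≤ τ → τ ≤ t / 2 → ‖H τ‖ ≤ (|ξ| / (1 + ξ ^ 2)) * Real.exp (-(kap ξ * (t - τ)))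
      * (A * (1 + τ) ^ (-(1 / 2 + b)) / wt τ ξ ^ s)) :
    ‖∫ τ in (0 : ℝ)..t / 2, H τ‖ ≤ Cearly s * A * (1 + t) ^ (-b) / wt t ξ ^ (s + 1) := by
  have ht2 : 0 ≤ t / 2 := by linarith
  have h1t : 0 < 1 + t := by linarith
  obtain ⟨hi, hle⟩ := integral_one_add_rpow_le (p := 1 / 2 + b) (t := t / 2) (by linarith) ht2
  set c : ℝ := (|ξ| / (1 + ξ ^ 2)) * Real.exp (-(kap ξ * t / 2)) * A / (1 + |ξ|) ^ s with hc
  have hc0 : 0 ≤ c := by positivity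
  have hbound : ∀ τ ∈ Set.Ioc 0 (t / 2), ‖H τ‖ ≤ c * (1 + τ) ^ (-(1 / 2 + b)) := by
    intro τ hτ
    have hτ0 : 0 ≤ τ := hτ.1.le
    have hr : 0 ≤ (1 + τ) ^ (-(1 / 2 + b)) := Real.rpow_nonneg (by linarith) _
    refine (hH τ hτ0 hτ.2).trans ?_
    have e1 : Real.exp (-(kap ξ * (t - τ))) ≤ Real.exp (-(kap ξ * t / 2)) := by
      refine Real.exp_le_exp.2 ?_
      have := mul_le_mul_of_nonneg_left hτ.2 (kap_nonneg ξ)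
      linarith
    have e2 : (1 + |ξ|) ^ s ≤ wt τ ξ ^ s :=
      pow_le_pow_left₀ (by positivity) (one_add_abs_le_wt hτ0 ξ) s
    have hwτ := wt_pos τ ξ
    calc _ ≤ (|ξ| / (1 + ξ ^ 2)) * Real.exp (-(kap ξ * t / 2))
          * (A * (1 + τ) ^ (-(1 / 2 + b)) / (1 + |ξ|) ^ s) := by gcongr
      _ = _ := by rw [hc]; ring
  have h1 := intervalIntegral.norm_integral_le_of_norm_le ht2
    (Eventually.of_forall hbound) (hi.const_mul c)
  refine h1.trans ?_
  rw [intervalIntegral.integral_const_mul, le_div_iff₀ (pow_pos (wt_pos t ξ) _)]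
  have h2 : (∫ τ in (0 : ℝ)..t / 2, (1 + τ) ^ (-(1 / 2 + b))) ≤ 4 * (√(1 + t) * (1 + t) ^ (-b)) := by
    refine hle.trans ?_
    rw [div_le_iff₀ (by linarith)]
    have e1 : (1 + t / 2) ^ (1 - (1 / 2 + b)) ≤ (1 + t) ^ (1 - (1 / 2 + b)) :=
      Real.rpow_le_rpow (by linarith) (by linarith) (by linarith)
    have e2 : (1 + t) ^ (1 - (1 / 2 + b)) = √(1 + t) * (1 + t) ^ (-b) := by
      rw [Real.sqrt_eq_rpow, ← Real.rpow_add h1t]; congr 1; ring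
    rw [e2] at e1
    have e3 : 0 ≤ √(1 + t) * (1 + t) ^ (-b) := by positivity
    nlinarith
  have h3 := wt_mul_exp_le (ξ := ξ) s ht
  have h0 : 0 < (1 + |ξ|) ^ s := by positivity
  calc c * (∫ τ in (0 : ℝ)..t / 2, (1 + τ) ^ (-(1 / 2 + b))) * wt t ξ ^ (s + 1)
      ≤ c * (4 * (√(1 + t) * (1 + t) ^ (-b))) * wt t ξ ^ (s + 1) := by
        have := (wt_pos t ξ).le
        gcongr
    _ = 4 * A * (1 + t) ^ (-b) / (1 + |ξ|) ^ s * (wt t ξ ^ (s + 1)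
        * ((|ξ| / (1 + ξ ^ 2)) * √(1 + t) * Real.exp (-(kap ξ * t / 2)))) := by
        rw [hc]; ring
    _ ≤ 4 * A * (1 + t) ^ (-b) / (1 + |ξ|) ^ s
        * (2 * (Real.exp 3 * (s + 2).factorial) * (1 + |ξ|) ^ s) := by
        gcongr
    _ = _ := by
        unfold Cearly
        field_simp
        ring

/-- The contribution of the times `τ ≥ t / 2` to the Duhamel integral. -/
lemma norm_duhamel_late_le {s : ℕ} {A b t ξ : ℝ} (hA : 0 ≤ A) (hb0 : 0 ≤ b) (hb : b ≤ 1 / 2)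
    (ht : 0 ≤ t) {H : ℝ → ℂ}
    (hH : ∀ τ, t / 2 ≤ τ → τ ≤ t → ‖H τ‖ ≤ (|ξ| / (1 + ξ ^ 2)) * Real.exp (-(kap ξ * (t - τ)))
      * (A * (1 + τ) ^ (-(1 / 2 + b)) / wt τ ξ ^ s)) :
    ‖∫ τ in t / 2..t, H τ‖ ≤ 2 ^ (s + 2) * A * (1 + t) ^ (-b) / wt t ξ ^ (s + 1) := by
  have h1t : 0 < 1 + t := by linarith
  have hw := wt_pos t ξ
  set c : ℝ := (|ξ| / (1 + ξ ^ 2)) * (A * (2 * (1 + t) ^ (-(1 / 2 + b))) * 2 ^ s / wt t ξ ^ s)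
    with hc
  have hc0 : 0 ≤ c := by positivity
  have hbound : ∀ τ ∈ Set.Ioc (t / 2) t, ‖H τ‖ ≤ c * Real.exp (-(kap ξ * (t - τ))) := by
    intro τ hτ
    have hτ0 : 0 ≤ τ := by have := hτ.1; linarith
    refine (hH τ hτ.1.le hτ.2).trans ?_
    have e1 : (1 + τ) ^ (-(1 / 2 + b)) ≤ 2 * (1 + t) ^ (-(1 / 2 + b)) := by
      have a1 : (1 + τ) ^ (-(1 / 2 + b)) ≤ ((1 + t) / 2) ^ (-(1 / 2 + b)) :=
        Real.rpow_le_rpow_of_nonpos (by linarith) (by have := hτ.1; linarith) (by linarith)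
      refine a1.trans ?_
      rw [Real.div_rpow h1t.le (by norm_num), Real.rpow_neg (by norm_num : (0 : ℝ) ≤ 2),
        div_inv_eq_mul, mul_comm]
      refine mul_le_mul_of_nonneg_right ?_ (by positivity)
      calc (2 : ℝ) ^ (1 / 2 + b) ≤ 2 ^ (1 : ℝ) :=
            Real.rpow_le_rpow_of_exponent_le (by norm_num) (by linarith)
        _ = 2 := Real.rpow_one 2
    have e2 : wt t ξ ≤ 2 * wt τ ξ := by
      have a1 : √(1 + t) ≤ 2 * √(1 + τ) := by
        refine Real.sqrt_le_iff.2 ⟨by positivity, ?_⟩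
        rw [mul_pow, Real.sq_sqrt (by linarith)]
        have := hτ.1; linarith
      have := mul_le_mul_of_nonneg_left a1 (abs_nonneg ξ)
      unfold wt
      linarith
    have e3 : wt t ξ ^ s ≤ 2 ^ s * wt τ ξ ^ s := by
      rw [← mul_pow]; exact pow_le_pow_left₀ hw.le e2 s
    have e4 : 1 / wt τ ξ ^ s ≤ 2 ^ s / wt t ξ ^ s := by
      rw [div_le_div_iff₀ (pow_pos (wt_pos τ ξ) s) (pow_pos hw s), one_mul]
      exact e3
    have hr : 0 ≤ (1 + τ) ^ (-(1 / 2 + b)) := Real.rpow_nonneg (by linarith) _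
    have hwτ := wt_pos τ ξ
    calc _ = (|ξ| / (1 + ξ ^ 2)) * (A * (1 + τ) ^ (-(1 / 2 + b)) * (1 / wt τ ξ ^ s))
          * Real.exp (-(kap ξ * (t - τ))) := by ring
      _ ≤ (|ξ| / (1 + ξ ^ 2)) * (A * (2 * (1 + t) ^ (-(1 / 2 + b))) * (2 ^ s / wt t ξ ^ s))
          * Real.exp (-(kap ξ * (t - τ))) := by gcongr
      _ = _ := by rw [hc]; ring
  have hi : IntervalIntegrable (fun τ => Real.exp (-(kap ξ * (t - τ)))) volume (t / 2) t :=
    Continuous.intervalIntegrable (by fun_prop) _ _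
  have h1 := intervalIntegral.norm_integral_le_of_norm_le (by linarith : t / 2 ≤ t)
    (Eventually.of_forall hbound) (hi.const_mul c)
  refine h1.trans ?_
  rw [intervalIntegral.integral_const_mul]
  set E := ∫ τ in t / 2..t, Real.exp (-(kap ξ * (t - τ))) with hE
  have hE0 : 0 ≤ E := intervalIntegral.integral_nonneg (by linarith) fun τ _ => (Real.exp_pos _).le
  have hE1 : kap ξ * E ≤ 1 := by
    rw [hE, integral_exp_kap]
    linarith [Real.exp_pos (-(kap ξ * (t - t / 2)))]
  have hE2 : E ≤ 1 + t := by
    have : E ≤ ∫ _τ in t / 2..t, (1 : ℝ) :=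
      intervalIntegral.integral_mono_on (by linarith) hi (by simp) fun τ hτ => by
        refine Real.exp_le_one_iff.2 ?_
        have := mul_nonneg (kap_nonneg ξ) (sub_nonneg.2 hτ.2)
        linarith
    refine this.trans ?_
    simp only [intervalIntegral.integral_const, smul_eq_mul, mul_one]
    linarith
  have hkey : wt t ξ * ((|ξ| / (1 + ξ ^ 2)) * E) ≤ 2 * √(1 + t) := by
    have hr := Real.sqrt_nonneg (1 + t)
    have a1 : (|ξ| / (1 + ξ ^ 2)) * E ≤ √(1 + t) := by
      refine Real.le_sqrt_of_sq_le ?_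
      have b1 : (|ξ| / (1 + ξ ^ 2)) ^ 2 ≤ kap ξ := by
        unfold kap
        rw [div_pow, sq_abs, div_le_div_iff₀ (by positivity) (by positivity)]
        nlinarith [sq_nonneg ξ, mul_nonneg (sq_nonneg ξ) (sq_nonneg ξ)]
      calc ((|ξ| / (1 + ξ ^ 2)) * E) ^ 2 = (|ξ| / (1 + ξ ^ 2)) ^ 2 * E * E := by ring
        _ ≤ kap ξ * E * E := by gcongr
        _ ≤ 1 * (1 + t) := by gcongr
        _ = _ := one_mul _
    have a2 : |ξ| * √(1 + t) * ((|ξ| / (1 + ξ ^ 2)) * E) ≤ √(1 + t) := by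
      have : |ξ| * √(1 + t) * ((|ξ| / (1 + ξ ^ 2)) * E) = √(1 + t) * (kap ξ * E) := by
        unfold kap
        rw [← sq_abs ξ]
        ring
      rw [this]
      exact mul_le_of_le_one_right hr hE1
    have : wt t ξ * ((|ξ| / (1 + ξ ^ 2)) * E) = (|ξ| / (1 + ξ ^ 2)) * E
        + |ξ| * √(1 + t) * ((|ξ| / (1 + ξ ^ 2)) * E) := by unfold wt; ring
    linarith
  rw [le_div_iff₀ (pow_pos hw _)]
  have e5 : (1 + t) ^ (-(1 / 2 + b)) * √(1 + t) = (1 + t) ^ (-b) := by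
    rw [Real.sqrt_eq_rpow, ← Real.rpow_add h1t]; congr 1; ring
  calc c * E * wt t ξ ^ (s + 1)
      = A * (2 * (1 + t) ^ (-(1 / 2 + b))) * 2 ^ s * (wt t ξ * ((|ξ| / (1 + ξ ^ 2)) * E)) := by
        rw [hc]; field_simp; ring
    _ ≤ A * (2 * (1 + t) ^ (-(1 / 2 + b))) * 2 ^ s * (2 * √(1 + t)) := by gcongr
    _ = 2 ^ (s + 2) * A * ((1 + t) ^ (-(1 / 2 + b)) * √(1 + t)) := by ring
    _ = _ := by rw [e5]

/-- The constant of the full Duhamel integral. -/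
def Cduh (s : ℕ) : ℝ := Cearly s + 2 ^ (s + 2)

lemma Cduh_pos (s : ℕ) : 0 < Cduh s := by
  have := Cearly_pos s
  unfold Cduh; positivity

lemma norm_duhamel_le {s : ℕ} {A b t ξ : ℝ} (hA : 0 ≤ A) (hb0 : 0 ≤ b) (hb : b ≤ 1 / 4)
    (ht : 0 ≤ t) {H : ℝ → ℂ} (hHi : IntervalIntegrable H volume 0 t)
    (hH : ∀ τ, 0 ≤ τ → τ ≤ t → ‖H τ‖ ≤ (|ξ| / (1 + ξ ^ 2)) * Real.exp (-(kap ξ * (t - τ)))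
      * (A * (1 + τ) ^ (-(1 / 2 + b)) / wt τ ξ ^ s)) :
    ‖∫ τ in (0 : ℝ)..t, H τ‖ ≤ Cduh s * A * (1 + t) ^ (-b) / wt t ξ ^ (s + 1) := by
  have ht2 : t / 2 ∈ Set.uIcc 0 t := by
    rw [Set.uIcc_of_le ht]; constructor <;> linarith
  have i1 := hHi.mono_set (Set.uIcc_subset_uIcc_left ht2)
  have i2 := hHi.mono_set (Set.uIcc_subset_uIcc_right ht2)
  rw [← intervalIntegral.integral_add_adjacent_intervals i1 i2]
  refine (norm_add_le _ _).trans ?_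
  have h1 := norm_duhamel_early_le (b := b) hA hb ht fun τ h0 h1 => hH τ h0 (by linarith)
  have h2 := norm_duhamel_late_le (b := b) hA hb0 (by linarith) ht
    fun τ h0 h1 => hH τ (by linarith) h1
  refine (add_le_add h1 h2).trans_eq ?_
  unfold Cduh
  ring

/-! ### The linear evolution -/

/-- The constant of the linear estimates. -/
def Clin (s : ℕ) : ℝ := 2 ^ (s + 2) * (Real.exp 3 * (s + 2).factorial)

lemma Clin_pos (s : ℕ) : 0 < Clin s := by unfold Clin; positivity

lemma wt_pow_mul_exp_low (s : ℕ) {t ξ : ℝ} (ht : 0 ≤ t) (h : |ξ| ≤ 1) :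
    wt t ξ ^ s * Real.exp (-(kap ξ * t / 4)) ≤ Clin s / wt t ξ ^ 2 := by
  rw [le_div_iff₀ (pow_pos (wt_pos t ξ) 2)]
  have hz := zz_nonneg t ξ
  have hwt := (wt_pos t ξ).le
  calc wt t ξ ^ s * Real.exp (-(kap ξ * t / 4)) * wt t ξ ^ 2
      = wt t ξ ^ (s + 2) * Real.exp (-(kap ξ * t / 4)) := by ring
    _ ≤ (2 * (1 + zz t ξ)) ^ (s + 2) * Real.exp (-(kap ξ * t / 4)) := by
        gcongr; exact wt_le_zz_low ht h
    _ = 2 ^ (s + 2) * ((1 + zz t ξ) ^ (s + 2) * Real.exp (-(kap ξ * t / 4))) := by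
        rw [mul_pow]; ring
    _ ≤ _ := by
        unfold Clin
        exact mul_le_mul_of_nonneg_left (zz_pow_mul_exp_le (s + 2) ht ξ) (by positivity)

lemma wt_pow_mul_exp_high (s : ℕ) {t ξ : ℝ} (ht : 0 ≤ t) (h : 1 ≤ |ξ|) :
    wt t ξ ^ s * Real.exp (-(kap ξ * t / 4)) ≤ Clin s * (1 + |ξ|) ^ s / (1 + t) := by
  rw [le_div_iff₀ (by linarith)]
  have hz := zz_nonneg t ξ
  have hwt := (wt_pos t ξ).le
  have h2 : (2 : ℝ) ≤ 2 ^ (s + 2) := by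
    calc (2 : ℝ) = 2 ^ 1 := by norm_num
      _ ≤ 2 ^ (s + 2) := pow_le_pow_right₀ (by norm_num) (by omega)
  calc wt t ξ ^ s * Real.exp (-(kap ξ * t / 4)) * (1 + t)
      ≤ ((1 + |ξ|) * (1 + zz t ξ)) ^ s * Real.exp (-(kap ξ * t / 4))
        * (2 * (1 + zz t ξ) ^ 2) := by
        gcongr
        · exact wt_le_zz ht ξ
        · exact sqrt_le_zz_high ht h
    _ = 2 * ((1 + zz t ξ) ^ (s + 2) * Real.exp (-(kap ξ * t / 4))) * (1 + |ξ|) ^ s := by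
        rw [mul_pow]; ring
    _ ≤ 2 ^ (s + 2) * (Real.exp 3 * (s + 2).factorial) * (1 + |ξ|) ^ s := by
        have := zz_pow_mul_exp_le (s + 2) ht ξ
        exact mul_le_mul_of_nonneg_right (mul_le_mul h2 this (by positivity) (by positivity))
          (by positivity)
    _ = _ := by unfold Clin; ring

lemma aestronglyMeasurable_of_weight {g : ℝ → ℂ} {s : ℕ} {D : ℝ}
    (h : L2Bd (fun ξ => ((wt 0 ξ ^ s : ℝ) : ℂ) * g ξ) D) : AEStronglyMeasurable g volume := by
  have h1 : Continuous fun ξ => ((wt 0 ξ ^ s : ℝ) : ℂ)⁻¹ :=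
    (continuous_wt_pow 0 s).inv₀ fun ξ => by
      rw [Complex.ofReal_ne_zero]; exact (pow_pos (wt_pos 0 ξ) s).ne'
  refine (h1.aestronglyMeasurable.mul h.1).congr (Eventually.of_forall fun ξ => ?_)
  have : ((wt 0 ξ ^ s : ℝ) : ℂ) ≠ 0 := by
    rw [Complex.ofReal_ne_zero]; exact (pow_pos (wt_pos 0 ξ) s).ne'
  simp only [Pi.mul_apply]
  field_simp

/-- The linear evolution of data whose Fourier transform is `O(|ξ|ᵃ)` at the origin. -/
lemma l2Bd_linear {s : ℕ} {a t D₁ D₂ : ℝ} (ha0 : 0 ≤ a) (ha1 : a ≤ 1) (ht : 0 ≤ t) (hD₁ : 0 ≤ D₁)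
    (hD₂ : 0 ≤ D₂) {g e : ℝ → ℂ} (he : AEStronglyMeasurable e volume)
    (he' : ∀ ξ, ‖e ξ‖ ≤ Real.exp (-(kap ξ * t / 4)))
    (hlow : ∀ ξ, |ξ| ≤ 1 → ‖g ξ‖ ≤ D₁ * |ξ| ^ a)
    (hg : L2Bd (fun ξ => ((wt 0 ξ ^ s : ℝ) : ℂ) * g ξ) D₂) :
    L2Bd (fun ξ => ((wt t ξ ^ s : ℝ) : ℂ) * (e ξ * g ξ))
      (Clin s * (2 * D₁ + D₂) * (1 + t) ^ (-(1 / 4 + a / 2))) := by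
  have h1t : 0 < 1 + t := by linarith
  have hC := (Clin_pos s).le
  have hmeas : AEStronglyMeasurable (fun ξ => ((wt t ξ ^ s : ℝ) : ℂ) * (e ξ * g ξ)) volume :=
    (continuous_wt_pow t s).aestronglyMeasurable.mul
      (he.mul (aestronglyMeasurable_of_weight hg))
  have b1 := (l2Bd_inv_wt ht).const_mul ((Clin s * D₁ * (1 + t) ^ (-(a / 2)) : ℝ) : ℂ)
  have b2 := hg.const_mul ((Clin s / (1 + t) : ℝ) : ℂ)
  rw [Complex.norm_real, Real.norm_of_nonneg (by positivity)] at b1 b2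
  have hp := b1.of_le_add b2 (by positivity) (by positivity) hmeas (fun ξ => ?_)
  · refine hp.le ?_
    have e1 : (1 + t) ^ (-(a / 2)) * (1 + t) ^ (-(1 / 4) : ℝ) = (1 + t) ^ (-(1 / 4 + a / 2)) := by
      rw [← Real.rpow_add h1t]; congr 1; ring
    have e2 : 1 / (1 + t) ≤ (1 + t) ^ (-(1 / 4 + a / 2)) := by
      rw [one_div, ← Real.rpow_neg_one]
      exact Real.rpow_le_rpow_of_exponent_le (by linarith) (by linarith)
    calc _ = Clin s * (2 * D₁) * ((1 + t) ^ (-(a / 2)) * (1 + t) ^ (-(1 / 4) : ℝ))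
          + Clin s * D₂ * (1 / (1 + t)) := by ring
      _ ≤ Clin s * (2 * D₁) * (1 + t) ^ (-(1 / 4 + a / 2))
          + Clin s * D₂ * (1 + t) ^ (-(1 / 4 + a / 2)) := by rw [e1]; gcongr
      _ = _ := by ring
  have hwt := wt_pos t ξ
  rw [norm_mul, norm_mul, norm_wt_pow, norm_mul, norm_mul, norm_mul, norm_wt_pow, wt_zero,
    Complex.norm_real, Complex.norm_real, Complex.norm_real, Real.norm_of_nonneg (by positivity),
    Real.norm_of_nonneg (by positivity), Real.norm_of_nonneg (by positivity)]
  rcases le_total |ξ| 1 with h | h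
  · refine le_add_of_le_of_nonneg ?_ (by positivity)
    have e1 := wt_pow_mul_exp_low s ht h
    have e2 : |ξ| ^ a ≤ (1 + t) ^ (-(a / 2)) * wt t ξ := by
      have hr : 0 < √(1 + t) := Real.sqrt_pos.2 h1t
      have a1 : |ξ| ≤ wt t ξ / √(1 + t) := by
        rw [le_div_iff₀ hr]; exact abs_mul_sqrt_le_wt t ξ
      calc |ξ| ^ a ≤ (wt t ξ / √(1 + t)) ^ a := Real.rpow_le_rpow (abs_nonneg ξ) a1 ha0
        _ = (1 + t) ^ (-(a / 2)) * wt t ξ ^ a := by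
          rw [Real.div_rpow hwt.le hr.le, Real.sqrt_eq_rpow, ← Real.rpow_mul h1t.le, mul_comm,
            Real.rpow_neg h1t.le, ← div_eq_inv_mul]
          congr 2
          ring
        _ ≤ (1 + t) ^ (-(a / 2)) * wt t ξ ^ (1 : ℝ) := by
          gcongr
          exact one_le_wt t ξ
        _ = _ := by rw [Real.rpow_one]
    calc wt t ξ ^ s * (‖e ξ‖ * ‖g ξ‖)
        ≤ wt t ξ ^ s * (Real.exp (-(kap ξ * t / 4)) * (D₁ * |ξ| ^ a)) := by
          gcongr
          · exact he' ξ
          · exact hlow ξ h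
      _ = (wt t ξ ^ s * Real.exp (-(kap ξ * t / 4))) * (D₁ * |ξ| ^ a) := by ring
      _ ≤ (Clin s / wt t ξ ^ 2) * (D₁ * ((1 + t) ^ (-(a / 2)) * wt t ξ)) := by gcongr
      _ = _ := by field_simp
  · refine le_add_of_nonneg_of_le (by positivity) ?_
    have e1 := wt_pow_mul_exp_high s ht h
    calc wt t ξ ^ s * (‖e ξ‖ * ‖g ξ‖)
        ≤ wt t ξ ^ s * (Real.exp (-(kap ξ * t / 4)) * ‖g ξ‖) := by
          gcongr
          exact he' ξ
      _ = (wt t ξ ^ s * Real.exp (-(kap ξ * t / 4))) * ‖g ξ‖ := by ring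
      _ ≤ (Clin s * (1 + |ξ|) ^ s / (1 + t)) * ‖g ξ‖ := by gcongr
      _ = _ := by ring

/-- The linear evolution of the derivative of a square integrable function. -/
lemma l2Bd_linear_deriv {s : ℕ} {t D₁ D₂ : ℝ} (ht : 0 ≤ t) (hD₁ : 0 ≤ D₁) (hD₂ : 0 ≤ D₂)
    {g V e : ℝ → ℂ} (he : AEStronglyMeasurable e volume)
    (he' : ∀ ξ, ‖e ξ‖ ≤ Real.exp (-(kap ξ * t / 4))) (hV : L2Bd V D₁)
    (hlow : ∀ ξ, |ξ| ≤ 1 → ‖g ξ‖ ≤ |ξ| * ‖V ξ‖)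
    (hg : L2Bd (fun ξ => ((wt 0 ξ ^ s : ℝ) : ℂ) * g ξ) D₂) :
    L2Bd (fun ξ => ((wt t ξ ^ s : ℝ) : ℂ) * (e ξ * g ξ))
      (Clin s * (D₁ * (1 + t) ^ (-(1 / 2) : ℝ) + D₂ * (1 + t) ^ (-1 : ℝ))) := by
  have h1t : 0 < 1 + t := by linarith
  have hC := (Clin_pos s).le
  have hmeas : AEStronglyMeasurable (fun ξ => ((wt t ξ ^ s : ℝ) : ℂ) * (e ξ * g ξ)) volume :=
    (continuous_wt_pow t s).aestronglyMeasurable.mul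
      (he.mul (aestronglyMeasurable_of_weight hg))
  have b1 := hV.const_mul ((Clin s * (1 + t) ^ (-(1 / 2) : ℝ) : ℝ) : ℂ)
  have b2 := hg.const_mul ((Clin s / (1 + t) : ℝ) : ℂ)
  rw [Complex.norm_real, Real.norm_of_nonneg (by positivity)] at b1 b2
  have hp := b1.of_le_add b2 (by positivity) (by positivity) hmeas (fun ξ => ?_)
  · refine hp.le (le_of_eq ?_)
    rw [Real.rpow_neg_one]
    ring
  have hwt := wt_pos t ξ
  rw [norm_mul, norm_mul, norm_wt_pow, norm_mul, norm_mul, norm_mul, norm_wt_pow, wt_zero,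
    Complex.norm_real, Complex.norm_real, Real.norm_of_nonneg (by positivity),
    Real.norm_of_nonneg (by positivity)]
  rcases le_total |ξ| 1 with h | h
  · refine le_add_of_le_of_nonneg ?_ (by positivity)
    have e1 := wt_pow_mul_exp_low s ht h
    have e2 : |ξ| ≤ (1 + t) ^ (-(1 / 2) : ℝ) * wt t ξ ^ 2 := by
      have hr : 0 < √(1 + t) := Real.sqrt_pos.2 h1t
      have a1 : |ξ| ≤ wt t ξ / √(1 + t) := by
        rw [le_div_iff₀ hr]; exact abs_mul_sqrt_le_wt t ξ
      refine a1.trans ?_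
      rw [Real.rpow_neg h1t.le, ← Real.sqrt_eq_rpow, div_eq_inv_mul]
      gcongr
      nlinarith [one_le_wt t ξ]
    calc wt t ξ ^ s * (‖e ξ‖ * ‖g ξ‖)
        ≤ wt t ξ ^ s * (Real.exp (-(kap ξ * t / 4)) * (|ξ| * ‖V ξ‖)) := by
          gcongr
          · exact he' ξ
          · exact hlow ξ h
      _ = (wt t ξ ^ s * Real.exp (-(kap ξ * t / 4))) * (|ξ| * ‖V ξ‖) := by ring
      _ ≤ (Clin s / wt t ξ ^ 2) * (((1 + t) ^ (-(1 / 2) : ℝ) * wt t ξ ^ 2) * ‖V ξ‖) := by gcongr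
      _ = _ := by field_simp
  · refine le_add_of_nonneg_of_le (by positivity) ?_
    have e1 := wt_pow_mul_exp_high s ht h
    calc wt t ξ ^ s * (‖e ξ‖ * ‖g ξ‖)
        ≤ wt t ξ ^ s * (Real.exp (-(kap ξ * t / 4)) * ‖g ξ‖) := by
          gcongr
          exact he' ξ
      _ = (wt t ξ ^ s * Real.exp (-(kap ξ * t / 4))) * ‖g ξ‖ := by ring
      _ ≤ (Clin s * (1 + |ξ|) ^ s / (1 + t)) * ‖g ξ‖ := by gcongr
      _ = _ := by ring

/-! ### The integral equation on the Fourier side -/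

lemma inv_one_add_abs_sq_le (η : ℝ) : ((1 + |η|) ^ 2)⁻¹ ≤ (1 + η ^ 2)⁻¹ := by
  refine inv_anti₀ (by positivity) ?_
  have := abs_nonneg η
  nlinarith [sq_abs η]

lemma integrable_inv_one_add_abs_sq : Integrable (fun η : ℝ => ((1 + |η|) ^ 2)⁻¹) volume := by
  refine integrable_inv_one_add_sq.mono' ?_ (Eventually.of_forall fun η => ?_)
  · exact (Continuous.inv₀ (by fun_prop) fun η => by positivity).aestronglyMeasurable
  · rw [Real.norm_of_nonneg (by positivity)]
    exact inv_one_add_abs_sq_le η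

/-- Joint continuity of the convolution of two families that are dominated by an integrable and by
a constant function. -/
lemma continuous_conv {X : Type*} [TopologicalSpace X] [FirstCountableTopology X]
    {f g : X → ℝ → ℂ} (hf : Continuous fun p : X × ℝ => f p.1 p.2)
    (hg : Continuous fun p : X × ℝ => g p.1 p.2) {D : ℝ → ℝ} {M : ℝ} (hD : Integrable D volume)
    (hfD : ∀ x η, ‖f x η‖ ≤ D η) (hgM : ∀ x η, ‖g x η‖ ≤ M) :
    Continuous fun p : X × ℝ => conv (f p.1) (g p.1) p.2 := by
  unfold conv
  refine continuous_of_dominated (bound := fun η => D η * M) (fun p => ?_) (fun p => ?_)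
    (hD.mul_const M) ?_
  · refine Continuous.aestronglyMeasurable ?_
    exact (hf.comp (continuous_const.prodMk continuous_id)).mul
      (hg.comp (continuous_const.prodMk (continuous_const.sub continuous_id)))
  · refine Eventually.of_forall fun η => ?_
    rw [norm_mul]
    have := (norm_nonneg _).trans (hfD p.1 η)
    exact mul_le_mul (hfD p.1 η) (hgM p.1 _) (norm_nonneg _) this
  · refine Eventually.of_forall fun η => ?_
    exact (hf.comp (continuous_fst.prodMk continuous_const)).mul
      (hg.comp (continuous_fst.prodMk (continuous_snd.sub continuous_const)))

/-- The Duhamel integral `∫₀ᵗ b(ξ) a(t - τ, ξ) B(τ, ξ) dτ`. -/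
def duh (γ : ℝ) (B : ℝ → ℝ → ℂ) (t ξ : ℝ) : ℂ :=
  ∫ τ in (0 : ℝ)..t, bsym ξ * asym γ (t - τ) ξ * B τ ξ

lemma continuous_duh_integrand (γ : ℝ) {B : ℝ → ℝ → ℂ}
    (hB : Continuous fun p : ℝ × ℝ => B p.1 p.2) :
    Continuous fun q : (ℝ × ℝ) × ℝ => bsym q.1.2 * asym γ (q.1.1 - q.2) q.1.2 * B q.2 q.1.2 := by
  refine ((continuous_bsym.comp (by fun_prop)).mul ?_).mul ?_
  · exact (continuous_asym γ).comp (f := fun q : (ℝ × ℝ) × ℝ => (q.1.1 - q.2, q.1.2))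
      (by fun_prop)
  · exact hB.comp (f := fun q : (ℝ × ℝ) × ℝ => (q.2, q.1.2)) (by fun_prop)

lemma continuous_duh (γ : ℝ) {B : ℝ → ℝ → ℂ} (hB : Continuous fun p : ℝ × ℝ => B p.1 p.2) :
    Continuous fun p : ℝ × ℝ => duh γ B p.1 p.2 :=
  intervalIntegral.continuous_parametric_intervalIntegral_of_continuous
    (f := fun (p : ℝ × ℝ) τ => bsym p.2 * asym γ (p.1 - τ) p.2 * B τ p.2)
    (continuous_duh_integrand γ hB) continuous_fst

lemma intervalIntegrable_duh (γ : ℝ) {B : ℝ → ℝ → ℂ}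
    (hB : Continuous fun p : ℝ × ℝ => B p.1 p.2) (t ξ a b : ℝ) :
    IntervalIntegrable (fun τ => bsym ξ * asym γ (t - τ) ξ * B τ ξ) volume a b :=
  ((continuous_duh_integrand γ hB).comp
    (f := fun τ : ℝ => ((t, ξ), τ)) (by fun_prop)).intervalIntegrable _ _

lemma norm_duh_integrand_le {s : ℕ} {γ A b t τ ξ : ℝ} (hτ : τ ≤ t) {z : ℂ}
    (hz : ‖z‖ ≤ A * (1 + τ) ^ (-(1 / 2 + b)) / wt τ ξ ^ s) :
    ‖bsym ξ * asym γ (t - τ) ξ * z‖ ≤ (|ξ| / (1 + ξ ^ 2)) * Real.exp (-(kap ξ * (t - τ)))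
      * (2 * Real.pi * A * (1 + τ) ^ (-(1 / 2 + b)) / wt τ ξ ^ s) := by
  rw [norm_mul, norm_mul]
  have h1 := norm_bsym_le ξ
  have h2 := norm_asym_le (sub_nonneg.2 hτ) γ ξ
  have hpi := Real.pi_pos
  calc ‖bsym ξ‖ * ‖asym γ (t - τ) ξ‖ * ‖z‖
      ≤ (2 * Real.pi * (|ξ| / (1 + ξ ^ 2))) * Real.exp (-(kap ξ * (t - τ)))
        * (A * (1 + τ) ^ (-(1 / 2 + b)) / wt τ ξ ^ s) := by gcongr
    _ = _ := by ring

lemma norm_duh_le {s : ℕ} {γ A b t ξ : ℝ} (hA : 0 ≤ A) (hb0 : 0 ≤ b) (hb : b ≤ 1 / 4)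
    (ht : 0 ≤ t) {B : ℝ → ℝ → ℂ} (hB : Continuous fun p : ℝ × ℝ => B p.1 p.2)
    (hBA : ∀ τ, 0 ≤ τ → τ ≤ t → ‖B τ ξ‖ ≤ A * (1 + τ) ^ (-(1 / 2 + b)) / wt τ ξ ^ s) :
    ‖duh γ B t ξ‖ ≤ Cduh s * (2 * Real.pi * A) * (1 + t) ^ (-b) / wt t ξ ^ (s + 1) := by
  have hpi := Real.pi_pos
  refine norm_duhamel_le (by positivity) hb0 hb ht (intervalIntegrable_duh γ hB t ξ 0 t)
    fun τ h0 h1 => ?_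
  exact norm_duh_integrand_le h1 (hBA τ h0 h1)

lemma rpow_quarter_mul {t : ℝ} (ht : 0 ≤ t) (A B b : ℝ) :
    A * (1 + t) ^ (-(1 / 4) : ℝ) * (B * (1 + t) ^ (-(1 / 4 + b)))
      = A * B * (1 + t) ^ (-(1 / 2 + b)) := by
  have h1 : (0 : ℝ) < 1 + t := by linarith
  have : (1 + t) ^ (-(1 / 2 + b)) = (1 + t) ^ (-(1 / 4) : ℝ) * (1 + t) ^ (-(1 / 4 + b)) := by
    rw [← Real.rpow_add h1]; congr 1; ring
  rw [this]; ring

/-- The bilinear source term of the Duhamel integral decays twice as fast as its factors. -/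
lemma norm_conv_rate_le {s : ℕ} {f g : ℝ → ℂ} {A B b t : ℝ} (hA : 0 ≤ A) (hB : 0 ≤ B) (ht : 0 ≤ t)
    (hf : L2Bd (fun ξ => ((wt t ξ ^ s : ℝ) : ℂ) * f ξ) (A * (1 + t) ^ (-(1 / 4) : ℝ)))
    (hg : L2Bd (fun ξ => ((wt t ξ ^ s : ℝ) : ℂ) * g ξ) (B * (1 + t) ^ (-(1 / 4 + b)))) (ξ : ℝ) :
    ‖conv f g ξ‖ ≤ A * B * (1 + t) ^ (-(1 / 2 + b)) / wt t ξ ^ s := by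
  have h1 : (0 : ℝ) ≤ 1 + t := by linarith
  rw [← rpow_quarter_mul ht]
  exact norm_conv_le (by positivity) (by positivity) hf hg ξ

open BoundedContinuousFunction NNReal

/-- The unknown of the fixed point problem: the linear evolution of `f₀` plus a remainder with a
bounded continuous density `n` against `wt⁻⁽ˢ⁺¹⁾`. Times are cut off at `0`, so that all functions
are defined on the whole line. -/
def ansatz (γ : ℝ) (s : ℕ) (f₀ : ℝ → ℂ) (n : (ℝ≥0 × ℝ) →ᵇ ℂ) (t ξ : ℝ) : ℂ :=
  asym γ (t.toNNReal : ℝ) ξ * f₀ ξ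
    + n (t.toNNReal, ξ) * (((wt (t.toNNReal : ℝ) ξ ^ (s + 1))⁻¹ : ℝ) : ℂ)

section ansatz

variable {γ : ℝ} {s : ℕ} {f₀ : ℝ → ℂ}

lemma continuous_inv_wt_pow (m : ℕ) :
    Continuous fun p : ℝ × ℝ => (((wt p.1 p.2 ^ m)⁻¹ : ℝ) : ℂ) :=
  Complex.continuous_ofReal.comp ((continuous_wt.pow m).inv₀ fun p =>
    (pow_pos (wt_pos p.1 p.2) m).ne')

lemma continuous_ansatz (hf₀ : Continuous f₀) (n : (ℝ≥0 × ℝ) →ᵇ ℂ) :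
    Continuous fun p : ℝ × ℝ => ansatz γ s f₀ n p.1 p.2 := by
  have ht : Continuous fun p : ℝ × ℝ => (p.1.toNNReal : ℝ) :=
    NNReal.continuous_coe.comp (continuous_real_toNNReal.comp continuous_fst)
  refine Continuous.add (Continuous.mul ?_ (hf₀.comp continuous_snd)) (Continuous.mul ?_ ?_)
  · exact (continuous_asym γ).comp (ht.prodMk continuous_snd)
  · exact n.continuous.comp
      ((continuous_real_toNNReal.comp continuous_fst).prodMk continuous_snd)
  · exact (continuous_inv_wt_pow (s + 1)).comp (ht.prodMk continuous_snd)

lemma norm_remainder_le (n : (ℝ≥0 × ℝ) →ᵇ ℂ) (t : ℝ≥0) (ξ : ℝ) (m : ℕ) :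
    ‖n (t, ξ) * (((wt (t : ℝ) ξ ^ m)⁻¹ : ℝ) : ℂ)‖ ≤ ‖n‖ / wt t ξ ^ m := by
  rw [norm_mul, Complex.norm_real,
    Real.norm_of_nonneg (inv_nonneg.2 (pow_nonneg (wt_pos _ ξ).le _)), div_eq_mul_inv]
  gcongr
  · exact inv_nonneg.2 (pow_nonneg (wt_pos _ ξ).le _)
  · exact n.norm_coe_le_norm _

lemma norm_ansatz_le (n : (ℝ≥0 × ℝ) →ᵇ ℂ) (t ξ : ℝ) :
    ‖ansatz γ s f₀ n t ξ‖ ≤ ‖f₀ ξ‖ + ‖n‖ / (1 + |ξ|) ^ (s + 1) := by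
  refine (norm_add_le _ _).trans (add_le_add ?_ ?_)
  · rw [norm_mul]
    exact mul_le_of_le_one_left (norm_nonneg _) (norm_asym_le_one t.toNNReal.2 γ ξ)
  · refine (norm_remainder_le n _ ξ _).trans ?_
    gcongr
    exact one_add_abs_le_wt t.toNNReal.2 ξ

lemma remainder_l2Bd (n : (ℝ≥0 × ℝ) →ᵇ ℂ) {t : ℝ} (ht : 0 ≤ t) :
    L2Bd (fun ξ => ((wt t ξ ^ s : ℝ) : ℂ)
      * (n (t.toNNReal, ξ) * (((wt (t.toNNReal : ℝ) ξ ^ (s + 1))⁻¹ : ℝ) : ℂ)))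
      (2 * ‖n‖ * (1 + t) ^ (-(1 / 4) : ℝ)) := by
  have h := l2Bd_of_le_inv_wt (G := fun ξ => ((wt t ξ ^ s : ℝ) : ℂ)
      * (n (t.toNNReal, ξ) * (((wt (t.toNNReal : ℝ) ξ ^ (s + 1))⁻¹ : ℝ) : ℂ))) ht (norm_nonneg n)
      ?_ (fun ξ => ?_)
  · exact h.le (le_of_eq (by ring))
  · refine Continuous.aestronglyMeasurable (Continuous.mul (continuous_wt_pow t s)
      (Continuous.mul ?_ ?_))
    · exact n.continuous.comp (continuous_const.prodMk continuous_id)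
    · exact (continuous_inv_wt_pow (s + 1)).comp (continuous_const.prodMk continuous_id)
  · have h1 := norm_remainder_le n t.toNNReal ξ (s + 1)
    have hw := wt_pos t ξ
    rw [norm_mul, norm_wt_pow]
    rw [Real.coe_toNNReal t ht] at h1 ⊢
    calc _ ≤ wt t ξ ^ s * (‖n‖ / wt t ξ ^ (s + 1)) := by gcongr
      _ = _ := by field_simp; ring

lemma ansatz_l2Bd {D₁ D₂ : ℝ} (hD₁ : 0 ≤ D₁) (hD₂ : 0 ≤ D₂)
    (hlow : ∀ ξ, ‖f₀ ξ‖ ≤ D₁) (hf₀ : L2Bd (fun ξ => ((wt 0 ξ ^ s : ℝ) : ℂ) * f₀ ξ) D₂)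
    (n : (ℝ≥0 × ℝ) →ᵇ ℂ) {t : ℝ} (ht : 0 ≤ t) :
    L2Bd (fun ξ => ((wt t ξ ^ s : ℝ) : ℂ) * ansatz γ s f₀ n t ξ)
      ((Clin s * (2 * D₁ + D₂) + 2 * ‖n‖) * (1 + t) ^ (-(1 / 4) : ℝ)) := by
  have hC := (Clin_pos s).le
  have h1 : 0 ≤ 1 + t := by linarith
  have hl := l2Bd_linear (e := asym γ t) (g := f₀) le_rfl zero_le_one ht hD₁ hD₂
    ((continuous_asym γ).comp (continuous_const.prodMk continuous_id)).aestronglyMeasurable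
    (fun ξ => (norm_asym_le ht γ ξ).trans (Real.exp_le_exp.2 (by
      have := mul_nonneg (kap_nonneg ξ) ht
      linarith)))
    (fun ξ _ => by simpa using hlow ξ) hf₀
  have := hl.add (remainder_l2Bd (s := s) n ht) (by positivity) (by positivity)
  refine (this.mono ?_ fun ξ => le_of_eq ?_).le (le_of_eq ?_)
  · refine this.1.congr (Eventually.of_forall fun ξ => ?_)
    unfold ansatz
    rw [Real.coe_toNNReal t ht]
    ring
  · congr 1
    unfold ansatz
    rw [Real.coe_toNNReal t ht]
    ring
  · rw [show -(1 / 4 + (0 : ℝ) / 2) = -(1 / 4) by norm_num]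
    ring

end ansatz

lemma conv_sub_self {f g : ℝ → ℂ} (hf : Continuous f) (hg : Continuous g) {D : ℝ → ℝ} {M : ℝ}
    (hD : Integrable D volume) (hfD : ∀ η, ‖f η‖ ≤ D η) (hgD : ∀ η, ‖g η‖ ≤ D η)
    (hfM : ∀ η, ‖f η‖ ≤ M) (hgM : ∀ η, ‖g η‖ ≤ M) (ξ : ℝ) :
    conv f f ξ - conv g g ξ = conv f (fun η => f η - g η) ξ + conv g (fun η => f η - g η) ξ := by
  have hi : ∀ {u v : ℝ → ℂ}, Continuous u → Continuous v → (∀ η, ‖u η‖ ≤ D η) →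
      (∀ η, ‖v η‖ ≤ M) → Integrable (fun η => u η * v (ξ - η)) volume := by
    intro u v hu hv huD hvM
    refine (hD.mul_const M).mono' (hu.mul (hv.comp (by fun_prop))).aestronglyMeasurable
      (Eventually.of_forall fun η => ?_)
    rw [norm_mul]
    exact mul_le_mul (huD η) (hvM _) (norm_nonneg _) ((norm_nonneg _).trans (huD η))
  have e : conv g f ξ = conv f g ξ := conv_comm g f ξ
  have e1 : conv f (fun η => f η - g η) ξ = conv f f ξ - conv f g ξ := by
    unfold conv
    rw [← integral_sub (hi hf hf hfD hfM) (hi hf hg hfD hgM)]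
    congr 1; ext η; ring
  have e2 : conv g (fun η => f η - g η) ξ = conv g f ξ - conv g g ξ := by
    unfold conv
    rw [← integral_sub (hi hg hf hgD hfM) (hi hg hg hgD hgM)]
    congr 1; ext η; ring
  rw [e1, e2, e]
  ring

/-! ### Reality of the solution -/

open ComplexConjugate in
/-- The symmetry of Fourier transforms of real functions. -/
def Herm (f : ℝ → ℂ) : Prop := ∀ ξ, f (-ξ) = conj (f ξ)

lemma Herm.conv {f g : ℝ → ℂ} (hf : Herm f) (hg : Herm g) : Herm (conv f g) := by
  intro ξ
  unfold BBMBurgers.conv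
  rw [← integral_conj, ← integral_neg_eq_self]
  congr 1
  ext η
  rw [map_mul, ← hf η, ← hg (ξ - η)]
  congr 2
  ring

lemma herm_bsym : Herm bsym := by
  intro ξ
  unfold bsym
  simp [map_ofNat]

lemma herm_asym (γ t : ℝ) : Herm (asym γ t) := by
  intro ξ
  rw [asym_eq, asym_eq, ← Complex.exp_conj]
  congr 1
  unfold Lsym
  simp only [map_mul, map_div₀, map_add, map_neg, map_pow, map_one, Complex.conj_ofReal,
    Complex.conj_I, mul_neg, Complex.ofReal_neg]
  congr 2 <;> ring

lemma Herm.duh {γ : ℝ} {B : ℝ → ℝ → ℂ} (hB : ∀ τ, Herm (B τ)) (t : ℝ) : Herm (duh γ B t) := by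
  intro ξ
  unfold BBMBurgers.duh
  rw [← intervalIntegral.intervalIntegral_conj]
  congr 1
  ext τ
  rw [map_mul, map_mul, ← herm_bsym, ← herm_asym, ← hB τ]

open BoundedContinuousFunction NNReal

/-! ### Solving the integral equation -/

/-- A solution `f(t, ξ)` of the mild formulation on the Fourier side with data `f₀`, together with
the bounds that come from its construction: `f(t)` is dominated by a fixed function of `L¹ ∩ L²`,
and its `L²` norm with the parabolic weight is at most `Λ (1 + t)^(-1/4)`. -/
structure IsFourierSol (β γ : ℝ) (s : ℕ) (f₀ : ℝ → ℂ) (Λ : ℝ) (f : ℝ → ℝ → ℂ) : Prop where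
  cont : Continuous fun p : ℝ × ℝ => f p.1 p.2
  dom : ∃ r, 0 ≤ r ∧ ∀ t ξ, ‖f t ξ‖ ≤ ‖f₀ ξ‖ + r / (1 + |ξ|) ^ (s + 1)
  bd : ∀ t, 0 ≤ t →
    L2Bd (fun ξ => ((wt t ξ ^ s : ℝ) : ℂ) * f t ξ) (Λ * (1 + t) ^ (-(1 / 4) : ℝ))
  eq : ∀ t, 0 ≤ t → ∀ ξ, f t ξ = asym γ t ξ * f₀ ξ
    - (β / 2 : ℝ) * duh γ (fun τ => conv (f τ) (f τ)) t ξ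
  herm : ∀ t, Herm (f t)

/-- A dominating function for functions bounded as in `IsFourierSol.dom`. -/
def domF (f₀ : ℝ → ℂ) (r η : ℝ) : ℝ := ‖f₀ η‖ + r * ((1 + |η|) ^ 2)⁻¹

lemma integrable_domF {f₀ : ℝ → ℂ} (h : Integrable f₀ volume) (r : ℝ) :
    Integrable (domF f₀ r) volume :=
  h.norm.add (integrable_inv_one_add_abs_sq.const_mul r)

lemma le_domF {s : ℕ} (hs : 1 ≤ s) {f₀ : ℝ → ℂ} {r : ℝ} (hr : 0 ≤ r) (η : ℝ) :
    ‖f₀ η‖ + r / (1 + |η|) ^ (s + 1) ≤ domF f₀ r η := by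
  unfold domF
  rw [div_eq_mul_inv]
  gcongr
  · have := abs_nonneg η; linarith
  · omega

lemma domF_le {f₀ : ℝ → ℂ} {D r : ℝ} (hr : 0 ≤ r) (h : ∀ η, ‖f₀ η‖ ≤ D) (η : ℝ) :
    domF f₀ r η ≤ D + r := by
  unfold domF
  refine add_le_add (h η) (mul_le_of_le_one_right hr (inv_le_one_of_one_le₀ ?_))
  exact one_le_pow₀ (by have := abs_nonneg η; linarith)

lemma conv_congr_norm_bound {A B t ξ : ℝ} {s : ℕ} {f g : ℝ → ℂ} (hA : 0 ≤ A) (hB : 0 ≤ B)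
    (ht : 0 ≤ t)
    (hf : L2Bd (fun ξ => ((wt t ξ ^ s : ℝ) : ℂ) * f ξ) (A * (1 + t) ^ (-(1 / 4) : ℝ)))
    (hg : L2Bd (fun ξ => ((wt t ξ ^ s : ℝ) : ℂ) * g ξ) (B * (1 + t) ^ (-(1 / 4) : ℝ))) :
    ‖conv f g ξ‖ ≤ A * B * (1 + t) ^ (-(1 / 2 + 0) : ℝ) / wt t ξ ^ s :=
  norm_conv_rate_le hA hB ht hf (by simpa using hg) ξ

section Fixed

variable {γ β : ℝ} {s : ℕ} {f₀ : ℝ → ℂ}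

lemma continuous_conv_ansatz (hs : 1 ≤ s) (hf₀c : Continuous f₀) (hf₀i : Integrable f₀ volume)
    {D₁ : ℝ} (hlow : ∀ ξ, ‖f₀ ξ‖ ≤ D₁) (n m : (ℝ≥0 × ℝ) →ᵇ ℂ) :
    Continuous fun p : ℝ × ℝ => conv (ansatz γ s f₀ n p.1) (ansatz γ s f₀ m p.1) p.2 :=
  continuous_conv (continuous_ansatz hf₀c n) (continuous_ansatz hf₀c m)
    (integrable_domF hf₀i ‖n‖)
    (fun t η => (norm_ansatz_le n t η).trans (le_domF hs (norm_nonneg n) η))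
    (fun t η => ((norm_ansatz_le m t η).trans (le_domF hs (norm_nonneg m) η)).trans
      (domF_le (norm_nonneg m) hlow η))

/-- The nonlinear part of the fixed point map, before multiplication with the weight. -/
def nonlin (β γ : ℝ) (s : ℕ) (f₀ : ℝ → ℂ) (n : (ℝ≥0 × ℝ) →ᵇ ℂ) (t ξ : ℝ) : ℂ :=
  -((β / 2 : ℝ) : ℂ) * duh γ (fun τ => conv (ansatz γ s f₀ n τ) (ansatz γ s f₀ n τ)) t ξ

lemma continuous_weighted_nonlin (hs : 1 ≤ s) (hf₀c : Continuous f₀)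
    (hf₀i : Integrable f₀ volume) {D₁ : ℝ} (hlow : ∀ ξ, ‖f₀ ξ‖ ≤ D₁) (n : (ℝ≥0 × ℝ) →ᵇ ℂ) :
    Continuous fun p : ℝ≥0 × ℝ => ((wt p.1 p.2 ^ (s + 1) : ℝ) : ℂ)
      * nonlin β γ s f₀ n p.1 p.2 := by
  have hc : Continuous fun p : ℝ≥0 × ℝ => ((p.1 : ℝ), p.2) :=
    (NNReal.continuous_coe.comp continuous_fst).prodMk continuous_snd
  have h1 : Continuous fun p : ℝ≥0 × ℝ => wt p.1 p.2 := Continuous.comp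
    (g := fun q : ℝ × ℝ => wt q.1 q.2) (f := fun p : ℝ≥0 × ℝ => ((p.1 : ℝ), p.2))
    continuous_wt hc
  have h2 : Continuous fun p : ℝ≥0 × ℝ => nonlin β γ s f₀ n p.1 p.2 := Continuous.comp
    (g := fun q : ℝ × ℝ => nonlin β γ s f₀ n q.1 q.2) (f := fun p : ℝ≥0 × ℝ => ((p.1 : ℝ), p.2))
    (continuous_const.mul (continuous_duh γ (continuous_conv_ansatz hs hf₀c hf₀i hlow n n))) hc
  exact (Complex.continuous_ofReal.comp (h1.pow (s + 1))).mul h2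

variable {D₁ D₂ : ℝ}

lemma norm_weighted_nonlin_le (hs : 1 ≤ s) (hf₀c : Continuous f₀) (hf₀i : Integrable f₀ volume)
    (hD₁ : 0 ≤ D₁) (hD₂ : 0 ≤ D₂) (hlow : ∀ ξ, ‖f₀ ξ‖ ≤ D₁)
    (hf₀ : L2Bd (fun ξ => ((wt 0 ξ ^ s : ℝ) : ℂ) * f₀ ξ) D₂)
    (n : (ℝ≥0 × ℝ) →ᵇ ℂ) {Λ : ℝ} (hΛ : Clin s * (2 * D₁ + D₂) + 2 * ‖n‖ ≤ Λ) (p : ℝ≥0 × ℝ) :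
    ‖((wt p.1 p.2 ^ (s + 1) : ℝ) : ℂ) * nonlin β γ s f₀ n p.1 p.2‖
      ≤ Real.pi * |β| * Cduh s * Λ ^ 2 := by
  have hC := (Clin_pos s).le
  have hΛ0 : 0 ≤ Λ := (by positivity : 0 ≤ Clin s * (2 * D₁ + D₂) + 2 * ‖n‖).trans hΛ
  have hw := wt_pos p.1 p.2
  have hb : ∀ τ, 0 ≤ τ → L2Bd (fun ξ => ((wt τ ξ ^ s : ℝ) : ℂ) * ansatz γ s f₀ n τ ξ)
      (Λ * (1 + τ) ^ (-(1 / 4) : ℝ)) := fun τ hτ =>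
    (ansatz_l2Bd hD₁ hD₂ hlow hf₀ n hτ).le
      (mul_le_mul_of_nonneg_right hΛ (Real.rpow_nonneg (by linarith) _))
  have h := norm_duh_le (γ := γ) (t := p.1) (ξ := p.2) (s := s) (mul_nonneg hΛ0 hΛ0) le_rfl
    (by norm_num) p.1.2
    (continuous_conv_ansatz hs hf₀c hf₀i hlow n n)
    (fun τ h0 _ => conv_congr_norm_bound hΛ0 hΛ0 h0 (hb τ h0) (hb τ h0))
  rw [neg_zero, Real.rpow_zero, mul_one] at h
  unfold nonlin
  rw [norm_mul, norm_wt_pow, norm_mul, norm_neg, Complex.norm_real, Real.norm_eq_abs, abs_div,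
    abs_two]
  calc wt p.1 p.2 ^ (s + 1) * (|β| / 2
        * ‖duh γ (fun τ => conv (ansatz γ s f₀ n τ) (ansatz γ s f₀ n τ)) p.1 p.2‖)
      ≤ wt p.1 p.2 ^ (s + 1) * (|β| / 2
        * (Cduh s * (2 * Real.pi * (Λ * Λ)) / wt p.1 p.2 ^ (s + 1))) := by gcongr
    _ = _ := by field_simp

/-- The fixed point map. -/
def fixMap (β γ : ℝ) (hs : 1 ≤ s) (hf₀c : Continuous f₀) (hf₀i : Integrable f₀ volume)
    (hD₁ : 0 ≤ D₁) (hD₂ : 0 ≤ D₂) (hlow : ∀ ξ, ‖f₀ ξ‖ ≤ D₁)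
    (hf₀ : L2Bd (fun ξ => ((wt 0 ξ ^ s : ℝ) : ℂ) * f₀ ξ) D₂) (n : (ℝ≥0 × ℝ) →ᵇ ℂ) :
    (ℝ≥0 × ℝ) →ᵇ ℂ :=
  BoundedContinuousFunction.ofNormedAddCommGroup
    (fun p : ℝ≥0 × ℝ => ((wt p.1 p.2 ^ (s + 1) : ℝ) : ℂ) * nonlin β γ s f₀ n p.1 p.2)
    (continuous_weighted_nonlin hs hf₀c hf₀i hlow n) _
    (norm_weighted_nonlin_le hs hf₀c hf₀i hD₁ hD₂ hlow hf₀ n le_rfl)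

lemma fixMap_apply (hs : 1 ≤ s) (hf₀c : Continuous f₀) (hf₀i : Integrable f₀ volume)
    (hD₁ : 0 ≤ D₁) (hD₂ : 0 ≤ D₂) (hlow : ∀ ξ, ‖f₀ ξ‖ ≤ D₁)
    (hf₀ : L2Bd (fun ξ => ((wt 0 ξ ^ s : ℝ) : ℂ) * f₀ ξ) D₂) (n : (ℝ≥0 × ℝ) →ᵇ ℂ) (p : ℝ≥0 × ℝ) :
    fixMap β γ hs hf₀c hf₀i hD₁ hD₂ hlow hf₀ n p
      = ((wt p.1 p.2 ^ (s + 1) : ℝ) : ℂ) * nonlin β γ s f₀ n p.1 p.2 := rfl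

lemma norm_weighted_nonlin_sub_le (hs : 1 ≤ s) (hf₀c : Continuous f₀) (hf₀i : Integrable f₀ volume)
    (hD₁ : 0 ≤ D₁) (hD₂ : 0 ≤ D₂) (hlow : ∀ ξ, ‖f₀ ξ‖ ≤ D₁)
    (hf₀ : L2Bd (fun ξ => ((wt 0 ξ ^ s : ℝ) : ℂ) * f₀ ξ) D₂)
    (n m : (ℝ≥0 × ℝ) →ᵇ ℂ) {Λ : ℝ} (hn : Clin s * (2 * D₁ + D₂) + 2 * ‖n‖ ≤ Λ)
    (p : ℝ≥0 × ℝ)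
    (hm : Clin s * (2 * D₁ + D₂) + 2 * ‖m‖ ≤ Λ) :
    ‖((wt p.1 p.2 ^ (s + 1) : ℝ) : ℂ) * nonlin β γ s f₀ n p.1 p.2
      - ((wt p.1 p.2 ^ (s + 1) : ℝ) : ℂ) * nonlin β γ s f₀ m p.1 p.2‖
      ≤ 4 * Real.pi * |β| * Cduh s * Λ * dist n m := by
  have hC := (Clin_pos s).le
  have hCd := (Cduh_pos s).le
  have hΛ0 : 0 ≤ Λ := (by positivity : 0 ≤ Clin s * (2 * D₁ + D₂) + 2 * ‖n‖).trans hn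
  have hpi := Real.pi_pos
  have hw := wt_pos p.1 p.2
  have hb : ∀ k : (ℝ≥0 × ℝ) →ᵇ ℂ, Clin s * (2 * D₁ + D₂) + 2 * ‖k‖ ≤ Λ → ∀ τ, 0 ≤ τ →
      L2Bd (fun ξ => ((wt τ ξ ^ s : ℝ) : ℂ) * ansatz γ s f₀ k τ ξ)
      (Λ * (1 + τ) ^ (-(1 / 4) : ℝ)) := fun k hk τ hτ =>
    (ansatz_l2Bd hD₁ hD₂ hlow hf₀ k hτ).le
      (mul_le_mul_of_nonneg_right hk (Real.rpow_nonneg (by linarith) _))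
  have hdiff : ∀ τ ξ, ansatz γ s f₀ n τ ξ - ansatz γ s f₀ m τ ξ
      = (n - m) (τ.toNNReal, ξ) * (((wt (τ.toNNReal : ℝ) ξ ^ (s + 1))⁻¹ : ℝ) : ℂ) := by
    intro τ ξ
    unfold ansatz
    rw [BoundedContinuousFunction.sub_apply]
    ring
  have hd : ∀ τ, 0 ≤ τ → L2Bd (fun ξ => ((wt τ ξ ^ s : ℝ) : ℂ)
      * (ansatz γ s f₀ n τ ξ - ansatz γ s f₀ m τ ξ))
      (2 * dist n m * (1 + τ) ^ (-(1 / 4) : ℝ)) := by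
    intro τ hτ
    simp only [hdiff]
    rw [dist_eq_norm]
    exact remainder_l2Bd (n - m) hτ
  obtain ⟨B, hB⟩ : ∃ B : ℝ → ℝ → ℂ, ∀ τ ξ,
      B τ ξ = conv (ansatz γ s f₀ n τ) (ansatz γ s f₀ n τ) ξ
        - conv (ansatz γ s f₀ m τ) (ansatz γ s f₀ m τ) ξ := ⟨_, fun _ _ => rfl⟩
  have hcn := continuous_conv_ansatz (γ := γ) hs hf₀c hf₀i hlow n n
  have hcm := continuous_conv_ansatz (γ := γ) hs hf₀c hf₀i hlow m m
  have hBc : Continuous fun p : ℝ × ℝ => B p.1 p.2 := by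
    simp only [hB]
    exact hcn.sub hcm
  have hcont : ∀ k : (ℝ≥0 × ℝ) →ᵇ ℂ, ∀ τ, Continuous (ansatz γ s f₀ k τ) := fun k τ =>
    (continuous_ansatz (γ := γ) (s := s) hf₀c k).comp (f := fun ξ : ℝ => (τ, ξ)) (by fun_prop)
  have hBb : ∀ τ, 0 ≤ τ → ‖B τ p.2‖ ≤ (4 * Λ * dist n m) * (1 + τ) ^ (-(1 / 2 + 0) : ℝ)
      / wt τ p.2 ^ s := by
    intro τ hτ
    set R := max ‖n‖ ‖m‖
    have hR : 0 ≤ R := (norm_nonneg n).trans (le_max_left _ _)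
    have hdom : ∀ k : (ℝ≥0 × ℝ) →ᵇ ℂ, ‖k‖ ≤ R → ∀ η,
        ‖ansatz γ s f₀ k τ η‖ ≤ domF f₀ R η := fun k hk η =>
      ((norm_ansatz_le k τ η).trans (by gcongr)).trans (le_domF hs hR η)
    have e := conv_sub_self (hcont n τ) (hcont m τ) (integrable_domF hf₀i R)
      (hdom n (le_max_left _ _)) (hdom m (le_max_right _ _))
      (fun η => (hdom n (le_max_left _ _) η).trans (domF_le hR hlow η))
      (fun η => (hdom m (le_max_right _ _) η).trans (domF_le hR hlow η)) p.2
    rw [hB, e]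
    refine (norm_add_le _ _).trans ?_
    have h1 := conv_congr_norm_bound (ξ := p.2) hΛ0 (by positivity) hτ (hb n hn τ hτ) (hd τ hτ)
    have h2 := conv_congr_norm_bound (ξ := p.2) hΛ0 (by positivity) hτ (hb m hm τ hτ) (hd τ hτ)
    refine (add_le_add h1 h2).trans_eq ?_
    ring
  have h := norm_duh_le (γ := γ) (t := p.1) (ξ := p.2) (s := s) (B := B) (b := 0)
    (A := 4 * Λ * dist n m) (by positivity) le_rfl (by norm_num) p.1.2 hBc
    (fun τ h0 _ => hBb τ h0)
  rw [neg_zero, Real.rpow_zero, mul_one] at h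
  have e2 : duh γ B p.1 p.2 = duh γ (fun τ => conv (ansatz γ s f₀ n τ) (ansatz γ s f₀ n τ)) p.1 p.2
      - duh γ (fun τ => conv (ansatz γ s f₀ m τ) (ansatz γ s f₀ m τ)) p.1 p.2 := by
    unfold duh
    rw [← intervalIntegral.integral_sub (intervalIntegrable_duh γ hcn _ _ _ _)
      (intervalIntegrable_duh γ hcm _ _ _ _)]
    congr 1
    ext τ
    rw [hB]
    ring
  have e3 : ((wt p.1 p.2 ^ (s + 1) : ℝ) : ℂ) * nonlin β γ s f₀ n p.1 p.2
      - ((wt p.1 p.2 ^ (s + 1) : ℝ) : ℂ) * nonlin β γ s f₀ m p.1 p.2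
      = ((wt p.1 p.2 ^ (s + 1) : ℝ) : ℂ) * (-((β / 2 : ℝ) : ℂ) * duh γ B p.1 p.2) := by
    rw [e2]
    unfold nonlin
    ring
  rw [e3, norm_mul, norm_wt_pow, norm_mul, norm_neg, Complex.norm_real,
    Real.norm_eq_abs, abs_div, abs_two]
  calc wt p.1 p.2 ^ (s + 1) * (|β| / 2 * ‖duh γ B p.1 p.2‖)
      ≤ wt p.1 p.2 ^ (s + 1) * (|β| / 2
        * (Cduh s * (2 * Real.pi * (4 * Λ * dist n m)) / wt p.1 p.2 ^ (s + 1))) := by gcongr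
    _ = _ := by field_simp

lemma dist_fixMap_le (hs : 1 ≤ s) (hf₀c : Continuous f₀) (hf₀i : Integrable f₀ volume)
    (hD₁ : 0 ≤ D₁) (hD₂ : 0 ≤ D₂) (hlow : ∀ ξ, ‖f₀ ξ‖ ≤ D₁)
    (hf₀ : L2Bd (fun ξ => ((wt 0 ξ ^ s : ℝ) : ℂ) * f₀ ξ) D₂)
    (n m : (ℝ≥0 × ℝ) →ᵇ ℂ) {Λ : ℝ} (hn : Clin s * (2 * D₁ + D₂) + 2 * ‖n‖ ≤ Λ)
    (hm : Clin s * (2 * D₁ + D₂) + 2 * ‖m‖ ≤ Λ) :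
    dist (fixMap β γ hs hf₀c hf₀i hD₁ hD₂ hlow hf₀ n) (fixMap β γ hs hf₀c hf₀i hD₁ hD₂ hlow hf₀ m)
      ≤ 4 * Real.pi * |β| * Cduh s * Λ * dist n m := by
  have hC := (Clin_pos s).le
  have hCd := (Cduh_pos s).le
  have hΛ0 : 0 ≤ Λ := (by positivity : 0 ≤ Clin s * (2 * D₁ + D₂) + 2 * ‖n‖).trans hn
  have hpi := Real.pi_pos
  rw [BoundedContinuousFunction.dist_le (by positivity)]
  intro p
  rw [dist_eq_norm, fixMap_apply, fixMap_apply]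
  exact norm_weighted_nonlin_sub_le hs hf₀c hf₀i hD₁ hD₂ hlow hf₀ n m hn p hm

/-- Small data give a solution on the Fourier side, by the contraction principle in the ball of
radius `r` of bounded continuous functions with Hermitian symmetry. -/
theorem exists_isFourierSol (hs : 1 ≤ s) (hf₀c : Continuous f₀) (hf₀i : Integrable f₀ volume)
    (hf₀h : Herm f₀) (hD₁ : 0 ≤ D₁) (hD₂ : 0 ≤ D₂) (hlow : ∀ ξ, ‖f₀ ξ‖ ≤ D₁)
    (hf₀ : L2Bd (fun ξ => ((wt 0 ξ ^ s : ℝ) : ℂ) * f₀ ξ) D₂) {r Λ : ℝ} (hr : 0 ≤ r)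
    (hΛ : Clin s * (2 * D₁ + D₂) + 2 * r ≤ Λ)
    (h1 : Real.pi * |β| * Cduh s * Λ ^ 2 ≤ r) (h2 : 4 * Real.pi * |β| * Cduh s * Λ ≤ 1 / 2) :
    ∃ f, IsFourierSol β γ s f₀ Λ f := by
  have hC := (Clin_pos s).le
  have hCd := (Cduh_pos s).le
  set Φ := fixMap β γ hs hf₀c hf₀i hD₁ hD₂ hlow hf₀ with hΦ
  let S : Set ((ℝ≥0 × ℝ) →ᵇ ℂ) := Metric.closedBall 0 r ∩
    {n | ∀ t ξ, n (t, -ξ) = (starRingEnd ℂ) (n (t, ξ))}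
  have hsym : ∀ n ∈ S, ∀ t, Herm (ansatz γ s f₀ n t) := by
    intro n hn t ξ
    unfold ansatz
    rw [herm_asym, hf₀h, hn.2, wt_neg, map_add, map_mul, map_mul, Complex.conj_ofReal]
  have hnorm : ∀ n ∈ S, ‖n‖ ≤ r := fun n hn => by simpa using hn.1
  have hΛn : ∀ n ∈ S, Clin s * (2 * D₁ + D₂) + 2 * ‖n‖ ≤ Λ := fun n hn => by
    have := hnorm n hn
    linarith
  have hSc : IsComplete S := by
    refine IsClosed.isComplete (Metric.isClosed_closedBall.inter ?_)
    simp only [Set.ofPred_forall]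
    refine isClosed_iInter fun t => isClosed_iInter fun ξ => isClosed_eq ?_ ?_
    · exact (continuous_eval_const _)
    · exact Complex.continuous_conj.comp (continuous_eval_const _)
  have hmaps : Set.MapsTo Φ S S := by
    intro n hn
    refine ⟨?_, fun t ξ => ?_⟩
    · rw [mem_closedBall_zero_iff, BoundedContinuousFunction.norm_le hr]
      intro p
      exact (norm_weighted_nonlin_le hs hf₀c hf₀i hD₁ hD₂ hlow hf₀ n (hΛn n hn) p).trans h1
    · rw [hΦ, fixMap_apply, fixMap_apply]
      unfold nonlin
      have := Herm.duh (γ := γ) (B := fun τ => conv (ansatz γ s f₀ n τ) (ansatz γ s f₀ n τ))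
        (fun τ => (hsym n hn τ).conv (hsym n hn τ)) t ξ
      rw [this, wt_neg, map_mul, map_mul, map_neg, Complex.conj_ofReal, Complex.conj_ofReal]
  have hcontr : ContractingWith (1 / 2 : ℝ≥0) (hmaps.restrict Φ S S) := by
    refine ⟨by norm_num, LipschitzWith.of_dist_le_mul fun n m => ?_⟩
    have := dist_fixMap_le (β := β) (γ := γ) hs hf₀c hf₀i hD₁ hD₂ hlow hf₀ n m
      (hΛn n n.2) (hΛn m m.2)
    refine this.trans ?_
    have e : ((1 / 2 : ℝ≥0) : ℝ) = 1 / 2 := by norm_num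
    rw [e]
    exact mul_le_mul_of_nonneg_right h2 dist_nonneg
  have h0 : (0 : (ℝ≥0 × ℝ) →ᵇ ℂ) ∈ S := by
    refine ⟨by simpa using hr, fun t ξ => ?_⟩
    simp
  obtain ⟨n, hnS, hfix, -⟩ := hcontr.exists_fixedPoint' hSc hmaps h0 (edist_ne_top _ _)
  refine ⟨ansatz γ s f₀ n, continuous_ansatz hf₀c n, ⟨r, hr, fun t ξ => ?_⟩, fun t ht => ?_,
    fun t ht ξ => ?_, hsym n hnS⟩
  · refine (norm_ansatz_le n t ξ).trans ?_
    have := hnorm n hnS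
    gcongr
  · exact (ansatz_l2Bd hD₁ hD₂ hlow hf₀ n ht).le
      (mul_le_mul_of_nonneg_right (hΛn n hnS) (Real.rpow_nonneg (by linarith) _))
  · have e := congrArg (fun k : (ℝ≥0 × ℝ) →ᵇ ℂ => k (t.toNNReal, ξ)) hfix
    simp only [hΦ, fixMap_apply, Real.coe_toNNReal t ht] at e
    conv_lhs => unfold ansatz
    rw [← e, Real.coe_toNNReal t ht]
    unfold nonlin
    have : ((wt t ξ ^ (s + 1) : ℝ) : ℂ) ≠ 0 := by
      rw [Complex.ofReal_ne_zero]
      exact (pow_pos (wt_pos t ξ) _).ne'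
    rw [Complex.ofReal_inv]
    field_simp
    ring

end Fixed

/-! ### Families of square integrable functions -/

lemma tendsto_eLpNorm_two {ι : Type*} {l : Filter ι} [l.IsCountablyGenerated] {G : ι → ℝ → ℂ}
    {D : ℝ → ℝ} (hD : MemLp D 2 volume) (hm : ∀ᶠ i in l, AEStronglyMeasurable (G i) volume)
    (hb : ∀ᶠ i in l, ∀ ξ, ‖G i ξ‖ ≤ D ξ) (h : ∀ ξ, Tendsto (fun i => G i ξ) l (𝓝 0)) :
    Tendsto (fun i => eLpNorm (G i) 2 volume) l (𝓝 0) := by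
  have e : ∀ F : ℝ → ℂ, eLpNorm F 2 volume = (∫⁻ ξ, ‖F ξ‖ₑ ^ (2 : ℝ)) ^ (1 / 2 : ℝ) := by
    intro F
    rw [eLpNorm_eq_lintegral_rpow_enorm_toReal (by norm_num) (by norm_num)]
    simp
  simp only [e]
  have hfin : ∫⁻ ξ, ‖D ξ‖ₑ ^ (2 : ℝ) ≠ ∞ := by
    have := lintegral_rpow_enorm_lt_top_of_eLpNorm_lt_top (by norm_num) (by norm_num) hD.2
    simpa using this.ne
  have key : Tendsto (fun i => ∫⁻ ξ, ‖G i ξ‖ₑ ^ (2 : ℝ)) l (𝓝 (∫⁻ _ : ℝ, 0)) := by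
    refine tendsto_lintegral_filter_of_dominated_convergence' (fun ξ => ‖D ξ‖ₑ ^ (2 : ℝ)) ?_ ?_ hfin
      ?_
    · filter_upwards [hm] with i hi
      exact hi.enorm.pow_const _
    · filter_upwards [hb] with i hi
      refine Eventually.of_forall fun ξ => ?_
      have : ‖G i ξ‖ₑ ≤ ‖D ξ‖ₑ := enorm_le_iff_norm_le.2 ((hi ξ).trans (le_abs_self _))
      gcongr
    · refine Eventually.of_forall fun ξ => ?_
      have h1 := (continuous_enorm.tendsto (0 : ℂ)).comp (h ξ)
      have h2 := (ENNReal.continuous_rpow_const (y := 2)).tendsto ‖(0 : ℂ)‖ₑ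
      have := h2.comp h1
      simpa [Function.comp_def] using this
  have h2 := (ENNReal.continuous_rpow_const (y := 1 / 2)).tendsto (∫⁻ _ : ℝ, 0)
  have := h2.comp key
  simpa [Function.comp_def] using this

lemma tendsto_toL2C {ι : Type*} {l : Filter ι} [l.IsCountablyGenerated] {F : ι → ℝ → ℂ}
    {F₀ : ℝ → ℂ} {D : ℝ → ℝ} (hD : MemLp D 2 volume)
    (hm : ∀ᶠ i in l, AEStronglyMeasurable (F i) volume)
    (hm₀ : AEStronglyMeasurable F₀ volume) (hb : ∀ᶠ i in l, ∀ ξ, ‖F i ξ‖ ≤ D ξ)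
    (hb₀ : ∀ ξ, ‖F₀ ξ‖ ≤ D ξ) (h : ∀ ξ, Tendsto (fun i => F i ξ) l (𝓝 (F₀ ξ))) :
    Tendsto (fun i => toL2C (F i)) l (𝓝 (toL2C F₀)) := by
  have hF₀ : MemLp F₀ 2 volume :=
    hD.mono hm₀ (Eventually.of_forall fun ξ => (hb₀ ξ).trans (le_abs_self _))
  have key : Tendsto (fun i => eLpNorm (fun ξ => F i ξ - F₀ ξ) 2 volume) l (𝓝 0) := by
    refine tendsto_eLpNorm_two (D := fun ξ => 2 * D ξ) (hD.const_mul 2) ?_ ?_ fun ξ => ?_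
    · filter_upwards [hm] with i hi using hi.sub hm₀
    · filter_upwards [hb] with i hi ξ
      refine (norm_sub_le _ _).trans ?_
      linarith [hi ξ, hb₀ ξ]
    · have := (h ξ).sub_const (F₀ ξ)
      rwa [sub_self] at this
  rw [tendsto_iff_norm_sub_tendsto_zero]
  have h2 : Tendsto (fun i => (eLpNorm (fun ξ => F i ξ - F₀ ξ) 2 volume).toReal) l (𝓝 0) := by
    have := (ENNReal.tendsto_toReal ENNReal.zero_ne_top).comp key
    simpa [Function.comp_def] using this
  refine h2.congr' ?_
  filter_upwards [hm, hb] with i h1 hi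
  have hFi : MemLp (F i) 2 volume :=
    hD.mono h1 (Eventually.of_forall fun ξ => (hi ξ).trans (le_abs_self _))
  have h3 : MemLp (fun ξ => F i ξ - F₀ ξ) 2 volume := hFi.sub hF₀
  rw [← toL2C_sub hFi hF₀, toL2C, dif_pos h3, Lp.norm_toLp]

lemma continuousOn_toL2C {S : Set ℝ} {F : ℝ → ℝ → ℂ} {D : ℝ → ℝ} (hD : MemLp D 2 volume)
    (hm : ∀ τ ∈ S, AEStronglyMeasurable (F τ) volume) (hb : ∀ τ ∈ S, ∀ ξ, ‖F τ ξ‖ ≤ D ξ)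
    (hc : ∀ ξ, ContinuousOn (fun τ => F τ ξ) S) : ContinuousOn (fun τ => toL2C (F τ)) S :=
  fun τ₀ h0 => tendsto_toL2C hD (by filter_upwards [self_mem_nhdsWithin] with τ hτ using hm τ hτ)
    (hm τ₀ h0) (by filter_upwards [self_mem_nhdsWithin] with τ hτ using hb τ hτ) (hb τ₀ h0)
    fun ξ => hc ξ τ₀ h0

/-- The Bochner integral of a family of square integrable functions is the pointwise integral. -/
lemma integral_toL2C {t : ℝ} (ht : 0 ≤ t) {F : ℝ → ℝ → ℂ} {D : ℝ → ℝ} (hD : MemLp D 2 volume)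
    (hF : Continuous fun p : ℝ × ℝ => F p.1 p.2) (hb : ∀ τ ∈ Set.Icc 0 t, ∀ ξ, ‖F τ ξ‖ ≤ D ξ) :
    ∫ τ in (0 : ℝ)..t, toL2C (F τ) = toL2C fun ξ => ∫ τ in (0 : ℝ)..t, F τ ξ := by
  have hFc : ∀ τ, Continuous (F τ) := fun τ => hF.comp (f := fun ξ : ℝ => (τ, ξ)) (by fun_prop)
  have hFt : ∀ ξ, Continuous fun τ => F τ ξ := fun ξ =>
    hF.comp (f := fun τ : ℝ => (τ, ξ)) (by fun_prop)
  have hLp : ∀ τ ∈ Set.Icc 0 t, MemLp (F τ) 2 volume := fun τ hτ =>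
    hD.of_le (hFc τ).aestronglyMeasurable
      (Eventually.of_forall fun ξ => (hb τ hτ ξ).trans (le_abs_self _))
  have hcont : ContinuousOn (fun τ => toL2C (F τ)) (Set.Icc 0 t) :=
    continuousOn_toL2C hD (fun τ _ => (hFc τ).aestronglyMeasurable) hb
      fun ξ => (hFt ξ).continuousOn
  have hint : IntervalIntegrable (fun τ => toL2C (F τ)) volume 0 t :=
    ContinuousOn.intervalIntegrable_of_Icc ht hcont
  have hG : Continuous fun ξ => ∫ τ in (0 : ℝ)..t, F τ ξ :=
    intervalIntegral.continuous_parametric_intervalIntegral_of_continuous'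
      (f := fun ξ τ => F τ ξ) (hF.comp (f := fun p : ℝ × ℝ => (p.2, p.1)) (by fun_prop)) 0 t
  have hGb : ∀ ξ, ‖∫ τ in (0 : ℝ)..t, F τ ξ‖ ≤ D ξ * t := by
    intro ξ
    have := intervalIntegral.norm_integral_le_of_norm_le_const (a := 0) (b := t) (C := D ξ)
      (f := fun τ => F τ ξ) (fun τ hτ => by
        rw [Set.uIoc_of_le ht] at hτ
        exact hb τ ⟨hτ.1.le, hτ.2⟩ ξ)
    rwa [sub_zero, abs_of_nonneg ht] at this
  have hGm : MemLp (fun ξ => ∫ τ in (0 : ℝ)..t, F τ ξ) 2 volume :=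
    (hD.mul_const t).of_le hG.aestronglyMeasurable
      (Eventually.of_forall fun ξ => (hGb ξ).trans (le_abs_self _))
  refine ext_inner_left ℂ fun φ => ?_
  have e1 : inner ℂ φ (∫ τ in (0 : ℝ)..t, toL2C (F τ))
      = ∫ τ in (0 : ℝ)..t, inner ℂ φ (toL2C (F τ)) :=
    ((innerSL ℂ φ).intervalIntegral_comp_comm hint).symm
  have e2 : ∀ {H : ℝ → ℂ}, MemLp H 2 volume →
      inner ℂ φ (toL2C H) = ∫ ξ, H ξ * (starRingEnd ℂ) (φ ξ) := by
    intro H hH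
    rw [L2.inner_def]
    refine integral_congr_ae ?_
    filter_upwards [coeFn_toL2C hH] with ξ hξ
    rw [hξ, RCLike.inner_apply]
  rw [e1, e2 hGm]
  have e3 : ∫ τ in (0 : ℝ)..t, inner ℂ φ (toL2C (F τ))
      = ∫ τ in (0 : ℝ)..t, ∫ ξ, F τ ξ * (starRingEnd ℂ) (φ ξ) := by
    refine intervalIntegral.integral_congr fun τ hτ => ?_
    rw [Set.uIcc_of_le ht] at hτ
    exact e2 (hLp τ hτ)
  rw [e3, intervalIntegral.integral_of_le ht]
  have hφ : MemLp (φ : ℝ → ℂ) 2 volume := Lp.memLp φ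
  have hbound : Integrable (fun p : ℝ × ℝ => D p.2 * ‖φ p.2‖)
      ((volume.restrict (Set.Ioc 0 t)).prod volume) := by
    have h1 : Integrable (fun ξ => D ξ * ‖φ ξ‖) volume := hD.integrable_mul hφ.norm
    exact h1.comp_snd _
  rw [integral_integral_swap]
  · congr 1
    ext ξ
    rw [intervalIntegral.integral_of_le ht, integral_mul_const]
  · refine hbound.mono' ?_ ?_
    · refine AEStronglyMeasurable.mul hF.aestronglyMeasurable ?_
      exact (Complex.continuous_conj.comp_aestronglyMeasurable hφ.1).comp_snd
    · have h1 : ∀ᵐ p : ℝ × ℝ ∂((volume.restrict (Set.Ioc 0 t)).prod volume),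
          p.1 ∈ Set.Ioc 0 t :=
        Measure.quasiMeasurePreserving_fst.ae (ae_restrict_mem measurableSet_Ioc)
      filter_upwards [h1] with p hp
      rw [Function.uncurry, norm_mul, RCLike.norm_conj]
      exact mul_le_mul_of_nonneg_right (hb p.1 ⟨hp.1.le, hp.2⟩ p.2) (norm_nonneg _)

/-! ### The nonlinear term and uniqueness of mild solutions -/

lemma memLp_inv_wt {t : ℝ} (ht : 0 ≤ t) : MemLp (fun ξ => (wt t ξ)⁻¹) 2 volume := by
  refine (l2Bd_inv_wt ht).memLp.norm.congr_norm ?_ (Eventually.of_forall fun ξ => by simp)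
  exact ((continuous_wt_right t).inv₀ fun ξ => (wt_pos t ξ).ne').aestronglyMeasurable

lemma abs_div_one_add_sq_le (ξ : ℝ) : |ξ| / (1 + ξ ^ 2) ≤ 2 * (wt 0 ξ)⁻¹ := by
  rw [wt_zero, ← div_eq_mul_inv, div_le_div_iff₀ (by positivity) (by positivity)]
  have := abs_nonneg ξ
  nlinarith [sq_abs ξ, sq_nonneg (|ξ| - 1)]

lemma norm_bsym_le_inv_wt (ξ : ℝ) : ‖bsym ξ‖ ≤ 4 * Real.pi * (wt 0 ξ)⁻¹ := by
  have h1 := norm_bsym_le ξ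
  have h2 := abs_div_one_add_sq_le ξ
  have := Real.pi_pos
  nlinarith

lemma norm_one_div_one_add_sq_le (x : ℝ) : ‖(1 / (1 + (x : ℂ) ^ 2))‖ ≤ 1 := by
  rw [norm_div, norm_one, norm_one_add_sq]
  exact div_le_one_of_le₀ (by nlinarith [sq_nonneg x]) (by positivity)

/-- The operator `(∂ₓT(t)) * (1 - ∂ₓ²)⁻¹` on the Fourier side. -/
lemma convDxT_resolvent (γ τ : ℝ) (G : L2C) :
    convDxT γ τ (resolvent G)
      = 𝓕⁻ (toL2C fun ξ => bsym ξ * asym γ τ ξ * (𝓕 G : L2C) ξ) := by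
  set R : ℝ → ℂ := fun ξ => 1 / (1 + ((2 * Real.pi * ξ : ℝ) : ℂ) ^ 2) * (𝓕 G : L2C) ξ with hR
  have hRm : MemLp R 2 volume := by
    refine (Lp.memLp (𝓕 G : L2C)).of_le ?_ (Eventually.of_forall fun ξ => ?_)
    · refine AEStronglyMeasurable.mul ?_ (Lp.memLp (𝓕 G : L2C)).1
      exact (continuous_const.div (by fun_prop) fun ξ =>
        one_add_sq_ne_zero (2 * Real.pi * ξ)).aestronglyMeasurable
    · rw [hR, norm_mul]
      exact mul_le_of_le_one_left (norm_nonneg _) (norm_one_div_one_add_sq_le _)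
  have e : resolvent G = 𝓕⁻ (toL2C R) := rfl
  rw [e, convDxT, multiplier, fourier_fourierInv_eq]
  congr 1
  refine toL2C_congr ?_
  filter_upwards [coeFn_toL2C hRm] with ξ hξ
  rw [hξ, hR]
  unfold bsym asym
  ring

lemma eLpNorm_coe_eq (u : L2) : eLpNorm u 2 volume = ENNReal.ofReal ‖u‖ := by
  rw [Lp.norm_def, ENNReal.ofReal_toReal (Lp.eLpNorm_ne_top u)]

lemma l2Bd_coe (u : L2) : L2Bd (fun x => (u x : ℂ)) ‖u‖ := by
  refine ⟨(memLp_ofReal (Lp.memLp u)).1, ?_⟩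
  rw [eLpNorm_ofReal, eLpNorm_coe_eq]

lemma cplx_sub (u v : L2) : cplx (u - v : L2) = cplx u - cplx v := by
  unfold cplx
  rw [← toL2C_sub (l2Bd_coe u).memLp (l2Bd_coe v).memLp]
  refine toL2C_congr ?_
  filter_upwards [Lp.coeFn_sub u v] with x hx
  rw [hx]
  push_cast [Pi.sub_apply]
  rfl

lemma norm_cplx (u : L2) : ‖cplx u‖ = ‖u‖ := by
  have h := (l2Bd_coe u).memLp
  rw [cplx, toL2C, dif_pos h, Lp.norm_toLp, eLpNorm_ofReal, Lp.norm_def]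

/-- The Fourier transform of the square of a square integrable function. -/
def sqHat (u : L2) : ℝ → ℂ := 𝓕 fun x => ((u x ^ 2 : ℝ) : ℂ)

lemma integrable_sq_coe (u : L2) : Integrable (fun x => ((u x ^ 2 : ℝ) : ℂ)) volume :=
  ((Lp.memLp u).integrable_sq).ofReal

lemma norm_sqHat_sub_le (u v : L2) (ξ : ℝ) :
    ‖sqHat u ξ - sqHat v ξ‖ ≤ ‖u - v‖ * (‖u‖ + ‖v‖) := by
  have e : sqHat u ξ - sqHat v ξ
      = 𝓕 (fun x => ((u x ^ 2 : ℝ) : ℂ) - ((v x ^ 2 : ℝ) : ℂ)) ξ := by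
    unfold sqHat
    simp only [Real.fourier_eq]
    rw [← integral_sub]
    · congr 1; ext x; rw [smul_sub]
    · exact (Real.fourierIntegral_convergent_iff ξ).2 (integrable_sq_coe u)
    · exact (Real.fourierIntegral_convergent_iff ξ).2 (integrable_sq_coe v)
  rw [e]
  refine (norm_fourier_le ξ).trans ?_
  have h1 := l2Bd_coe (u - v)
  have h2 := (l2Bd_coe u).add (l2Bd_coe v) (norm_nonneg _) (norm_nonneg _)
  refine le_trans (le_of_eq ?_)
    (h1.integral_mul_le h2 (norm_nonneg _) (add_nonneg (norm_nonneg _) (norm_nonneg _)))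
  refine integral_congr_ae ?_
  filter_upwards [Lp.coeFn_sub u v] with x hx
  rw [hx, ← norm_mul]
  congr 1
  push_cast [Pi.sub_apply]
  ring

lemma norm_sqHat_le (u : L2) (ξ : ℝ) : ‖sqHat u ξ‖ ≤ ‖u‖ ^ 2 := by
  have := norm_sqHat_sub_le u 0 ξ
  have e : sqHat 0 ξ = 0 := by
    unfold sqHat
    rw [Real.fourier_eq]
    refine integral_eq_zero_of_ae ?_
    filter_upwards [Lp.coeFn_zero ℝ 2 (volume : Measure ℝ)] with x hx
    rw [hx]
    simp
  rw [e] at this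
  simpa [sq] using this

lemma continuous_sqHat (u : L2) : Continuous (sqHat u) := continuous_fourier (integrable_sq_coe u)

lemma integrable_of_weight {s : ℕ} (hs : 1 ≤ s) {F : ℝ → ℂ} (hF : AEStronglyMeasurable F volume)
    (h : MemLp (fun ξ : ℝ => (((1 + |ξ|) ^ s : ℝ) : ℂ) * F ξ) 2 volume) :
    Integrable F volume := by
  have hi := (memLp_inv_wt le_rfl).integrable_mul h.norm
  refine hi.mono' hF (Eventually.of_forall fun ξ => ?_)
  simp only [Pi.mul_apply]
  have h1 : (1 : ℝ) ≤ 1 + |ξ| := by have := abs_nonneg ξ; linarith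
  rw [wt_zero, norm_mul, Complex.norm_real, Real.norm_of_nonneg (by positivity), ← mul_assoc]
  refine le_mul_of_one_le_left (norm_nonneg _) ?_
  rw [← div_eq_inv_mul, one_le_div (by positivity)]
  exact le_self_pow₀ h1 (by omega)

lemma MemH.memLp_weight {s : ℕ} {f : ℝ → ℝ} (hf : MemH s f) :
    MemLp (fun ξ : ℝ => (((1 + |ξ|) ^ s : ℝ) : ℂ) * (𝓕 (cplx f) : L2C) ξ) 2 volume := by
  refine ⟨?_, (eLpNorm_weight_fourier_le hf).trans_lt
    (ENNReal.mul_lt_top ENNReal.ofReal_lt_top hf.2)⟩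
  refine AEStronglyMeasurable.mul ?_ (Lp.memLp _).1
  exact (Complex.continuous_ofReal.comp (by fun_prop)).aestronglyMeasurable

/-- A function in `Hˢ`, `s ≥ 1`, is bounded, so its square is square integrable. -/
lemma MemH.memLp_sq {s : ℕ} (hs : 1 ≤ s) {f : ℝ → ℝ} (hf : MemH s f) :
    MemLp (fun x => ((f x ^ 2 : ℝ) : ℂ)) 2 volume := by
  set F : ℝ → ℂ := fun ξ => (𝓕 (cplx f) : L2C) ξ with hF
  have hFm : MemLp F 2 volume := Lp.memLp _
  have hFi : Integrable F volume := integrable_of_weight hs hFm.1 hf.memLp_weight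
  have e : cplx f = 𝓕⁻ (toL2C F) := by
    rw [hF, toL2C_coeFn, fourierInv_fourier_eq]
  have h1 := fourierInv_toL2C hFi hFm
  rw [← e] at h1
  have h2 : ∀ᵐ x, |f x| ≤ ∫ ξ, ‖F ξ‖ := by
    filter_upwards [h1, coeFn_toL2C (memLp_ofReal hf.1)] with x hx hx'
    rw [cplx, hx'] at hx
    have := norm_fourierInv_le (f := F) x
    rwa [← hx, Complex.norm_real] at this
  have hm : AEStronglyMeasurable (fun x => ((f x ^ 2 : ℝ) : ℂ)) volume :=
    Complex.continuous_ofReal.comp_aestronglyMeasurable (hf.1.1.pow 2)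
  refine (hf.1.const_mul (∫ ξ, ‖F ξ‖)).of_le hm ?_
  filter_upwards [h2] with x hx
  have h0 : 0 ≤ ∫ ξ, ‖F ξ‖ := integral_nonneg fun _ => norm_nonneg _
  rw [Complex.norm_real, norm_pow, norm_mul, Real.norm_of_nonneg h0, Real.norm_eq_abs, sq]
  exact mul_le_mul_of_nonneg_right hx (abs_nonneg _)

/-- The integrand of the mild formulation on the Fourier side. -/
lemma convDxT_resolvent_sq {s : ℕ} (hs : 1 ≤ s) (γ τ : ℝ) {u : L2} (hu : MemH s u) :
    convDxT γ τ (resolvent (cplx fun x => u x ^ 2))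
      = 𝓕⁻ (toL2C fun ξ => bsym ξ * asym γ τ ξ * sqHat u ξ) := by
  rw [convDxT_resolvent]
  congr 1
  refine toL2C_congr ?_
  have := fourier_toL2C (integrable_sq_coe u) (hu.memLp_sq hs)
  filter_upwards [this] with ξ hξ
  rw [cplx, hξ]
  rfl

lemma norm_le_sobolevNorm (s : ℕ) (v : L2) : ENNReal.ofReal ‖v‖ ≤ sobolevNorm s v := by
  refine le_trans ?_ (derivNorm_le_sobolevNorm (Nat.zero_le s) v)
  refine le_trans (le_of_eq ?_) (eLpNorm_fourier_le_derivNorm (Lp.memLp v) 0)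
  simp only [pow_zero, one_mul]
  rw [← norm_cplx, ← Lp.norm_fourier_eq, Lp.norm_def, ENNReal.ofReal_toReal (Lp.eLpNorm_ne_top _)]

lemma MemCH.continuousOn {s : ℕ} {u : ℝ → L2} (h : MemCH s u) : ContinuousOn u (Set.Ici 0) := by
  intro t₀ h0
  refine tendsto_iff_norm_sub_tendsto_zero.2 ?_
  have h1 := tendsto_of_tendsto_of_tendsto_of_le_of_le tendsto_const_nhds (h.2 t₀ h0)
    (fun _ => zero_le) (fun t => norm_le_sobolevNorm s (u t - u t₀))
  have h2 := (ENNReal.tendsto_toReal ENNReal.zero_ne_top).comp h1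
  refine h2.congr fun t => ?_
  simp only [Function.comp, ENNReal.toReal_ofReal (norm_nonneg _)]

lemma continuousOn_sqHat {S : Set ℝ} {u : ℝ → L2} (hu : ContinuousOn u S) (ξ : ℝ) :
    ContinuousOn (fun τ => sqHat (u τ) ξ) S := by
  intro τ₀ h0
  refine tendsto_iff_norm_sub_tendsto_zero.2 ?_
  have h1 : Tendsto (fun τ => ‖u τ - u τ₀‖ * (‖u τ‖ + ‖u τ₀‖)) (𝓝[S] τ₀) (𝓝 0) := by
    have a := tendsto_iff_norm_sub_tendsto_zero.1 (hu τ₀ h0)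
    have b := ((hu τ₀ h0).norm).add_const ‖u τ₀‖
    simpa using a.mul b
  exact squeeze_zero (fun _ => norm_nonneg _) (fun τ => norm_sqHat_sub_le _ _ ξ) h1

lemma aestronglyMeasurable_duh_sq (γ τ : ℝ) (u : L2) :
    AEStronglyMeasurable (fun ξ => bsym ξ * asym γ τ ξ * sqHat u ξ) volume :=
  ((continuous_bsym.mul ((continuous_asym γ).comp (f := fun ξ : ℝ => (τ, ξ)) (by fun_prop))).mul
    (continuous_sqHat u)).aestronglyMeasurable

lemma norm_duh_sq_le {γ τ : ℝ} (hτ : 0 ≤ τ) {z : ℂ} {m : ℝ} (hz : ‖z‖ ≤ m) (ξ : ℝ) :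
    ‖bsym ξ * asym γ τ ξ * z‖ ≤ (4 * Real.pi * m) * (wt 0 ξ)⁻¹ := by
  rw [norm_mul, norm_mul]
  have h1 := norm_bsym_le_inv_wt ξ
  have h2 := norm_asym_le_one hτ γ ξ
  have h0 : 0 ≤ (wt 0 ξ)⁻¹ := inv_nonneg.2 (wt_pos 0 ξ).le
  calc ‖bsym ξ‖ * ‖asym γ τ ξ‖ * ‖z‖ ≤ (4 * Real.pi * (wt 0 ξ)⁻¹) * 1 * m := by
        have := Real.pi_pos
        gcongr
    _ = _ := by ring

lemma exists_norm_le_of_continuousOn {u : ℝ → L2} (hu : ContinuousOn u (Set.Ici 0)) (t : ℝ) :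
    ∃ m, 0 ≤ m ∧ ∀ τ ∈ Set.Icc 0 t, ‖u τ‖ ≤ m := by
  obtain ⟨m, hm⟩ := isCompact_Icc.exists_bound_of_continuousOn
    (hu.mono (Set.Icc_subset_Ici_self : Set.Icc 0 t ⊆ Set.Ici 0))
  exact ⟨max m 0, le_max_right _ _, fun τ hτ => (hm τ hτ).trans (le_max_left _ _)⟩

lemma continuousOn_duh_sq (γ : ℝ) {u : ℝ → L2} (hu : ContinuousOn u (Set.Ici 0)) (t : ℝ) :
    ContinuousOn (fun τ => toL2C fun ξ => bsym ξ * asym γ (t - τ) ξ * sqHat (u τ) ξ)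
      (Set.Icc 0 t) := by
  obtain ⟨m, -, hm⟩ := exists_norm_le_of_continuousOn hu t
  refine continuousOn_toL2C ((memLp_inv_wt le_rfl).const_mul (4 * Real.pi * m ^ 2))
    (fun τ _ => aestronglyMeasurable_duh_sq γ (t - τ) (u τ)) (fun τ hτ ξ => ?_) (fun ξ => ?_)
  · exact norm_duh_sq_le (by linarith [hτ.2])
      ((norm_sqHat_le _ _).trans (pow_le_pow_left₀ (norm_nonneg _) (hm τ hτ) 2)) ξ
  · refine ContinuousOn.mul (Continuous.continuousOn ?_)
      (continuousOn_sqHat (hu.mono Set.Icc_subset_Ici_self) ξ)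
    exact continuous_const.mul
      ((continuous_asym γ).comp (f := fun τ : ℝ => (t - τ, ξ)) (by fun_prop))

/-- The Lipschitz bound of the nonlinear term in `L²`. -/
lemma norm_duh_sq_sub_le {γ τ : ℝ} (hτ : 0 ≤ τ) (u v : L2) :
    ‖(toL2C fun ξ => bsym ξ * asym γ τ ξ * sqHat u ξ)
      - toL2C fun ξ => bsym ξ * asym γ τ ξ * sqHat v ξ‖
      ≤ 8 * Real.pi * (‖u‖ + ‖v‖) * ‖u - v‖ := by
  have hm : ∀ w : L2, MemLp (fun ξ => bsym ξ * asym γ τ ξ * sqHat w ξ) 2 volume := fun w =>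
    ((memLp_inv_wt le_rfl).const_mul (4 * Real.pi * ‖w‖ ^ 2)).of_le
      (aestronglyMeasurable_duh_sq γ τ w)
      (Eventually.of_forall fun ξ => (norm_duh_sq_le hτ (norm_sqHat_le w ξ) ξ).trans (le_abs_self _))
  rw [← toL2C_sub (hm u) (hm v)]
  have hpi := Real.pi_pos
  have hB : L2Bd (fun ξ => bsym ξ * asym γ τ ξ * sqHat u ξ - bsym ξ * asym γ τ ξ * sqHat v ξ)
      ((4 * Real.pi * (‖u - v‖ * (‖u‖ + ‖v‖))) * (2 * (1 + (0 : ℝ)) ^ (-(1 / 4) : ℝ))) := by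
    refine l2Bd_of_le_inv_wt le_rfl (by positivity) ((hm u).sub (hm v)).1 fun ξ => ?_
    rw [← mul_sub, div_eq_mul_inv]
    exact norm_duh_sq_le hτ (norm_sqHat_sub_le u v ξ) ξ
  refine (hB.norm_toL2C_le (by positivity)).trans (le_of_eq ?_)
  rw [add_zero, Real.one_rpow]
  ring

/-- The integral form of Gronwall's inequality with vanishing initial value. -/
lemma eq_zero_of_le_integral {y : ℝ → ℝ} (hy : Continuous y) (h0 : ∀ t, 0 ≤ y t) {K T : ℝ}
    (hK : ∀ t ∈ Set.Icc 0 T, y t ≤ K * ∫ τ in (0 : ℝ)..t, y τ) :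
    ∀ t ∈ Set.Icc 0 T, y t = 0 := by
  have hd : ∀ t, HasDerivAt (fun t => ∫ τ in (0 : ℝ)..t, y τ) (y t) t := fun t =>
    intervalIntegral.integral_hasDerivAt_right (hy.intervalIntegrable _ _)
      hy.stronglyMeasurable.stronglyMeasurableAtFilter hy.continuousAt
  have hn : ∀ t ∈ Set.Icc 0 T, 0 ≤ ∫ τ in (0 : ℝ)..t, y τ := fun t ht =>
    intervalIntegral.integral_nonneg ht.1 fun τ _ => h0 τ
  have key := norm_le_gronwallBound_of_norm_deriv_right_le (f := fun t => ∫ τ in (0 : ℝ)..t, y τ)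
    (f' := y) (δ := 0) (K := K) (ε := 0) (a := 0) (b := T)
    (fun t _ => (hd t).continuousAt.continuousWithinAt)
    (fun t _ => (hd t).hasDerivWithinAt) (by simp) (fun t ht => by
      have ht' : t ∈ Set.Icc 0 T := ⟨ht.1, ht.2.le⟩
      rw [Real.norm_of_nonneg (h0 t), Real.norm_of_nonneg (hn t ht'), add_zero]
      exact hK t ht')
  intro t ht
  have h1 := key t ht
  have h2 : gronwallBound 0 K 0 (t - 0) = 0 := by
    by_cases hK0 : K = 0
    · simp [gronwallBound, hK0]
    · simp [gronwallBound, hK0]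
  rw [h2, norm_le_zero_iff] at h1
  have h3 := hK t ht
  rw [h1, mul_zero] at h3
  exact le_antisymm h3 (h0 t)

/-- Mild solutions in `C⁰([0, ∞); Hˢ)`, `s ≥ 1`, are unique. -/
theorem mild_unique {β γ : ℝ} {s : ℕ} (hs : 1 ≤ s) {u₀ : ℝ → ℝ} {u v : ℝ → L2}
    (hu : IsGlobalMildSolution β γ s u₀ u) (hv : IsGlobalMildSolution β γ s u₀ v) {t : ℝ}
    (ht : 0 ≤ t) : v t = u t := by
  have huc := hu.1.continuousOn
  have hvc := hv.1.continuousOn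
  obtain ⟨m, hm0, hm⟩ := exists_norm_le_of_continuousOn huc t
  obtain ⟨n, hn0, hn⟩ := exists_norm_le_of_continuousOn hvc t
  set y : ℝ → ℝ := fun τ => ‖v (max τ 0) - u (max τ 0)‖ with hy
  have hyc : Continuous y := by
    have hmax : Continuous fun τ : ℝ => max τ 0 := by fun_prop
    exact ((hvc.comp_continuous hmax fun τ => Set.mem_Ici.2 (le_max_right _ _)).sub
      (huc.comp_continuous hmax fun τ => Set.mem_Ici.2 (le_max_right _ _))).norm
  have hy' : ∀ τ, 0 ≤ τ → y τ = ‖v τ - u τ‖ := fun τ hτ => by rw [hy]; simp [hτ]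
  have hpi := Real.pi_pos
  have key : ∀ r ∈ Set.Icc 0 t,
      y r ≤ (|β| / 2 * (8 * Real.pi * (n + m))) * ∫ τ in (0 : ℝ)..r, y τ := by
    intro r hr
    have hF : ∀ w : ℝ → L2, IsGlobalMildSolution β γ s u₀ w →
        ∫ τ in (0 : ℝ)..r, convDxT γ (r - τ) (resolvent (cplx fun x => w τ x ^ 2))
        = ∫ τ in (0 : ℝ)..r,
          𝓕⁻ (toL2C fun ξ => bsym ξ * asym γ (r - τ) ξ * sqHat (w τ) ξ) := by
      intro w hw
      refine intervalIntegral.integral_congr fun τ hτ => ?_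
      rw [Set.uIcc_of_le hr.1] at hτ
      exact convDxT_resolvent_sq hs γ (r - τ) (hw.1.1 τ hτ.1)
    have hI : ∀ w : ℝ → L2, IsGlobalMildSolution β γ s u₀ w → IntervalIntegrable (fun τ =>
        (𝓕⁻ (toL2C fun ξ => bsym ξ * asym γ (r - τ) ξ * sqHat (w τ) ξ) : L2C)) volume 0 r := by
      intro w hw
      refine ContinuousOn.intervalIntegrable_of_Icc hr.1 ?_
      exact (Lp.fourierTransformₗᵢ ℝ ℂ).symm.continuous.comp_continuousOn
        (continuousOn_duh_sq γ hw.1.continuousOn r)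
    have e : cplx (v r - u r : L2) = -(((β / 2 : ℝ) : ℂ) • ∫ τ in (0 : ℝ)..r,
        ((𝓕⁻ (toL2C fun ξ => bsym ξ * asym γ (r - τ) ξ * sqHat (v τ) ξ) : L2C)
          - 𝓕⁻ (toL2C fun ξ => bsym ξ * asym γ (r - τ) ξ * sqHat (u τ) ξ))) := by
      rw [cplx_sub, hv.2 r hr.1, hu.2 r hr.1, hF u hu, hF v hv,
        intervalIntegral.integral_sub (hI v hv) (hI u hu), smul_sub]
      abel
    rw [hy' r hr.1, ← norm_cplx, e, norm_neg, norm_smul, Complex.norm_real, Real.norm_eq_abs,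
      abs_div, abs_two, mul_assoc]
    refine mul_le_mul_of_nonneg_left ?_ (by positivity)
    rw [← intervalIntegral.integral_const_mul]
    refine intervalIntegral.norm_integral_le_of_norm_le hr.1 ?_
      ((hyc.const_mul _).intervalIntegrable _ _)
    refine Eventually.of_forall fun τ hτ => ?_
    have hτ' : τ ∈ Set.Icc 0 t := ⟨hτ.1.le, hτ.2.trans hr.2⟩
    have e2 : ∀ F G : L2C, ‖(𝓕⁻ F : L2C) - 𝓕⁻ G‖ = ‖F - G‖ := fun F G => by
      have := (Lp.fourierTransformₗᵢ ℝ ℂ).symm.norm_map (F - G)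
      rw [map_sub] at this
      exact this
    rw [e2, hy' τ hτ.1.le]
    refine (norm_duh_sq_sub_le (by linarith [hτ.2]) (v τ) (u τ)).trans ?_
    have := hm τ hτ'
    have := hn τ hτ'
    gcongr
  have := eq_zero_of_le_integral hyc (fun τ => norm_nonneg _) key t ⟨ht, le_rfl⟩
  rw [hy' t ht, norm_sub_eq_zero_iff] at this
  exact this

/-! ### Existence of mild solutions -/

lemma herm_fourier (u : ℝ → ℝ) : Herm (𝓕 fun x => (u x : ℂ)) := by
  intro ξ
  rw [Real.fourier_eq, Real.fourier_eq, ← integral_conj]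
  congr 1
  ext x
  rw [inner_neg_right, Circle.smul_def, Circle.smul_def, smul_eq_mul, smul_eq_mul, map_mul,
    Complex.conj_ofReal, ← Circle.coe_inv_eq_conj, ← AddChar.map_neg_eq_inv]

lemma Herm.fourierInv_im {f : ℝ → ℂ} (hf : Herm f) (x : ℝ) : (𝓕⁻ f x).im = 0 := by
  rw [← Complex.conj_eq_iff_im, Real.fourierInv_eq, ← integral_conj, ← integral_neg_eq_self]
  congr 1
  ext ξ
  rw [inner_neg_left, Circle.smul_def, Circle.smul_def, smul_eq_mul, smul_eq_mul, map_mul, hf ξ,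
    Complex.conj_conj, ← Circle.coe_inv_eq_conj, ← AddChar.map_neg_eq_inv, neg_neg]

lemma Herm.ofReal_fourierInv {f : ℝ → ℂ} (hf : Herm f) (x : ℝ) :
    (((𝓕⁻ f x).re : ℝ) : ℂ) = 𝓕⁻ f x := by
  apply Complex.ext <;> simp [hf.fourierInv_im x]

/-- The Sobolev norm in terms of the Fourier transform. -/
lemma sobolevNorm_le_weight {s : ℕ} {v : ℝ → ℝ} (hv : MemLp v 2 volume) {h : ℝ → ℂ}
    (e : (𝓕 (cplx v) : L2C) =ᵐ[volume] h)
    (hm : MemLp (fun ξ : ℝ => (((1 + |ξ|) ^ s : ℝ) : ℂ) * h ξ) 2 volume) :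
    sobolevNorm s v ≤ ((s + 1 : ℕ) : ℝ≥0∞) ^ (1 / 2 : ℝ) * ENNReal.ofReal ((2 * Real.pi) ^ s)
      * eLpNorm (fun ξ : ℝ => (((1 + |ξ|) ^ s : ℝ) : ℂ) * h ξ) 2 volume := by
  have h1 : AEStronglyMeasurable h volume := (Lp.memLp (𝓕 (cplx v) : L2C)).1.congr e
  have hpi : 1 ≤ 2 * Real.pi := by linarith [Real.pi_gt_three]
  have key : ∀ n ≤ s, derivNorm n 2 v ≤ ENNReal.ofReal ((2 * Real.pi) ^ s)
      * eLpNorm (fun ξ : ℝ => (((1 + |ξ|) ^ s : ℝ) : ℂ) * h ξ) 2 volume := by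
    intro n hn
    have e' : (fun ξ : ℝ => (2 * Real.pi * Complex.I * ξ) ^ n * (𝓕 (cplx v) : L2C) ξ)
        =ᵐ[volume] fun ξ : ℝ => (2 * Real.pi * Complex.I * ξ) ^ n * h ξ := by
      filter_upwards [e] with ξ hξ
      rw [hξ]
    have hb : ∀ ξ : ℝ, ‖(2 * Real.pi * Complex.I * ξ) ^ n * h ξ‖
        ≤ (2 * Real.pi) ^ s * ‖(((1 + |ξ|) ^ s : ℝ) : ℂ) * h ξ‖ := by
      intro ξ
      have h0 : 0 ≤ |ξ| := abs_nonneg ξ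
      rw [norm_mul, norm_two_pi_I_mul_pow, norm_mul, Complex.norm_real,
        Real.norm_of_nonneg (by positivity), ← mul_assoc, ← mul_pow]
      refine mul_le_mul_of_nonneg_right ?_ (norm_nonneg _)
      calc (2 * Real.pi * |ξ|) ^ n ≤ (2 * Real.pi * (1 + |ξ|)) ^ n := by gcongr; linarith
        _ ≤ (2 * Real.pi * (1 + |ξ|)) ^ s := pow_le_pow_right₀ (by nlinarith) hn
    have hm' : MemLp (fun ξ : ℝ => (2 * Real.pi * Complex.I * ξ) ^ n * h ξ) 2 volume := by
      refine hm.of_le_mul (c := (2 * Real.pi) ^ s) ?_ (Eventually.of_forall hb)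
      exact (by fun_prop : Continuous fun ξ : ℝ =>
        (2 * Real.pi * Complex.I * ξ : ℂ) ^ n).aestronglyMeasurable.mul h1
    refine (derivNorm_two_le hv n ((memLp_congr_ae e').2 hm')).trans ?_
    rw [eLpNorm_congr_ae e']
    exact eLpNorm_le_mul_eLpNorm_of_ae_le_mul (Eventually.of_forall hb) 2
  refine (sobolevNorm_le key).trans (le_of_eq ?_)
  rw [ENNReal.mul_rpow_of_nonneg _ _ (by norm_num), ← ENNReal.rpow_natCast, ← ENNReal.rpow_mul,
    Nat.cast_ofNat, mul_one_div_cancel two_ne_zero, ENNReal.rpow_one, mul_assoc]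

lemma continuous_weight (s : ℕ) : Continuous fun ξ : ℝ => (((1 + |ξ|) ^ s : ℝ) : ℂ) :=
  Complex.continuous_ofReal.comp (by fun_prop)

lemma fourier_cplx_ae {u₀ : ℝ → ℝ} (hi : Integrable u₀ volume) (h2 : MemLp u₀ 2 volume) :
    (𝓕 (cplx u₀) : L2C) =ᵐ[volume] 𝓕 fun x => (u₀ x : ℂ) :=
  fourier_toL2C hi.ofReal (memLp_ofReal h2)

section Existence

variable {β γ Λ : ℝ} {s : ℕ} {f₀ : ℝ → ℂ} {f : ℝ → ℝ → ℂ}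

lemma IsFourierSol.continuous_apply (hf : IsFourierSol β γ s f₀ Λ f) (t : ℝ) :
    Continuous (f t) := hf.cont.comp (f := fun ξ : ℝ => (t, ξ)) (by fun_prop)

lemma IsFourierSol.continuous_time (hf : IsFourierSol β γ s f₀ Λ f) (ξ : ℝ) :
    Continuous fun t => f t ξ := hf.cont.comp (f := fun t : ℝ => (t, ξ)) (by fun_prop)

/-- The weighted solution is dominated by a square integrable function. -/
lemma IsFourierSol.exists_dom (hf : IsFourierSol β γ s f₀ Λ f)
    (hw : MemLp (fun ξ : ℝ => (((1 + |ξ|) ^ s : ℝ) : ℂ) * f₀ ξ) 2 volume) :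
    ∃ D : ℝ → ℝ, MemLp D 2 volume ∧
      ∀ t ξ, ‖(((1 + |ξ|) ^ s : ℝ) : ℂ) * f t ξ‖ ≤ D ξ := by
  obtain ⟨r, hr, hd⟩ := hf.dom
  refine ⟨fun ξ => ‖(((1 + |ξ|) ^ s : ℝ) : ℂ) * f₀ ξ‖ + r * (wt 0 ξ)⁻¹,
    hw.norm.add ((memLp_inv_wt le_rfl).const_mul r), fun t ξ => ?_⟩
  have h0 : 0 < 1 + |ξ| := by positivity
  simp only [norm_mul, Complex.norm_real]
  rw [Real.norm_of_nonneg (by positivity), wt_zero]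
  calc (1 + |ξ|) ^ s * ‖f t ξ‖ ≤ (1 + |ξ|) ^ s * (‖f₀ ξ‖ + r / (1 + |ξ|) ^ (s + 1)) := by
        gcongr; exact hd t ξ
    _ = _ := by field_simp; ring

lemma IsFourierSol.memLp_weight (hf : IsFourierSol β γ s f₀ Λ f)
    (hw : MemLp (fun ξ : ℝ => (((1 + |ξ|) ^ s : ℝ) : ℂ) * f₀ ξ) 2 volume) (t : ℝ) :
    MemLp (fun ξ : ℝ => (((1 + |ξ|) ^ s : ℝ) : ℂ) * f t ξ) 2 volume := by
  obtain ⟨D, hD, hb⟩ := hf.exists_dom hw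
  exact hD.of_le ((continuous_weight s).mul (hf.continuous_apply t)).aestronglyMeasurable
    (Eventually.of_forall fun ξ => (hb t ξ).trans (le_abs_self _))

lemma memLp_of_weight {s : ℕ} {F : ℝ → ℂ} (hF : AEStronglyMeasurable F volume)
    (h : MemLp (fun ξ : ℝ => (((1 + |ξ|) ^ s : ℝ) : ℂ) * F ξ) 2 volume) : MemLp F 2 volume := by
  refine h.of_le hF (Eventually.of_forall fun ξ => ?_)
  rw [norm_mul, Complex.norm_real, Real.norm_of_nonneg (by positivity)]
  refine le_mul_of_one_le_left (norm_nonneg _) (one_le_pow₀ ?_)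
  have := abs_nonneg ξ
  linarith

lemma IsFourierSol.memLp (hf : IsFourierSol β γ s f₀ Λ f)
    (hw : MemLp (fun ξ : ℝ => (((1 + |ξ|) ^ s : ℝ) : ℂ) * f₀ ξ) 2 volume) (t : ℝ) :
    MemLp (f t) 2 volume :=
  memLp_of_weight (hf.continuous_apply t).aestronglyMeasurable (hf.memLp_weight hw t)

lemma IsFourierSol.integrable (hs : 1 ≤ s) (hf : IsFourierSol β γ s f₀ Λ f)
    (hw : MemLp (fun ξ : ℝ => (((1 + |ξ|) ^ s : ℝ) : ℂ) * f₀ ξ) 2 volume) (t : ℝ) :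
    Integrable (f t) volume :=
  integrable_of_weight hs (hf.continuous_apply t).aestronglyMeasurable (hf.memLp_weight hw t)

lemma IsFourierSol.continuous_conv (hs : 1 ≤ s) (hf : IsFourierSol β γ s f₀ Λ f)
    (hf₀i : Integrable f₀ volume) {D₁ : ℝ} (hlow : ∀ ξ, ‖f₀ ξ‖ ≤ D₁) :
    Continuous fun p : ℝ × ℝ => conv (f p.1) (f p.1) p.2 := by
  obtain ⟨r, hr, hd⟩ := hf.dom
  exact BBMBurgers.continuous_conv hf.cont hf.cont (integrable_domF hf₀i r)
    (fun t η => (hd t η).trans (le_domF hs hr η))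
    (fun t η => ((hd t η).trans (le_domF hs hr η)).trans (domF_le hr hlow η))

lemma IsFourierSol.norm_conv_le (hΛ : 0 ≤ Λ) (hf : IsFourierSol β γ s f₀ Λ f) {t : ℝ}
    (ht : 0 ≤ t) (ξ : ℝ) :
    ‖conv (f t) (f t) ξ‖ ≤ Λ * Λ * (1 + t) ^ (-(1 / 2) : ℝ) / wt t ξ ^ s := by
  simpa using conv_congr_norm_bound hΛ hΛ ht (hf.bd t ht) (hf.bd t ht) (ξ := ξ)

lemma IsFourierSol.norm_conv_le_inv_wt (hs : 1 ≤ s) (hΛ : 0 ≤ Λ)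
    (hf : IsFourierSol β γ s f₀ Λ f) {t : ℝ} (ht : 0 ≤ t) (ξ : ℝ) :
    ‖conv (f t) (f t) ξ‖ ≤ Λ * Λ * (wt 0 ξ)⁻¹ := by
  refine (hf.norm_conv_le hΛ ht ξ).trans ?_
  rw [← div_eq_mul_inv]
  have h1 : (1 + t) ^ (-(1 / 2) : ℝ) ≤ 1 := Real.rpow_le_one_of_one_le_of_nonpos (by linarith)
    (by norm_num)
  have h2 : wt 0 ξ ≤ wt t ξ ^ s :=
    (wt_mono ht ξ).trans (le_self_pow₀ (one_le_wt t ξ) (by omega))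
  have h3 := wt_pos 0 ξ
  have h4 : Λ * Λ * (1 + t) ^ (-(1 / 2) : ℝ) ≤ Λ * Λ := mul_le_of_le_one_right (by positivity) h1
  gcongr

/-- The solution on the Fourier side is the Fourier transform of a mild solution. -/
theorem exists_mild (hs : 1 ≤ s) {u₀ : ℝ → ℝ} (hi : Integrable u₀ volume) (h2 : MemLp u₀ 2 volume)
    (h0 : f₀ = 𝓕 fun x => (u₀ x : ℂ)) (hΛ : 0 ≤ Λ) (hf : IsFourierSol β γ s f₀ Λ f)
    (hw : MemLp (fun ξ : ℝ => (((1 + |ξ|) ^ s : ℝ) : ℂ) * f₀ ξ) 2 volume) :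
    ∃ u : ℝ → L2, IsGlobalMildSolution β γ s u₀ u ∧
      ∀ t, (𝓕 (cplx (u t)) : L2C) =ᵐ[volume] f t := by
  have hf₀c : Continuous f₀ := by rw [h0]; exact continuous_fourier hi.ofReal
  have hf₀i : Integrable f₀ volume := integrable_of_weight hs hf₀c.aestronglyMeasurable hw
  have hlow : ∀ ξ, ‖f₀ ξ‖ ≤ ∫ x, ‖(u₀ x : ℂ)‖ := fun ξ => by rw [h0]; exact norm_fourier_le ξ
  have hfi := hf.integrable hs hw
  have hf2 := hf.memLp hw
  have hre : ∀ t, MemLp (fun x => (𝓕⁻ (f t) x).re) 2 volume := fun t =>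
    (memLp_fourierInv (hfi t) (hf2 t)).re
  set u : ℝ → L2 := fun t => (hre t).toLp _ with hu
  have hux : ∀ t, ∀ᵐ x, ((u t x : ℝ) : ℂ) = 𝓕⁻ (f t) x := by
    intro t
    filter_upwards [(hre t).coeFn_toLp] with x hx
    rw [hu]
    simp only
    rw [hx, (hf.herm t).ofReal_fourierInv]
  have huc : ∀ t, cplx (u t) = 𝓕⁻ (toL2C (f t)) := fun t => by
    rw [← toL2C_fourierInv (hfi t) (hf2 t)]
    exact toL2C_congr (hux t)
  have hhat : ∀ t, (𝓕 (cplx (u t)) : L2C) = toL2C (f t) := fun t => by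
    rw [huc, fourier_fourierInv_eq]
  have hhat' : ∀ t, (𝓕 (cplx (u t)) : L2C) =ᵐ[volume] f t := fun t => by
    rw [hhat]
    exact coeFn_toL2C (hf2 t)
  refine ⟨u, ⟨⟨fun t _ => ⟨Lp.memLp _, ?_⟩, fun t₀ _ => ?_⟩, fun t ht => ?_⟩, hhat'⟩
  · refine (sobolevNorm_le_weight (Lp.memLp _) (hhat' t) (hf.memLp_weight hw t)).trans_lt ?_
    refine ENNReal.mul_lt_top (ENNReal.mul_lt_top ?_ ENNReal.ofReal_lt_top)
      (hf.memLp_weight hw t).2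
    exact ENNReal.rpow_lt_top_of_nonneg (by norm_num) (ENNReal.natCast_ne_top _)
  · obtain ⟨D, hD, hb⟩ := hf.exists_dom hw
    have hm : ∀ t, MemLp (fun ξ : ℝ => (((1 + |ξ|) ^ s : ℝ) : ℂ) * (f t ξ - f t₀ ξ)) 2 volume := by
      intro t
      simp only [mul_sub]
      exact (hf.memLp_weight hw t).sub (hf.memLp_weight hw t₀)
    have hd : ∀ t, (𝓕 (cplx (u t - u t₀ : L2)) : L2C) =ᵐ[volume] fun ξ => f t ξ - f t₀ ξ := by
      intro t
      have : (𝓕 (cplx (u t - u t₀ : L2)) : L2C) = toL2C fun ξ => f t ξ - f t₀ ξ := by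
        rw [cplx_sub, toL2C_sub (hf2 t) (hf2 t₀), ← hhat, ← hhat]
        exact (Lp.fourierTransformₗᵢ ℝ ℂ).map_sub _ _
      rw [this]
      exact coeFn_toL2C ((hf2 t).sub (hf2 t₀))
    have hlim : Tendsto (fun t => eLpNorm (fun ξ : ℝ => (((1 + |ξ|) ^ s : ℝ) : ℂ)
        * (f t ξ - f t₀ ξ)) 2 volume) (𝓝[Set.Ici 0] t₀) (𝓝 0) := by
      refine tendsto_eLpNorm_two (hD.const_mul 2) (Eventually.of_forall fun t => (hm t).1)
        (Eventually.of_forall fun t ξ => ?_) fun ξ => ?_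
      · rw [mul_sub]
        have := norm_sub_le ((((1 + |ξ|) ^ s : ℝ) : ℂ) * f t ξ) ((((1 + |ξ|) ^ s : ℝ) : ℂ) * f t₀ ξ)
        have := hb t ξ
        have := hb t₀ ξ
        linarith
      · have := ((((hf.continuous_time ξ).tendsto t₀).mono_left
          (nhdsWithin_le_nhds (s := Set.Ici 0))).sub_const (f t₀ ξ)).const_mul
          (((1 + |ξ|) ^ s : ℝ) : ℂ)
        simpa using this
    refine tendsto_of_tendsto_of_tendsto_of_le_of_le tendsto_const_nhds ?_ (fun _ => zero_le)
      (fun t => sobolevNorm_le_weight (Lp.memLp _) (hd t) (hm t))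
    have := ENNReal.Tendsto.const_mul (a := ((s + 1 : ℕ) : ℝ≥0∞) ^ (1 / 2 : ℝ)
      * ENNReal.ofReal ((2 * Real.pi) ^ s)) hlim (Or.inr (ENNReal.mul_ne_top
        (ENNReal.rpow_ne_top_of_nonneg (by norm_num) (ENNReal.natCast_ne_top _))
        ENNReal.ofReal_ne_top))
    simpa using this
  · have hconv := hf.continuous_conv hs hf₀i hlow
    have hcm : ∀ τ, 0 ≤ τ → MemLp (conv (f τ) (f τ)) 2 volume := fun τ hτ =>
      ((memLp_inv_wt le_rfl).const_mul (Λ * Λ)).of_le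
        (hconv.comp (f := fun ξ : ℝ => (τ, ξ)) (by fun_prop)).aestronglyMeasurable
        (Eventually.of_forall fun ξ => (hf.norm_conv_le_inv_wt hs hΛ hτ ξ).trans (le_abs_self _))
    have hsq : ∀ τ, 0 ≤ τ → cplx (fun x => u τ x ^ 2) = 𝓕⁻ (toL2C (conv (f τ) (f τ))) := by
      intro τ hτ
      rw [← fourier_mul_eq_conv (hfi τ) (hfi τ) (hcm τ hτ)]
      refine toL2C_congr ?_
      filter_upwards [hux τ] with x hx
      rw [← hx, Complex.ofReal_pow, sq]
    set F : ℝ → ℝ → ℂ := fun τ ξ => bsym ξ * asym γ (t - τ) ξ * conv (f τ) (f τ) ξ with hF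
    have hint : ∫ τ in (0 : ℝ)..t, convDxT γ (t - τ) (resolvent (cplx fun x => u τ x ^ 2))
        = ∫ τ in (0 : ℝ)..t, (𝓕⁻ (toL2C (F τ)) : L2C) := by
      refine intervalIntegral.integral_congr fun τ hτ => ?_
      rw [Set.uIcc_of_le ht] at hτ
      rw [convDxT_resolvent, hsq τ hτ.1, fourier_fourierInv_eq]
      congr 1
      refine toL2C_congr ?_
      filter_upwards [coeFn_toL2C (hcm τ hτ.1)] with ξ hξ
      rw [hξ]
    have hFc : Continuous fun p : ℝ × ℝ => F p.1 p.2 :=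
      (continuous_duh_integrand γ (B := fun τ => conv (f τ) (f τ)) hconv).comp (f := fun p : ℝ × ℝ => ((t, p.2), p.1))
        (by fun_prop)
    have hFb : ∀ τ ∈ Set.Icc 0 t, ∀ ξ, ‖F τ ξ‖ ≤ (4 * Real.pi * (Λ * Λ)) * (wt 0 ξ)⁻¹ := by
      intro τ hτ ξ
      refine norm_duh_sq_le (sub_nonneg.2 hτ.2) ((hf.norm_conv_le_inv_wt hs hΛ hτ.1 ξ).trans ?_) ξ
      refine mul_le_of_le_one_right (by positivity) (inv_le_one_of_one_le₀ (one_le_wt 0 ξ))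
    have hD := (memLp_inv_wt le_rfl).const_mul (4 * Real.pi * (Λ * Λ))
    have hswap : ∫ τ in (0 : ℝ)..t, (𝓕⁻ (toL2C (F τ)) : L2C)
        = 𝓕⁻ (toL2C fun ξ => duh γ (fun τ => conv (f τ) (f τ)) t ξ) := by
      have e1 : (∫ τ in (0 : ℝ)..t, (𝓕⁻ (toL2C (F τ)) : L2C))
          = 𝓕⁻ (∫ τ in (0 : ℝ)..t, toL2C (F τ)) :=
        (Lp.fourierTransformₗᵢ ℝ ℂ).symm.toContinuousLinearEquiv.toContinuousLinearMap
          |>.intervalIntegral_comp_comm (ContinuousOn.intervalIntegrable_of_Icc ht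
            (continuousOn_toL2C hD (fun τ _ =>
              (hFc.comp (f := fun ξ : ℝ => (τ, ξ)) (by fun_prop)).aestronglyMeasurable) hFb
              fun ξ => (hFc.comp (f := fun τ : ℝ => (τ, ξ)) (by fun_prop)).continuousOn))
      rw [e1, integral_toL2C ht hD hFc hFb]
      rfl
    have hm1 : MemLp (fun ξ => asym γ t ξ * f₀ ξ) 2 volume := by
      have : MemLp f₀ 2 volume := memLp_of_weight hf₀c.aestronglyMeasurable hw
      refine this.of_le (((continuous_asym γ).comp (f := fun ξ : ℝ => (t, ξ))
        (by fun_prop)).mul hf₀c).aestronglyMeasurable (Eventually.of_forall fun ξ => ?_)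
      rw [norm_mul]
      exact mul_le_of_le_one_left (norm_nonneg _) (norm_asym_le_one ht γ ξ)
    have hm2 : MemLp (fun ξ => ((β / 2 : ℝ) : ℂ) * duh γ (fun τ => conv (f τ) (f τ)) t ξ) 2
        volume := by
      have := hm1.sub (hf2 t)
      refine (memLp_congr_ae (Eventually.of_forall fun ξ => ?_)).1 this
      simp only [Pi.sub_apply]
      rw [hf.eq t ht ξ]
      ring
    have hβm : ∀ {G : ℝ → ℂ}, MemLp (fun ξ => ((β / 2 : ℝ) : ℂ) * G ξ) 2 volume →
        toL2C (fun ξ => ((β / 2 : ℝ) : ℂ) * G ξ) = ((β / 2 : ℝ) : ℂ) • toL2C G := by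
      intro G hG
      by_cases hβ : ((β / 2 : ℝ) : ℂ) = 0
      · rw [hβ, zero_smul]
        have : (fun ξ => (0 : ℂ) * G ξ) = fun _ => (0 : ℂ) * 0 := by ext ξ; simp
        rw [this, toL2C_const_mul (f := fun _ => 0) 0 MemLp.zero', zero_smul]
      · have : MemLp G 2 volume := by
          have := hG.const_mul (((β / 2 : ℝ) : ℂ)⁻¹)
          refine (memLp_congr_ae (Eventually.of_forall fun ξ => ?_)).1 this
          rw [← mul_assoc, inv_mul_cancel₀ hβ, one_mul]
        exact toL2C_const_mul _ this
    have hconvT : convT γ t (cplx u₀) = 𝓕⁻ (toL2C fun ξ => asym γ t ξ * f₀ ξ) := by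
      unfold convT multiplier
      congr 1
      refine toL2C_congr ?_
      filter_upwards [fourier_cplx_ae hi h2] with ξ hξ
      rw [hξ, h0]
      rfl
    rw [hint, hswap, huc, hconvT]
    have e3 : toL2C (f t) = toL2C (fun ξ => asym γ t ξ * f₀ ξ)
        - ((β / 2 : ℝ) : ℂ) • toL2C fun ξ => duh γ (fun τ => conv (f τ) (f τ)) t ξ := by
      rw [← hβm hm2, ← toL2C_sub hm1 hm2]
      exact toL2C_congr (Eventually.of_forall fun ξ => hf.eq t ht ξ)
    rw [e3]
    have := (Lp.fourierTransformₗᵢ ℝ ℂ).symm.map_sub (toL2C fun ξ => asym γ t ξ * f₀ ξ)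
      (((β / 2 : ℝ) : ℂ) • toL2C fun ξ => duh γ (fun τ => conv (f τ) (f τ)) t ξ)
    refine this.trans ?_
    rw [(Lp.fourierTransformₗᵢ ℝ ℂ).symm.map_smul]
    rfl

end Existence

/-! ### The initial data -/

section Data

variable {u₀ : ℝ → ℝ} {δ : ℝ}

lemma integrable_of_eLpNorm (hu : Continuous u₀) (h : eLpNorm u₀ 1 volume ≤ ENNReal.ofReal δ) :
    Integrable u₀ volume :=
  memLp_one_iff_integrable.1 ⟨hu.aestronglyMeasurable, h.trans_lt ENNReal.ofReal_lt_top⟩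

lemma norm_fourier_le_of_eLpNorm (hu : Continuous u₀) (hδ : 0 ≤ δ)
    (h : eLpNorm u₀ 1 volume ≤ ENNReal.ofReal δ) (ξ : ℝ) : ‖𝓕 (fun x => (u₀ x : ℂ)) ξ‖ ≤ δ := by
  refine (norm_fourier_le ξ).trans ?_
  have e : ∫ x, ‖(u₀ x : ℂ)‖ = ∫ x, ‖u₀ x‖ := by simp
  rw [e, integral_norm_eq_lintegral_enorm hu.aestronglyMeasurable,
    ← eLpNorm_one_eq_lintegral_enorm]
  exact ENNReal.toReal_le_of_le_ofReal hδ h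

lemma l2Bd_weight_fourier {s : ℕ} (hi : Integrable u₀ volume) (h2 : MemH s u₀)
    (h : sobolevNorm s u₀ ≤ ENNReal.ofReal δ) :
    L2Bd (fun ξ => ((wt 0 ξ ^ s : ℝ) : ℂ) * 𝓕 (fun x => (u₀ x : ℂ)) ξ) (2 ^ (s + 1) * δ) := by
  have e : (fun ξ : ℝ => (((1 + |ξ|) ^ s : ℝ) : ℂ) * (𝓕 (cplx u₀) : L2C) ξ)
      =ᵐ[volume] fun ξ => ((wt 0 ξ ^ s : ℝ) : ℂ) * 𝓕 (fun x => (u₀ x : ℂ)) ξ := by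
    filter_upwards [fourier_cplx_ae hi h2.1] with ξ hξ
    rw [hξ, wt_zero]
  refine ⟨h2.memLp_weight.1.congr e, ?_⟩
  rw [← eLpNorm_congr_ae e, ENNReal.ofReal_mul (by positivity)]
  exact (eLpNorm_weight_fourier_le h2).trans (by gcongr)

end Data

/-! ### The profile of the nonlinear diffusion wave -/

/-- The tail `∫_z^∞ exp(-y²) dy` of the Gaussian integral. -/
def gaussTail (z : ℝ) : ℝ := ∫ y in Set.Ioi z, Real.exp (-y ^ 2)

lemma integrable_exp_neg_sq : Integrable (fun y : ℝ => Real.exp (-y ^ 2)) volume := by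
  simpa using integrable_exp_neg_mul_sq (b := 1) one_pos

lemma integral_exp_neg_sq : ∫ y : ℝ, Real.exp (-y ^ 2) = √Real.pi := by
  simpa using integral_gaussian 1

lemma gaussTail_eq (z : ℝ) :
    gaussTail z = gaussTail 0 - ∫ y in (0 : ℝ)..z, Real.exp (-y ^ 2) := by
  unfold gaussTail
  rw [← intervalIntegral.integral_interval_add_Ioi (a := 0) (b := z)
    integrable_exp_neg_sq.integrableOn integrable_exp_neg_sq.integrableOn]
  ring

lemma gaussTail_nonneg (z : ℝ) : 0 ≤ gaussTail z :=
  integral_nonneg fun _ => (Real.exp_pos _).le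

lemma gaussTail_le (z : ℝ) : gaussTail z ≤ √Real.pi := by
  rw [← integral_exp_neg_sq]
  exact setIntegral_le_integral integrable_exp_neg_sq
    (Eventually.of_forall fun _ => (Real.exp_pos _).le)

lemma hasDerivAt_gaussTail (z : ℝ) : HasDerivAt gaussTail (-Real.exp (-z ^ 2)) z := by
  have hc : Continuous fun y : ℝ => Real.exp (-y ^ 2) := by fun_prop
  have h := intervalIntegral.integral_hasDerivAt_right (hc.intervalIntegrable 0 z)
    hc.stronglyMeasurable.stronglyMeasurableAtFilter hc.continuousAt
  have h2 := h.const_sub (gaussTail 0)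
  exact h2.congr_of_eventuallyEq (Eventually.of_forall gaussTail_eq)

lemma tendsto_gaussTail_atTop : Tendsto gaussTail atTop (𝓝 0) := by
  have h := intervalIntegral_tendsto_integral_Ioi (0 : ℝ)
    integrable_exp_neg_sq.integrableOn tendsto_id
  have h2 := h.const_sub (gaussTail 0)
  have e : gaussTail 0 - ∫ x in Set.Ioi (0 : ℝ), Real.exp (-x ^ 2) = 0 := sub_self _
  rw [e] at h2
  exact h2.congr fun z => (gaussTail_eq z).symm

lemma tendsto_gaussTail_atBot : Tendsto gaussTail atBot (𝓝 √Real.pi) := by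
  have h := intervalIntegral_tendsto_integral_Iic (0 : ℝ)
    integrable_exp_neg_sq.integrableOn tendsto_id
  have h2 := h.const_add (gaussTail 0)
  have e : gaussTail 0 + ∫ x in Set.Iic (0 : ℝ), Real.exp (-x ^ 2) = √Real.pi := by
    rw [← integral_exp_neg_sq, add_comm, gaussTail,
      intervalIntegral.integral_Iic_add_Ioi integrable_exp_neg_sq.integrableOn
        integrable_exp_neg_sq.integrableOn]
  rw [e] at h2
  refine h2.congr fun z => ?_
  rw [gaussTail_eq z, intervalIntegral.integral_symm, id]
  ring

/-- The Hopf–Cole variable of the nonlinear diffusion wave: `χ_* = -(2/β) (log hopfCole)'`. -/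
def hopfCole (β M z : ℝ) : ℝ := √Real.pi + (Real.exp (β * M / 2) - 1) * gaussTail (z / 2)

/-- The derivative of `hopfCole`. -/
def hopfCole' (β M z : ℝ) : ℝ := -((Real.exp (β * M / 2) - 1) / 2) * Real.exp (-z ^ 2 / 4)

lemma hasDerivAt_hopfCole (β M z : ℝ) : HasDerivAt (hopfCole β M) (hopfCole' β M z) z := by
  have h1 : HasDerivAt (fun z : ℝ => z / 2) (1 / 2) z := (hasDerivAt_id z).div_const 2
  have h2 := (hasDerivAt_gaussTail (z / 2)).comp z h1
  have h3 := (h2.const_mul (Real.exp (β * M / 2) - 1)).const_add √Real.pi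
  refine h3.congr_deriv ?_
  unfold hopfCole'
  rw [show -(z / 2) ^ 2 = -z ^ 2 / 4 by ring]
  ring

lemma hasDerivAt_hopfCole' (β M z : ℝ) :
    HasDerivAt (hopfCole' β M) (-(z / 2) * hopfCole' β M z) z := by
  have h1 : HasDerivAt (fun z : ℝ => -z ^ 2 / 4) (-(z / 2)) z := by
    refine (((hasDerivAt_pow 2 z).neg).div_const 4).congr_deriv ?_
    simp
    ring
  refine (h1.exp.const_mul (-((Real.exp (β * M / 2) - 1) / 2))).congr_deriv ?_
  unfold hopfCole'
  ring

lemma exp_sub_one_bounds {β M : ℝ} (h : |β * M| ≤ 2) :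
    |Real.exp (β * M / 2) - 1| ≤ |β * M| ∧ 1 / 3 ≤ Real.exp (β * M / 2) := by
  have h1 : |β * M / 2| ≤ 1 := by rw [abs_div, abs_two]; linarith
  refine ⟨(Real.abs_exp_sub_one_le h1).trans_eq (by rw [abs_div, abs_two]; ring), ?_⟩
  have h2 : Real.exp (-1) ≤ Real.exp (β * M / 2) := Real.exp_le_exp.2 (abs_le.1 h1).1
  have h3 : 1 / 3 ≤ Real.exp (-1) := by
    rw [Real.exp_neg, ← one_div]
    exact one_div_le_one_div_of_le (Real.exp_pos 1) (by linarith [Real.exp_one_lt_d9])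
  linarith

lemma one_le_sqrt_pi : 1 ≤ √Real.pi := by
  rw [Real.one_le_sqrt]
  linarith [Real.pi_gt_three]

lemma sqrt_pi_le_two : √Real.pi ≤ 2 := by
  rw [Real.sqrt_le_left (by norm_num)]
  linarith [Real.pi_le_four]

lemma hopfCole_ge {β M : ℝ} (h : |β * M| ≤ 2) (z : ℝ) : 1 / 3 ≤ hopfCole β M z := by
  have h1 := (exp_sub_one_bounds h).2
  have h2 := gaussTail_nonneg (z / 2)
  have h3 := gaussTail_le (z / 2)
  have h4 := one_le_sqrt_pi
  unfold hopfCole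
  by_cases hE : 1 ≤ Real.exp (β * M / 2)
  · nlinarith
  · push Not at hE
    nlinarith

lemma hopfCole_le {β M : ℝ} (h : |β * M| ≤ 2) (z : ℝ) : hopfCole β M z ≤ 6 := by
  have h1 := (exp_sub_one_bounds h).1
  have h2 := gaussTail_nonneg (z / 2)
  have h3 := gaussTail_le (z / 2)
  have h4 := sqrt_pi_le_two
  have h5 := le_abs_self (Real.exp (β * M / 2) - 1)
  have h6 : (Real.exp (β * M / 2) - 1) * gaussTail (z / 2) ≤ 2 * 2 := by
    calc _ ≤ 2 * gaussTail (z / 2) := by gcongr; linarith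
      _ ≤ 2 * 2 := by gcongr; linarith
  unfold hopfCole
  linarith

lemma abs_hopfCole'_le {β M : ℝ} (h : |β * M| ≤ 2) (z : ℝ) :
    |hopfCole' β M z| ≤ |β * M| / 2 * Real.exp (-z ^ 2 / 4) := by
  have h1 := (exp_sub_one_bounds h).1
  unfold hopfCole'
  rw [abs_mul, abs_neg, abs_div, abs_two, abs_of_pos (Real.exp_pos _)]
  gcongr

lemma chiStar_eq (β M z : ℝ) :
    chiStar β M z = -(2 / β) * (hopfCole' β M z / hopfCole β M z) := by
  unfold chiStar hopfCole hopfCole' gaussTail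
  ring

/-- The profile equation `χ_*' = -(z/2) χ_* + (β/2) χ_*²`. -/
lemma hasDerivAt_chiStar {β M : ℝ} (hβ : β ≠ 0) (h : |β * M| ≤ 2) (z : ℝ) :
    HasDerivAt (chiStar β M) (-(z / 2) * chiStar β M z + β / 2 * chiStar β M z ^ 2) z := by
  have hD : hopfCole β M z ≠ 0 := (by linarith [hopfCole_ge h z] : 0 < hopfCole β M z).ne'
  have h1 := ((hasDerivAt_hopfCole' β M z).div (hasDerivAt_hopfCole β M z) hD).const_mul (-(2 / β))
  rw [show chiStar β M = fun z => -(2 / β) * (hopfCole' β M z / hopfCole β M z) from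
    funext (chiStar_eq β M)]
  refine h1.congr_deriv ?_
  field_simp
  ring

lemma abs_chiStar_le {β M : ℝ} (hβ : β ≠ 0) (h : |β * M| ≤ 2) (z : ℝ) :
    |chiStar β M z| ≤ 3 * |M| * Real.exp (-z ^ 2 / 4) := by
  have h1 := abs_hopfCole'_le h z
  have h2 := hopfCole_ge h z
  have hb : 0 < |β| := abs_pos.2 hβ
  rw [chiStar_eq, abs_mul, abs_neg, abs_div, abs_two, abs_div,
    abs_of_pos (by linarith : 0 < hopfCole β M z)]
  calc 2 / |β| * (|hopfCole' β M z| / hopfCole β M z)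
      ≤ 2 / |β| * ((|β * M| / 2 * Real.exp (-z ^ 2 / 4)) / (1 / 3)) := by gcongr
    _ = _ := by rw [abs_mul]; field_simp

/-- The functions of `M` and `z` spanned by the products `zⁱ χ_*ʲ⁺¹`. This class is closed under
differentiation in `z`. -/
inductive ChiSpan (β : ℝ) : (ℝ → ℝ → ℝ) → Prop
  | monomial (i j : ℕ) : ChiSpan β fun M z => z ^ i * chiStar β M z ^ (j + 1)
  | add {g h : ℝ → ℝ → ℝ} : ChiSpan β g → ChiSpan β h → ChiSpan β fun M z => g M z + h M z
  | mul (c : ℝ) {g : ℝ → ℝ → ℝ} : ChiSpan β g → ChiSpan β fun M z => c * g M z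

lemma ChiSpan.exists_deriv {β : ℝ} (hβ : β ≠ 0) {g : ℝ → ℝ → ℝ} (hg : ChiSpan β g) :
    ∃ g', ChiSpan β g' ∧ ∀ M, |β * M| ≤ 2 → ∀ z, HasDerivAt (g M) (g' M z) z := by
  induction hg with
  | monomial i j =>
    refine ⟨_, ((monomial (i - 1) j).mul i).add
      (((monomial (i + 1) j).mul (-((j + 1 : ℝ) / 2))).add
        ((monomial i (j + 1)).mul ((j + 1 : ℝ) * (β / 2)))), fun M hM z => ?_⟩
    refine ((hasDerivAt_pow i z).mul ((hasDerivAt_chiStar hβ hM z).pow (j + 1))).congr_deriv ?_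
    simp only [Pi.pow_apply, Nat.add_sub_cancel]
    push_cast
    ring
  | add _ _ h1 h2 =>
    obtain ⟨g', hg', hd⟩ := h1
    obtain ⟨k', hk', hd'⟩ := h2
    exact ⟨_, hg'.add hk', fun M hM z => (hd M hM z).add (hd' M hM z)⟩
  | mul c _ h1 =>
    obtain ⟨g', hg', hd⟩ := h1
    exact ⟨_, hg'.mul c, fun M hM z => (hd M hM z).const_mul c⟩

lemma abs_pow_mul_exp_le (i : ℕ) (z : ℝ) :
    |z| ^ i * Real.exp (-z ^ 2 / 4) ≤ 1 + 4 ^ i * i.factorial := by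
  have h0 : 0 ≤ z ^ 2 / 4 := by positivity
  have h1 := Real.pow_div_factorial_le_exp _ h0 i
  have hf : (0 : ℝ) < i.factorial := by exact_mod_cast i.factorial_pos
  rw [div_le_iff₀ hf, div_pow, div_le_iff₀ (by positivity)] at h1
  have h2 : |z| ^ i ≤ 1 + (z ^ 2) ^ i := by
    have e : (z ^ 2) ^ i = (|z| ^ i) ^ 2 := by rw [← sq_abs, ← pow_mul, ← pow_mul, mul_comm]
    rw [e]
    nlinarith [sq_nonneg (|z| ^ i - 1), pow_nonneg (abs_nonneg z) i]
  have h3 : Real.exp (-z ^ 2 / 4) * Real.exp (z ^ 2 / 4) = 1 := by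
    rw [← Real.exp_add, neg_div, neg_add_cancel, Real.exp_zero]
  have h4 : Real.exp (-z ^ 2 / 4) ≤ 1 := Real.exp_le_one_iff.2 (by linarith [h0, neg_div 4 (z ^ 2)])
  have h5 := Real.exp_pos (-z ^ 2 / 4)
  calc |z| ^ i * Real.exp (-z ^ 2 / 4)
      ≤ (1 + Real.exp (z ^ 2 / 4) * i.factorial * 4 ^ i) * Real.exp (-z ^ 2 / 4) := by
        gcongr; linarith
    _ = Real.exp (-z ^ 2 / 4) + (Real.exp (-z ^ 2 / 4) * Real.exp (z ^ 2 / 4))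
        * (4 ^ i * i.factorial) := by ring
    _ ≤ _ := by rw [h3, one_mul]; linarith

lemma ChiSpan.exists_bound {β : ℝ} (hβ : β ≠ 0) {g : ℝ → ℝ → ℝ} (hg : ChiSpan β g) :
    ∃ C, 0 ≤ C ∧ ∀ M, |β * M| ≤ 2 → |M| ≤ 1 → ∀ z, |g M z| ≤ C * |M| * (1 + z ^ 2)⁻¹ := by
  induction hg with
  | monomial i j =>
    refine ⟨((1 + 4 ^ i * i.factorial) + (1 + 4 ^ (i + 2) * (i + 2).factorial)) * 3 ^ (j + 1),
      by positivity, fun M hM h1 z => ?_⟩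
    have hz : 0 < 1 + z ^ 2 := by positivity
    have ha := abs_pow_mul_exp_le i z
    have hb := abs_pow_mul_exp_le (i + 2) z
    set E := Real.exp (-z ^ 2 / 4) with hE
    have hE0 : 0 < E := Real.exp_pos _
    have hE1 : E ≤ 1 := Real.exp_le_one_iff.2 (by nlinarith [sq_nonneg z])
    rw [← div_eq_mul_inv, le_div_iff₀ hz, abs_mul, abs_pow, abs_pow]
    have hM0 := abs_nonneg M
    have hc : |chiStar β M z| ^ (j + 1) ≤ 3 ^ (j + 1) * |M| * E := by
      calc |chiStar β M z| ^ (j + 1) ≤ (3 * |M| * E) ^ (j + 1) := by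
            gcongr; exact abs_chiStar_le hβ hM z
        _ = 3 ^ (j + 1) * (|M| ^ (j + 1)) * (E ^ (j + 1)) := by rw [mul_pow, mul_pow]
        _ ≤ 3 ^ (j + 1) * |M| * E := by
            gcongr
            · exact pow_le_of_le_one hM0 h1 (Nat.succ_ne_zero j)
            · exact pow_le_of_le_one hE0.le hE1 (Nat.succ_ne_zero j)
    calc |z| ^ i * |chiStar β M z| ^ (j + 1) * (1 + z ^ 2)
        ≤ |z| ^ i * (3 ^ (j + 1) * |M| * E) * (1 + z ^ 2) := by gcongr
      _ = (|z| ^ i * E + |z| ^ (i + 2) * E) * 3 ^ (j + 1) * |M| := by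
          rw [pow_add |z| i 2, sq_abs]; ring
      _ ≤ _ := by gcongr
  | add _ _ h1 h2 =>
    obtain ⟨C, hC, h⟩ := h1
    obtain ⟨C', hC', h'⟩ := h2
    refine ⟨C + C', by positivity, fun M hM hM1 z => (abs_add_le _ _).trans ?_⟩
    linarith [h M hM hM1 z, h' M hM hM1 z]
  | mul c _ h1 =>
    obtain ⟨C, hC, h⟩ := h1
    refine ⟨|c| * C, by positivity, fun M hM hM1 z => ?_⟩
    rw [abs_mul, mul_assoc, mul_assoc, ← mul_assoc C]
    exact mul_le_mul_of_nonneg_left (h M hM hM1 z) (abs_nonneg c)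

lemma ChiSpan.integrable {β : ℝ} (hβ : β ≠ 0) {g : ℝ → ℝ → ℝ} (hg : ChiSpan β g) {M : ℝ}
    (hM : |β * M| ≤ 2) (h1 : |M| ≤ 1) : Integrable (fun z => (g M z : ℂ)) volume := by
  obtain ⟨C, hC, hb⟩ := hg.exists_bound hβ
  obtain ⟨g', -, hd⟩ := hg.exists_deriv hβ
  have hc : Continuous (g M) := continuous_iff_continuousAt.2 fun z => (hd M hM z).continuousAt
  refine (integrable_inv_one_add_sq.const_mul (C * |M|)).mono'
    (Complex.continuous_ofReal.comp hc).aestronglyMeasurable (Eventually.of_forall fun z => ?_)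
  rw [Complex.norm_real]
  exact hb M hM h1 z

lemma ChiSpan.exists_fourier_bound {β : ℝ} (hβ : β ≠ 0) {g : ℝ → ℝ → ℝ} (hg : ChiSpan β g)
    (n : ℕ) : ∃ C, 0 ≤ C ∧ ∀ M, |β * M| ≤ 2 → |M| ≤ 1 → ∀ ξ : ℝ,
      |ξ| ^ n * ‖𝓕 (fun z => (g M z : ℂ)) ξ‖ ≤ C * |M| := by
  induction n generalizing g with
  | zero =>
    obtain ⟨C, hC, hb⟩ := hg.exists_bound hβ
    refine ⟨C * Real.pi, by positivity, fun M hM h1 ξ => ?_⟩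
    rw [pow_zero, one_mul]
    refine (norm_fourier_le ξ).trans ?_
    calc ∫ z, ‖(g M z : ℂ)‖ ≤ ∫ z, C * |M| * (1 + z ^ 2)⁻¹ :=
          integral_mono (hg.integrable hβ hM h1).norm
            (integrable_inv_one_add_sq.const_mul (C * |M|)) fun z => by
              simp only [Complex.norm_real]; exact hb M hM h1 z
      _ = _ := by
          rw [integral_const_mul, integral_univ_inv_one_add_sq]; ring
  | succ n ih =>
    obtain ⟨g', hg', hd⟩ := hg.exists_deriv hβ
    obtain ⟨C, hC, h⟩ := ih hg'
    refine ⟨C, hC, fun M hM h1 ξ => ?_⟩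
    have hdc : ∀ z, HasDerivAt (fun z => (g M z : ℂ)) (g' M z : ℂ) z := fun z =>
      (hd M hM z).ofReal_comp
    have hder : deriv (fun z => (g M z : ℂ)) = fun z => (g' M z : ℂ) := funext fun z => (hdc z).deriv
    have e := Real.fourier_deriv (hg.integrable hβ hM h1) (fun z => (hdc z).differentiableAt)
      (by rw [hder]; exact hg'.integrable hβ hM h1)
    rw [hder] at e
    have h2 := h M hM h1 ξ
    rw [e] at h2
    simp only [smul_eq_mul, norm_mul, Complex.norm_ofNat, Complex.norm_real, Complex.norm_I,
      Real.norm_eq_abs, abs_of_pos Real.pi_pos] at h2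
    refine le_trans ?_ h2
    have hpi : 1 ≤ 2 * Real.pi := by linarith [Real.pi_gt_three]
    calc |ξ| ^ (n + 1) * ‖𝓕 (fun z => (g M z : ℂ)) ξ‖
        = 1 * (|ξ| ^ (n + 1) * ‖𝓕 (fun z => (g M z : ℂ)) ξ‖) := (one_mul _).symm
      _ ≤ (2 * Real.pi) * (|ξ| ^ (n + 1) * ‖𝓕 (fun z => (g M z : ℂ)) ξ‖) := by gcongr
      _ = _ := by ring

lemma chiSpan_chiStar (β : ℝ) : ChiSpan β (chiStar β) := by
  simpa using ChiSpan.monomial (β := β) 0 0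

/-- The Fourier transform of the profile. -/
def chiFT (β M : ℝ) : ℝ → ℂ := 𝓕 fun z => (chiStar β M z : ℂ)

lemma exists_norm_chiFT_le {β : ℝ} (hβ : β ≠ 0) (N : ℕ) : ∃ C, 0 ≤ C ∧ ∀ M, |β * M| ≤ 2 →
    |M| ≤ 1 → ∀ ξ : ℝ, ‖chiFT β M ξ‖ ≤ C * |M| / (1 + |ξ|) ^ N := by
  obtain ⟨C₀, h0, hb0⟩ := (chiSpan_chiStar β).exists_fourier_bound hβ 0
  obtain ⟨C₁, h1, hb1⟩ := (chiSpan_chiStar β).exists_fourier_bound hβ N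
  refine ⟨2 ^ N * (C₀ + C₁), by positivity, fun M hM hM1 ξ => ?_⟩
  have hξ := abs_nonneg ξ
  rw [le_div_iff₀ (by positivity)]
  have e0 := hb0 M hM hM1 ξ
  have e1 := hb1 M hM hM1 ξ
  rw [pow_zero, one_mul] at e0
  have e2 : (1 + |ξ|) ^ N ≤ 2 ^ N * (1 + |ξ| ^ N) := by
    have h3 : 1 + |ξ| ≤ 2 * max 1 |ξ| := by
      have := le_max_left 1 |ξ|
      have := le_max_right 1 |ξ|
      linarith
    calc (1 + |ξ|) ^ N ≤ (2 * max 1 |ξ|) ^ N := by gcongr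
      _ = 2 ^ N * (max 1 |ξ|) ^ N := mul_pow _ _ _
      _ ≤ 2 ^ N * (1 + |ξ| ^ N) := by
          gcongr
          rcases max_choice 1 |ξ| with h | h <;> rw [h]
          · rw [one_pow]; linarith [pow_nonneg hξ N]
          · linarith
  calc ‖chiFT β M ξ‖ * (1 + |ξ|) ^ N ≤ ‖chiFT β M ξ‖ * (2 ^ N * (1 + |ξ| ^ N)) := by gcongr
    _ = 2 ^ N * (‖chiFT β M ξ‖ + |ξ| ^ N * ‖chiFT β M ξ‖) := by ring
    _ ≤ 2 ^ N * (C₀ * |M| + C₁ * |M|) := mul_le_mul_of_nonneg_left (add_le_add e0 e1) (by positivity)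
    _ = _ := by ring

section chiFT

variable {β M : ℝ}

lemma continuous_chiStar (hβ : β ≠ 0) (h : |β * M| ≤ 2) : Continuous (chiStar β M) :=
  continuous_iff_continuousAt.2 fun z => (hasDerivAt_chiStar hβ h z).continuousAt

lemma integrable_chiStar (hβ : β ≠ 0) (h : |β * M| ≤ 2) (h1 : |M| ≤ 1) :
    Integrable (fun z => (chiStar β M z : ℂ)) volume :=
  (chiSpan_chiStar β).integrable hβ h h1

lemma continuous_chiFT (hβ : β ≠ 0) (h : |β * M| ≤ 2) (h1 : |M| ≤ 1) : Continuous (chiFT β M) :=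
  continuous_fourier (integrable_chiStar hβ h h1)

lemma integrable_chiFT (hβ : β ≠ 0) (h : |β * M| ≤ 2) (h1 : |M| ≤ 1) :
    Integrable (chiFT β M) volume := by
  obtain ⟨C, hC, hb⟩ := exists_norm_chiFT_le hβ 2
  refine (integrable_inv_one_add_abs_sq.const_mul (C * |M|)).mono'
    (continuous_chiFT hβ h h1).aestronglyMeasurable (Eventually.of_forall fun ξ => ?_)
  rw [← div_eq_mul_inv]
  exact hb M h h1 ξ

lemma fourierInv_chiFT (hβ : β ≠ 0) (h : |β * M| ≤ 2) (h1 : |M| ≤ 1) :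
    𝓕⁻ (chiFT β M) = fun z => (chiStar β M z : ℂ) :=
  Continuous.fourierInv_fourier_eq (Complex.continuous_ofReal.comp (continuous_chiStar hβ h))
    (integrable_chiStar hβ h h1) (integrable_chiFT hβ h h1)

/-- The total mass of the profile is `M`. -/
lemma integral_chiStar (hβ : β ≠ 0) (h : |β * M| ≤ 2) (h1 : |M| ≤ 1) :
    ∫ z, chiStar β M z = M := by
  have hpos : ∀ z, 0 < hopfCole β M z := fun z => by linarith [hopfCole_ge h z]
  have hd : ∀ z, HasDerivAt (fun z => -(2 / β) * Real.log (hopfCole β M z)) (chiStar β M z) z := by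
    intro z
    rw [chiStar_eq]
    exact ((hasDerivAt_hopfCole β M z).log (hpos z).ne').const_mul _
  have hhalf : Tendsto (fun z : ℝ => z / 2) atTop atTop := tendsto_id.atTop_div_const (by norm_num)
  have hhalf' : Tendsto (fun z : ℝ => z / 2) atBot atBot := tendsto_id.atBot_div_const (by norm_num)
  have hpi : 0 < √Real.pi := by linarith [one_le_sqrt_pi]
  have htop : Tendsto (hopfCole β M) atTop (𝓝 √Real.pi) := by
    have := ((tendsto_gaussTail_atTop.comp hhalf).const_mul (Real.exp (β * M / 2) - 1)).const_add
      √Real.pi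
    rw [mul_zero, add_zero] at this
    exact this
  have hbot : Tendsto (hopfCole β M) atBot (𝓝 (√Real.pi * Real.exp (β * M / 2))) := by
    have := ((tendsto_gaussTail_atBot.comp hhalf').const_mul (Real.exp (β * M / 2) - 1)).const_add
      √Real.pi
    have e : √Real.pi + (Real.exp (β * M / 2) - 1) * √Real.pi
      = √Real.pi * Real.exp (β * M / 2) := by ring
    rw [e] at this
    exact this
  have hi : Integrable (chiStar β M) volume := by
    have := (integrable_chiStar hβ h h1).re
    simpa using this
  have := integral_of_hasDerivAt_of_tendsto hd hi
    ((hbot.log (by positivity)).const_mul (-(2 / β))) ((htop.log hpi.ne').const_mul (-(2 / β)))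
  rw [this, Real.log_mul hpi.ne' (Real.exp_pos _).ne', Real.log_exp]
  field_simp
  ring

lemma chiFT_zero (hβ : β ≠ 0) (h : |β * M| ≤ 2) (h1 : |M| ≤ 1) : chiFT β M 0 = M := by
  unfold chiFT
  rw [Real.fourier_eq]
  simp only [inner_zero_right, neg_zero, AddChar.map_zero_eq_one, one_smul]
  exact (integral_complex_ofReal (f := chiStar β M)).trans (by rw [integral_chiStar hβ h h1])

/-- The profile equation on the Fourier side. -/
lemma hasDerivAt_chiFT (hβ : β ≠ 0) (h : |β * M| ≤ 2) (h1 : |M| ≤ 1) (ξ : ℝ) :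
    HasDerivAt (chiFT β M) (-(8 * Real.pi ^ 2 * ξ) * chiFT β M ξ
      - 2 * Real.pi * Complex.I * β * conv (chiFT β M) (chiFT β M) ξ) ξ := by
  have hi := integrable_chiStar hβ h h1
  have hX := integrable_chiFT hβ h h1
  have hXc := continuous_chiFT hβ h h1
  have hs : ChiSpan β fun M z => chiStar β M z ^ 2 := by
    simpa using ChiSpan.monomial (β := β) 0 1
  have hz : ChiSpan β fun M z => z * chiStar β M z := by
    simpa using ChiSpan.monomial (β := β) 1 0
  have hsi := hs.integrable hβ h h1
  have hzi := hz.integrable hβ h h1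
  have hd : ∀ z, HasDerivAt (fun z => (chiStar β M z : ℂ))
      ((-(z / 2) * chiStar β M z + β / 2 * chiStar β M z ^ 2 : ℝ) : ℂ) z := fun z =>
    (hasDerivAt_chiStar hβ h z).ofReal_comp
  have hder : deriv (fun z => (chiStar β M z : ℂ))
      = fun z => ((-(z / 2) * chiStar β M z + β / 2 * chiStar β M z ^ 2 : ℝ) : ℂ) :=
    funext fun z => (hd z).deriv
  have hderi : Integrable (deriv fun z => (chiStar β M z : ℂ)) volume := by
    rw [hder]
    refine ((hzi.const_mul (-(1 / 2))).add (hsi.const_mul (β / 2 : ℂ))).congr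
      (Eventually.of_forall fun z => ?_)
    simp only [Pi.add_apply]
    push_cast
    ring
  have e1 := congrFun (Real.fourier_deriv hi (fun z => (hd z).differentiableAt) hderi) ξ
  simp only [smul_eq_mul] at e1
  -- the square of the profile is the inverse Fourier transform of the convolution
  have e2 : 𝓕 (fun z => ((chiStar β M z ^ 2 : ℝ) : ℂ)) ξ = conv (chiFT β M) (chiFT β M) ξ := by
    have hci := integrable_conv hX hX
    have hcc : Continuous (conv (chiFT β M) (chiFT β M)) := by
      obtain ⟨C, hC, hb⟩ := exists_norm_chiFT_le hβ 0
      have := BBMBurgers.continuous_conv (X := Unit) (f := fun _ => chiFT β M)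
        (g := fun _ => chiFT β M) (hXc.comp continuous_snd) (hXc.comp continuous_snd) hX.norm
        (fun _ _ => le_rfl) (M := C * |M|) (fun _ η => by simpa using hb M h h1 η)
      exact this.comp (f := fun ξ : ℝ => ((), ξ)) (by fun_prop)
    have hsq : 𝓕⁻ (conv (chiFT β M) (chiFT β M)) = fun z => ((chiStar β M z ^ 2 : ℝ) : ℂ) := by
      ext z
      rw [fourierInv_conv hX hX, fourierInv_chiFT hβ h h1, Complex.ofReal_pow, sq]
    have hfi : Integrable (𝓕 (conv (chiFT β M) (chiFT β M))) volume := by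
      have : Integrable (𝓕⁻ (conv (chiFT β M) (chiFT β M))) volume := by rw [hsq]; exact hsi
      have h2 := this.comp_neg
      refine h2.congr (Eventually.of_forall fun z => ?_)
      simp only
      rw [Real.fourierInv_eq_fourier_neg, neg_neg]
    rw [← hsq, Continuous.fourier_fourierInv_eq hcc hci hfi]
  have e3 := Real.hasDerivAt_fourier hi (by
    refine hzi.congr (Eventually.of_forall fun z => ?_)
    simp) ξ
  refine e3.congr_deriv ?_
  have e4 : (fun z : ℝ => (-2 * Real.pi * Complex.I * z) • (chiStar β M z : ℂ))
      = fun z => (4 * Real.pi * Complex.I) * deriv (fun z => (chiStar β M z : ℂ)) z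
        - (2 * Real.pi * Complex.I * β) * ((chiStar β M z ^ 2 : ℝ) : ℂ) := by
    ext z
    rw [hder, smul_eq_mul]
    push_cast
    ring
  have e5 : 𝓕 (fun z => (4 * Real.pi * Complex.I) * deriv (fun z => (chiStar β M z : ℂ)) z
        - (2 * Real.pi * Complex.I * β) * ((chiStar β M z ^ 2 : ℝ) : ℂ)) ξ
      = (4 * Real.pi * Complex.I) * 𝓕 (deriv fun z => (chiStar β M z : ℂ)) ξ
        - (2 * Real.pi * Complex.I * β) * 𝓕 (fun z => ((chiStar β M z ^ 2 : ℝ) : ℂ)) ξ := by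
    simp only [Real.fourier_eq]
    rw [← integral_const_mul, ← integral_const_mul, ← integral_sub]
    · congr 1
      ext z
      simp only [Circle.smul_def, smul_eq_mul]
      ring
    · exact ((Real.fourierIntegral_convergent_iff ξ).2 hderi).const_mul _
    · exact ((Real.fourierIntegral_convergent_iff ξ).2 hsi).const_mul _
  rw [e4, e5, e1, e2]
  unfold chiFT
  linear_combination (8 * Real.pi ^ 2 * ξ * 𝓕 (fun z => (chiStar β M z : ℂ)) ξ) * Complex.I_sq

end chiFT

/-! ### The diffusion wave on the Fourier side -/

/-- The Fourier transform of the nonlinear diffusion wave at time `t`. -/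
def chiHat (β M t ξ : ℝ) : ℂ := chiFT β M (ξ * √(1 + t))

section chiHat

variable {β M : ℝ}

lemma continuous_chiHat (hβ : β ≠ 0) (h : |β * M| ≤ 2) (h1 : |M| ≤ 1) :
    Continuous fun p : ℝ × ℝ => chiHat β M p.1 p.2 :=
  (continuous_chiFT hβ h h1).comp (f := fun p : ℝ × ℝ => p.2 * √(1 + p.1)) (by fun_prop)

lemma continuous_chiHat_right (hβ : β ≠ 0) (h : |β * M| ≤ 2) (h1 : |M| ≤ 1) (t : ℝ) :
    Continuous (chiHat β M t) :=
  (continuous_chiHat hβ h h1).comp (f := fun ξ : ℝ => (t, ξ)) (by fun_prop)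

lemma exists_norm_chiHat_le (hβ : β ≠ 0) (N : ℕ) : ∃ C, 0 ≤ C ∧ ∀ M, |β * M| ≤ 2 →
    |M| ≤ 1 → ∀ t ξ : ℝ, ‖chiHat β M t ξ‖ ≤ C * |M| / wt t ξ ^ N := by
  obtain ⟨C, hC, hb⟩ := exists_norm_chiFT_le hβ N
  refine ⟨C, hC, fun M hM h1 t ξ => (hb M hM h1 _).trans_eq ?_⟩
  rw [abs_mul, abs_of_nonneg (Real.sqrt_nonneg _)]
  rfl

lemma l2Bd_of_le_wt {g : ℝ → ℂ} {N s : ℕ} (hN : s + 1 ≤ N) {t c : ℝ} (ht : 0 ≤ t) (hc : 0 ≤ c)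
    (hg : AEStronglyMeasurable g volume) (h : ∀ ξ, ‖g ξ‖ ≤ c / wt t ξ ^ N) :
    L2Bd (fun ξ => ((wt t ξ ^ s : ℝ) : ℂ) * g ξ) (2 * c * (1 + t) ^ (-(1 / 4) : ℝ)) := by
  refine (l2Bd_of_le_inv_wt (c := c) ht hc
    ((continuous_wt_pow t s).aestronglyMeasurable.mul hg) fun ξ => ?_).le (le_of_eq (by ring))
  have hw := wt_pos t ξ
  rw [Pi.mul_apply, norm_mul, norm_wt_pow]
  calc wt t ξ ^ s * ‖g ξ‖ ≤ wt t ξ ^ s * (c / wt t ξ ^ (s + 1)) := by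
        gcongr
        refine (h ξ).trans ?_
        have := pow_le_pow_right₀ (one_le_wt t ξ) hN
        gcongr
    _ = c / wt t ξ := by field_simp; ring

/-- The scaling of the Fourier transform. -/
lemma fourier_scale (g : ℝ → ℂ) {r : ℝ} (hr : 0 < r) (ξ : ℝ) :
    𝓕 (fun x => (1 / r : ℂ) * g (x / r)) ξ = 𝓕 g (ξ * r) := by
  rw [Real.fourier_eq, Real.fourier_eq]
  have h := Measure.integral_comp_div
    (fun y : ℝ => Real.fourierChar (-(inner ℝ y (ξ * r))) • g y) r
  rw [abs_of_pos hr] at h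
  have e : ∫ x, Real.fourierChar (-(inner ℝ x ξ)) • ((1 / r : ℂ) * g (x / r))
      = (1 / r : ℂ) * ∫ x, Real.fourierChar (-(inner ℝ (x / r) (ξ * r))) • g (x / r) := by
    rw [← integral_const_mul]
    congr 1
    ext x
    have : inner ℝ (x / r) (ξ * r) = inner ℝ x ξ := by
      simp only [RCLike.inner_apply, conj_trivial]
      field_simp
    rw [this, Circle.smul_def, Circle.smul_def, smul_eq_mul, smul_eq_mul]
    ring
  rw [e, h, Complex.real_smul, ← mul_assoc, one_div, inv_mul_cancel₀, one_mul]
  exact_mod_cast hr.ne'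

lemma fourier_chi {t : ℝ} (ht : 0 ≤ t) : 𝓕 (fun x => (chi β M t x : ℂ)) = chiHat β M t := by
  have hr : 0 < √(1 + t) := Real.sqrt_pos.2 (by linarith)
  ext ξ
  unfold chiHat chiFT
  rw [← fourier_scale _ hr]
  refine congrArg (fun g : ℝ → ℂ => 𝓕 g ξ) (funext fun x => ?_)
  unfold chi
  push_cast
  rfl

lemma continuous_chi (hβ : β ≠ 0) (h : |β * M| ≤ 2) (t : ℝ) : Continuous (chi β M t) := by
  unfold chi
  exact continuous_const.mul ((continuous_chiStar hβ h).comp (continuous_id.div_const _))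

lemma integrable_chi (hβ : β ≠ 0) (h : |β * M| ≤ 2) (h1 : |M| ≤ 1) {t : ℝ} (ht : 0 ≤ t) :
    Integrable (chi β M t) volume := by
  have hr : √(1 + t) ≠ 0 := (Real.sqrt_pos.2 (by linarith)).ne'
  have hi : Integrable (chiStar β M) volume := by simpa using (integrable_chiStar hβ h h1).re
  exact (hi.comp_div hr).const_mul _

lemma abs_chi_le (hβ : β ≠ 0) (h : |β * M| ≤ 2) {t : ℝ} (ht : 0 ≤ t) (x : ℝ) :
    |chi β M t x| ≤ 3 * |M| := by
  have hr : 1 ≤ √(1 + t) := Real.one_le_sqrt.2 (by linarith)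
  have h1 := abs_chiStar_le hβ h (x / √(1 + t))
  have h2 : Real.exp (-(x / √(1 + t)) ^ 2 / 4) ≤ 1 :=
    Real.exp_le_one_iff.2 (by nlinarith [sq_nonneg (x / √(1 + t))])
  unfold chi
  rw [abs_mul, abs_of_nonneg (by positivity)]
  calc 1 / √(1 + t) * |chiStar β M (x / √(1 + t))| ≤ 1 * (3 * |M| * 1) := by
        gcongr
        · rw [div_le_one (by linarith)]; exact hr
        · exact h1.trans (by gcongr)
    _ = _ := by ring

lemma memLp_chi (hβ : β ≠ 0) (h : |β * M| ≤ 2) (h1 : |M| ≤ 1) {t : ℝ} (ht : 0 ≤ t) :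
    MemLp (chi β M t) 2 volume := by
  have hi := integrable_chi hβ h h1 ht
  refine (memLp_two_iff_integrable_sq hi.1).2 ?_
  refine (hi.norm.const_mul (3 * |M|)).mono' (hi.1.pow 2) (Eventually.of_forall fun x => ?_)
  rw [norm_pow, sq]
  exact mul_le_mul_of_nonneg_right (abs_chi_le hβ h ht x) (norm_nonneg _)

lemma integrable_chiHat (hβ : β ≠ 0) (h : |β * M| ≤ 2) (h1 : |M| ≤ 1) {t : ℝ} (ht : 0 ≤ t) :
    Integrable (chiHat β M t) volume := by
  have hr : √(1 + t) ≠ 0 := (Real.sqrt_pos.2 (by linarith)).ne'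
  exact (integrable_chiFT hβ h h1).comp_mul_right' hr

lemma fourierInv_chiHat (hβ : β ≠ 0) (h : |β * M| ≤ 2) (h1 : |M| ≤ 1) {t : ℝ} (ht : 0 ≤ t) :
    𝓕⁻ (chiHat β M t) = fun x => (chi β M t x : ℂ) := by
  rw [← fourier_chi ht]
  refine Continuous.fourierInv_fourier_eq (Complex.continuous_ofReal.comp (continuous_chi hβ h t))
    (integrable_chi hβ h h1 ht).ofReal ?_
  have := integrable_chiHat hβ h h1 ht
  rwa [← fourier_chi ht] at this

lemma conv_chiHat {t : ℝ} (ht : 0 ≤ t) (ξ : ℝ) : conv (chiHat β M t) (chiHat β M t) ξ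
    = (1 / √(1 + t) : ℝ) * conv (chiFT β M) (chiFT β M) (ξ * √(1 + t)) := by
  have hr : 0 < √(1 + t) := Real.sqrt_pos.2 (by linarith)
  unfold conv chiHat
  have := Measure.integral_comp_mul_right
    (fun η : ℝ => chiFT β M η * chiFT β M (ξ * √(1 + t) - η)) √(1 + t)
  rw [abs_of_pos (inv_pos.2 hr)] at this
  simp only [sub_mul]
  rw [this, Complex.real_smul, one_div]

/-- The equation `χ_t = χ_xx - β χ χ_x` on the Fourier side. -/
lemma hasDerivAt_chiHat (hβ : β ≠ 0) (h : |β * M| ≤ 2) (h1 : |M| ≤ 1) {t : ℝ} (ht : 0 ≤ t)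
    (ξ : ℝ) : HasDerivAt (fun t => chiHat β M t ξ)
      (-((2 * Real.pi * ξ : ℝ) : ℂ) ^ 2 * chiHat β M t ξ
        - (β / 2 : ℝ) * (Complex.I * (2 * Real.pi * ξ : ℝ))
          * conv (chiHat β M t) (chiHat β M t) ξ) t := by
  have h1t : 0 < 1 + t := by linarith
  have hr : 0 < √(1 + t) := Real.sqrt_pos.2 h1t
  have hs : HasDerivAt (fun t : ℝ => ξ * √(1 + t)) (ξ * (1 / (2 * √(1 + t)))) t :=
    (((hasDerivAt_id t).const_add 1).sqrt h1t.ne').const_mul ξ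
  have hc := (hasDerivAt_chiFT hβ h h1 (ξ * √(1 + t))).scomp t hs
  refine hc.congr_deriv ?_
  rw [conv_chiHat ht, Complex.real_smul]
  unfold chiHat
  have hr' : (√(1 + t) : ℂ) ≠ 0 := by exact_mod_cast hr.ne'
  push_cast
  field_simp
  ring

end chiHat

/-! ### The equation for the difference -/

/-- The difference of the solution and the diffusion wave on the Fourier side. -/
def wdiff (β M : ℝ) (f : ℝ → ℝ → ℂ) (t ξ : ℝ) : ℂ := f t ξ - chiHat β M t ξ

/-- The error with which the diffusion wave solves the BBM–Burgers equation. -/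
def chiErr (β γ M τ ξ : ℝ) : ℂ :=
  (Lsym γ ξ + ((2 * Real.pi * ξ : ℝ) : ℂ) ^ 2) * chiHat β M τ ξ
    + (β / 2 : ℝ) * (Complex.I * (2 * Real.pi * ξ : ℝ) - bsym ξ)
      * conv (chiHat β M τ) (chiHat β M τ) ξ

/-- The source term of the equation `w_t = L w + wsrc` for the difference. -/
def wsrc (β γ M : ℝ) (f : ℝ → ℝ → ℂ) (τ ξ : ℝ) : ℂ :=
  -((β / 2 : ℝ) : ℂ) * bsym ξ
    * (conv (f τ) (f τ) ξ - conv (chiHat β M τ) (chiHat β M τ) ξ) + chiErr β γ M τ ξ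

section Difference

variable {β γ M Λ : ℝ} {s : ℕ} {f₀ : ℝ → ℂ} {f : ℝ → ℝ → ℂ}

lemma continuousOn_conv_chiHat (hβ : β ≠ 0) (h : |β * M| ≤ 2) (h1 : |M| ≤ 1) :
    ContinuousOn (fun p : ℝ × ℝ => conv (chiHat β M p.1) (chiHat β M p.1) p.2)
      (Set.Ici 0 ×ˢ Set.univ) := by
  have hX := integrable_chiFT hβ h h1
  have hXc := continuous_chiFT hβ h h1
  obtain ⟨C, hC, hb⟩ := exists_norm_chiFT_le hβ 0
  have hcc : Continuous (conv (chiFT β M) (chiFT β M)) := by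
    have := BBMBurgers.continuous_conv (X := Unit) (f := fun _ => chiFT β M)
      (g := fun _ => chiFT β M) (hXc.comp continuous_snd) (hXc.comp continuous_snd) hX.norm
      (fun _ _ => le_rfl) (M := C * |M|) (fun _ η => by simpa using hb M h h1 η)
    exact this.comp (f := fun ξ : ℝ => ((), ξ)) (by fun_prop)
  have : ContinuousOn (fun p : ℝ × ℝ => ((1 / √(1 + p.1) : ℝ) : ℂ)
      * conv (chiFT β M) (chiFT β M) (p.2 * √(1 + p.1))) (Set.Ici 0 ×ˢ Set.univ) := by
    refine ContinuousOn.mul ?_ (hcc.comp (by fun_prop)).continuousOn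
    refine Complex.continuous_ofReal.comp_continuousOn ?_
    refine continuousOn_const.div (by fun_prop) fun p hp => ?_
    exact (Real.sqrt_pos.2 (by linarith [Set.mem_Ici.1 hp.1])).ne'
  exact this.congr fun p hp => conv_chiHat hp.1 p.2

/-- The solution on the Fourier side solves `f_t = L f - (β/2) b (f ∗ f)`. -/
lemma IsFourierSol.hasDerivAt (hf : IsFourierSol β γ s f₀ Λ f)
    (hc : Continuous fun p : ℝ × ℝ => conv (f p.1) (f p.1) p.2) {t : ℝ} (ht : 0 < t) (ξ : ℝ) :
    HasDerivAt (fun t => f t ξ)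
      (Lsym γ ξ * f t ξ - (β / 2 : ℝ) * bsym ξ * conv (f t) (f t) ξ) t := by
  set g : ℝ → ℂ := fun τ => bsym ξ * asym γ (-τ) ξ * conv (f τ) (f τ) ξ with hg
  have hgc : Continuous g := by
    refine (continuous_const.mul ((continuous_asym γ).comp (f := fun τ : ℝ => (-τ, ξ))
      (by fun_prop))).mul ?_
    exact hc.comp (f := fun τ : ℝ => (τ, ξ)) (by fun_prop)
  have h1 := intervalIntegral.integral_hasDerivAt_right (hgc.intervalIntegrable 0 t)
    hgc.stronglyMeasurable.stronglyMeasurableAtFilter hgc.continuousAt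
  have h2 := (hasDerivAt_asym γ t ξ).mul ((h1.const_mul ((β / 2 : ℝ) : ℂ)).const_sub (f₀ ξ))
  have e : ∀ r, 0 ≤ r → f r ξ
      = asym γ r ξ * (f₀ ξ - ((β / 2 : ℝ) : ℂ) * ∫ τ in (0 : ℝ)..r, g τ) := by
    intro r hr
    rw [hf.eq r hr ξ, mul_sub]
    congr 1
    unfold duh
    rw [mul_left_comm, ← intervalIntegral.integral_const_mul (asym γ r ξ)]
    congr 1
    refine intervalIntegral.integral_congr fun τ _ => ?_
    simp only [hg]
    rw [sub_eq_add_neg, asym_add]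
    ring
  have h3 : HasDerivAt (fun t => f t ξ) _ t := h2.congr_of_eventuallyEq (by
    filter_upwards [lt_mem_nhds ht] with r hr
    exact e r hr.le)
  refine h3.congr_deriv ?_
  have e1 : asym γ t ξ * asym γ (-t) ξ = 1 := by rw [← asym_add, add_neg_cancel, asym_zero]
  rw [e t ht.le]
  simp only [hg]
  linear_combination (-((β / 2 : ℝ) : ℂ) * bsym ξ * conv (f t) (f t) ξ) * e1

lemma hasDerivAt_wdiff (hβ : β ≠ 0) (h : |β * M| ≤ 2) (h1 : |M| ≤ 1)
    (hf : IsFourierSol β γ s f₀ Λ f)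
    (hc : Continuous fun p : ℝ × ℝ => conv (f p.1) (f p.1) p.2) {t : ℝ} (ht : 0 < t) (ξ : ℝ) :
    HasDerivAt (fun t => wdiff β M f t ξ)
      (Lsym γ ξ * wdiff β M f t ξ + wsrc β γ M f t ξ) t := by
  refine ((hf.hasDerivAt hc ht ξ).sub (hasDerivAt_chiHat hβ h h1 ht.le ξ)).congr_deriv ?_
  unfold wdiff wsrc chiErr
  ring

lemma continuous_wdiff (hβ : β ≠ 0) (h : |β * M| ≤ 2) (h1 : |M| ≤ 1)
    (hf : IsFourierSol β γ s f₀ Λ f) : Continuous fun p : ℝ × ℝ => wdiff β M f p.1 p.2 :=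
  hf.cont.sub (continuous_chiHat hβ h h1)

lemma continuousOn_wsrc (hβ : β ≠ 0) (h : |β * M| ≤ 2) (h1 : |M| ≤ 1)
    (hc : Continuous fun p : ℝ × ℝ => conv (f p.1) (f p.1) p.2) :
    ContinuousOn (fun p : ℝ × ℝ => wsrc β γ M f p.1 p.2) (Set.Ici 0 ×ˢ Set.univ) := by
  have h2 := continuousOn_conv_chiHat hβ h h1
  unfold wsrc chiErr
  refine ContinuousOn.add (ContinuousOn.mul (Continuous.continuousOn ?_) (hc.continuousOn.sub h2))
    (ContinuousOn.add (Continuous.continuousOn ?_)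
      (ContinuousOn.mul (Continuous.continuousOn ?_) h2))
  · exact continuous_const.mul (continuous_bsym.comp continuous_snd)
  · exact (((continuous_Lsym γ).comp continuous_snd).add (by fun_prop)).mul
      (continuous_chiHat hβ h h1)
  · exact continuous_const.mul
      (Continuous.sub (by fun_prop) (continuous_bsym.comp continuous_snd))

/-- The Duhamel formula for the difference, started at the time `r`. -/
lemma wdiff_eq (hβ : β ≠ 0) (h : |β * M| ≤ 2) (h1 : |M| ≤ 1) (hf : IsFourierSol β γ s f₀ Λ f)
    (hc : Continuous fun p : ℝ × ℝ => conv (f p.1) (f p.1) p.2) {r t : ℝ} (hr : 0 ≤ r)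
    (hrt : r ≤ t) (ξ : ℝ) :
    IntervalIntegrable (fun τ => asym γ (t - τ) ξ * wsrc β γ M f τ ξ) volume r t ∧
    wdiff β M f t ξ = asym γ (t - r) ξ * wdiff β M f r ξ
      + ∫ τ in r..t, asym γ (t - τ) ξ * wsrc β γ M f τ ξ := by
  have ha : Continuous fun τ => asym γ (t - τ) ξ :=
    (continuous_asym γ).comp (f := fun τ : ℝ => (t - τ, ξ)) (by fun_prop)
  have hw : Continuous fun τ => wdiff β M f τ ξ :=
    (continuous_wdiff hβ h h1 hf).comp (f := fun τ : ℝ => (τ, ξ)) (by fun_prop)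
  have hs : ContinuousOn (fun τ => wsrc β γ M f τ ξ) (Set.Icc r t) :=
    (continuousOn_wsrc hβ h h1 hc).comp (f := fun τ : ℝ => (τ, ξ)) (by fun_prop)
      fun τ hτ => ⟨hr.trans hτ.1, Set.mem_univ _⟩
  have hi : IntervalIntegrable (fun τ => asym γ (t - τ) ξ * wsrc β γ M f τ ξ) volume r t :=
    ContinuousOn.intervalIntegrable_of_Icc hrt (ha.continuousOn.mul hs)
  refine ⟨hi, ?_⟩
  have hd : ∀ τ ∈ Set.Ioo r t, HasDerivAt (fun τ => asym γ (t - τ) ξ * wdiff β M f τ ξ)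
      (asym γ (t - τ) ξ * wsrc β γ M f τ ξ) τ := by
    intro τ hτ
    have h2 := (hasDerivAt_asym γ (t - τ) ξ).scomp τ ((hasDerivAt_id τ).const_sub t)
    refine (h2.mul (hasDerivAt_wdiff hβ h h1 hf hc (hr.trans_lt hτ.1) ξ)).congr_deriv ?_
    simp only [neg_smul, one_smul, Function.comp]
    ring
  have := intervalIntegral.integral_eq_sub_of_hasDerivAt_of_le hrt
    (ha.mul hw).continuousOn hd hi
  rw [this]
  simp only [Pi.mul_apply, sub_self, asym_zero]
  ring

/-! ### The decay of the source terms -/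

lemma norm_Lsym_add_le (γ ξ : ℝ) : ‖Lsym γ ξ + ((2 * Real.pi * ξ : ℝ) : ℂ) ^ 2‖
    ≤ (2 * Real.pi) ^ 4 * (1 + |γ|) * (|ξ| / (1 + ξ ^ 2)) * (ξ ^ 2 + |ξ| ^ 3) := by
  set k : ℝ := 2 * Real.pi * ξ with hk
  have hne := one_add_sq_ne_zero k
  have e : Lsym γ ξ + (k : ℂ) ^ 2
      = ((k : ℂ) ^ 4 + Complex.I * (γ * (k : ℂ) ^ 3)) / (1 + (k : ℂ) ^ 2) := by
    unfold Lsym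
    rw [← hk]
    field_simp
    ring
  have hpi : 1 ≤ 2 * Real.pi := by linarith [Real.pi_gt_three]
  have hkabs : |k| = 2 * Real.pi * |ξ| := by
    rw [hk, abs_mul, abs_of_pos Real.two_pi_pos]
  rw [e, norm_div, norm_one_add_sq]
  have h1 : ‖(k : ℂ) ^ 4 + Complex.I * (γ * (k : ℂ) ^ 3)‖ ≤ |k| ^ 4 + |γ| * |k| ^ 3 := by
    refine (norm_add_le _ _).trans (le_of_eq ?_)
    simp
  have hξ := abs_nonneg ξ
  have hγ := abs_nonneg γ
  have h2 : |k| ^ 4 + |γ| * |k| ^ 3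
      ≤ (2 * Real.pi) ^ 4 * (1 + |γ|) * (|ξ| * (ξ ^ 2 + |ξ| ^ 3)) := by
    rw [hkabs, mul_pow (2 * Real.pi) |ξ| 4, mul_pow (2 * Real.pi) |ξ| 3, ← sq_abs ξ]
    have h3 : (2 * Real.pi) ^ 3 ≤ (2 * Real.pi) ^ 4 := pow_le_pow_right₀ hpi (by norm_num)
    calc (2 * Real.pi) ^ 4 * |ξ| ^ 4 + |γ| * ((2 * Real.pi) ^ 3 * |ξ| ^ 3)
        ≤ (2 * Real.pi) ^ 4 * |ξ| ^ 4 + |γ| * ((2 * Real.pi) ^ 4 * |ξ| ^ 3) := by gcongr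
      _ ≤ (2 * Real.pi) ^ 4 * |ξ| ^ 4 + |γ| * ((2 * Real.pi) ^ 4 * |ξ| ^ 3)
          + (2 * Real.pi) ^ 4 * |ξ| ^ 3 + |γ| * ((2 * Real.pi) ^ 4 * |ξ| ^ 4) := by
          have : 0 ≤ (2 * Real.pi) ^ 4 * |ξ| ^ 3 + |γ| * ((2 * Real.pi) ^ 4 * |ξ| ^ 4) := by
            positivity
          linarith
      _ = _ := by ring
  calc _ ≤ ((2 * Real.pi) ^ 4 * (1 + |γ|) * (|ξ| * (ξ ^ 2 + |ξ| ^ 3))) / (1 + ξ ^ 2) := by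
        refine div_le_div₀ (by positivity) (h1.trans h2) (by positivity) ?_
        linarith [sq_le_two_pi_mul_sq ξ]
    _ = _ := by ring

lemma norm_ik_sub_bsym_le (ξ : ℝ) : ‖Complex.I * (2 * Real.pi * ξ : ℝ) - bsym ξ‖
    ≤ (2 * Real.pi) ^ 4 * (|ξ| / (1 + ξ ^ 2)) * ξ ^ 2 := by
  set k : ℝ := 2 * Real.pi * ξ with hk
  have hne := one_add_sq_ne_zero k
  have e : Complex.I * (k : ℂ) - bsym ξ = Complex.I * (k : ℂ) ^ 3 / (1 + (k : ℂ) ^ 2) := by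
    unfold bsym
    rw [← hk]
    field_simp
    ring
  have hpi : 1 ≤ 2 * Real.pi := by linarith [Real.pi_gt_three]
  have hkabs : |k| = 2 * Real.pi * |ξ| := by
    rw [hk, abs_mul, abs_of_pos Real.two_pi_pos]
  rw [e, norm_div, norm_one_add_sq]
  have h1 : ‖Complex.I * (k : ℂ) ^ 3‖ = (2 * Real.pi) ^ 3 * |ξ| ^ 3 := by
    simp [hkabs, mul_pow]
  rw [h1]
  have h3 : (2 * Real.pi) ^ 3 ≤ (2 * Real.pi) ^ 4 := pow_le_pow_right₀ hpi (by norm_num)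
  calc _ ≤ ((2 * Real.pi) ^ 4 * |ξ| ^ 3) / (1 + ξ ^ 2) := by
        refine div_le_div₀ (by positivity) (by gcongr) (by positivity) ?_
        linarith [sq_le_two_pi_mul_sq ξ]
    _ = _ := by rw [← sq_abs ξ]; ring

lemma sq_mul_le_wt {τ : ℝ} (hτ : 0 ≤ τ) (ξ : ℝ) : ξ ^ 2 * (1 + τ) ≤ wt τ ξ ^ 2 := by
  have h1 := abs_mul_sqrt_le_wt τ ξ
  have h2 : (|ξ| * √(1 + τ)) ^ 2 = ξ ^ 2 * (1 + τ) := by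
    rw [mul_pow, sq_abs, Real.sq_sqrt (by linarith)]
  rw [← h2]
  exact pow_le_pow_left₀ (by positivity) h1 2

lemma sq_add_cube_mul_le_wt {τ : ℝ} (hτ : 0 ≤ τ) (ξ : ℝ) :
    (ξ ^ 2 + |ξ| ^ 3) * (1 + τ) ≤ 2 * wt τ ξ ^ 3 := by
  have h1 := sq_mul_le_wt hτ ξ
  have h2 := one_le_wt τ ξ
  have h3 : |ξ| ≤ wt τ ξ := by linarith [one_add_abs_le_wt hτ ξ]
  have h4 : wt τ ξ ^ 2 ≤ wt τ ξ ^ 3 := pow_le_pow_right₀ h2 (by norm_num)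
  have h5 : |ξ| ^ 3 * (1 + τ) ≤ wt τ ξ ^ 3 := by
    calc |ξ| ^ 3 * (1 + τ) = |ξ| * (ξ ^ 2 * (1 + τ)) := by rw [← sq_abs ξ]; ring
      _ ≤ wt τ ξ * wt τ ξ ^ 2 := by gcongr
      _ = _ := by ring
  linarith

/-- The error of the diffusion wave gains a factor `(1 + τ)⁻¹`. -/
lemma exists_norm_chiErr_le (hβ : β ≠ 0) (γ : ℝ) (s : ℕ) : ∃ C, 0 ≤ C ∧ ∀ M, |β * M| ≤ 2 →
    |M| ≤ 1 → ∀ τ, 0 ≤ τ → ∀ ξ : ℝ, ‖chiErr β γ M τ ξ‖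
      ≤ (|ξ| / (1 + ξ ^ 2)) * (C * (1 + τ) ^ (-1 : ℝ) / wt τ ξ ^ s) := by
  obtain ⟨C, hC, hb⟩ := exists_norm_chiHat_le hβ (s + 3)
  refine ⟨(2 * Real.pi) ^ 4 * (1 + |γ|) * (2 * C) + |β| / 2 * (2 * Real.pi) ^ 4 * (4 * C ^ 2),
    by positivity, fun M hM hM1 τ hτ ξ => ?_⟩
  have h1τ : 0 < 1 + τ := by linarith
  have hw := wt_pos τ ξ
  have hx : ∀ ξ, ‖chiHat β M τ ξ‖ ≤ C / wt τ ξ ^ (s + 3) := fun ξ => by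
    refine (hb M hM hM1 τ ξ).trans ?_
    have := pow_pos (wt_pos τ ξ) (s + 3)
    have : C * |M| ≤ C := mul_le_of_le_one_right hC hM1
    gcongr
  have hl := l2Bd_of_le_wt (s := s + 2) le_rfl hτ hC
    (continuous_chiHat_right hβ hM hM1 τ).aestronglyMeasurable hx
  have hconv : ‖conv (chiHat β M τ) (chiHat β M τ) ξ‖ ≤ 4 * C ^ 2 / wt τ ξ ^ (s + 2) := by
    have h2 := conv_congr_norm_bound (ξ := ξ) (by positivity) (by positivity) hτ hl hl
    refine h2.trans ?_
    have h3 : (1 + τ) ^ (-(1 / 2 + 0) : ℝ) ≤ 1 :=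
      Real.rpow_le_one_of_one_le_of_nonpos (by linarith) (by norm_num)
    have h4 : 2 * C * (2 * C) * (1 + τ) ^ (-(1 / 2 + 0) : ℝ) ≤ 4 * C ^ 2 := by
      calc _ ≤ 2 * C * (2 * C) * 1 := by gcongr
        _ = _ := by ring
    gcongr
  have hq : ξ ^ 2 ≤ wt τ ξ ^ 2 / (1 + τ) := by
    rw [le_div_iff₀ h1τ]; exact sq_mul_le_wt hτ ξ
  have hq3 : ξ ^ 2 + |ξ| ^ 3 ≤ 2 * wt τ ξ ^ 3 / (1 + τ) := by
    rw [le_div_iff₀ h1τ]; exact sq_add_cube_mul_le_wt hτ ξ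
  have hA := norm_Lsym_add_le γ ξ
  have hB := norm_ik_sub_bsym_le ξ
  have hβ0 := abs_nonneg β
  have hγ0 := abs_nonneg γ
  have hξ0 := abs_nonneg ξ
  unfold chiErr
  refine (norm_add_le _ _).trans ?_
  rw [norm_mul, norm_mul, norm_mul, Complex.norm_real, Real.norm_eq_abs, abs_div, abs_two,
    Real.rpow_neg_one]
  calc ‖Lsym γ ξ + ((2 * Real.pi * ξ : ℝ) : ℂ) ^ 2‖ * ‖chiHat β M τ ξ‖
        + |β| / 2 * ‖Complex.I * (2 * Real.pi * ξ : ℝ) - bsym ξ‖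
          * ‖conv (chiHat β M τ) (chiHat β M τ) ξ‖
      ≤ ((2 * Real.pi) ^ 4 * (1 + |γ|) * (|ξ| / (1 + ξ ^ 2)) * (2 * wt τ ξ ^ 3 / (1 + τ)))
          * (C / wt τ ξ ^ (s + 3))
        + |β| / 2 * ((2 * Real.pi) ^ 4 * (|ξ| / (1 + ξ ^ 2)) * (wt τ ξ ^ 2 / (1 + τ)))
          * (4 * C ^ 2 / wt τ ξ ^ (s + 2)) := by
        gcongr
        · exact hA.trans (by gcongr)
        · exact hx ξ
        · exact hB.trans (by gcongr)
    _ = _ := by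
        field_simp
        ring

end Difference

/-! ### Decay of the difference by absorption -/

/-- A small solution on the Fourier side together with a small diffusion wave: `m` bounds the
wave, `Ce` the error with which it solves the equation, and `small` makes the quadratic terms
absorbable. -/
structure Setting (β γ M : ℝ) (s : ℕ) (f₀ : ℝ → ℂ) (Λ m Ce : ℝ) (f : ℝ → ℝ → ℂ) : Prop where
  one_le : 1 ≤ s
  hβ : β ≠ 0
  hM : |β * M| ≤ 2
  hM1 : |M| ≤ 1
  sol : IsFourierSol β γ s f₀ Λ f
  Λ0 : 0 ≤ Λ
  m0 : 0 ≤ m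
  Ce0 : 0 ≤ Ce
  bdd : ∃ R, ∀ t ξ, ‖f t ξ‖ ≤ R
  int : ∀ t, Integrable (f t) volume
  convc : Continuous fun p : ℝ × ℝ => conv (f p.1) (f p.1) p.2
  wave : ∀ t, 0 ≤ t →
    L2Bd (fun ξ => ((wt t ξ ^ s : ℝ) : ℂ) * chiHat β M t ξ) (m * (1 + t) ^ (-(1 / 4) : ℝ))
  err : ∀ t, 0 ≤ t → ∀ ξ, ‖chiErr β γ M t ξ‖
      ≤ (|ξ| / (1 + ξ ^ 2)) * (Ce * (1 + t) ^ (-1 : ℝ) / wt t ξ ^ s)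
  small : 2 * Cduh s * (Real.pi * |β| * (Λ + m)) ≤ 1 / 2

/-- Absorption: a quantity that bounds itself with the factor `1/2` up to a constant, starting from
some finite bound. -/
lemma absorb {P : ℝ → Prop} {A : ℝ} (hA : 0 < A) (hmono : ∀ W V, P W → W ≤ V → P V)
    (hstep : ∀ W, 0 ≤ W → P W → P (A + W / 2)) {W₀ : ℝ} (h0 : P W₀) : P (3 * A) := by
  have key : ∀ n : ℕ, P (2 * A + |W₀| / 2 ^ n) := by
    intro n
    induction n with
    | zero => exact hmono _ _ h0 (by have := le_abs_self W₀; simp; linarith)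
    | succ n ih =>
      refine hmono _ _ (hstep _ (by positivity) ih) (le_of_eq ?_)
      rw [pow_succ]
      field_simp
      ring
  obtain ⟨n, hn⟩ := pow_unbounded_of_one_lt (|W₀| / A) (by norm_num : (1 : ℝ) < 2)
  refine hmono _ _ (key n) ?_
  rw [div_lt_iff₀ hA] at hn
  have : |W₀| / 2 ^ n ≤ A := by
    rw [div_le_iff₀ (by positivity)]; linarith
  linarith

namespace Setting

variable {β γ M Λ m Ce : ℝ} {s : ℕ} {f₀ : ℝ → ℂ} {f : ℝ → ℝ → ℂ}

lemma norm_conv_sub_conv_le (S : Setting β γ M s f₀ Λ m Ce f) {τ : ℝ} (hτ : 0 ≤ τ)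
    {W b : ℝ} (hW : 0 ≤ W)
    (hw : L2Bd (fun ξ => ((wt τ ξ ^ s : ℝ) : ℂ) * wdiff β M f τ ξ) (W * (1 + τ) ^ (-(1 / 4 + b))))
    (ξ : ℝ) :
    ‖conv (f τ) (f τ) ξ - conv (chiHat β M τ) (chiHat β M τ) ξ‖
      ≤ (Λ + m) * W * (1 + τ) ^ (-(1 / 2 + b)) / wt τ ξ ^ s := by
  obtain ⟨R, hR⟩ := S.bdd
  obtain ⟨C, hC, hb⟩ := exists_norm_chiHat_le S.hβ 0
  have e := conv_sub_self (S.sol.continuous_apply τ) (continuous_chiHat_right S.hβ S.hM S.hM1 τ)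
    ((S.int τ).norm.add (integrable_chiHat S.hβ S.hM S.hM1 hτ).norm)
    (fun η => by simp) (fun η => by simp) (M := max R (C * |M|))
    (fun η => (hR τ η).trans (le_max_left _ _))
    (fun η => (by simpa using hb M S.hM S.hM1 τ η : _ ≤ C * |M|).trans (le_max_right _ _)) ξ
  rw [e]
  refine (norm_add_le _ _).trans ?_
  have b1 := norm_conv_rate_le S.Λ0 hW hτ (S.sol.bd τ hτ) hw ξ
  have b2 := norm_conv_rate_le S.m0 hW hτ (S.wave τ hτ) hw ξ
  refine (add_le_add b1 b2).trans_eq ?_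
  ring

lemma norm_wsrc_le (S : Setting β γ M s f₀ Λ m Ce f) {τ : ℝ} (hτ : 0 ≤ τ) {W b ξ : ℝ}
    (hW : 0 ≤ W) (hb : b ≤ 1 / 2)
    (hw : L2Bd (fun ξ => ((wt τ ξ ^ s : ℝ) : ℂ) * wdiff β M f τ ξ)
      (W * (1 + τ) ^ (-(1 / 4 + b)))) :
    ‖wsrc β γ M f τ ξ‖ ≤ (|ξ| / (1 + ξ ^ 2))
      * ((Real.pi * |β| * (Λ + m) * W + Ce) * (1 + τ) ^ (-(1 / 2 + b)) / wt τ ξ ^ s) := by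
  have hS := S.norm_conv_sub_conv_le hτ hW hw ξ
  have hwt := wt_pos τ ξ
  have hr : (1 + τ) ^ (-1 : ℝ) ≤ (1 + τ) ^ (-(1 / 2 + b)) :=
    Real.rpow_le_rpow_of_exponent_le (by linarith) (by linarith)
  have hbs := norm_bsym_le ξ
  have hpi := Real.pi_pos
  have hCe := S.Ce0
  unfold wsrc
  refine (norm_add_le _ _).trans ?_
  rw [norm_mul, norm_mul, norm_neg, Complex.norm_real, Real.norm_eq_abs, abs_div, abs_two]
  calc _ ≤ |β| / 2 * (2 * Real.pi * (|ξ| / (1 + ξ ^ 2)))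
          * ((Λ + m) * W * (1 + τ) ^ (-(1 / 2 + b)) / wt τ ξ ^ s)
        + (|ξ| / (1 + ξ ^ 2)) * (Ce * (1 + τ) ^ (-(1 / 2 + b)) / wt τ ξ ^ s) := by
        refine add_le_add (by gcongr) ((S.err τ hτ ξ).trans ?_)
        gcongr
    _ = _ := by ring

lemma continuous_wdiff_apply (S : Setting β γ M s f₀ Λ m Ce f) (t : ℝ) :
    Continuous (wdiff β M f t) :=
  (continuous_wdiff S.hβ S.hM S.hM1 S.sol).comp (f := fun ξ : ℝ => (t, ξ)) (by fun_prop)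

lemma l2Bd_wdiff_apriori (S : Setting β γ M s f₀ Λ m Ce f) {t : ℝ} (ht : 0 ≤ t) :
    L2Bd (fun ξ => ((wt t ξ ^ s : ℝ) : ℂ) * wdiff β M f t ξ)
      ((Λ + m) * (1 + t) ^ (-(1 / 4) : ℝ)) := by
  have hΛ := S.Λ0
  have hm := S.m0
  have := (S.sol.bd t ht).add ((S.wave t ht).const_mul (-1)) (by positivity) (by positivity)
  refine (this.mono ?_ fun ξ => le_of_eq ?_).le (le_of_eq ?_)
  · exact this.1.congr (Eventually.of_forall fun ξ => by simp only [wdiff]; ring)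
  · congr 1
    unfold wdiff
    ring
  · simp
    ring

/-- The absorption argument for the decay of the difference: if the remaining terms of the Duhamel
formula, started at the time `r t ∈ {0, t/2}`, are `O((1 + t)^(-(1/4 + b)))`, then so is the
difference. -/
lemma l2Bd_wdiff_of_linear (S : Setting β γ M s f₀ Λ m Ce f) {b L : ℝ} (hb0 : 0 ≤ b)
    (hb : b ≤ 1 / 2) (hL : 0 ≤ L) {r : ℝ → ℝ} (hr : ∀ t, 0 ≤ t → 0 ≤ r t ∧ r t ≤ t)
    (hduh : ∀ t, 0 ≤ t → ∀ A, 0 ≤ A → ∀ ξ,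
      (∀ τ, r t ≤ τ → τ ≤ t → ‖asym γ (t - τ) ξ * wsrc β γ M f τ ξ‖
        ≤ (|ξ| / (1 + ξ ^ 2)) * Real.exp (-(kap ξ * (t - τ)))
          * (A * (1 + τ) ^ (-(1 / 2 + b)) / wt τ ξ ^ s)) →
      ‖∫ τ in r t..t, asym γ (t - τ) ξ * wsrc β γ M f τ ξ‖
        ≤ Cduh s * A * (1 + t) ^ (-b) / wt t ξ ^ (s + 1))
    (hlin : ∀ t, 0 ≤ t → L2Bd (fun ξ => ((wt t ξ ^ s : ℝ) : ℂ)
      * (asym γ (t - r t) ξ * wdiff β M f (r t) ξ)) (L * (1 + t) ^ (-(1 / 4 + b)))) {t : ℝ}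
    (ht : 0 ≤ t) :
    L2Bd (fun ξ => ((wt t ξ ^ s : ℝ) : ℂ) * wdiff β M f t ξ)
      (3 * (L + 2 * Cduh s * Ce + 1) * (1 + t) ^ (-(1 / 4 + b))) := by
  have hC := (Cduh_pos s).le
  have hCe := S.Ce0
  have hΛ := S.Λ0
  have hm := S.m0
  have hpi := Real.pi_pos
  have key : ∀ T, ∀ t ∈ Set.Icc 0 T, L2Bd (fun ξ => ((wt t ξ ^ s : ℝ) : ℂ) * wdiff β M f t ξ)
      (3 * (L + 2 * Cduh s * Ce + 1) * (1 + t) ^ (-(1 / 4 + b))) := by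
    intro T
    refine absorb (P := fun W => ∀ t ∈ Set.Icc 0 T,
      L2Bd (fun ξ => ((wt t ξ ^ s : ℝ) : ℂ) * wdiff β M f t ξ) (W * (1 + t) ^ (-(1 / 4 + b))))
      (by positivity) ?_ ?_ (W₀ := (Λ + m) * (1 + T) ^ b) ?_
    · intro W V hP hWV t ht
      exact (hP t ht).le (mul_le_mul_of_nonneg_right hWV
        (Real.rpow_nonneg (by linarith [ht.1]) _))
    · intro W hW hP t ht
      have h1t : 0 < 1 + t := by linarith [ht.1]
      have hrt := hr t ht.1
      set A := Real.pi * |β| * (Λ + m) * W + Ce with hA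
      have hA0 : 0 ≤ A := by positivity
      have hI : ∀ ξ, ‖∫ τ in r t..t, asym γ (t - τ) ξ * wsrc β γ M f τ ξ‖
          ≤ (Cduh s * A * (1 + t) ^ (-b)) / wt t ξ ^ (s + 1) := by
        intro ξ
        refine hduh t ht.1 A hA0 ξ fun τ h0 h1 => ?_
        have hτ : 0 ≤ τ := hrt.1.trans h0
        have e1 := S.norm_wsrc_le (ξ := ξ) hτ hW hb (hP τ ⟨hτ, h1.trans ht.2⟩)
        have e2 := norm_asym_le (sub_nonneg.2 h1) γ ξ
        have hw := wt_pos τ ξ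
        rw [norm_mul]
        calc _ ≤ Real.exp (-(kap ξ * (t - τ))) * ((|ξ| / (1 + ξ ^ 2))
              * (A * (1 + τ) ^ (-(1 / 2 + b)) / wt τ ξ ^ s)) := by gcongr
          _ = _ := by ring
      have heq : ∀ ξ, wdiff β M f t ξ - asym γ (t - r t) ξ * wdiff β M f (r t) ξ
          = ∫ τ in r t..t, asym γ (t - τ) ξ * wsrc β γ M f τ ξ := fun ξ => by
        rw [(wdiff_eq S.hβ S.hM S.hM1 S.sol S.convc hrt.1 hrt.2 ξ).2]
        ring
      have hac : Continuous (asym γ (t - r t)) :=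
        (continuous_asym γ).comp (f := fun ξ : ℝ => (t - r t, ξ)) (by fun_prop)
      have hD := l2Bd_of_le_wt (s := s) (c := Cduh s * A * (1 + t) ^ (-b))
        (g := fun ξ => wdiff β M f t ξ - asym γ (t - r t) ξ * wdiff β M f (r t) ξ) le_rfl ht.1
        (by positivity)
        ((S.continuous_wdiff_apply t).sub
          (hac.mul (S.continuous_wdiff_apply (r t)))).aestronglyMeasurable
        (fun ξ => by rw [heq]; exact hI ξ)
      have hsum := (hlin t ht.1).add hD (by positivity) (by positivity)
      refine (hsum.mono ((continuous_wt_pow t s).mul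
        (S.continuous_wdiff_apply t)).aestronglyMeasurable fun ξ => le_of_eq ?_).le ?_
      · simp only [Pi.mul_apply]
        congr 1
        ring
      · have e : (1 + t) ^ (-(1 / 4 + b)) = (1 + t) ^ (-b) * (1 + t) ^ (-(1 / 4) : ℝ) := by
          rw [← Real.rpow_add h1t]; congr 1; ring
        have hsm := mul_le_mul_of_nonneg_right S.small hW
        calc L * (1 + t) ^ (-(1 / 4 + b))
              + 2 * (Cduh s * A * (1 + t) ^ (-b)) * (1 + t) ^ (-(1 / 4) : ℝ)
            = (L + 2 * Cduh s * Ce + 2 * Cduh s * (Real.pi * |β| * (Λ + m)) * W)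
              * (1 + t) ^ (-(1 / 4 + b)) := by rw [hA, e]; ring
          _ ≤ _ := mul_le_mul_of_nonneg_right (by linarith) (Real.rpow_nonneg h1t.le _)
    · intro t ht
      have h1t : 0 < 1 + t := by linarith [ht.1]
      refine (S.l2Bd_wdiff_apriori ht.1).le ?_
      have e : (1 + t) ^ (-(1 / 4) : ℝ) = (1 + t) ^ b * (1 + t) ^ (-(1 / 4 + b)) := by
        rw [← Real.rpow_add h1t]; congr 1; ring
      have h2 : (1 + t) ^ b ≤ (1 + T) ^ b :=
        Real.rpow_le_rpow h1t.le (by linarith [ht.2]) hb0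
      rw [e, ← mul_assoc]
      gcongr
  exact key t t ⟨ht, le_rfl⟩

/-- The decay of the difference up to the rate `(1 + t)^(-1/2)` is an effect of the linear
evolution. -/
theorem l2Bd_wdiff_of_le_half (S : Setting β γ M s f₀ Λ m Ce f) {a D₁ D₂ : ℝ} (ha0 : 0 ≤ a)
    (ha : a ≤ 1 / 2) (hD₁ : 0 ≤ D₁) (hD₂ : 0 ≤ D₂)
    (hlow : ∀ ξ, |ξ| ≤ 1 → ‖wdiff β M f 0 ξ‖ ≤ D₁ * |ξ| ^ a)
    (hw : L2Bd (fun ξ => ((wt 0 ξ ^ s : ℝ) : ℂ) * wdiff β M f 0 ξ) D₂) {t : ℝ} (ht : 0 ≤ t) :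
    L2Bd (fun ξ => ((wt t ξ ^ s : ℝ) : ℂ) * wdiff β M f t ξ)
      (3 * (Clin s * (2 * D₁ + D₂) + 2 * Cduh s * Ce + 1) * (1 + t) ^ (-(1 / 4 + a / 2))) := by
  have hC := (Clin_pos s).le
  refine S.l2Bd_wdiff_of_linear (r := fun _ => 0) (by linarith) (by linarith) (by positivity)
    (fun t ht => ⟨le_rfl, ht⟩) (fun t ht A hA ξ hH => ?_) (fun t ht => ?_) ht
  · exact norm_duhamel_le hA (by linarith) (by linarith) ht
      (wdiff_eq S.hβ S.hM S.hM1 S.sol S.convc le_rfl ht ξ).1 hH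
  · simp only [sub_zero]
    refine l2Bd_linear ha0 (by linarith) ht hD₁ hD₂
      ((continuous_asym γ).comp (f := fun ξ : ℝ => (t, ξ)) (by fun_prop)).aestronglyMeasurable
      (fun ξ => (norm_asym_le ht γ ξ).trans (Real.exp_le_exp.2 ?_)) hlow hw
    have := mul_nonneg (kap_nonneg ξ) ht
    linarith

/-- The decay of the difference follows from the decay of an antiderivative `V`. -/
theorem l2Bd_wdiff_of_antideriv (S : Setting β γ M s f₀ Λ m Ce f) {b D₁ D₂ : ℝ} (hb0 : 0 ≤ b)
    (hb : b ≤ 1 / 2) (hD₁ : 0 ≤ D₁) (hD₂ : 0 ≤ D₂) {V : ℝ → ℝ → ℂ}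
    (hV : ∀ t, 0 ≤ t → ∀ ξ, ‖wdiff β M f t ξ‖ ≤ |ξ| * ‖V t ξ‖)
    (hVb : ∀ t, 0 ≤ t → L2Bd (V t) (D₁ * (1 + t) ^ (1 / 4 - b)))
    (hw : ∀ t, 0 ≤ t → L2Bd (fun ξ => ((wt t ξ ^ s : ℝ) : ℂ) * wdiff β M f t ξ) D₂) {t : ℝ}
    (ht : 0 ≤ t) :
    L2Bd (fun ξ => ((wt t ξ ^ s : ℝ) : ℂ) * wdiff β M f t ξ)
      (3 * (Clin s * (2 * D₁ + D₂) + 2 * Cduh s * Ce + 1) * (1 + t) ^ (-(1 / 4 + b))) := by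
  have hC := (Clin_pos s).le
  refine S.l2Bd_wdiff_of_linear (r := fun t => t / 2) hb0 hb (by positivity)
    (fun t ht => ⟨by linarith, by linarith⟩) (fun t ht A hA ξ hH => ?_) (fun t ht => ?_) ht
  · refine (norm_duhamel_late_le hA hb0 hb ht hH).trans ?_
    have : (2 : ℝ) ^ (s + 2) ≤ Cduh s := by
      unfold Cduh
      linarith [(Cearly_pos s).le]
    have hw := wt_pos t ξ
    gcongr
  · have h1t : 0 < 1 + t := by linarith
    have ht2 : 0 ≤ t / 2 := by linarith
    have e0 : t - t / 2 = t / 2 := by ring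
    simp only [e0]
    have hw0 : L2Bd (fun ξ => ((wt 0 ξ ^ s : ℝ) : ℂ) * wdiff β M f (t / 2) ξ) D₂ := by
      refine (hw (t / 2) ht2).mono ((continuous_wt_pow 0 s).mul
        (S.continuous_wdiff_apply (t / 2))).aestronglyMeasurable fun ξ => ?_
      rw [norm_mul, norm_mul, norm_wt_pow, norm_wt_pow]
      have := wt_mono ht2 ξ
      have := wt_pos 0 ξ
      gcongr
    have hV2 : L2Bd (V (t / 2)) (D₁ * (2 * (1 + t) ^ (1 / 4 - b))) := by
      refine (hVb (t / 2) ht2).le (mul_le_mul_of_nonneg_left ?_ hD₁)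
      have hhalf : (1 + t) / 2 ≤ 1 + t / 2 := by linarith
      rcases le_total 0 (1 / 4 - b) with hs | hs
      · have := Real.rpow_le_rpow (by linarith) (by linarith : 1 + t / 2 ≤ 1 + t) hs
        have h0 : 0 ≤ (1 + t) ^ (1 / 4 - b) := by positivity
        linarith
      · have h2 := Real.rpow_le_rpow_of_nonpos (by linarith) hhalf hs
        refine h2.trans ?_
        rw [Real.div_rpow h1t.le (by norm_num), div_eq_mul_inv, mul_comm,
          ← Real.rpow_neg (by norm_num)]
        refine mul_le_mul_of_nonneg_right ?_ (by positivity)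
        calc (2 : ℝ) ^ (-(1 / 4 - b)) ≤ 2 ^ (1 : ℝ) :=
              Real.rpow_le_rpow_of_exponent_le (by norm_num) (by linarith)
          _ = 2 := by norm_num
    refine (l2Bd_linear_deriv (e := asym γ (t / 2)) ht (by positivity) hD₂
      ((continuous_asym γ).comp (f := fun ξ : ℝ => (t / 2, ξ)) (by fun_prop)).aestronglyMeasurable
      (fun ξ => (norm_asym_le ht2 γ ξ).trans (Real.exp_le_exp.2 ?_)) hV2
      (fun ξ _ => hV (t / 2) ht2 ξ) hw0).le ?_
    · have := mul_nonneg (kap_nonneg ξ) ht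
      linarith
    · have e1 : (1 + t) ^ (-(1 / 4 + b)) = (1 + t) ^ (1 / 4 - b) * (1 + t) ^ (-(1 / 2) : ℝ) := by
        rw [← Real.rpow_add h1t]; congr 1; ring
      have e2 : (1 + t) ^ (-1 : ℝ) ≤ (1 + t) ^ (-(1 / 4 + b)) :=
        Real.rpow_le_rpow_of_exponent_le (by linarith) (by linarith)
      calc Clin s * (D₁ * (2 * (1 + t) ^ (1 / 4 - b)) * (1 + t) ^ (-(1 / 2) : ℝ)
            + D₂ * (1 + t) ^ (-1 : ℝ))
          ≤ Clin s * (D₁ * (2 * (1 + t) ^ (1 / 4 - b)) * (1 + t) ^ (-(1 / 2) : ℝ)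
            + D₂ * (1 + t) ^ (-(1 / 4 + b))) := by gcongr
        _ = _ := by rw [e1]; ring

end Setting

/-! ### Fractional decay and low frequencies -/

lemma integrable_comp_abs {f : ℝ → ℝ} (hf : IntegrableOn f (Set.Ioi 0)) :
    Integrable (fun x => f |x|) volume := by
  have hpos : IntegrableOn (fun x => f |x|) (Set.Ioi 0) := by
    refine hf.congr_fun (fun y hy => ?_) measurableSet_Ioi
    have : 0 < y := hy
    simp only [abs_of_pos this]
  have hneg : IntegrableOn (fun x => f |x|) (Set.Iic 0) := by
    rw [← Measure.map_neg_eq_self (volume : Measure ℝ)]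
    let m : MeasurableEmbedding fun x : ℝ => -x := (Homeomorph.neg ℝ).measurableEmbedding
    rw [m.integrableOn_map_iff]
    simp_rw [Function.comp_def, abs_neg, Set.neg_preimage, Set.neg_Iic, neg_zero]
    exact Iff.mpr integrableOn_Ici_iff_integrableOn_Ioi hpos
  rw [← integrableOn_univ, ← Set.Iic_union_Ioi (a := (0 : ℝ))]
  exact IntegrableOn.union hneg hpos

/-- The constant `∫ |y|^(-1-a) min(2, 2π|y|) dy` in the Hölder estimate for the Fourier transform. -/
def hoelderConst (a : ℝ) : ℝ := ∫ y : ℝ, |y| ^ (-1 - a) * min 2 (2 * Real.pi * |y|)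

lemma hoelderConst_nonneg (a : ℝ) : 0 ≤ hoelderConst a :=
  integral_nonneg fun y => by have := Real.pi_pos; positivity

lemma integrable_hoelder {a : ℝ} (ha0 : 0 < a) (ha1 : a < 1) :
    Integrable (fun y : ℝ => |y| ^ (-1 - a) * min 2 (2 * Real.pi * |y|)) volume := by
  have hpi := Real.pi_pos
  have hm : Measurable (fun y : ℝ => y ^ (-1 - a) * min 2 (2 * Real.pi * y)) := by fun_prop
  have key : IntegrableOn (fun y : ℝ => y ^ (-1 - a) * min 2 (2 * Real.pi * y)) (Set.Ioi 0) := by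
    rw [← Set.Ioc_union_Ioi_eq_Ioi zero_le_one]
    refine IntegrableOn.union ?_ ?_
    · have h : IntegrableOn (fun y : ℝ => 2 * Real.pi * y ^ (-a)) (Set.Ioc 0 1) := by
        have := intervalIntegral.intervalIntegrable_rpow' (a := 0) (b := 1)
          (by linarith : -1 < -a)
        rw [intervalIntegrable_iff_integrableOn_Ioc_of_le zero_le_one] at this
        exact this.const_mul _
      refine h.mono' hm.aestronglyMeasurable ?_
      filter_upwards [ae_restrict_mem measurableSet_Ioc] with y hy
      have h0 := hy.1
      rw [Real.norm_of_nonneg (by positivity)]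
      calc y ^ (-1 - a) * min 2 (2 * Real.pi * y) ≤ y ^ (-1 - a) * (2 * Real.pi * y) := by
            gcongr; exact min_le_right _ _
        _ = 2 * Real.pi * (y ^ (-1 - a) * y ^ (1 : ℝ)) := by rw [Real.rpow_one]; ring
        _ = _ := by rw [← Real.rpow_add h0]; congr 2; ring
    · have h : IntegrableOn (fun y : ℝ => y ^ (-1 - a) * 2) (Set.Ioi 1) :=
        (integrableOn_Ioi_rpow_of_lt (by linarith) one_pos).mul_const _
      refine h.mono' hm.aestronglyMeasurable ?_
      filter_upwards [ae_restrict_mem measurableSet_Ioi] with y hy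
      have h0 : 0 < y := one_pos.trans hy
      rw [Real.norm_of_nonneg (by positivity)]
      gcongr
      exact min_le_left _ _
  exact integrable_comp_abs key

/-- The Fourier transform of a function that is `O(|x|^(-1-a))` is Hölder continuous of order `a`
at `0`. -/
theorem norm_fourier_sub_le {a K : ℝ} (ha0 : 0 < a) (ha1 : a < 1) {g : ℝ → ℂ}
    (hg : Integrable g volume) (hK : ∀ x, ‖g x‖ ≤ K * (1 + |x|) ^ (-(1 + a))) (ξ : ℝ) :
    ‖𝓕 g ξ - 𝓕 g 0‖ ≤ hoelderConst a * K * |ξ| ^ a := by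
  have hpi := Real.pi_pos
  have hK0 : 0 ≤ K := by simpa using (norm_nonneg _).trans (hK 0)
  rcases eq_or_ne ξ 0 with rfl | hξ
  · simp [Real.zero_rpow ha0.ne']
  have hξ' : 0 < |ξ| := abs_pos.2 hξ
  have e1 : 𝓕 g ξ - 𝓕 g 0
      = ∫ x, (Complex.exp (Complex.I * (-2 * Real.pi * x * ξ : ℝ)) - 1) * g x := by
    rw [Real.fourier_real_eq_integral_exp_smul, Real.fourier_real_eq_integral_exp_smul]
    have hi : ∀ η : ℝ, Integrable (fun x : ℝ =>
        Complex.exp ((-2 * Real.pi * x * η : ℝ) * Complex.I) • g x) volume := fun η => by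
      refine hg.bdd_mul (c := 1) (by fun_prop) (Eventually.of_forall fun x => ?_)
      rw [Complex.norm_exp_ofReal_mul_I]
    rw [← integral_sub (hi ξ) (hi 0)]
    refine integral_congr_ae (Eventually.of_forall fun x => ?_)
    simp only [smul_eq_mul, mul_zero, Complex.ofReal_zero, zero_mul, Complex.exp_zero]
    rw [mul_comm Complex.I]
    ring
  have hb : ∀ x : ℝ, ‖(Complex.exp (Complex.I * (-2 * Real.pi * x * ξ : ℝ)) - 1) * g x‖
      ≤ K * (|ξ| ^ (1 + a) * (|x * ξ| ^ (-1 - a) * min 2 (2 * Real.pi * |x * ξ|))) := by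
    intro x
    rw [norm_mul]
    rcases eq_or_ne x 0 with rfl | hx
    · simp
    have hx' : 0 < |x| := abs_pos.2 hx
    have b1 : ‖Complex.exp (Complex.I * (-2 * Real.pi * x * ξ : ℝ)) - 1‖
        ≤ min 2 (2 * Real.pi * |x * ξ|) := by
      refine le_min ?_ ?_
      · refine (norm_sub_le _ _).trans ?_
        rw [mul_comm Complex.I, Complex.norm_exp_ofReal_mul_I]
        norm_num
      · refine (Real.norm_exp_I_mul_ofReal_sub_one_le).trans_eq ?_
        rw [Real.norm_eq_abs, show -2 * Real.pi * x * ξ = -(2 * Real.pi * (x * ξ)) by ring,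
          abs_neg, abs_mul, abs_of_pos (by positivity)]
    have b2 : ‖g x‖ ≤ K * |x| ^ (-1 - a) := by
      refine (hK x).trans (mul_le_mul_of_nonneg_left ?_ hK0)
      rw [show -(1 + a) = -1 - a by ring]
      exact Real.rpow_le_rpow_of_nonpos hx' (by linarith) (by linarith)
    have e : |x| ^ (-1 - a) = |ξ| ^ (1 + a) * |x * ξ| ^ (-1 - a) := by
      rw [abs_mul, Real.mul_rpow hx'.le hξ'.le, mul_left_comm, ← Real.rpow_add hξ']
      simp
    calc _ ≤ min 2 (2 * Real.pi * |x * ξ|) * (K * |x| ^ (-1 - a)) := by gcongr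
      _ = _ := by rw [e]; ring
  have hi := ((((integrable_comp_mul_right_iff _ hξ).2 (integrable_hoelder ha0 ha1)).const_mul
    (|ξ| ^ (1 + a))).const_mul K)
  rw [e1]
  refine (norm_integral_le_of_norm_le hi (Eventually.of_forall hb)).trans_eq ?_
  rw [integral_const_mul, integral_const_mul, Measure.integral_comp_mul_right
    (fun y => |y| ^ (-1 - a) * min 2 (2 * Real.pi * |y|)) ξ, abs_inv, smul_eq_mul]
  unfold hoelderConst
  rw [Real.rpow_add hξ', Real.rpow_one]
  field_simp

/-- The square integral over the line of a power, damped by the heat semigroup. -/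
lemma l2Bd_heat_rpow {a σ : ℝ} (ha : 1 / 2 < a) (hσ : 0 < σ) :
    L2Bd (fun ξ => ((Real.exp (-(σ * (2 * Real.pi * ξ) ^ 2)) * |ξ| ^ (a - 1) : ℝ) : ℂ))
      (√(Real.Gamma (a - 1 / 2)) * σ ^ (1 / 4 - a / 2)) := by
  have hG := (Real.Gamma_pos_of_pos (by linarith : 0 < a - 1 / 2)).le
  have hpi := Real.pi_gt_three
  have hmeas : Measurable fun ξ : ℝ =>
      Real.exp (-(σ * (2 * Real.pi * ξ) ^ 2)) * |ξ| ^ (a - 1) := by fun_prop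
  have hle : ∀ ξ : ℝ, ‖((Real.exp (-(σ * (2 * Real.pi * ξ) ^ 2)) * |ξ| ^ (a - 1) : ℝ) : ℂ)‖ ^ 2
      ≤ |ξ| ^ (2 * a - 2) * Real.exp (-σ * |ξ| ^ (2 : ℝ)) := by
    intro ξ
    rw [Complex.norm_real, Real.norm_of_nonneg (by positivity), mul_pow, ← Real.exp_nat_mul,
      ← Real.rpow_natCast (|ξ| ^ (a - 1)), ← Real.rpow_mul (abs_nonneg _), mul_comm]
    have e : (a - 1) * ((2 : ℕ) : ℝ) = 2 * a - 2 := by push_cast; ring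
    rw [e]
    refine mul_le_mul_of_nonneg_left (Real.exp_le_exp.2 ?_) (by positivity)
    rw [Real.rpow_two, sq_abs]
    push_cast
    have h4 : (1 : ℝ) ≤ 2 * (2 * Real.pi) ^ 2 := by nlinarith
    have := mul_le_mul_of_nonneg_left h4 (mul_nonneg hσ.le (sq_nonneg ξ))
    nlinarith
  have hI := integrableOn_rpow_mul_exp_neg_mul_rpow (p := 2) (s := 2 * a - 2) (b := σ)
    (by linarith) (by norm_num) hσ
  have hI2 : Integrable (fun ξ : ℝ => |ξ| ^ (2 * a - 2) * Real.exp (-σ * |ξ| ^ (2 : ℝ))) volume :=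
    integrable_comp_abs hI
  refine l2Bd_of_integral (Complex.measurable_ofReal.comp hmeas).aestronglyMeasurable
    (by positivity) (hI2.mono' (by fun_prop) (Eventually.of_forall fun ξ => ?_)) ?_
  · rw [Real.norm_of_nonneg (by positivity)]
    exact hle ξ
  · calc _ ≤ ∫ ξ : ℝ, |ξ| ^ (2 * a - 2) * Real.exp (-σ * |ξ| ^ (2 : ℝ)) :=
          integral_mono_of_nonneg (Eventually.of_forall fun ξ => by positivity) hI2
            (Eventually.of_forall hle)
      _ = 2 * ∫ ξ in Set.Ioi (0 : ℝ), ξ ^ (2 * a - 2) * Real.exp (-σ * ξ ^ (2 : ℝ)) :=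
          integral_comp_abs (f := fun ξ => ξ ^ (2 * a - 2) * Real.exp (-σ * ξ ^ (2 : ℝ)))
      _ = σ ^ (-(a - 1 / 2)) * Real.Gamma (a - 1 / 2) := by
          rw [integral_rpow_mul_exp_neg_mul_rpow (by norm_num) (by linarith) hσ]
          rw [show (2 * a - 2 + 1) / 2 = a - 1 / 2 by ring,
            show -(2 * a - 2 + 1) / 2 = -(a - 1 / 2) by ring]
          ring
      _ = _ := by
          rw [mul_pow, Real.sq_sqrt hG, ← Real.rpow_natCast (σ ^ (1 / 4 - a / 2)),
            ← Real.rpow_mul hσ.le, mul_comm]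
          congr 2
          push_cast
          ring

/-- Decay under the heat semigroup of data that are `O(|ξ|^(a-1))` on the Fourier side. -/
lemma l2Bd_heat {a t A B : ℝ} (ha : 1 / 2 < a) (ha1 : a < 1) (ht : 0 ≤ t) (hA : 0 ≤ A)
    (hB : 0 ≤ B) {H : ℝ → ℂ} (hH : L2Bd H B) (hle : ∀ᵐ ξ, ‖H ξ‖ ≤ A * |ξ| ^ (a - 1)) :
    L2Bd (fun ξ => ((Real.exp (-(t * (2 * Real.pi * ξ) ^ 2)) : ℝ) : ℂ) * H ξ)
      (2 * (√(Real.Gamma (a - 1 / 2)) * A + B) * (1 + t) ^ (1 / 4 - a / 2)) := by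
  have hm : AEStronglyMeasurable
      (fun ξ : ℝ => ((Real.exp (-(t * (2 * Real.pi * ξ) ^ 2)) : ℝ) : ℂ) * H ξ) volume :=
    (by fun_prop : Continuous fun ξ : ℝ => ((Real.exp (-(t * (2 * Real.pi * ξ) ^ 2)) : ℝ) : ℂ)
      ).aestronglyMeasurable.mul hH.1
  have hp : ∀ {z : ℝ}, 0 < z → (1 + t) / 2 ≤ z → z ^ (1 / 4 - a / 2)
      ≤ 2 * (1 + t) ^ (1 / 4 - a / 2) := fun {z} hz h => by
    refine (Real.rpow_le_rpow_of_nonpos (by linarith) h (by linarith)).trans ?_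
    rw [Real.div_rpow (by linarith) (by norm_num), div_eq_mul_inv, mul_comm,
      ← Real.rpow_neg (by norm_num)]
    refine mul_le_mul_of_nonneg_right ?_ (Real.rpow_nonneg (by linarith) _)
    calc (2 : ℝ) ^ (-(1 / 4 - a / 2)) ≤ 2 ^ (1 : ℝ) :=
          Real.rpow_le_rpow_of_exponent_le (by norm_num) (by linarith)
      _ = 2 := by norm_num
  have h1t : 0 < 1 + t := by linarith
  have hpos : 0 ≤ (1 + t) ^ (1 / 4 - a / 2) := Real.rpow_nonneg h1t.le _
  rcases le_total t 1 with h1 | h1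
  · refine (hH.mono hm fun ξ => ?_).le ?_
    · rw [norm_mul, Complex.norm_real, Real.norm_of_nonneg (Real.exp_nonneg _)]
      refine mul_le_of_le_one_left (norm_nonneg _) (Real.exp_le_one_iff.2 ?_)
      have : 0 ≤ t * (2 * Real.pi * ξ) ^ 2 := by positivity
      linarith
    · have := hp one_pos (by linarith)
      rw [Real.one_rpow] at this
      have h2 := mul_le_mul_of_nonneg_left this hB
      have h3 : 0 ≤ √(Real.Gamma (a - 1 / 2)) * A * (1 + t) ^ (1 / 4 - a / 2) := by positivity
      nlinarith
  · have ht0 : 0 < t := by linarith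
    have h0 := (l2Bd_heat_rpow ha ht0).const_mul (A : ℂ)
    refine L2Bd.le (A := ‖(A : ℂ)‖ * (√(Real.Gamma (a - 1 / 2)) * t ^ (1 / 4 - a / 2)))
      ⟨hm, (eLpNorm_mono_ae ?_).trans h0.2⟩ ?_
    · filter_upwards [hle] with ξ hξ
      rw [norm_mul, norm_mul, Complex.norm_real, Complex.norm_real, Complex.norm_real,
        Real.norm_of_nonneg hA, Real.norm_of_nonneg (Real.exp_nonneg _),
        Real.norm_of_nonneg (by positivity)]
      calc _ ≤ Real.exp (-(t * (2 * Real.pi * ξ) ^ 2)) * (A * |ξ| ^ (a - 1)) := by gcongr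
        _ = _ := by ring
    · rw [Complex.norm_real, Real.norm_of_nonneg hA]
      calc A * (√(Real.Gamma (a - 1 / 2)) * t ^ (1 / 4 - a / 2))
          ≤ A * (√(Real.Gamma (a - 1 / 2)) * (2 * (1 + t) ^ (1 / 4 - a / 2))) := by
            gcongr
            exact hp ht0 (by linarith)
        _ ≤ _ := by
            have : 0 ≤ 2 * B * (1 + t) ^ (1 / 4 - a / 2) := by positivity
            nlinarith

/-- The time integrals of the Duhamel formula for the heat equation. -/
lemma integral_sub_rpow_mul_le {p q t : ℝ} (hp0 : 0 ≤ p) (hp : p < 1) (hq0 : 0 ≤ q) (hq : q < 1)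
    (ht : 0 ≤ t) :
    IntervalIntegrable (fun τ => (t - τ) ^ (-p) * (1 + τ) ^ (-q)) volume 0 t ∧
      ∫ τ in (0 : ℝ)..t, (t - τ) ^ (-p) * (1 + τ) ^ (-q)
        ≤ (4 / (1 - p) + 4 / (1 - q)) * (1 + t) ^ (1 - p - q) := by
  have h1p : 0 < 1 - p := by linarith
  have h1q : 0 < 1 - q := by linarith
  have h1t : 0 < 1 + t := by linarith
  have i1 : IntervalIntegrable (fun τ => (t - τ) ^ (-p)) volume 0 t := by
    have := (intervalIntegral.intervalIntegrable_rpow' (a := 0) (b := t)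
      (by linarith : -1 < -p)).comp_sub_left t
    simpa using this.symm
  have v1 : ∫ τ in (0 : ℝ)..t, (t - τ) ^ (-p) = t ^ (1 - p) / (1 - p) := by
    rw [intervalIntegral.integral_comp_sub_left (fun τ => τ ^ (-p)), sub_self, sub_zero,
      integral_rpow (Or.inl (by linarith)), Real.zero_rpow (by linarith)]
    rw [show -p + 1 = 1 - p by ring, sub_zero]
  obtain ⟨i2, v2⟩ := integral_one_add_rpow_le hq ht
  have hle1 : ∀ τ ∈ Set.Icc 0 t, (t - τ) ^ (-p) * (1 + τ) ^ (-q) ≤ (t - τ) ^ (-p) := by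
    intro τ hτ
    refine mul_le_of_le_one_right (Real.rpow_nonneg (by linarith [hτ.2]) _) ?_
    exact Real.rpow_le_one_of_one_le_of_nonpos (by linarith [hτ.1]) (by linarith)
  have i3 : IntervalIntegrable (fun τ => (t - τ) ^ (-p) * (1 + τ) ^ (-q)) volume 0 t := by
    refine i1.mono_fun (by fun_prop) ?_
    rw [Set.uIoc_of_le ht]
    filter_upwards [ae_restrict_mem measurableSet_Ioc] with τ hτ
    have h1 : 0 ≤ (t - τ) ^ (-p) := Real.rpow_nonneg (by linarith [hτ.2]) _
    have h2 : 0 ≤ (1 + τ) ^ (-q) := Real.rpow_nonneg (by linarith [hτ.1]) _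
    rw [Real.norm_of_nonneg (mul_nonneg h1 h2), Real.norm_of_nonneg h1]
    exact hle1 τ ⟨hτ.1.le, hτ.2⟩
  refine ⟨i3, ?_⟩
  have hfrac1 : 0 ≤ 4 / (1 - p) := by positivity
  have hfrac2 : 0 ≤ 4 / (1 - q) := by positivity
  have hpos : 0 ≤ (1 + t) ^ (1 - p - q) := Real.rpow_nonneg h1t.le _
  have half : ∀ {z r : ℝ}, 0 ≤ r → r ≤ 1 → (1 + t) / 4 ≤ z → z ^ (-r) ≤ 4 * (1 + t) ^ (-r) := by
    intro z r hr hr1 hz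
    refine (Real.rpow_le_rpow_of_nonpos (by linarith) hz (by linarith)).trans ?_
    rw [Real.div_rpow h1t.le (by norm_num), div_eq_mul_inv, mul_comm,
      ← Real.rpow_neg (by norm_num)]
    refine mul_le_mul_of_nonneg_right ?_ (Real.rpow_nonneg h1t.le _)
    calc (4 : ℝ) ^ (-(-r)) ≤ 4 ^ (1 : ℝ) :=
          Real.rpow_le_rpow_of_exponent_le (by norm_num) (by linarith)
      _ = 4 := by norm_num
  rcases le_total t 1 with h1 | h1
  · have e1 : t ^ (1 - p) ≤ 1 := Real.rpow_le_one ht h1 h1p.le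
    have e2 : (1 : ℝ) ≤ 2 * (1 + t) ^ (1 - p - q) := by
      have := Real.rpow_le_rpow_of_exponent_le (by linarith : 1 ≤ 1 + t)
        (by linarith : (-1 : ℝ) ≤ 1 - p - q)
      rw [Real.rpow_neg_one] at this
      have h2 : (2 : ℝ)⁻¹ ≤ (1 + t)⁻¹ := by gcongr; linarith
      linarith
    calc _ ≤ ∫ τ in (0 : ℝ)..t, (t - τ) ^ (-p) :=
          intervalIntegral.integral_mono_on ht i3 i1 hle1
      _ = t ^ (1 - p) / (1 - p) := v1
      _ ≤ (2 * (1 + t) ^ (1 - p - q)) / (1 - p) := by gcongr; exact e1.trans e2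
      _ ≤ 4 / (1 - p) * (1 + t) ^ (1 - p - q) := by
          rw [div_mul_eq_mul_div]
          gcongr
          norm_num
      _ ≤ _ := by gcongr; linarith
  · have hle2 : ∀ τ ∈ Set.Icc 0 t, (t - τ) ^ (-p) * (1 + τ) ^ (-q)
        ≤ 4 * (1 + t) ^ (-p) * (1 + τ) ^ (-q) + (t - τ) ^ (-p) * (4 * (1 + t) ^ (-q)) := by
      intro τ hτ
      have p1 : 0 ≤ (t - τ) ^ (-p) := Real.rpow_nonneg (by linarith [hτ.2]) _
      have p2 : 0 ≤ (1 + τ) ^ (-q) := Real.rpow_nonneg (by linarith [hτ.1]) _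
      have p3 : 0 ≤ (1 + t) ^ (-q) := Real.rpow_nonneg h1t.le _
      have p4 : 0 ≤ (1 + t) ^ (-p) := Real.rpow_nonneg h1t.le _
      rcases le_total τ (t / 2) with h | h
      · have := half hp0 hp.le (by linarith : (1 + t) / 4 ≤ t - τ)
        nlinarith [mul_le_mul_of_nonneg_right this p2, mul_nonneg p1 p3]
      · have := half hq0 hq.le (by linarith : (1 + t) / 4 ≤ 1 + τ)
        nlinarith [mul_le_mul_of_nonneg_left this p1, mul_nonneg p4 p2]
    have e1 : (1 + t) ^ (-p) * (1 + t) ^ (1 - q) = (1 + t) ^ (1 - p - q) := by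
      rw [← Real.rpow_add h1t]; congr 1; ring
    have e2 : (1 + t) ^ (1 - p) * (1 + t) ^ (-q) = (1 + t) ^ (1 - p - q) := by
      rw [← Real.rpow_add h1t, ← sub_eq_add_neg]
    calc _ ≤ ∫ τ in (0 : ℝ)..t, (4 * (1 + t) ^ (-p) * (1 + τ) ^ (-q)
          + (t - τ) ^ (-p) * (4 * (1 + t) ^ (-q))) :=
          intervalIntegral.integral_mono_on ht i3 ((i2.const_mul _).add (i1.mul_const _)) hle2
      _ = 4 * (1 + t) ^ (-p) * (∫ τ in (0 : ℝ)..t, (1 + τ) ^ (-q))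
          + t ^ (1 - p) / (1 - p) * (4 * (1 + t) ^ (-q)) := by
          rw [intervalIntegral.integral_add (i2.const_mul _) (i1.mul_const _),
            intervalIntegral.integral_const_mul, intervalIntegral.integral_mul_const, v1]
      _ ≤ 4 * (1 + t) ^ (-p) * ((1 + t) ^ (1 - q) / (1 - q))
          + (1 + t) ^ (1 - p) / (1 - p) * (4 * (1 + t) ^ (-q)) := by
          gcongr
          linarith
      _ = 4 / (1 - q) * ((1 + t) ^ (-p) * (1 + t) ^ (1 - q))
          + 4 / (1 - p) * ((1 + t) ^ (1 - p) * (1 + t) ^ (-q)) := by ring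
      _ = _ := by rw [e1, e2]; ring

/-! ### Differentiation of families of square integrable functions -/

/-- A family with a dominated derivative is differentiable as a family in `L²`. -/
lemma hasDerivAt_toL2C {a b τ₀ : ℝ} (hτ₀ : τ₀ ∈ Set.Ioo a b) {F F' : ℝ → ℝ → ℂ} {D : ℝ → ℝ}
    (hD : MemLp D 2 volume) (hF : ∀ τ ∈ Set.Ioo a b, MemLp (F τ) 2 volume)
    (hF' : AEStronglyMeasurable (F' τ₀) volume)
    (hd : ∀ τ ∈ Set.Ioo a b, ∀ x, HasDerivAt (fun τ => F τ x) (F' τ x) τ)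
    (hb : ∀ τ ∈ Set.Ioo a b, ∀ x, ‖F' τ x‖ ≤ D x) :
    HasDerivAt (fun τ => toL2C (F τ)) (toL2C (F' τ₀)) τ₀ := by
  rw [hasDerivAt_iff_tendsto_slope]
  have hU : Set.Ioo a b ∈ 𝓝[≠] τ₀ := mem_nhdsWithin_of_mem_nhds (Ioo_mem_nhds hτ₀.1 hτ₀.2)
  have key : Tendsto (fun τ => toL2C fun x => ((τ - τ₀)⁻¹ : ℝ) * (F τ x - F τ₀ x)) (𝓝[≠] τ₀)
      (𝓝 (toL2C (F' τ₀))) := by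
    refine tendsto_toL2C hD ?_ hF' ?_ (hb τ₀ hτ₀) fun x => ?_
    · filter_upwards [hU] with τ hτ
      exact ((hF τ hτ).1.sub (hF τ₀ hτ₀).1).const_mul _
    · filter_upwards [hU, self_mem_nhdsWithin] with τ hτ hne x
      have h := (convex_Ioo a b).norm_image_sub_le_of_norm_hasDerivWithin_le
        (fun σ hσ => (hd σ hσ x).hasDerivWithinAt) (fun σ hσ => hb σ hσ x) hτ₀ hτ
      have hpos : 0 < ‖τ - τ₀‖ := norm_pos_iff.2 (sub_ne_zero.2 hne)
      rw [norm_mul, Complex.norm_real, norm_inv, inv_mul_le_iff₀ hpos, mul_comm]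
      exact h
    · have := (hasDerivAt_iff_tendsto_slope.1 (hd τ₀ hτ₀ x))
      refine this.congr fun τ => ?_
      rw [slope_def_module, Complex.real_smul]
  refine key.congr' ?_
  filter_upwards [hU] with τ hτ
  rw [slope_def_module, ← toL2C_sub (hF τ hτ) (hF τ₀ hτ₀),
    toL2C_const_mul _ (show MemLp (fun x => F τ x - F τ₀ x) 2 volume from
      (hF τ hτ).sub (hF τ₀ hτ₀))]
  exact Complex.coe_smul _ _

/-- Multiplication of a square integrable function by a bounded function. -/
def mulL2 (m : ℝ → ℂ) (G : L2C) : L2C := toL2C fun x => m x * G x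

section mulL2

variable {m : ℝ → ℂ} {C : ℝ}

lemma memLp_mul (hm : AEStronglyMeasurable m volume) (hC : ∀ x, ‖m x‖ ≤ C) (G : L2C) :
    MemLp (fun x => m x * G x) 2 volume :=
  (Lp.memLp G).of_le_mul (c := C) (hm.mul (Lp.aestronglyMeasurable G))
    (Eventually.of_forall fun x => by
      rw [norm_mul]
      exact mul_le_mul_of_nonneg_right (hC x) (norm_nonneg _))

lemma coeFn_mulL2 (hm : AEStronglyMeasurable m volume) (hC : ∀ x, ‖m x‖ ≤ C) (G : L2C) :
    mulL2 m G =ᵐ[volume] fun x => m x * G x := coeFn_toL2C (memLp_mul hm hC G)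

lemma norm_mulL2_le (hm : AEStronglyMeasurable m volume) (hC : ∀ x, ‖m x‖ ≤ C)
    (G : L2C) : ‖mulL2 m G‖ ≤ C * ‖G‖ := by
  refine Lp.norm_le_mul_norm_of_ae_le_mul ?_
  filter_upwards [coeFn_mulL2 hm hC G] with x hx
  rw [hx, norm_mul]
  exact mul_le_mul_of_nonneg_right (hC x) (norm_nonneg _)

lemma mulL2_add (hm : AEStronglyMeasurable m volume) (hC : ∀ x, ‖m x‖ ≤ C) (G H : L2C) :
    mulL2 m (G + H) = mulL2 m G + mulL2 m H := by
  unfold mulL2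
  rw [← toL2C_add (memLp_mul hm hC G) (memLp_mul hm hC H)]
  refine toL2C_congr ?_
  filter_upwards [Lp.coeFn_add G H] with x hx
  rw [hx, Pi.add_apply, mul_add]

lemma mulL2_sub (hm : AEStronglyMeasurable m volume) (hC : ∀ x, ‖m x‖ ≤ C) (G H : L2C) :
    mulL2 m (G - H) = mulL2 m G - mulL2 m H := by
  unfold mulL2
  rw [← toL2C_sub (memLp_mul hm hC G) (memLp_mul hm hC H)]
  refine toL2C_congr ?_
  filter_upwards [Lp.coeFn_sub G H] with x hx
  rw [hx, Pi.sub_apply, mul_sub]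

lemma mulL2_smul (hm : AEStronglyMeasurable m volume) (hC : ∀ x, ‖m x‖ ≤ C) (c : ℝ) (G : L2C) :
    mulL2 m (c • G) = c • mulL2 m G := by
  have : c • mulL2 m G = (c : ℂ) • mulL2 m G := (Complex.coe_smul _ _).symm
  rw [this]
  unfold mulL2
  rw [← toL2C_const_mul _ (memLp_mul hm hC G)]
  refine toL2C_congr ?_
  filter_upwards [Lp.coeFn_smul c G] with x hx
  rw [hx, Pi.smul_apply, Complex.real_smul]
  ring

end mulL2

lemma tendsto_mulL2 {ι : Type*} {l : Filter ι} [l.IsCountablyGenerated] {m : ι → ℝ → ℂ}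
    {m₀ : ℝ → ℂ} {C : ℝ} (hm : ∀ᶠ i in l, AEStronglyMeasurable (m i) volume)
    (hm₀ : AEStronglyMeasurable m₀ volume) (hb : ∀ᶠ i in l, ∀ x, ‖m i x‖ ≤ C)
    (hb₀ : ∀ x, ‖m₀ x‖ ≤ C) (h : ∀ x, Tendsto (fun i => m i x) l (𝓝 (m₀ x))) {G : ι → L2C}
    {G₀ : L2C} (hG : Tendsto G l (𝓝 G₀)) :
    Tendsto (fun i => mulL2 (m i) (G i)) l (𝓝 (mulL2 m₀ G₀)) := by
  have h1 : Tendsto (fun i => mulL2 (m i) G₀) l (𝓝 (mulL2 m₀ G₀)) := by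
    refine tendsto_toL2C (D := fun x => C * ‖G₀ x‖) ((Lp.memLp G₀).norm.const_mul C) ?_
      (hm₀.mul (Lp.aestronglyMeasurable G₀)) ?_ (fun x => ?_) fun x => (h x).mul_const _
    · filter_upwards [hm] with i hi using hi.mul (Lp.aestronglyMeasurable G₀)
    · filter_upwards [hb] with i hi x
      rw [norm_mul]
      exact mul_le_mul_of_nonneg_right (hi x) (norm_nonneg _)
    · rw [norm_mul]
      exact mul_le_mul_of_nonneg_right (hb₀ x) (norm_nonneg _)
  have h2 : Tendsto (fun i => mulL2 (m i) (G i - G₀)) l (𝓝 0) := by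
    have h3 : Tendsto (fun i => C * ‖G i - G₀‖) l (𝓝 0) := by
      have := ((tendsto_iff_norm_sub_tendsto_zero.1 hG).const_mul C)
      rwa [mul_zero] at this
    refine squeeze_zero_norm' ?_ h3
    filter_upwards [hm, hb] with i h1 h2 using norm_mulL2_le h1 h2 _
  have := h2.add h1
  rw [zero_add] at this
  refine this.congr' ?_
  filter_upwards [hm, hb] with i h1 h2
  rw [← mulL2_add h1 h2, sub_add_cancel]

lemma hasDerivAt_mulL2 {a b τ₀ : ℝ} (hτ₀ : τ₀ ∈ Set.Ioo a b) {m m' : ℝ → ℝ → ℂ} {C : ℝ}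
    (hm : ∀ τ ∈ Set.Ioo a b, AEStronglyMeasurable (m τ) volume)
    (hm' : AEStronglyMeasurable (m' τ₀) volume)
    (hd : ∀ τ ∈ Set.Ioo a b, ∀ x, HasDerivAt (fun τ => m τ x) (m' τ x) τ)
    (hb : ∀ τ ∈ Set.Ioo a b, ∀ x, ‖m τ x‖ ≤ C) (hb' : ∀ τ ∈ Set.Ioo a b, ∀ x, ‖m' τ x‖ ≤ C)
    {G : ℝ → L2C} {G' : L2C} (hG : HasDerivAt G G' τ₀) :
    HasDerivAt (fun τ => mulL2 (m τ) (G τ)) (mulL2 (m' τ₀) (G τ₀) + mulL2 (m τ₀) G') τ₀ := by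
  have hU : Set.Ioo a b ∈ 𝓝[≠] τ₀ := mem_nhdsWithin_of_mem_nhds (Ioo_mem_nhds hτ₀.1 hτ₀.2)
  have h1 : HasDerivAt (fun τ => mulL2 (m τ) (G τ₀)) (mulL2 (m' τ₀) (G τ₀)) τ₀ := by
    refine hasDerivAt_toL2C (F' := fun τ x => m' τ x * G τ₀ x) hτ₀
      (D := fun x => C * ‖G τ₀ x‖) ((Lp.memLp (G τ₀)).norm.const_mul C)
      (fun τ hτ => memLp_mul (hm τ hτ) (hb τ hτ) _) (hm'.mul (Lp.aestronglyMeasurable _))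
      (fun τ hτ x => (hd τ hτ x).mul_const _) fun τ hτ x => ?_
    rw [norm_mul]
    exact mul_le_mul_of_nonneg_right (hb' τ hτ x) (norm_nonneg _)
  rw [hasDerivAt_iff_tendsto_slope] at h1 hG ⊢
  have h2 := tendsto_mulL2 (by filter_upwards [hU] with τ hτ using hm τ hτ) (hm τ₀ hτ₀)
    (by filter_upwards [hU] with τ hτ using hb τ hτ) (hb τ₀ hτ₀)
    (fun x => (hd τ₀ hτ₀ x).continuousAt.tendsto.mono_left nhdsWithin_le_nhds) hG
  refine (h1.add h2).congr' ?_
  filter_upwards [hU] with τ hτ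
  simp only [slope_def_module]
  rw [mulL2_smul (hm τ hτ) (hb τ hτ), mulL2_sub (hm τ hτ) (hb τ hτ), ← smul_add]
  congr 1
  abel

/-! ### The Hopf–Cole factor -/

/-- The Hopf–Cole factor `θ(τ, x)`, the positive solution of the heat equation with
`βχ = -2 θ_x / θ`. -/
def hcF (β M τ x : ℝ) : ℂ := (hopfCole β M (x / √(1 + τ)) : ℝ)

/-- The space derivative of the Hopf–Cole factor. -/
def hcF1 (β M τ x : ℝ) : ℂ := (hopfCole' β M (x / √(1 + τ)) / √(1 + τ) : ℝ)

/-- The second space derivative, and the time derivative, of the Hopf–Cole factor. -/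
def hcF2 (β M τ x : ℝ) : ℂ :=
  (-(x / √(1 + τ) / 2) * hopfCole' β M (x / √(1 + τ)) / (1 + τ) : ℝ)

section HopfCole

variable {β M : ℝ}

lemma hasDerivAt_hcF (β M τ x : ℝ) : HasDerivAt (hcF β M τ) (hcF1 β M τ x) x := by
  have h1 : HasDerivAt (fun x : ℝ => x / √(1 + τ)) (1 / √(1 + τ)) x :=
    (hasDerivAt_id x).div_const _
  have h2 := ((hasDerivAt_hopfCole β M (x / √(1 + τ))).comp x h1).ofReal_comp
  refine h2.congr_deriv ?_
  unfold hcF1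
  rw [mul_one_div]

lemma hasDerivAt_hcF1 {τ : ℝ} (hτ : 0 ≤ τ) (x : ℝ) :
    HasDerivAt (hcF1 β M τ) (hcF2 β M τ x) x := by
  have hs : √(1 + τ) * √(1 + τ) = 1 + τ := Real.mul_self_sqrt (by linarith)
  have h1 : HasDerivAt (fun x : ℝ => x / √(1 + τ)) (1 / √(1 + τ)) x :=
    (hasDerivAt_id x).div_const _
  have h2 := (((hasDerivAt_hopfCole' β M (x / √(1 + τ))).comp x h1).div_const
    √(1 + τ)).ofReal_comp
  refine h2.congr_deriv ?_
  unfold hcF2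
  congr 1
  rw [mul_one_div, div_div _ √(1 + τ) √(1 + τ), hs]

lemma hasDerivAt_hcF_time {τ : ℝ} (hτ : 0 ≤ τ) (x : ℝ) :
    HasDerivAt (fun τ => hcF β M τ x) (hcF2 β M τ x) τ := by
  have h1τ : 0 < 1 + τ := by linarith
  have hs : √(1 + τ) * √(1 + τ) = 1 + τ := Real.mul_self_sqrt h1τ.le
  have hs0 : 0 < √(1 + τ) := Real.sqrt_pos.2 h1τ
  have h0 : HasDerivAt (fun τ : ℝ => √(1 + τ)) (1 / (2 * √(1 + τ))) τ := by
    have := ((hasDerivAt_id τ).const_add 1).sqrt h1τ.ne'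
    simpa using this
  have h1 : HasDerivAt (fun τ : ℝ => x / √(1 + τ))
      ((0 * √(1 + τ) - x * (1 / (2 * √(1 + τ)))) / √(1 + τ) ^ 2) τ :=
    (hasDerivAt_const τ x).div h0 hs0.ne'
  have h2 := ((hasDerivAt_hopfCole β M (x / √(1 + τ))).comp τ h1).ofReal_comp
  refine h2.congr_deriv ?_
  unfold hcF2
  congr 1
  rw [sq, hs]
  field_simp
  ring

lemma contDiff_hopfCole (β M : ℝ) : ContDiff ℝ ((⊤ : ℕ∞) : WithTop ℕ∞) (hopfCole β M) := by
  rw [contDiff_infty_iff_deriv]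
  refine ⟨fun z => (hasDerivAt_hopfCole β M z).differentiableAt, ?_⟩
  have : deriv (hopfCole β M) = fun z => hopfCole' β M z :=
    funext fun z => (hasDerivAt_hopfCole β M z).deriv
  rw [this]
  unfold hopfCole'
  fun_prop

lemma contDiff_hcF (β M τ : ℝ) : ContDiff ℝ ((⊤ : ℕ∞) : WithTop ℕ∞) (hcF β M τ) :=
  Complex.ofRealCLM.contDiff.comp
    ((contDiff_hopfCole β M).comp (contDiff_id.div_const √(1 + τ)))

lemma contDiff_hcF1 (β M τ : ℝ) : ContDiff ℝ ((⊤ : ℕ∞) : WithTop ℕ∞) (hcF1 β M τ) := by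
  have : deriv (hcF β M τ) = hcF1 β M τ := funext fun x => (hasDerivAt_hcF β M τ x).deriv
  rw [← this]
  exact (contDiff_infty_iff_deriv.1 (contDiff_hcF β M τ)).2

lemma aestronglyMeasurable_hcF (β M τ : ℝ) : AEStronglyMeasurable (hcF β M τ) volume :=
  (contDiff_hcF β M τ).continuous.aestronglyMeasurable

lemma aestronglyMeasurable_hcF1 (β M τ : ℝ) : AEStronglyMeasurable (hcF1 β M τ) volume :=
  (contDiff_hcF1 β M τ).continuous.aestronglyMeasurable

lemma aestronglyMeasurable_hcF2 (β M τ : ℝ) : AEStronglyMeasurable (hcF2 β M τ) volume := by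
  refine Continuous.aestronglyMeasurable ?_
  unfold hcF2 hopfCole'
  fun_prop

lemma norm_hcF_le (hM : |β * M| ≤ 2) (τ x : ℝ) : ‖hcF β M τ x‖ ≤ 6 := by
  unfold hcF
  rw [Complex.norm_real, Real.norm_of_nonneg (by linarith [hopfCole_ge hM (x / √(1 + τ))])]
  exact hopfCole_le hM _

lemma one_third_le_norm_hcF (hM : |β * M| ≤ 2) (τ x : ℝ) : 1 / 3 ≤ ‖hcF β M τ x‖ := by
  unfold hcF
  rw [Complex.norm_real]
  exact (hopfCole_ge hM _).trans (le_abs_self _)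

lemma one_le_sqrt_one_add {τ : ℝ} (hτ : 0 ≤ τ) : 1 ≤ √(1 + τ) :=
  Real.one_le_sqrt.2 (by linarith)

lemma norm_hcF1_le (hM : |β * M| ≤ 2) {τ : ℝ} (hτ : 0 ≤ τ) (x : ℝ) : ‖hcF1 β M τ x‖ ≤ 6 := by
  have h1 := one_le_sqrt_one_add hτ
  have h2 := abs_hopfCole'_le hM (x / √(1 + τ))
  have h3 : Real.exp (-(x / √(1 + τ)) ^ 2 / 4) ≤ 1 := by
    rw [Real.exp_le_one_iff]
    have := sq_nonneg (x / √(1 + τ))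
    linarith
  unfold hcF1
  rw [Complex.norm_real, Real.norm_eq_abs, abs_div, abs_of_pos (by linarith : 0 < √(1 + τ))]
  have h4 := abs_nonneg (hopfCole' β M (x / √(1 + τ)))
  refine (div_le_self h4 h1).trans (h2.trans ?_)
  nlinarith [Real.exp_pos (-(x / √(1 + τ)) ^ 2 / 4), abs_nonneg (β * M)]

lemma norm_hcF2_le (hM : |β * M| ≤ 2) {τ : ℝ} (hτ : 0 ≤ τ) (x : ℝ) : ‖hcF2 β M τ x‖ ≤ 6 := by
  set z := x / √(1 + τ)
  have h2 := abs_hopfCole'_le hM z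
  have h3 := abs_pow_mul_exp_le 1 z
  norm_num at h3
  have hz := abs_nonneg z
  have h5 : |z| * |hopfCole' β M z| ≤ 5 := by
    have h6 : |hopfCole' β M z| ≤ Real.exp (-z ^ 2 / 4) := by
      refine h2.trans (mul_le_of_le_one_left (Real.exp_nonneg _) (by linarith))
    exact (mul_le_mul_of_nonneg_left h6 hz).trans h3
  change ‖((-(z / 2) * hopfCole' β M z / (1 + τ) : ℝ) : ℂ)‖ ≤ 6
  rw [Complex.norm_real, Real.norm_eq_abs, abs_div, abs_of_pos (by linarith : 0 < 1 + τ)]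
  refine (div_le_self (abs_nonneg _) (by linarith)).trans ?_
  rw [abs_mul, abs_neg, abs_div, abs_two]
  linarith

lemma chi_mul_hcF (hβ : β ≠ 0) (hM : |β * M| ≤ 2) (τ x : ℝ) :
    hcF β M τ x * ((-β : ℂ) * (chi β M τ x : ℂ)) = 2 * hcF1 β M τ x := by
  have h1 := hopfCole_ge hM (x / √(1 + τ))
  have h2 : hopfCole β M (x / √(1 + τ)) ≠ 0 := by linarith
  have : hopfCole β M (x / √(1 + τ)) * (-β * chi β M τ x)
      = 2 * (hopfCole' β M (x / √(1 + τ)) / √(1 + τ)) := by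
    unfold chi
    rw [chiStar_eq]
    field_simp
  unfold hcF hcF1
  exact_mod_cast this

lemma norm_hcF1_le_chi (hβ : β ≠ 0) (hM : |β * M| ≤ 2) (τ x : ℝ) :
    ‖hcF1 β M τ x‖ ≤ 3 * |β| * ‖(chi β M τ x : ℂ)‖ := by
  have h := congrArg norm (chi_mul_hcF hβ hM τ x)
  rw [norm_mul, norm_mul, norm_mul, norm_neg, Complex.norm_real β, Real.norm_eq_abs,
    Complex.norm_ofNat] at h
  have h6 := norm_hcF_le hM τ x
  have h7 : 0 ≤ |β| * ‖(chi β M τ x : ℂ)‖ := by positivity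
  nlinarith

/-! ### Duhamel's formula for the Hopf–Cole variable -/

lemma fourier_mulL2_deriv {F F' : L2C} {θ θ' : ℝ → ℂ} {C : ℝ}
    (h : ∀ᵐ ξ, (𝓕 F' : L2C) ξ = 2 * Real.pi * Complex.I * ξ * (𝓕 F : L2C) ξ)
    (hθ : ContDiff ℝ ((⊤ : ℕ∞) : WithTop ℕ∞) θ) (hd : ∀ x, HasDerivAt θ (θ' x) x)
    (hm : AEStronglyMeasurable θ' volume) (hC : ∀ x, ‖θ x‖ ≤ C) (hC' : ∀ x, ‖θ' x‖ ≤ C) :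
    ∀ᵐ ξ, (𝓕 (mulL2 θ' F + mulL2 θ F') : L2C) ξ
      = 2 * Real.pi * Complex.I * ξ * (𝓕 (mulL2 θ F) : L2C) ξ := by
  have hd' : deriv θ = θ' := funext fun x => (hd x).deriv
  have m1 := memLp_mul hm hC' F
  have m2 := memLp_mul hθ.continuous.aestronglyMeasurable hC F'
  have := fourier_mul_deriv (f := F) (f' := F') (Lp.memLp F) (Lp.memLp F')
    (by rwa [toL2C_coeFn, toL2C_coeFn]) hθ
    (memLp_mul hθ.continuous.aestronglyMeasurable hC F) (by rw [hd']; exact m1.add m2)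
  rw [hd', toL2C_add m1 m2] at this
  exact this

lemma coeFn_fourier_add (F G : L2C) :
    (𝓕 (F + G) : L2C) =ᵐ[volume] fun ξ => (𝓕 F : L2C) ξ + (𝓕 G : L2C) ξ := by
  have : (𝓕 (F + G) : L2C) = 𝓕 F + 𝓕 G := (Lp.fourierTransformₗᵢ ℝ ℂ).map_add F G
  rw [this]
  exact Lp.coeFn_add _ _

/-- The Hopf–Cole transformation: multiplication by `θ` turns the linearized Burgers operator into
the heat operator. -/
lemma fourier_hopfCole (hβ : β ≠ 0) (hM : |β * M| ≤ 2) {τ : ℝ} (hτ : 0 ≤ τ)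
    {W w w' P P' Q : L2C}
    (hw : ∀ᵐ ξ, (𝓕 w : L2C) ξ = 2 * Real.pi * Complex.I * ξ * (𝓕 W : L2C) ξ)
    (hw' : ∀ᵐ ξ, (𝓕 w' : L2C) ξ = 2 * Real.pi * Complex.I * ξ * (𝓕 w : L2C) ξ)
    (hP : ∀ᵐ ξ, (𝓕 P' : L2C) ξ = 2 * Real.pi * Complex.I * ξ * (𝓕 P : L2C) ξ) :
    ∀ᵐ ξ, (𝓕 (mulL2 (hcF2 β M τ) W + mulL2 (hcF β M τ)
        (w' + mulL2 (fun x => (-β : ℂ) * (chi β M τ x : ℂ)) w + P' + Q)) : L2C) ξ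
      = (2 * Real.pi * Complex.I * ξ) ^ 2 * (𝓕 (mulL2 (hcF β M τ) W) : L2C) ξ
        + (2 * Real.pi * Complex.I * ξ * (𝓕 (mulL2 (hcF β M τ) P) : L2C) ξ
          - (𝓕 (mulL2 (hcF1 β M τ) P) : L2C) ξ + (𝓕 (mulL2 (hcF β M τ) Q) : L2C) ξ) := by
  have c0 := norm_hcF_le hM τ
  have c1 := norm_hcF1_le hM hτ
  have c2 := norm_hcF2_le hM hτ
  have m0 := aestronglyMeasurable_hcF β M τ
  have m1 := aestronglyMeasurable_hcF1 β M τ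
  have m2 := aestronglyMeasurable_hcF2 β M τ
  have eχ : mulL2 (hcF β M τ) (mulL2 (fun x => (-β : ℂ) * (chi β M τ x : ℂ)) w)
      = mulL2 (hcF1 β M τ) w + mulL2 (hcF1 β M τ) w := by
    have mχ : AEStronglyMeasurable (fun x => (-β : ℂ) * (chi β M τ x : ℂ)) volume :=
      (continuous_const.mul (Complex.continuous_ofReal.comp
        (continuous_chi hβ hM τ))).aestronglyMeasurable
    have cχ : ∀ x, ‖(-β : ℂ) * (chi β M τ x : ℂ)‖ ≤ |β| * (3 * |M|) := fun x => by
      rw [norm_mul, norm_neg, Complex.norm_real, Complex.norm_real, Real.norm_eq_abs,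
        Real.norm_eq_abs]
      exact mul_le_mul_of_nonneg_left (abs_chi_le hβ hM hτ x) (abs_nonneg _)
    refine Lp.ext ?_
    filter_upwards [coeFn_mulL2 m0 c0 (mulL2 (fun x => (-β : ℂ) * (chi β M τ x : ℂ)) w),
      coeFn_mulL2 mχ cχ w, Lp.coeFn_add (mulL2 (hcF1 β M τ) w) (mulL2 (hcF1 β M τ) w),
      coeFn_mulL2 m1 c1 w] with x e1 e2 e3 e4
    rw [e1, e2, e3, Pi.add_apply, e4, ← mul_assoc, chi_mul_hcF hβ hM]
    ring
  have e : mulL2 (hcF2 β M τ) W + mulL2 (hcF β M τ)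
        (w' + mulL2 (fun x => (-β : ℂ) * (chi β M τ x : ℂ)) w + P' + Q)
      = (mulL2 (hcF2 β M τ) W + mulL2 (hcF1 β M τ) w)
        + (mulL2 (hcF1 β M τ) w + mulL2 (hcF β M τ) w')
        + mulL2 (hcF β M τ) P' + mulL2 (hcF β M τ) Q := by
    rw [mulL2_add m0 c0, mulL2_add m0 c0, mulL2_add m0 c0, eχ]
    abel
  have d1 := fourier_mulL2_deriv hw (contDiff_hcF1 β M τ) (hasDerivAt_hcF1 hτ) m2 c1 c2
  have d2 := fourier_mulL2_deriv hw' (contDiff_hcF β M τ) (hasDerivAt_hcF β M τ) m1 c0 c1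
  have d3 := fourier_mulL2_deriv hw (contDiff_hcF β M τ) (hasDerivAt_hcF β M τ) m1 c0 c1
  have d4 := fourier_mulL2_deriv hP (contDiff_hcF β M τ) (hasDerivAt_hcF β M τ) m1 c0 c1
  rw [e]
  filter_upwards [d1, d2, d3, d4, coeFn_fourier_add ((mulL2 (hcF2 β M τ) W
      + mulL2 (hcF1 β M τ) w) + (mulL2 (hcF1 β M τ) w + mulL2 (hcF β M τ) w')
      + mulL2 (hcF β M τ) P') (mulL2 (hcF β M τ) Q),
    coeFn_fourier_add ((mulL2 (hcF2 β M τ) W + mulL2 (hcF1 β M τ) w)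
      + (mulL2 (hcF1 β M τ) w + mulL2 (hcF β M τ) w')) (mulL2 (hcF β M τ) P'),
    coeFn_fourier_add (mulL2 (hcF2 β M τ) W + mulL2 (hcF1 β M τ) w)
      (mulL2 (hcF1 β M τ) w + mulL2 (hcF β M τ) w'),
    coeFn_fourier_add (mulL2 (hcF1 β M τ) W) (mulL2 (hcF β M τ) w),
    coeFn_fourier_add (mulL2 (hcF1 β M τ) P) (mulL2 (hcF β M τ) P')]
    with ξ d1 d2 d3 d4 a1 a2 a3 a4 a5
  rw [a1, a2, a3, d1, d2]
  rw [a4] at d3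
  rw [a5] at d4
  linear_combination (2 * Real.pi * Complex.I * ξ) * d3 + d4

end HopfCole

lemma l2Bd_coeC (G : L2C) : L2Bd G ‖G‖ := by
  refine ⟨Lp.aestronglyMeasurable G, ?_⟩
  rw [Lp.norm_def, ENNReal.ofReal_toReal (Lp.eLpNorm_ne_top G)]

/-- The symbol of the heat semigroup at the time `σ`. -/
def heatSym (σ ξ : ℝ) : ℂ := (Real.exp (-(σ * (2 * Real.pi * ξ) ^ 2)) : ℝ)

lemma continuous_heatSym (σ : ℝ) : Continuous (heatSym σ) := by
  unfold heatSym
  fun_prop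

lemma norm_heatSym_le {σ : ℝ} (hσ : 0 ≤ σ) (ξ : ℝ) : ‖heatSym σ ξ‖ ≤ 1 := by
  unfold heatSym
  rw [Complex.norm_real, Real.norm_of_nonneg (Real.exp_nonneg _), Real.exp_le_one_iff]
  have : 0 ≤ σ * (2 * Real.pi * ξ) ^ 2 := by positivity
  linarith

lemma neg_two_pi_I_mul_sq (ξ : ℝ) :
    -(2 * Real.pi * Complex.I * ξ) ^ 2 = (((2 * Real.pi * ξ) ^ 2 : ℝ) : ℂ) := by
  push_cast
  linear_combination -(2 * Real.pi * (ξ : ℂ)) ^ 2 * Complex.I_sq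

lemma hasDerivAt_heatSym (t τ ξ : ℝ) : HasDerivAt (fun τ => heatSym (t - τ) ξ)
    (-(2 * Real.pi * Complex.I * ξ) ^ 2 * heatSym (t - τ) ξ) τ := by
  have h1 : HasDerivAt (fun τ : ℝ => -((t - τ) * (2 * Real.pi * ξ) ^ 2))
      ((2 * Real.pi * ξ) ^ 2) τ := by
    have := (((hasDerivAt_id τ).const_sub t).mul_const ((2 * Real.pi * ξ) ^ 2)).neg
    exact this.congr_deriv (by simp)
  refine h1.exp.ofReal_comp.congr_deriv ?_
  rw [neg_two_pi_I_mul_sq]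
  unfold heatSym
  push_cast
  ring

lemma abs_mul_exp_neg_sq_le (y : ℝ) : |y| * Real.exp (-y ^ 2) ≤ 1 := by
  have h1 := Real.add_one_le_exp (y ^ 2)
  have h2 : |y| ≤ Real.exp (y ^ 2) := by
    have := sq_abs y
    nlinarith [sq_nonneg (|y| - 1), abs_nonneg y]
  rw [Real.exp_neg, ← div_eq_mul_inv, div_le_one (Real.exp_pos _)]
  exact h2

lemma norm_deriv_heatSym_le {σ : ℝ} (hσ : 0 < σ) (ξ : ℝ) :
    ‖2 * Real.pi * Complex.I * ξ * heatSym σ ξ‖ ≤ σ ^ (-(1 / 2) : ℝ) := by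
  have hs : 0 < √σ := Real.sqrt_pos.2 hσ
  have h := abs_mul_exp_neg_sq_le (√σ * (2 * Real.pi * ξ))
  have e1 : -(√σ * (2 * Real.pi * ξ)) ^ 2 = -(σ * (2 * Real.pi * ξ) ^ 2) := by
    rw [mul_pow, Real.sq_sqrt hσ.le]
  rw [e1, abs_mul, abs_of_pos hs] at h
  have e2 : ‖2 * Real.pi * Complex.I * ξ * heatSym σ ξ‖
      = |2 * Real.pi * ξ| * Real.exp (-(σ * (2 * Real.pi * ξ) ^ 2)) := by
    unfold heatSym
    rw [norm_mul, Complex.norm_real, Real.norm_of_nonneg (Real.exp_nonneg _)]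
    congr 1
    rw [norm_mul, norm_mul, norm_mul, Complex.norm_I, Complex.norm_real, Complex.norm_real,
      Complex.norm_ofNat, Real.norm_of_nonneg Real.pi_pos.le, abs_mul, abs_mul, abs_two,
      abs_of_pos Real.pi_pos, Real.norm_eq_abs, mul_one]
  rw [e2, Real.rpow_neg hσ.le, ← Real.sqrt_eq_rpow, ← one_div, le_div_iff₀ hs]
  linarith

lemma norm_deriv2_heatSym_le {σ η : ℝ} (hη : 0 < η) (hσ : η ≤ σ) (ξ : ℝ) :
    ‖-(2 * Real.pi * Complex.I * ξ) ^ 2 * heatSym σ ξ‖ ≤ 1 / η := by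
  have e : -(2 * Real.pi * Complex.I * ξ) ^ 2 * heatSym σ ξ
      = (((2 * Real.pi * ξ) ^ 2 * Real.exp (-(σ * (2 * Real.pi * ξ) ^ 2)) : ℝ) : ℂ) := by
    rw [neg_two_pi_I_mul_sq]
    unfold heatSym
    push_cast
    rfl
  rw [e, Complex.norm_real, Real.norm_of_nonneg (by positivity), le_div_iff₀ hη, Real.exp_neg,
    ← div_eq_mul_inv, div_mul_eq_mul_div, div_le_one (Real.exp_pos _)]
  have h1 := Real.add_one_le_exp (σ * (2 * Real.pi * ξ) ^ 2)
  have h2 := mul_le_mul_of_nonneg_right hσ (sq_nonneg (2 * Real.pi * ξ))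
  linarith

/-- The heat semigroup maps `L¹` to `L²`. -/
lemma norm_mulL2_heatSym_le {σ : ℝ} (hσ : 0 < σ) {g : ℝ → ℂ} (hg : Integrable g volume)
    (hg2 : MemLp g 2 volume) : ‖mulL2 (heatSym σ) (𝓕 (toL2C g))‖
      ≤ √(Real.Gamma (1 / 2)) * σ ^ (-(1 / 4) : ℝ) * ∫ x, ‖g x‖ := by
  have hI : 0 ≤ ∫ x, ‖g x‖ := integral_nonneg fun x => norm_nonneg _
  have h0 := (l2Bd_heat_rpow (a := 1) (by norm_num) hσ).mono_mul
    (G := fun ξ => heatSym σ ξ * 𝓕 g ξ) hI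
    ((continuous_heatSym σ).mul (continuous_fourier hg)).aestronglyMeasurable fun ξ => by
      rw [sub_self, Real.rpow_zero, mul_one, norm_mul, mul_comm]
      exact mul_le_mul_of_nonneg_right (norm_fourier_le ξ) (norm_nonneg _)
  have e : mulL2 (heatSym σ) (𝓕 (toL2C g)) = toL2C fun ξ => heatSym σ ξ * 𝓕 g ξ := by
    refine toL2C_congr ?_
    filter_upwards [fourier_toL2C hg hg2] with ξ hξ
    rw [hξ]
  rw [e]
  have h1 : 0 ≤ σ ^ (1 / 4 - 1 / 2 : ℝ) := Real.rpow_nonneg hσ.le _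
  refine (h0.norm_toL2C_le (by positivity)).trans_eq ?_
  rw [show (1 : ℝ) - 1 / 2 = 1 / 2 by norm_num, show (1 / 4 - 1 / 2 : ℝ) = -(1 / 4) by norm_num]
  ring

lemma hasDerivAt_fourier {Z : ℝ → L2C} {Z' : L2C} {τ : ℝ} (h : HasDerivAt Z Z' τ) :
    HasDerivAt (fun τ => (𝓕 (Z τ) : L2C)) (𝓕 Z') τ :=
  (((Lp.fourierTransformₗᵢ ℝ ℂ).toContinuousLinearEquiv.toContinuousLinearMap.restrictScalars
    ℝ).hasFDerivAt.comp_hasDerivAt τ h)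

/-- The constant in `norm_le_of_hopfCole`. -/
def hopfConst (β a A B m : ℝ) : ℝ :=
  6 * A * (4 / (1 - 1 / 2) + 4 / (1 - 3 / 4))
    + √(Real.Gamma (1 / 2)) * (3 * |β| * m * A + 6 * B)
      * (4 / (1 - 1 / 4) + 4 / (1 - (1 / 2 + a / 2)))

section Decay

variable {β M : ℝ}

lemma hasDerivAt_heat_hopfCole (hβ : β ≠ 0) (hM : |β * M| ≤ 2) {W : ℝ → L2C}
    {w w' P P' Q : L2C} {τ t : ℝ} (hτ : 0 < τ) (hτt : τ < t)
    (hWd : HasDerivAt W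
      (w' + mulL2 (fun x => (-β : ℂ) * (chi β M τ x : ℂ)) w + P' + Q) τ)
    (hw : ∀ᵐ ξ, (𝓕 w : L2C) ξ = 2 * Real.pi * Complex.I * ξ * (𝓕 (W τ) : L2C) ξ)
    (hw' : ∀ᵐ ξ, (𝓕 w' : L2C) ξ = 2 * Real.pi * Complex.I * ξ * (𝓕 w : L2C) ξ)
    (hP : ∀ᵐ ξ, (𝓕 P' : L2C) ξ = 2 * Real.pi * Complex.I * ξ * (𝓕 P : L2C) ξ) :
    HasDerivAt (fun τ => mulL2 (heatSym (t - τ)) (𝓕 (mulL2 (hcF β M τ) (W τ))))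
      (mulL2 (fun ξ => 2 * Real.pi * Complex.I * ξ * heatSym (t - τ) ξ)
          (𝓕 (mulL2 (hcF β M τ) P))
        - mulL2 (heatSym (t - τ)) (𝓕 (mulL2 (hcF1 β M τ) P))
        + mulL2 (heatSym (t - τ)) (𝓕 (mulL2 (hcF β M τ) Q))) τ := by
  have hmem : τ ∈ Set.Ioo (τ / 2) ((τ + t) / 2) := ⟨by linarith, by linarith⟩
  have hpos : ∀ σ ∈ Set.Ioo (τ / 2) ((τ + t) / 2), 0 ≤ σ := fun σ hσ => by linarith [hσ.1]
  have hη : 0 < (t - τ) / 2 := by linarith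
  have hge : ∀ σ ∈ Set.Ioo (τ / 2) ((τ + t) / 2), (t - τ) / 2 ≤ t - σ := fun σ hσ => by
    linarith [hσ.2]
  have hσt : 0 < t - τ := by linarith
  have hZ := hasDerivAt_mulL2 (m := hcF β M) (m' := hcF2 β M) hmem
    (fun σ _ => aestronglyMeasurable_hcF β M σ) (aestronglyMeasurable_hcF2 β M τ)
    (fun σ hσ x => hasDerivAt_hcF_time (hpos σ hσ) x) (fun σ _ => norm_hcF_le hM σ)
    (fun σ hσ => norm_hcF2_le hM (hpos σ hσ)) hWd
  have me : ∀ σ, AEStronglyMeasurable (heatSym σ) volume := fun σ =>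
    (continuous_heatSym σ).aestronglyMeasurable
  have md : ∀ σ, AEStronglyMeasurable
      (fun ξ : ℝ => -(2 * Real.pi * Complex.I * ξ) ^ 2 * heatSym σ ξ) volume := fun σ =>
    Continuous.aestronglyMeasurable
      ((by fun_prop : Continuous fun ξ : ℝ => -(2 * Real.pi * Complex.I * (ξ : ℂ)) ^ 2).mul
        (continuous_heatSym σ))
  have mk : AEStronglyMeasurable
      (fun ξ : ℝ => 2 * Real.pi * Complex.I * ξ * heatSym (t - τ) ξ) volume :=
    Continuous.aestronglyMeasurable
      ((by fun_prop : Continuous fun ξ : ℝ => 2 * Real.pi * Complex.I * (ξ : ℂ)).mul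
        (continuous_heatSym _))
  have hY := hasDerivAt_mulL2 (C := max 1 (1 / ((t - τ) / 2)))
    (m := fun σ ξ => heatSym (t - σ) ξ)
    (m' := fun σ ξ => -(2 * Real.pi * Complex.I * ξ) ^ 2 * heatSym (t - σ) ξ) hmem
    (fun σ _ => me _) (md _) (fun σ _ ξ => hasDerivAt_heatSym t σ ξ)
    (fun σ hσ ξ => (norm_heatSym_le (hη.le.trans (hge σ hσ)) ξ).trans (le_max_left _ _))
    (fun σ hσ ξ => (norm_deriv2_heatSym_le hη (hge σ hσ) ξ).trans (le_max_right _ _))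
    (hasDerivAt_fourier hZ)
  refine hY.congr_deriv ?_
  have c1 := norm_heatSym_le hσt.le
  have c2 := norm_deriv2_heatSym_le hσt le_rfl
  have c3 := norm_deriv_heatSym_le hσt
  refine Lp.ext ?_
  filter_upwards [fourier_hopfCole hβ hM hτ.le hw hw' hP (Q := Q),
    Lp.coeFn_add (mulL2 (fun ξ : ℝ => -(2 * Real.pi * Complex.I * ξ) ^ 2 * heatSym (t - τ) ξ)
      (𝓕 (mulL2 (hcF β M τ) (W τ)))) (mulL2 (heatSym (t - τ)) (𝓕 (mulL2 (hcF2 β M τ) (W τ)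
        + mulL2 (hcF β M τ) (w' + mulL2 (fun x => (-β : ℂ) * (chi β M τ x : ℂ)) w + P' + Q)))),
    coeFn_mulL2 (md _) c2 (𝓕 (mulL2 (hcF β M τ) (W τ))),
    coeFn_mulL2 (me _) c1 (𝓕 (mulL2 (hcF2 β M τ) (W τ)
        + mulL2 (hcF β M τ) (w' + mulL2 (fun x => (-β : ℂ) * (chi β M τ x : ℂ)) w + P' + Q))),
    Lp.coeFn_add (mulL2 (fun ξ : ℝ => 2 * Real.pi * Complex.I * ξ * heatSym (t - τ) ξ)
          (𝓕 (mulL2 (hcF β M τ) P))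
        - mulL2 (heatSym (t - τ)) (𝓕 (mulL2 (hcF1 β M τ) P)))
        (mulL2 (heatSym (t - τ)) (𝓕 (mulL2 (hcF β M τ) Q))),
    Lp.coeFn_sub (mulL2 (fun ξ : ℝ => 2 * Real.pi * Complex.I * ξ * heatSym (t - τ) ξ)
          (𝓕 (mulL2 (hcF β M τ) P)))
        (mulL2 (heatSym (t - τ)) (𝓕 (mulL2 (hcF1 β M τ) P))),
    coeFn_mulL2 mk c3 (𝓕 (mulL2 (hcF β M τ) P)),
    coeFn_mulL2 (me _) c1 (𝓕 (mulL2 (hcF1 β M τ) P)),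
    coeFn_mulL2 (me _) c1 (𝓕 (mulL2 (hcF β M τ) Q))] with ξ h1 h2 h3 h4 h5 h6 h7 h8 h9
  rw [h2, Pi.add_apply, h3, h4, h1, h5, Pi.add_apply, h6, Pi.sub_apply, h7, h8, h9]
  ring

/-- The decay of an antiderivative `W` of the difference, by Duhamel's formula for the heat
equation that `θW` satisfies. -/
theorem norm_le_of_hopfCole (hβ : β ≠ 0) (hM : |β * M| ≤ 2) {a A B m A₀ : ℝ}
    (ha1 : a < 1) (ha : 0 ≤ a) (hA : 0 ≤ A) (hB : 0 ≤ B) (hm : 0 ≤ m)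
    {W w w' P P' Q : ℝ → L2C} {q : ℝ → ℝ → ℂ} (hWc : ContinuousOn W (Set.Ici 0))
    (hWd : ∀ τ, 0 < τ → HasDerivAt W
      (w' τ + mulL2 (fun x => (-β : ℂ) * (chi β M τ x : ℂ)) (w τ) + P' τ + Q τ) τ)
    (hw : ∀ τ, 0 < τ →
      ∀ᵐ ξ, (𝓕 (w τ) : L2C) ξ = 2 * Real.pi * Complex.I * ξ * (𝓕 (W τ) : L2C) ξ)
    (hw' : ∀ τ, 0 < τ →
      ∀ᵐ ξ, (𝓕 (w' τ) : L2C) ξ = 2 * Real.pi * Complex.I * ξ * (𝓕 (w τ) : L2C) ξ)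
    (hP : ∀ τ, 0 < τ →
      ∀ᵐ ξ, (𝓕 (P' τ) : L2C) ξ = 2 * Real.pi * Complex.I * ξ * (𝓕 (P τ) : L2C) ξ)
    (hPb : ∀ τ, 0 < τ → ‖P τ‖ ≤ A * (1 + τ) ^ (-(3 / 4) : ℝ))
    (hQ : ∀ τ, 0 < τ → Q τ = toL2C (q τ)) (hqi : ∀ τ, 0 < τ → Integrable (q τ) volume)
    (hq2 : ∀ τ, 0 < τ → MemLp (q τ) 2 volume)
    (hqb : ∀ τ, 0 < τ → ∫ x, ‖q τ x‖ ≤ B * (1 + τ) ^ (-1 : ℝ))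
    (hχ : ∀ τ, 0 < τ → L2Bd (fun x => (chi β M τ x : ℂ)) (m * (1 + τ) ^ (-(1 / 4) : ℝ)))
    (h0 : ∀ t, 0 ≤ t → ‖mulL2 (heatSym t) (𝓕 (mulL2 (hcF β M 0) (W 0)))‖
      ≤ A₀ * (1 + t) ^ (1 / 4 - a / 2)) {t : ℝ} (ht : 0 ≤ t) :
    ‖W t‖ ≤ 3 * (A₀ + hopfConst β a A B m) * (1 + t) ^ (1 / 4 - a / 2) := by
  have h1t : 0 < 1 + t := by linarith
  set c := √(Real.Gamma (1 / 2)) * (3 * |β| * m * A + 6 * B) with hc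
  have hc0 : 0 ≤ c := by positivity
  set Y : ℝ → L2C := fun τ => mulL2 (heatSym (t - τ)) (𝓕 (mulL2 (hcF β M τ) (W τ))) with hY
  obtain ⟨i1, v1⟩ := integral_sub_rpow_mul_le (p := 1 / 2) (q := 3 / 4) (by norm_num)
    (by norm_num) (by norm_num) (by norm_num) ht
  obtain ⟨i2, v2⟩ := integral_sub_rpow_mul_le (p := 1 / 4) (q := 1 / 2 + a / 2) (by norm_num)
    (by norm_num) (by linarith) (by linarith) ht
  have hder : ∀ τ ∈ Set.Ioo 0 t, HasDerivAt Y
      (mulL2 (fun ξ => 2 * Real.pi * Complex.I * ξ * heatSym (t - τ) ξ)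
          (𝓕 (mulL2 (hcF β M τ) (P τ)))
        - mulL2 (heatSym (t - τ)) (𝓕 (mulL2 (hcF1 β M τ) (P τ)))
        + mulL2 (heatSym (t - τ)) (𝓕 (mulL2 (hcF β M τ) (Q τ)))) τ := fun τ hτ =>
    hasDerivAt_heat_hopfCole hβ hM hτ.1 hτ.2 (hWd τ hτ.1) (hw τ hτ.1) (hw' τ hτ.1) (hP τ hτ.1)
  have hcont : ContinuousOn Y (Set.Icc 0 t) := by
    intro τ hτ
    have hZ : Tendsto (fun σ => mulL2 (hcF β M σ) (W σ)) (𝓝[Set.Icc 0 t] τ)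
        (𝓝 (mulL2 (hcF β M τ) (W τ))) := by
      refine tendsto_mulL2 (C := 6)
        (Eventually.of_forall fun σ => aestronglyMeasurable_hcF β M σ)
        (aestronglyMeasurable_hcF β M τ) (Eventually.of_forall fun σ => norm_hcF_le hM σ)
        (norm_hcF_le hM τ) (fun x => ?_)
        ((hWc τ hτ.1).mono_left (nhdsWithin_mono _ Set.Icc_subset_Ici_self))
      exact (hasDerivAt_hcF_time hτ.1 x).continuousAt.tendsto.mono_left nhdsWithin_le_nhds
    have hFZ := ((Lp.fourierTransformₗᵢ ℝ ℂ).continuous.tendsto _).comp hZ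
    refine tendsto_mulL2 (C := 1)
      (Eventually.of_forall fun σ => (continuous_heatSym _).aestronglyMeasurable)
      (continuous_heatSym _).aestronglyMeasurable ?_ (norm_heatSym_le (by linarith [hτ.2]))
      (fun ξ => (hasDerivAt_heatSym t τ ξ).continuousAt.tendsto.mono_left nhdsWithin_le_nhds) hFZ
    filter_upwards [self_mem_nhdsWithin] with σ hσ
    exact norm_heatSym_le (by linarith [hσ.2])
  have hbound : ∀ τ ∈ Set.Ioo 0 t, ‖deriv Y τ‖
      ≤ 6 * A * ((t - τ) ^ (-(1 / 2) : ℝ) * (1 + τ) ^ (-(3 / 4) : ℝ))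
        + c * ((t - τ) ^ (-(1 / 4) : ℝ) * (1 + τ) ^ (-(1 / 2 + a / 2))) := by
    intro τ hτ
    have hσ : 0 < t - τ := by linarith [hτ.2]
    have h1τ : 0 < 1 + τ := by linarith [hτ.1]
    have m0 := aestronglyMeasurable_hcF β M τ
    have m1 := aestronglyMeasurable_hcF1 β M τ
    have c0 := norm_hcF_le hM τ
    have c1 := norm_hcF1_le hM hτ.1.le
    have mk : AEStronglyMeasurable
        (fun ξ : ℝ => 2 * Real.pi * Complex.I * ξ * heatSym (t - τ) ξ) volume :=
      Continuous.aestronglyMeasurable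
        ((by fun_prop : Continuous fun ξ : ℝ => 2 * Real.pi * Complex.I * (ξ : ℂ)).mul
          (continuous_heatSym _))
    have p1 : 0 ≤ (t - τ) ^ (-(1 / 2) : ℝ) := Real.rpow_nonneg hσ.le _
    have p2 : 0 ≤ (t - τ) ^ (-(1 / 4) : ℝ) := Real.rpow_nonneg hσ.le _
    have hrate : (1 + τ) ^ (-1 : ℝ) ≤ (1 + τ) ^ (-(1 / 2 + a / 2)) :=
      Real.rpow_le_rpow_of_exponent_le (by linarith [hτ.1]) (by linarith)
    have b1 : ‖mulL2 (fun ξ => 2 * Real.pi * Complex.I * ξ * heatSym (t - τ) ξ)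
        (𝓕 (mulL2 (hcF β M τ) (P τ)))‖
        ≤ (t - τ) ^ (-(1 / 2) : ℝ) * (6 * (A * (1 + τ) ^ (-(3 / 4) : ℝ))) := by
      refine (norm_mulL2_le mk (norm_deriv_heatSym_le hσ) _).trans ?_
      refine mul_le_mul_of_nonneg_left ?_ p1
      refine ((Lp.fourierTransformₗᵢ ℝ ℂ).norm_map _).trans_le
        ((norm_mulL2_le m0 c0 _).trans ?_)
      exact mul_le_mul_of_nonneg_left (hPb τ hτ.1) (by norm_num)
    have b2 : ‖mulL2 (heatSym (t - τ)) (𝓕 (mulL2 (hcF1 β M τ) (P τ)))‖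
        ≤ √(Real.Gamma (1 / 2)) * (t - τ) ^ (-(1 / 4) : ℝ)
          * (3 * |β| * m * A * (1 + τ) ^ (-1 : ℝ)) := by
      have hχτ := hχ τ hτ.1
      have hPτ : L2Bd (P τ) (A * (1 + τ) ^ (-(3 / 4) : ℝ)) := (l2Bd_coeC _).le (hPb τ hτ.1)
      have hi := hχτ.integrable_mul hPτ
      have hle : ∀ x, ‖hcF1 β M τ x * P τ x‖
          ≤ 3 * |β| * (‖(chi β M τ x : ℂ)‖ * ‖P τ x‖) := fun x => by
        rw [norm_mul, ← mul_assoc]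
        exact mul_le_mul_of_nonneg_right (norm_hcF1_le_chi hβ hM τ x) (norm_nonneg _)
      have hgi : Integrable (fun x => hcF1 β M τ x * P τ x) volume :=
        (hi.const_mul (3 * |β|)).mono' (m1.mul (Lp.aestronglyMeasurable _))
          (Eventually.of_forall hle)
      refine (norm_mulL2_heatSym_le hσ hgi (memLp_mul m1 c1 _)).trans ?_
      refine mul_le_mul_of_nonneg_left ?_ (by positivity)
      calc ∫ x, ‖hcF1 β M τ x * P τ x‖
          ≤ ∫ x, 3 * |β| * (‖(chi β M τ x : ℂ)‖ * ‖P τ x‖) :=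
            integral_mono hgi.norm (hi.const_mul _) hle
        _ ≤ 3 * |β| * (m * (1 + τ) ^ (-(1 / 4) : ℝ) * (A * (1 + τ) ^ (-(3 / 4) : ℝ))) := by
            rw [integral_const_mul]
            exact mul_le_mul_of_nonneg_left
              (hχτ.integral_mul_le hPτ (by positivity) (by positivity)) (by positivity)
        _ = _ := by
            have : (1 + τ) ^ (-1 : ℝ) = (1 + τ) ^ (-(1 / 4) : ℝ) * (1 + τ) ^ (-(3 / 4) : ℝ) := by
              rw [← Real.rpow_add h1τ]; norm_num
            rw [this]; ring
    have b3 : ‖mulL2 (heatSym (t - τ)) (𝓕 (mulL2 (hcF β M τ) (Q τ)))‖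
        ≤ √(Real.Gamma (1 / 2)) * (t - τ) ^ (-(1 / 4) : ℝ) * (6 * B * (1 + τ) ^ (-1 : ℝ)) := by
      have e : mulL2 (hcF β M τ) (Q τ) = toL2C fun x => hcF β M τ x * q τ x := by
        refine toL2C_congr ?_
        filter_upwards [coeFn_toL2C (hq2 τ hτ.1)] with x hx
        rw [hQ τ hτ.1, hx]
      have hgi : Integrable (fun x => hcF β M τ x * q τ x) volume :=
        (hqi τ hτ.1).bdd_mul m0 (Eventually.of_forall c0)
      have hg2 : MemLp (fun x => hcF β M τ x * q τ x) 2 volume :=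
        (hq2 τ hτ.1).of_le_mul (c := 6) (m0.mul (hq2 τ hτ.1).1) (Eventually.of_forall fun x => by
          rw [norm_mul]
          exact mul_le_mul_of_nonneg_right (c0 x) (norm_nonneg _))
      rw [e]
      refine (norm_mulL2_heatSym_le hσ hgi hg2).trans ?_
      refine mul_le_mul_of_nonneg_left ?_ (by positivity)
      calc ∫ x, ‖hcF β M τ x * q τ x‖ ≤ ∫ x, 6 * ‖q τ x‖ := by
            refine integral_mono hgi.norm ((hqi τ hτ.1).norm.const_mul _) fun x => ?_
            simp only [norm_mul]
            exact mul_le_mul_of_nonneg_right (c0 x) (norm_nonneg _)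
        _ ≤ _ := by
            rw [integral_const_mul, mul_assoc]
            exact mul_le_mul_of_nonneg_left (hqb τ hτ.1) (by norm_num)
    rw [(hder τ hτ).deriv]
    refine (norm_add_le _ _).trans ((add_le_add_left (norm_sub_le _ _) _).trans ?_)
    refine (add_le_add (add_le_add b1 b2) b3).trans ?_
    have e : (t - τ) ^ (-(1 / 2) : ℝ) * (6 * (A * (1 + τ) ^ (-(3 / 4) : ℝ)))
        + √(Real.Gamma (1 / 2)) * (t - τ) ^ (-(1 / 4) : ℝ)
          * (3 * |β| * m * A * (1 + τ) ^ (-1 : ℝ))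
        + √(Real.Gamma (1 / 2)) * (t - τ) ^ (-(1 / 4) : ℝ) * (6 * B * (1 + τ) ^ (-1 : ℝ))
        = 6 * A * ((t - τ) ^ (-(1 / 2) : ℝ) * (1 + τ) ^ (-(3 / 4) : ℝ))
          + c * ((t - τ) ^ (-(1 / 4) : ℝ) * (1 + τ) ^ (-1 : ℝ)) := by rw [hc]; ring
    rw [e]
    gcongr
  have key := norm_sub_le_integral_of_norm_deriv_le_of_le ht hcont
    (fun τ hτ => (hder τ hτ).differentiableAt.differentiableWithinAt)
    (Eventually.of_forall fun τ hτ => hbound τ hτ) ((i1.const_mul (6 * A)).add (i2.const_mul c))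
  have hZt : Y t = 𝓕 (mulL2 (hcF β M t) (W t)) := by
    have e : ∀ ξ, heatSym (t - t) ξ = 1 := fun ξ => by simp [heatSym]
    simp only [hY, mulL2, e, one_mul]
    exact toL2C_coeFn _
  have hY0 : ‖Y 0‖ ≤ A₀ * (1 + t) ^ (1 / 4 - a / 2) := by
    have := h0 t ht
    simpa only [hY, sub_zero] using this
  have hint : ∫ τ in (0 : ℝ)..t, (6 * A * ((t - τ) ^ (-(1 / 2) : ℝ) * (1 + τ) ^ (-(3 / 4) : ℝ))
      + c * ((t - τ) ^ (-(1 / 4) : ℝ) * (1 + τ) ^ (-(1 / 2 + a / 2))))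
      ≤ hopfConst β a A B m * (1 + t) ^ (1 / 4 - a / 2) := by
    rw [intervalIntegral.integral_add (i1.const_mul _) (i2.const_mul _),
      intervalIntegral.integral_const_mul, intervalIntegral.integral_const_mul]
    have e1 : (1 + t) ^ (1 - 1 / 2 - 3 / 4 : ℝ) ≤ (1 + t) ^ (1 / 4 - a / 2) :=
      Real.rpow_le_rpow_of_exponent_le (by linarith) (by linarith)
    have e2 : (1 + t) ^ (1 - 1 / 4 - (1 / 2 + a / 2)) = (1 + t) ^ (1 / 4 - a / 2) := by
      congr 1; ring
    have f1 : (0 : ℝ) ≤ 4 / (1 - 1 / 2) + 4 / (1 - 3 / 4) := by norm_num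
    calc _ ≤ 6 * A * ((4 / (1 - 1 / 2) + 4 / (1 - 3 / 4)) * (1 + t) ^ (1 / 4 - a / 2))
          + c * ((4 / (1 - 1 / 4) + 4 / (1 - (1 / 2 + a / 2))) * (1 + t) ^ (1 / 4 - a / 2)) := by
          refine add_le_add (mul_le_mul_of_nonneg_left
            (v1.trans (mul_le_mul_of_nonneg_left e1 f1)) (by positivity))
            (mul_le_mul_of_nonneg_left (v2.trans_eq (by rw [e2])) hc0)
      _ = _ := by unfold hopfConst; rw [hc]; ring
  have hZ : ‖mulL2 (hcF β M t) (W t)‖ ≤ (A₀ + hopfConst β a A B m) * (1 + t) ^ (1 / 4 - a / 2) := by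
    have e : ‖mulL2 (hcF β M t) (W t)‖ = ‖Y t‖ := by
      rw [hZt]
      exact ((Lp.fourierTransformₗᵢ ℝ ℂ).norm_map _).symm
    have := norm_le_norm_add_norm_sub (Y 0) (Y t)
    rw [norm_sub_rev] at this
    rw [e]
    linarith [key.trans hint]
  have hW : ‖W t‖ ≤ 3 * ‖mulL2 (hcF β M t) (W t)‖ := by
    refine Lp.norm_le_mul_norm_of_ae_le_mul ?_
    filter_upwards [coeFn_mulL2 (aestronglyMeasurable_hcF β M t) (norm_hcF_le hM t) (W t)]
      with x hx
    rw [hx, norm_mul]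
    have := one_third_le_norm_hcF hM t x
    nlinarith [norm_nonneg (W t x)]
  linarith

end Decay

/-! ### The antiderivative of the difference -/

/-- The antiderivative of the difference between the solution and the diffusion wave, on the
Fourier side. -/
def antid (β M : ℝ) (f : ℝ → ℝ → ℂ) (t ξ : ℝ) : ℂ :=
  wdiff β M f t ξ / (2 * Real.pi * Complex.I * ξ)

/-- The flux `P̂` of the terms that distinguish the BBM–Burgers equation from the Burgers
equation. -/
def pHat (β γ : ℝ) (f : ℝ → ℝ → ℂ) (τ ξ : ℝ) : ℂ :=
  (-((2 * Real.pi * ξ : ℝ) : ℂ) ^ 2 - Complex.I * (γ * (2 * Real.pi * ξ : ℝ)))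
      / (1 + ((2 * Real.pi * ξ : ℝ) : ℂ) ^ 2) * f τ ξ
    - (β / 2 : ℝ) * bsym ξ * conv (f τ) (f τ) ξ

lemma norm_two_pi_I_mul (ξ : ℝ) : ‖(2 * Real.pi * Complex.I * ξ : ℂ)‖ = 2 * Real.pi * |ξ| := by
  simpa using norm_two_pi_I_mul_pow ξ 1

lemma abs_div_one_add_sq_le_one (ξ : ℝ) : |ξ| / (1 + ξ ^ 2) ≤ 1 := by
  rw [div_le_one (by positivity)]
  nlinarith [sq_nonneg (|ξ| - 1), sq_abs ξ]

lemma norm_Lsym_le (γ ξ : ℝ) : ‖Lsym γ ξ‖ ≤ (1 + |γ|) * (2 * Real.pi * |ξ|) := by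
  have hk : |2 * Real.pi * ξ| = 2 * Real.pi * |ξ| := by
    rw [abs_mul, abs_of_pos (by positivity : 0 < 2 * Real.pi)]
  unfold Lsym
  rw [← hk]
  set k := 2 * Real.pi * ξ
  rw [norm_div, norm_one_add_sq, div_le_iff₀ (by positivity)]
  refine (norm_add_le _ _).trans ?_
  rw [norm_neg, norm_pow, norm_mul, norm_mul, norm_pow, Complex.norm_I, Complex.norm_real,
    Complex.norm_real, Real.norm_eq_abs, Real.norm_eq_abs, one_mul]
  have h1 : |k| ^ 2 = k ^ 2 := sq_abs k
  have h2 : |k| ≤ 1 + k ^ 2 := by nlinarith [sq_nonneg (|k| - 1), abs_nonneg k]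
  have h3 : |k| ^ 3 ≤ |k| * (1 + k ^ 2) := by nlinarith [abs_nonneg k]
  have h4 : |k| ^ 2 ≤ |k| * (1 + k ^ 2) := by nlinarith [abs_nonneg k]
  nlinarith [mul_le_mul_of_nonneg_left h3 (abs_nonneg γ)]

lemma norm_pHat_symbol_le (γ ξ : ℝ) :
    ‖(-((2 * Real.pi * ξ : ℝ) : ℂ) ^ 2 - Complex.I * (γ * (2 * Real.pi * ξ : ℝ)))
      / (1 + ((2 * Real.pi * ξ : ℝ) : ℂ) ^ 2)‖
      ≤ (1 + |γ|) * min (2 * Real.pi * |ξ|) 1 := by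
  have hk : |2 * Real.pi * ξ| = 2 * Real.pi * |ξ| := by
    rw [abs_mul, abs_of_pos (by positivity : 0 < 2 * Real.pi)]
  rw [← hk]
  set k := 2 * Real.pi * ξ
  rw [norm_div, norm_one_add_sq, div_le_iff₀ (by positivity)]
  refine (norm_sub_le _ _).trans ?_
  rw [norm_neg, norm_pow, norm_mul, norm_mul, Complex.norm_I, Complex.norm_real,
    Complex.norm_real, Real.norm_eq_abs, Real.norm_eq_abs, one_mul]
  have h1 : |k| ^ 2 = k ^ 2 := sq_abs k
  have h2 : |k| ≤ 1 + k ^ 2 := by nlinarith [sq_nonneg (|k| - 1), abs_nonneg k]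
  have h0 := abs_nonneg k
  have h4 : |k| ^ 2 ≤ min |k| 1 * (1 + k ^ 2) := by
    rcases le_total |k| 1 with h | h
    · rw [min_eq_left h]; nlinarith
    · rw [min_eq_right h]; nlinarith
  have h3 : |k| ≤ min |k| 1 * (1 + k ^ 2) := by
    rcases le_total |k| 1 with h | h
    · rw [min_eq_left h]; nlinarith [mul_nonneg h0 (sq_nonneg k)]
    · rw [min_eq_right h]; nlinarith
  nlinarith [mul_le_mul_of_nonneg_left h3 (abs_nonneg γ)]

/-- The equation for the antiderivative, in the form to which the Hopf–Cole transformation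
applies. -/
lemma antid_equation (β γ M : ℝ) {f : ℝ → ℝ → ℂ} {τ ξ : ℝ} (hξ : ξ ≠ 0)
    (hconv : conv (f τ) (f τ) ξ - conv (chiHat β M τ) (chiHat β M τ) ξ
      = 2 * conv (chiHat β M τ) (wdiff β M f τ) ξ + conv (wdiff β M f τ) (wdiff β M f τ) ξ) :
    (Lsym γ ξ * wdiff β M f τ ξ + wsrc β γ M f τ ξ) / (2 * Real.pi * Complex.I * ξ)
      = 2 * Real.pi * Complex.I * ξ * wdiff β M f τ ξ
        + (-β : ℂ) * conv (chiHat β M τ) (wdiff β M f τ) ξ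
        + 2 * Real.pi * Complex.I * ξ * pHat β γ f τ ξ
        + (-(β / 2 : ℝ) : ℂ) * conv (wdiff β M f τ) (wdiff β M f τ) ξ := by
  have hk : (2 * Real.pi * Complex.I * ξ : ℂ) ≠ 0 := by
    have := Real.pi_ne_zero
    simp [hξ, this, Complex.I_ne_zero]
  have h1 := one_add_sq_ne_zero (2 * Real.pi * ξ)
  rw [div_eq_iff hk]
  have hc : conv (f τ) (f τ) ξ = conv (chiHat β M τ) (chiHat β M τ) ξ
      + (2 * conv (chiHat β M τ) (wdiff β M f τ) ξ + conv (wdiff β M f τ) (wdiff β M f τ) ξ) := by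
    rw [← hconv]; ring
  have hI := Complex.I_sq
  unfold wsrc chiErr pHat bsym Lsym
  rw [hc]
  generalize conv (chiHat β M τ) (chiHat β M τ) ξ = A
  generalize conv (chiHat β M τ) (wdiff β M f τ) ξ = B
  generalize conv (wdiff β M f τ) (wdiff β M f τ) ξ = C
  unfold wdiff
  generalize f τ ξ = F
  generalize chiHat β M τ ξ = X
  push_cast at h1 ⊢
  generalize hκ : (2 * Real.pi * ξ : ℂ) = κ at *
  have e : (2 * Real.pi * Complex.I * ξ : ℂ) = Complex.I * κ := by rw [← hκ]; ring
  rw [e]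
  have hr := inv_mul_cancel₀ h1
  simp only [div_eq_mul_inv _ (1 + κ ^ 2)]
  generalize (1 + κ ^ 2)⁻¹ = r at hr ⊢
  linear_combination (-κ ^ 2 * F - β / 2 * Complex.I * κ * (A + 2 * B + C)) * hr
    - κ ^ 2 * (F - X + (-κ ^ 2 - Complex.I * (γ * κ)) * r * F
      - β / 2 * Complex.I * κ * r * (A + 2 * B + C)) * hI

namespace Setting

variable {β γ M Λ m Ce : ℝ} {s : ℕ} {f₀ : ℝ → ℂ} {f : ℝ → ℝ → ℂ}

lemma hasDerivAt_antid (S : Setting β γ M s f₀ Λ m Ce f) {τ : ℝ} (hτ : 0 < τ) (ξ : ℝ) :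
    HasDerivAt (fun τ => antid β M f τ ξ)
      ((Lsym γ ξ * wdiff β M f τ ξ + wsrc β γ M f τ ξ) / (2 * Real.pi * Complex.I * ξ)) τ :=
  (hasDerivAt_wdiff S.hβ S.hM S.hM1 S.sol S.convc hτ ξ).div_const _

lemma continuous_antid_time (S : Setting β γ M s f₀ Λ m Ce f) (ξ : ℝ) :
    Continuous fun τ => antid β M f τ ξ :=
  ((continuous_wdiff S.hβ S.hM S.hM1 S.sol).comp (f := fun τ : ℝ => (τ, ξ))
    (by fun_prop)).div_const _

lemma aestronglyMeasurable_antid (S : Setting β γ M s f₀ Λ m Ce f) (τ : ℝ) :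
    AEStronglyMeasurable (antid β M f τ) volume := by
  have h1 : Measurable fun ξ : ℝ => (2 * Real.pi * Complex.I * ξ : ℂ) := by fun_prop
  exact ((S.continuous_wdiff_apply τ).measurable.div h1).aestronglyMeasurable

lemma exists_dom_wdiff (S : Setting β γ M s f₀ Λ m Ce f)
    (hdom : ∃ D : ℝ → ℝ, MemLp D 2 volume ∧
      ∀ t ξ, ‖(((1 + |ξ|) ^ s : ℝ) : ℂ) * f t ξ‖ ≤ D ξ) :
    ∃ D : ℝ → ℝ, MemLp D 2 volume ∧ ∀ t, 0 ≤ t → ∀ ξ, ‖wdiff β M f t ξ‖ ≤ D ξ := by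
  obtain ⟨D, hD, hb⟩ := hdom
  obtain ⟨C, hC, hχ⟩ := exists_norm_chiHat_le S.hβ 1
  refine ⟨fun ξ => D ξ + C * |M| * (wt 0 ξ)⁻¹, hD.add ((memLp_inv_wt le_rfl).const_mul _),
    fun t ht ξ => (norm_sub_le _ _).trans (add_le_add ?_ ?_)⟩
  · refine le_trans ?_ (hb t ξ)
    rw [norm_mul, Complex.norm_real, Real.norm_of_nonneg (by positivity)]
    refine le_mul_of_one_le_left (norm_nonneg _) (one_le_pow₀ ?_)
    have := abs_nonneg ξ
    linarith
  · refine (hχ M S.hM S.hM1 t ξ).trans ?_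
    rw [pow_one, div_eq_mul_inv]
    have := wt_mono ht ξ
    have := wt_pos 0 ξ
    gcongr

lemma inv_wt_pow_le {s : ℕ} (hs : 1 ≤ s) (t ξ : ℝ) : (wt t ξ ^ s)⁻¹ ≤ (wt t ξ)⁻¹ := by
  have h1 := one_le_wt t ξ
  have := wt_pos t ξ
  gcongr
  exact le_self_pow₀ h1 (by omega)

lemma exists_dom_deriv_antid (S : Setting β γ M s f₀ Λ m Ce f)
    (hdom : ∃ D : ℝ → ℝ, MemLp D 2 volume ∧
      ∀ t ξ, ‖(((1 + |ξ|) ^ s : ℝ) : ℂ) * f t ξ‖ ≤ D ξ) :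
    ∃ D : ℝ → ℝ, MemLp D 2 volume ∧ ∀ t, 0 ≤ t → ∀ ξ,
      ‖(Lsym γ ξ * wdiff β M f t ξ + wsrc β γ M f t ξ) / (2 * Real.pi * Complex.I * ξ)‖ ≤ D ξ := by
  obtain ⟨D, hD, hb⟩ := S.exists_dom_wdiff hdom
  have hΛ := S.Λ0
  have hm := S.m0
  have hCe := S.Ce0
  have hpi := Real.pi_pos
  set A := Real.pi * |β| * (Λ + m) * (Λ + m) + Ce with hA
  have hA0 : 0 ≤ A := by positivity
  refine ⟨fun ξ => (1 + |γ|) * D ξ + A * (wt 0 ξ)⁻¹,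
    (hD.const_mul _).add ((memLp_inv_wt le_rfl).const_mul _), fun t ht ξ => ?_⟩
  have hD0 : 0 ≤ D ξ := (norm_nonneg _).trans (hb t ht ξ)
  have hwt := wt_pos 0 ξ
  rcases eq_or_ne ξ 0 with rfl | hξ
  · simp only [Complex.ofReal_zero, mul_zero, div_zero, norm_zero]
    positivity
  have hξ' : 0 < |ξ| := abs_pos.2 hξ
  rw [norm_div, norm_two_pi_I_mul, div_le_iff₀ (by positivity)]
  refine (norm_add_le _ _).trans ?_
  rw [norm_mul]
  have h1 := norm_Lsym_le γ ξ
  have hap := S.l2Bd_wdiff_apriori ht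
  have h2 := S.norm_wsrc_le (b := 0) (W := Λ + m) (ξ := ξ) ht (by positivity) (by norm_num)
    (by simpa only [add_zero] using hap)
  have hr : (1 + t) ^ (-(1 / 2 + 0) : ℝ) ≤ 1 :=
    Real.rpow_le_one_of_one_le_of_nonpos (by linarith) (by norm_num)
  have hinv : (wt t ξ ^ s)⁻¹ ≤ (wt 0 ξ)⁻¹ :=
    (inv_wt_pow_le S.one_le t ξ).trans (by have := wt_mono ht ξ; gcongr)
  have h3 : |ξ| / (1 + ξ ^ 2) ≤ |ξ| := div_le_self hξ'.le (by nlinarith [sq_nonneg ξ])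
  have hr0 : 0 ≤ (1 + t) ^ (-(1 / 2 + 0) : ℝ) := Real.rpow_nonneg (by linarith) _
  have hwt' := wt_pos t ξ
  have h4 : ‖wsrc β γ M f t ξ‖ ≤ |ξ| * (A * (wt 0 ξ)⁻¹) := by
    refine h2.trans ?_
    rw [div_eq_mul_inv (_ * _) (wt t ξ ^ s)]
    calc _ ≤ |ξ| * (A * 1 * (wt 0 ξ)⁻¹) := by gcongr
      _ = _ := by ring
  have h5 : |ξ| * (A * (wt 0 ξ)⁻¹) ≤ A * (wt 0 ξ)⁻¹ * (2 * Real.pi * |ξ|) := by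
    have : 0 ≤ A * (wt 0 ξ)⁻¹ * |ξ| := by positivity
    nlinarith [Real.pi_gt_three]
  calc _ ≤ (1 + |γ|) * (2 * Real.pi * |ξ|) * D ξ + A * (wt 0 ξ)⁻¹ * (2 * Real.pi * |ξ|) := by
        gcongr
        · exact hb t ht ξ
        · exact h4.trans h5
    _ = _ := by ring

/-- On a bounded time interval the antiderivative is dominated by a square integrable function. -/
lemma exists_dom_antid (S : Setting β γ M s f₀ Λ m Ce f)
    (hdom : ∃ D : ℝ → ℝ, MemLp D 2 volume ∧
      ∀ t ξ, ‖(((1 + |ξ|) ^ s : ℝ) : ℂ) * f t ξ‖ ≤ D ξ)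
    (hV0 : MemLp (antid β M f 0) 2 volume) (T : ℝ) :
    ∃ D : ℝ → ℝ, MemLp D 2 volume ∧ ∀ t ∈ Set.Icc 0 T, ∀ ξ, ‖antid β M f t ξ‖ ≤ D ξ := by
  obtain ⟨D, hD, hb⟩ := S.exists_dom_deriv_antid hdom
  refine ⟨fun ξ => ‖antid β M f 0 ξ‖ + T * D ξ, hV0.norm.add (hD.const_mul T), fun t ht ξ => ?_⟩
  have h := norm_sub_le_integral_of_norm_deriv_le_of_le (B := fun _ => D ξ) ht.1
    (S.continuous_antid_time ξ).continuousOn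
    (fun τ hτ => (S.hasDerivAt_antid hτ.1 ξ).differentiableAt.differentiableWithinAt)
    (Eventually.of_forall fun τ hτ => by
      rw [(S.hasDerivAt_antid hτ.1 ξ).deriv]
      exact hb τ hτ.1.le ξ) intervalIntegrable_const
  rw [intervalIntegral.integral_const, sub_zero, smul_eq_mul] at h
  have hD0 : 0 ≤ D ξ := (norm_nonneg _).trans (hb 0 le_rfl ξ)
  have h2 := mul_le_mul_of_nonneg_right ht.2 hD0
  have h3 := norm_le_norm_add_norm_sub (antid β M f 0 ξ) (antid β M f t ξ)
  rw [norm_sub_rev] at h3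
  linarith

lemma memLp_antid (S : Setting β γ M s f₀ Λ m Ce f)
    (hdom : ∃ D : ℝ → ℝ, MemLp D 2 volume ∧
      ∀ t ξ, ‖(((1 + |ξ|) ^ s : ℝ) : ℂ) * f t ξ‖ ≤ D ξ)
    (hV0 : MemLp (antid β M f 0) 2 volume) {t : ℝ} (ht : 0 ≤ t) :
    MemLp (antid β M f t) 2 volume := by
  obtain ⟨D, hD, hb⟩ := S.exists_dom_antid hdom hV0 t
  exact hD.of_le (S.aestronglyMeasurable_antid t)
    (Eventually.of_forall fun ξ => (hb t ⟨ht, le_rfl⟩ ξ).trans (le_abs_self _))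

lemma continuousOn_antid (S : Setting β γ M s f₀ Λ m Ce f)
    (hdom : ∃ D : ℝ → ℝ, MemLp D 2 volume ∧
      ∀ t ξ, ‖(((1 + |ξ|) ^ s : ℝ) : ℂ) * f t ξ‖ ≤ D ξ)
    (hV0 : MemLp (antid β M f 0) 2 volume) :
    ContinuousOn (fun t => toL2C (antid β M f t)) (Set.Ici 0) := by
  intro τ hτ
  obtain ⟨D, hD, hb⟩ := S.exists_dom_antid hdom hV0 (τ + 1)
  have h := continuousOn_toL2C hD (fun σ _ => S.aestronglyMeasurable_antid σ) hb
    (fun ξ => (S.continuous_antid_time ξ).continuousOn) τ ⟨hτ, by linarith⟩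
  refine h.mono_of_mem_nhdsWithin ?_
  have : Set.Iio (τ + 1) ∈ 𝓝 τ := Iio_mem_nhds (by linarith)
  filter_upwards [self_mem_nhdsWithin, mem_nhdsWithin_of_mem_nhds this] with σ h1 h2
  exact ⟨h1, le_of_lt h2⟩

lemma hasDerivAt_toL2C_antid (S : Setting β γ M s f₀ Λ m Ce f)
    (hdom : ∃ D : ℝ → ℝ, MemLp D 2 volume ∧
      ∀ t ξ, ‖(((1 + |ξ|) ^ s : ℝ) : ℂ) * f t ξ‖ ≤ D ξ)
    (hV0 : MemLp (antid β M f 0) 2 volume) {τ : ℝ} (hτ : 0 < τ) :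
    HasDerivAt (fun t => toL2C (antid β M f t)) (toL2C fun ξ =>
      (Lsym γ ξ * wdiff β M f τ ξ + wsrc β γ M f τ ξ) / (2 * Real.pi * Complex.I * ξ)) τ := by
  obtain ⟨D, hD, hb⟩ := S.exists_dom_deriv_antid hdom
  refine hasDerivAt_toL2C (a := 0) (b := τ + 1) (F' := fun τ ξ =>
      (Lsym γ ξ * wdiff β M f τ ξ + wsrc β γ M f τ ξ) / (2 * Real.pi * Complex.I * ξ))
    ⟨hτ, by linarith⟩ hD (fun σ hσ => S.memLp_antid hdom hV0 hσ.1.le) ?_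
    (fun σ hσ ξ => S.hasDerivAt_antid hσ.1 ξ) (fun σ hσ ξ => hb σ hσ.1.le ξ)
  have h1 : Measurable fun ξ : ℝ => (2 * Real.pi * Complex.I * ξ : ℂ) := by fun_prop
  have h2 : Continuous (wsrc β γ M f τ) := by
    have := (continuousOn_wsrc (γ := γ) S.hβ S.hM S.hM1 S.convc).comp
      (f := fun ξ : ℝ => (τ, ξ)) (s := Set.univ) (by fun_prop) (fun ξ _ => ⟨hτ.le, trivial⟩)
    exact continuousOn_univ.1 this
  exact ((((continuous_Lsym γ).mul (S.continuous_wdiff_apply τ)).add h2).measurable.div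
    h1).aestronglyMeasurable

end Setting

lemma L2Bd.of_wt {t c : ℝ} {s : ℕ} {g : ℝ → ℂ}
    (h : L2Bd (fun ξ => ((wt t ξ ^ s : ℝ) : ℂ) * g ξ) c) (hg : AEStronglyMeasurable g volume) :
    L2Bd g c := by
  refine h.mono hg fun ξ => ?_
  rw [norm_mul, norm_wt_pow]
  exact le_mul_of_one_le_left (norm_nonneg _) (one_le_pow₀ (one_le_wt t ξ))

lemma measurable_two_pi_I_mul : Measurable fun ξ : ℝ => (2 * Real.pi * Complex.I * ξ : ℂ) := by
  fun_prop

lemma norm_two_pi_I_mul_mul (ξ : ℝ) (z : ℂ) :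
    ‖2 * Real.pi * Complex.I * ξ * z‖ = 2 * Real.pi * |ξ| * ‖z‖ := by
  rw [norm_mul, norm_two_pi_I_mul]

lemma div_wt_pow_le {s : ℕ} (hs : 1 ≤ s) {c : ℝ} (hc : 0 ≤ c) (t ξ : ℝ) :
    c / wt t ξ ^ s ≤ c / wt t ξ := by
  rw [div_eq_mul_inv, div_eq_mul_inv]
  exact mul_le_mul_of_nonneg_left (Setting.inv_wt_pow_le hs t ξ) hc

/-- A derivative gains the factor `(1 + t)^(-1/2)`. -/
lemma L2Bd.deriv_of_wt {t c : ℝ} {s : ℕ} (hs : 1 ≤ s) (ht : 0 ≤ t) {g : ℝ → ℂ}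
    (h : L2Bd (fun ξ => ((wt t ξ ^ s : ℝ) : ℂ) * g ξ) c) (hg : AEStronglyMeasurable g volume) :
    L2Bd (fun ξ => 2 * Real.pi * Complex.I * ξ * g ξ)
      (2 * Real.pi * (1 + t) ^ (-(1 / 2) : ℝ) * c) := by
  have h1t : 0 < 1 + t := by linarith
  refine h.mono_mul (by positivity)
    (measurable_two_pi_I_mul.aestronglyMeasurable.mul hg) fun ξ => ?_
  rw [norm_two_pi_I_mul_mul, norm_mul, norm_wt_pow]
  have h1 := abs_mul_sqrt_le_wt t ξ
  have h2 : wt t ξ ≤ wt t ξ ^ s := le_self_pow₀ (one_le_wt t ξ) (by omega)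
  have h3 : |ξ| ≤ (1 + t) ^ (-(1 / 2) : ℝ) * wt t ξ ^ s := by
    rw [Real.rpow_neg h1t.le, ← Real.sqrt_eq_rpow, inv_mul_eq_div,
      le_div_iff₀ (Real.sqrt_pos.2 h1t)]
    exact h1.trans h2
  calc 2 * Real.pi * |ξ| * ‖g ξ‖
      ≤ 2 * Real.pi * ((1 + t) ^ (-(1 / 2) : ℝ) * wt t ξ ^ s) * ‖g ξ‖ := by
        have := Real.pi_pos
        gcongr
    _ = _ := by ring

lemma hasDerivAt_fourierInv {Z : ℝ → L2C} {Z' : L2C} {τ : ℝ} (h : HasDerivAt Z Z' τ) :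
    HasDerivAt (fun τ => (𝓕⁻ (Z τ) : L2C)) (𝓕⁻ Z') τ :=
  (((Lp.fourierTransformₗᵢ ℝ ℂ).symm.toContinuousLinearEquiv.toContinuousLinearMap.restrictScalars
    ℝ).hasFDerivAt.comp_hasDerivAt τ h)

lemma fourierInv_add' (F G : L2C) : (𝓕⁻ (F + G) : L2C) = 𝓕⁻ F + 𝓕⁻ G :=
  (Lp.fourierTransformₗᵢ ℝ ℂ).symm.map_add F G

lemma norm_fourierInv_eq (F : L2C) : ‖(𝓕⁻ F : L2C)‖ = ‖F‖ :=
  (Lp.fourierTransformₗᵢ ℝ ℂ).symm.norm_map F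

lemma fourier_fourierInv_eq (F : L2C) : (𝓕 (𝓕⁻ F : L2C) : L2C) = F :=
  (Lp.fourierTransformₗᵢ ℝ ℂ).apply_symm_apply F

/-- On the Fourier side of `L²`, a relation between symbols is a relation between functions. -/
lemma fourier_relation {g g' : ℝ → ℂ} (hg : MemLp g 2 volume) (hg' : MemLp g' 2 volume)
    (h : ∀ᵐ ξ, g' ξ = 2 * Real.pi * Complex.I * ξ * g ξ) :
    ∀ᵐ ξ, (𝓕 (𝓕⁻ (toL2C g') : L2C) : L2C) ξ
      = 2 * Real.pi * Complex.I * ξ * (𝓕 (𝓕⁻ (toL2C g) : L2C) : L2C) ξ := by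
  rw [fourier_fourierInv_eq, fourier_fourierInv_eq]
  filter_upwards [h, coeFn_toL2C hg, coeFn_toL2C hg'] with ξ h1 h2 h3
  rw [h3, h2, h1]

lemma L2Bd.fourierInv {g : ℝ → ℂ} {A : ℝ} (hA : 0 ≤ A) (h : L2Bd g A)
    (hi : Integrable g volume) : L2Bd (𝓕⁻ g) A := by
  have e := toL2C_fourierInv hi h.memLp
  have h1 : ‖toL2C (𝓕⁻ g)‖ ≤ A := by
    rw [e, norm_fourierInv_eq]
    exact h.norm_toL2C_le hA
  have h2 := (l2Bd_coeC (toL2C (𝓕⁻ g))).le h1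
  refine ⟨(continuous_fourierInv hi).aestronglyMeasurable, ?_⟩
  rw [← eLpNorm_congr_ae (coeFn_toL2C (memLp_fourierInv hi h.memLp))]
  exact h2.2

/-- A bound for the flux `pHat`. -/
def fluxConst (β γ Λ : ℝ) : ℝ := (1 + |γ|) * (2 * Real.pi * Λ) + 2 * Real.pi * |β| * (Λ * Λ)

namespace Setting

variable {β γ M Λ m Ce : ℝ} {s : ℕ} {f₀ : ℝ → ℂ} {f : ℝ → ℝ → ℂ}

lemma integrable_wdiff (S : Setting β γ M s f₀ Λ m Ce f) {t : ℝ} (ht : 0 ≤ t) :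
    Integrable (wdiff β M f t) volume :=
  (S.int t).sub (integrable_chiHat S.hβ S.hM S.hM1 ht)

lemma continuous_conv_apply (S : Setting β γ M s f₀ Λ m Ce f) (t : ℝ) :
    Continuous (conv (f t) (f t)) :=
  S.convc.comp (f := fun ξ : ℝ => (t, ξ)) (by fun_prop)

lemma l2Bd_conv (S : Setting β γ M s f₀ Λ m Ce f) {t : ℝ} (ht : 0 ≤ t) :
    L2Bd (conv (f t) (f t)) (Λ * Λ * (1 + t) ^ (-(1 / 2) : ℝ) * (2 * (1 + t) ^ (-(1 / 4) : ℝ))) := by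
  have hΛ := S.Λ0
  refine l2Bd_of_le_inv_wt ht (by positivity) (S.continuous_conv_apply t).aestronglyMeasurable
    fun ξ => (S.sol.norm_conv_le hΛ ht ξ).trans
      (div_wt_pow_le S.one_le (by positivity) t ξ)

lemma aestronglyMeasurable_pHat_symbol (γ : ℝ) : AEStronglyMeasurable (fun ξ : ℝ =>
    (-((2 * Real.pi * ξ : ℝ) : ℂ) ^ 2 - Complex.I * (γ * (2 * Real.pi * ξ : ℝ)))
      / (1 + ((2 * Real.pi * ξ : ℝ) : ℂ) ^ 2)) volume :=
  (by fun_prop : Measurable _).aestronglyMeasurable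

lemma l2Bd_pHat (S : Setting β γ M s f₀ Λ m Ce f) {t : ℝ} (ht : 0 ≤ t) :
    L2Bd (pHat β γ f t) (fluxConst β γ Λ * (1 + t) ^ (-(3 / 4) : ℝ)) := by
  have h1t : 0 < 1 + t := by linarith
  have hΛ := S.Λ0
  have hpi := Real.pi_pos
  have hf := (S.sol.bd t ht).deriv_of_wt S.one_le ht
    (S.sol.continuous_apply t).aestronglyMeasurable
  have h1 := hf.mono_mul (G := fun ξ : ℝ =>
      (-((2 * Real.pi * ξ : ℝ) : ℂ) ^ 2 - Complex.I * (γ * (2 * Real.pi * ξ : ℝ)))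
      / (1 + ((2 * Real.pi * ξ : ℝ) : ℂ) ^ 2) * f t ξ) (c := 1 + |γ|) (by positivity)
    ((aestronglyMeasurable_pHat_symbol γ).mul (S.sol.continuous_apply t).aestronglyMeasurable)
    fun ξ => by
      rw [norm_mul, norm_two_pi_I_mul_mul]
      refine (mul_le_mul_of_nonneg_right ((norm_pHat_symbol_le γ ξ).trans
        (mul_le_mul_of_nonneg_left (min_le_left _ _) (by positivity)))
        (norm_nonneg _)).trans_eq (mul_assoc _ _ _)
  have h2 := (S.l2Bd_conv ht).mono_mul (G := fun ξ : ℝ =>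
      ((β / 2 : ℝ) : ℂ) * bsym ξ * conv (f t) (f t) ξ) (c := |β| / 2 * (2 * Real.pi)) (by positivity)
    ((continuous_const.mul continuous_bsym).mul (S.continuous_conv_apply t)).aestronglyMeasurable
    fun ξ => by
      rw [norm_mul, norm_mul, Complex.norm_real, Real.norm_eq_abs, abs_div, abs_two]
      have := (norm_bsym_le ξ).trans
        (mul_le_mul_of_nonneg_left (abs_div_one_add_sq_le_one ξ) (by positivity))
      rw [mul_one] at this
      gcongr
  refine (h1.of_le_add h2 (H := pHat β γ f t) (by positivity) (by positivity) ?_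
    fun ξ => norm_sub_le _ _).le
    (le_of_eq ?_)
  · exact h1.1.sub h2.1
  · have e1 : (1 + t) ^ (-(3 / 4) : ℝ) = (1 + t) ^ (-(1 / 2) : ℝ) * (1 + t) ^ (-(1 / 4) : ℝ) := by
      rw [← Real.rpow_add h1t]; norm_num
    unfold fluxConst
    rw [e1]
    ring

lemma memLp_deriv_pHat (S : Setting β γ M s f₀ Λ m Ce f) {t : ℝ} (ht : 0 ≤ t) :
    MemLp (fun ξ => 2 * Real.pi * Complex.I * ξ * pHat β γ f t ξ) 2 volume := by
  have h1t : 0 < 1 + t := by linarith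
  have hΛ := S.Λ0
  have hpi := Real.pi_pos
  have hf := (S.sol.bd t ht).deriv_of_wt S.one_le ht
    (S.sol.continuous_apply t).aestronglyMeasurable
  have h1 := hf.mono_mul (G := fun ξ : ℝ => 2 * Real.pi * Complex.I * ξ *
      ((-((2 * Real.pi * ξ : ℝ) : ℂ) ^ 2 - Complex.I * (γ * (2 * Real.pi * ξ : ℝ)))
      / (1 + ((2 * Real.pi * ξ : ℝ) : ℂ) ^ 2) * f t ξ)) (c := 1 + |γ|) (by positivity)
    (measurable_two_pi_I_mul.aestronglyMeasurable.mul ((aestronglyMeasurable_pHat_symbol γ).mul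
      (S.sol.continuous_apply t).aestronglyMeasurable))
    fun ξ => by
      rw [norm_two_pi_I_mul_mul, norm_two_pi_I_mul_mul, norm_mul (_ / _), mul_left_comm]
      refine mul_le_mul_of_nonneg_right ((norm_pHat_symbol_le γ ξ).trans ?_) (by positivity)
      exact mul_le_of_le_one_right (by positivity) (min_le_right _ _)
  have h2 := (S.l2Bd_conv ht).mono_mul (G := fun ξ : ℝ => 2 * Real.pi * Complex.I * ξ *
      (((β / 2 : ℝ) : ℂ) * bsym ξ * conv (f t) (f t) ξ))
    (c := |β| / 2 * (2 * Real.pi) ^ 2) (by positivity)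
    (measurable_two_pi_I_mul.aestronglyMeasurable.mul ((continuous_const.mul continuous_bsym).mul
      (S.continuous_conv_apply t)).aestronglyMeasurable)
    fun ξ => by
      rw [norm_two_pi_I_mul_mul, norm_mul, norm_mul, Complex.norm_real, Real.norm_eq_abs,
        abs_div, abs_two]
      have h3 : |ξ| * (|ξ| / (1 + ξ ^ 2)) ≤ 1 := by
        rw [← mul_div_assoc, div_le_one (by positivity), abs_mul_abs_self]
        nlinarith
      have h4 : |ξ| * ‖bsym ξ‖ ≤ 2 * Real.pi := by
        calc |ξ| * ‖bsym ξ‖ ≤ |ξ| * (2 * Real.pi * (|ξ| / (1 + ξ ^ 2))) := by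
              gcongr
              exact norm_bsym_le ξ
          _ = 2 * Real.pi * (|ξ| * (|ξ| / (1 + ξ ^ 2))) := by ring
          _ ≤ 2 * Real.pi * 1 := by gcongr
          _ = _ := mul_one _
      calc _ = |β| / 2 * (2 * Real.pi) * (|ξ| * ‖bsym ξ‖) * ‖conv (f t) (f t) ξ‖ := by ring
        _ ≤ |β| / 2 * (2 * Real.pi) * (2 * Real.pi) * ‖conv (f t) (f t) ξ‖ := by gcongr
        _ = _ := by ring
  have h3 := h1.memLp.sub h2.memLp
  refine h3.ae_eq (Eventually.of_forall fun ξ => ?_)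
  simp only [pHat, Pi.sub_apply]
  ring

lemma conv_sub_conv_eq (S : Setting β γ M s f₀ Λ m Ce f) {τ : ℝ} (hτ : 0 ≤ τ) (ξ : ℝ) :
    conv (f τ) (f τ) ξ - conv (chiHat β M τ) (chiHat β M τ) ξ
      = 2 * conv (chiHat β M τ) (wdiff β M f τ) ξ
        + conv (wdiff β M f τ) (wdiff β M f τ) ξ := by
  obtain ⟨R, hR⟩ := S.bdd
  obtain ⟨C, hC, hb⟩ := exists_norm_chiHat_le S.hβ 0
  have hχ : ∀ η, ‖chiHat β M τ η‖ ≤ C * |M| := fun η => by simpa using hb M S.hM S.hM1 τ η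
  have e := conv_sub_self (S.sol.continuous_apply τ) (continuous_chiHat_right S.hβ S.hM S.hM1 τ)
    ((S.int τ).norm.add (integrable_chiHat S.hβ S.hM S.hM1 hτ).norm)
    (fun η => by simp) (fun η => by simp) (M := max R (C * |M|))
    (fun η => (hR τ η).trans (le_max_left _ _))
    (fun η => (hχ η).trans (le_max_right _ _)) ξ
  have hw : ∀ η, ‖wdiff β M f τ η‖ ≤ R + C * |M| := fun η =>
    (norm_sub_le _ _).trans (add_le_add (hR τ η) (hχ η))
  have hwm : AEStronglyMeasurable (fun η => wdiff β M f τ (ξ - η)) volume :=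
    ((S.continuous_wdiff_apply τ).comp (continuous_sub_left ξ)).aestronglyMeasurable
  have hi : ∀ {g : ℝ → ℂ}, Integrable g volume →
      Integrable (fun η => g η * wdiff β M f τ (ξ - η)) volume := fun hg =>
    hg.mul_bdd hwm (Eventually.of_forall fun η => hw (ξ - η))
  have e2 : conv (f τ) (wdiff β M f τ) ξ
      = conv (chiHat β M τ) (wdiff β M f τ) ξ + conv (wdiff β M f τ) (wdiff β M f τ) ξ := by
    unfold conv
    rw [← integral_add (hi (integrable_chiHat S.hβ S.hM S.hM1 hτ)) (hi (S.integrable_wdiff hτ))]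
    refine integral_congr_ae (Eventually.of_forall fun η => ?_)
    simp only [wdiff]
    ring
  rw [e]
  change conv (f τ) (wdiff β M f τ) ξ + conv (chiHat β M τ) (wdiff β M f τ) ξ = _
  rw [e2]
  ring

lemma memLp_conv_of_rate {t A B : ℝ} {s : ℕ} (hs : 1 ≤ s) {g h : ℝ → ℂ} (ht : 0 ≤ t) (hA : 0 ≤ A)
    (hB : 0 ≤ B) (hg : L2Bd (fun ξ => ((wt t ξ ^ s : ℝ) : ℂ) * g ξ) A)
    (hh : L2Bd (fun ξ => ((wt t ξ ^ s : ℝ) : ℂ) * h ξ) B) (hgi : Integrable g volume)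
    (hhi : Integrable h volume) : MemLp (conv g h) 2 volume := by
  refine (l2Bd_of_le_inv_wt (c := A * B) ht (by positivity) (integrable_conv hgi hhi).1
    fun ξ => (norm_conv_le hA hB hg hh ξ).trans (div_wt_pow_le hs (by positivity) t ξ)).memLp

/-- The physical-space form of the product of the wave and the difference. -/
lemma fourierInv_conv_chiHat (S : Setting β γ M s f₀ Λ m Ce f) {τ : ℝ} (hτ : 0 ≤ τ)
    (hc : MemLp (conv (chiHat β M τ) (wdiff β M f τ)) 2 volume)
    (hw : MemLp (wdiff β M f τ) 2 volume) :
    (𝓕⁻ (toL2C fun ξ => (-β : ℂ) * conv (chiHat β M τ) (wdiff β M f τ) ξ) : L2C)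
      = mulL2 (fun x => (-β : ℂ) * (chi β M τ x : ℂ)) (𝓕⁻ (toL2C (wdiff β M f τ))) := by
  have hχ := integrable_chiHat S.hβ S.hM S.hM1 hτ
  have hwi := S.integrable_wdiff hτ
  have hχ' := fourierInv_chiHat S.hβ S.hM S.hM1 hτ
  have hprod : MemLp (fun x => 𝓕⁻ (chiHat β M τ) x * 𝓕⁻ (wdiff β M f τ) x) 2 volume :=
    (memLp_fourierInv (integrable_conv hχ hwi) hc).ae_eq
      (Eventually.of_forall fun x => fourierInv_conv hχ hwi x)
  have e1 : (𝓕⁻ ((-β : ℂ) • toL2C (conv (chiHat β M τ) (wdiff β M f τ))) : L2C)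
      = (-β : ℂ) • 𝓕⁻ (toL2C (conv (chiHat β M τ) (wdiff β M f τ))) :=
    (Lp.fourierTransformₗᵢ ℝ ℂ).symm.map_smul _ _
  rw [toL2C_const_mul _ hc, e1, ← fourier_mul_eq_conv hχ hwi hc, ← toL2C_const_mul _ hprod]
  refine toL2C_congr ?_
  filter_upwards [fourierInv_toL2C hwi hw] with x hx
  rw [hx, hχ', mul_assoc]

/-- The decay of the antiderivative of the difference, for data that decay under the heat
semigroup after the Hopf–Cole transformation. -/
theorem norm_antid_le (S : Setting β γ M s f₀ Λ m Ce f)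
    (hdom : ∃ D : ℝ → ℝ, MemLp D 2 volume ∧
      ∀ t ξ, ‖(((1 + |ξ|) ^ s : ℝ) : ℂ) * f t ξ‖ ≤ D ξ)
    (hV0 : MemLp (antid β M f 0) 2 volume) {a A₀ A₁ : ℝ} (ha : 0 ≤ a) (ha1 : a < 1)
    (hA₁ : 0 ≤ A₁)
    (hw : ∀ t, 0 ≤ t → L2Bd (fun ξ => ((wt t ξ ^ s : ℝ) : ℂ) * wdiff β M f t ξ)
      (A₁ * (1 + t) ^ (-(1 / 2) : ℝ)))
    (h0 : ∀ t, 0 ≤ t →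
      ‖mulL2 (heatSym t) (𝓕 (mulL2 (hcF β M 0) (𝓕⁻ (toL2C (antid β M f 0)))))‖
        ≤ A₀ * (1 + t) ^ (1 / 4 - a / 2)) {t : ℝ} (ht : 0 ≤ t) :
    ‖toL2C (antid β M f t)‖
      ≤ 3 * (A₀ + hopfConst β a (fluxConst β γ Λ) (|β| / 2 * A₁ ^ 2) m)
        * (1 + t) ^ (1 / 4 - a / 2) := by
  have hΛ := S.Λ0
  have hm := S.m0
  have hpi := Real.pi_pos
  have hwm : ∀ t, AEStronglyMeasurable (wdiff β M f t) volume := fun t =>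
    (S.continuous_wdiff_apply t).aestronglyMeasurable
  have hw2 : ∀ t, 0 ≤ t → L2Bd (wdiff β M f t) (A₁ * (1 + t) ^ (-(1 / 2) : ℝ)) := fun t ht =>
    (hw t ht).of_wt (hwm t)
  have hdw : ∀ t, 0 ≤ t → MemLp (fun ξ => 2 * Real.pi * Complex.I * ξ * wdiff β M f t ξ) 2
      volume := fun t ht => ((hw t ht).deriv_of_wt S.one_le ht (hwm t)).memLp
  have hcχ : ∀ t, 0 ≤ t → MemLp (conv (chiHat β M t) (wdiff β M f t)) 2 volume := fun t ht =>
    memLp_conv_of_rate S.one_le ht (by positivity) (by positivity) (S.wave t ht) (hw t ht)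
      (integrable_chiHat S.hβ S.hM S.hM1 ht) (S.integrable_wdiff ht)
  have hcw : ∀ t, 0 ≤ t → MemLp (conv (wdiff β M f t) (wdiff β M f t)) 2 volume := fun t ht =>
    memLp_conv_of_rate S.one_le ht (by positivity) (by positivity) (hw t ht) (hw t ht)
      (S.integrable_wdiff ht) (S.integrable_wdiff ht)
  have hflux : 0 ≤ fluxConst β γ Λ := by unfold fluxConst; positivity
  set q : ℝ → ℝ → ℂ := fun τ x =>
    (-(β / 2 : ℝ) : ℂ) * (𝓕⁻ (wdiff β M f τ) x * 𝓕⁻ (wdiff β M f τ) x) with hq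
  have hsq : ∀ τ, 0 < τ →
      MemLp (fun x => 𝓕⁻ (wdiff β M f τ) x * 𝓕⁻ (wdiff β M f τ) x) 2 volume := fun τ hτ =>
    (memLp_fourierInv (integrable_conv (S.integrable_wdiff hτ.le) (S.integrable_wdiff hτ.le))
      (hcw τ hτ.le)).ae_eq (Eventually.of_forall fun x =>
        fourierInv_conv (S.integrable_wdiff hτ.le) (S.integrable_wdiff hτ.le) x)
  have hphys : ∀ τ, 0 < τ → L2Bd (𝓕⁻ (wdiff β M f τ)) (A₁ * (1 + τ) ^ (-(1 / 2) : ℝ)) :=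
    fun τ hτ => (hw2 τ hτ.le).fourierInv (by positivity) (S.integrable_wdiff hτ.le)
  have hnq : ∀ τ x, ‖q τ x‖
      = |β| / 2 * (‖𝓕⁻ (wdiff β M f τ) x‖ * ‖𝓕⁻ (wdiff β M f τ) x‖) := fun τ x => by
    rw [hq]
    simp only [norm_mul]
    rw [norm_neg, Complex.norm_real, Real.norm_eq_abs, abs_div, abs_two]
  have hqi : ∀ τ, 0 < τ → Integrable (q τ) volume := fun τ hτ => by
    have := ((hphys τ hτ).integrable_mul (hphys τ hτ)).const_mul (|β| / 2)
    exact this.mono' ((hsq τ hτ).1.const_mul _) (Eventually.of_forall fun x => (hnq τ x).le)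
  have e := norm_fourierInv_eq (toL2C (antid β M f t))
  rw [← e]
  refine norm_le_of_hopfCole S.hβ S.hM ha1 ha hflux (by positivity) hm
    (W := fun τ => 𝓕⁻ (toL2C (antid β M f τ))) (w := fun τ => 𝓕⁻ (toL2C (wdiff β M f τ)))
    (w' := fun τ => 𝓕⁻ (toL2C fun ξ => 2 * Real.pi * Complex.I * ξ * wdiff β M f τ ξ))
    (P := fun τ => 𝓕⁻ (toL2C (pHat β γ f τ)))
    (P' := fun τ => 𝓕⁻ (toL2C fun ξ => 2 * Real.pi * Complex.I * ξ * pHat β γ f τ ξ))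
    (Q := fun τ => 𝓕⁻ (toL2C fun ξ =>
      (-(β / 2 : ℝ) : ℂ) * conv (wdiff β M f τ) (wdiff β M f τ) ξ)) (q := q)
    ?_ ?_ ?_ ?_ ?_ ?_ ?_ hqi ?_ ?_ ?_ h0 ht
  · exact (Lp.fourierTransformₗᵢ ℝ ℂ).symm.continuous.comp_continuousOn
      (S.continuousOn_antid hdom hV0)
  · intro τ hτ
    refine (hasDerivAt_fourierInv (S.hasDerivAt_toL2C_antid hdom hV0 hτ)).congr_deriv ?_
    have h1 := hdw τ hτ.le
    have h2 := (hcχ τ hτ.le).const_mul (-β : ℂ)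
    have h3 := S.memLp_deriv_pHat hτ.le
    have h4 := (hcw τ hτ.le).const_mul (-(β / 2 : ℝ) : ℂ)
    have e : (toL2C fun ξ => (Lsym γ ξ * wdiff β M f τ ξ + wsrc β γ M f τ ξ)
          / (2 * Real.pi * Complex.I * ξ))
        = toL2C (fun ξ => 2 * Real.pi * Complex.I * ξ * wdiff β M f τ ξ)
          + toL2C (fun ξ => (-β : ℂ) * conv (chiHat β M τ) (wdiff β M f τ) ξ)
          + toL2C (fun ξ => 2 * Real.pi * Complex.I * ξ * pHat β γ f τ ξ)
          + toL2C (fun ξ => (-(β / 2 : ℝ) : ℂ)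
            * conv (wdiff β M f τ) (wdiff β M f τ) ξ) := by
      have h12 : MemLp (fun ξ => 2 * Real.pi * Complex.I * ξ * wdiff β M f τ ξ
          + (-β : ℂ) * conv (chiHat β M τ) (wdiff β M f τ) ξ) 2 volume := h1.add h2
      have h123 : MemLp (fun ξ => 2 * Real.pi * Complex.I * ξ * wdiff β M f τ ξ
          + (-β : ℂ) * conv (chiHat β M τ) (wdiff β M f τ) ξ
          + 2 * Real.pi * Complex.I * ξ * pHat β γ f τ ξ) 2 volume := h12.add h3
      rw [← toL2C_add h1 h2, ← toL2C_add h12 h3, ← toL2C_add h123 h4]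
      refine toL2C_congr ?_
      filter_upwards [Measure.ae_ne volume (0 : ℝ)] with ξ hξ
      exact antid_equation β γ M hξ (S.conv_sub_conv_eq hτ.le ξ)
    rw [e, fourierInv_add', fourierInv_add', fourierInv_add',
      S.fourierInv_conv_chiHat hτ.le (hcχ τ hτ.le) (hw2 τ hτ.le).memLp]
  · intro τ hτ
    refine fourier_relation (S.memLp_antid hdom hV0 hτ.le) (hw2 τ hτ.le).memLp ?_
    filter_upwards [Measure.ae_ne volume (0 : ℝ)] with ξ hξ
    have hk : (2 * Real.pi * Complex.I * ξ : ℂ) ≠ 0 := by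
      simp [hξ, Real.pi_ne_zero, Complex.I_ne_zero]
    exact (mul_div_cancel₀ _ hk).symm
  · intro τ hτ
    exact fourier_relation (hw2 τ hτ.le).memLp (hdw τ hτ.le) (Eventually.of_forall fun ξ => rfl)
  · intro τ hτ
    exact fourier_relation (S.l2Bd_pHat hτ.le).memLp (S.memLp_deriv_pHat hτ.le)
      (Eventually.of_forall fun ξ => rfl)
  · intro τ hτ
    rw [norm_fourierInv_eq]
    exact (S.l2Bd_pHat hτ.le).norm_toL2C_le (by positivity)
  · intro τ hτ
    have e1 : (𝓕⁻ ((-(β / 2 : ℝ) : ℂ) • toL2C (conv (wdiff β M f τ) (wdiff β M f τ))) : L2C)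
        = (-(β / 2 : ℝ) : ℂ) • 𝓕⁻ (toL2C (conv (wdiff β M f τ) (wdiff β M f τ))) :=
      (Lp.fourierTransformₗᵢ ℝ ℂ).symm.map_smul _ _
    rw [toL2C_const_mul _ (hcw τ hτ.le), e1,
      ← fourier_mul_eq_conv (S.integrable_wdiff hτ.le) (S.integrable_wdiff hτ.le) (hcw τ hτ.le),
      ← toL2C_const_mul _ (hsq τ hτ)]
  · intro τ hτ
    exact (hsq τ hτ).const_mul _
  · intro τ hτ
    have h1τ : 0 < 1 + τ := by linarith
    have h := (hphys τ hτ).integral_mul_le (hphys τ hτ) (by positivity) (by positivity)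
    simp only [hnq]
    rw [integral_const_mul]
    have e1 : (1 + τ) ^ (-1 : ℝ) = (1 + τ) ^ (-(1 / 2) : ℝ) * (1 + τ) ^ (-(1 / 2) : ℝ) := by
      rw [← Real.rpow_add h1τ]; norm_num
    calc _ ≤ |β| / 2 * (A₁ * (1 + τ) ^ (-(1 / 2) : ℝ) * (A₁ * (1 + τ) ^ (-(1 / 2) : ℝ))) := by
          gcongr
      _ = _ := by rw [e1]; ring
  · intro τ hτ
    have h := ((S.wave τ hτ.le).of_wt
      (continuous_chiHat_right S.hβ S.hM S.hM1 τ).aestronglyMeasurable).fourierInv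
      (by positivity) (integrable_chiHat S.hβ S.hM S.hM1 hτ.le)
    rwa [fourierInv_chiHat S.hβ S.hM S.hM1 hτ.le] at h

end Setting

/-! ### Decay for localized data -/

lemma exp_neg_sq_le {p : ℝ} (hp : p ≤ 2) (x : ℝ) :
    Real.exp (-x ^ 2 / 4) ≤ 68 * (1 + |x|) ^ (-p) := by
  have h0 := abs_nonneg x
  have h2 := abs_pow_mul_exp_le 2 x
  have h3 : Real.exp (-x ^ 2 / 4) ≤ 1 := Real.exp_le_one_iff.2 (by nlinarith [sq_nonneg x])
  have h4 : (1 + |x|) ^ (-2 : ℝ) ≤ (1 + |x|) ^ (-p) :=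
    Real.rpow_le_rpow_of_exponent_le (by linarith) (by linarith)
  have h5 : Real.exp (-x ^ 2 / 4) ≤ 68 * (1 + |x|) ^ (-2 : ℝ) := by
    rw [Real.rpow_neg (by positivity), Real.rpow_two, ← div_eq_mul_inv, le_div_iff₀ (by positivity)]
    norm_num [Nat.factorial] at h2
    have h6 : (1 + |x|) ^ 2 ≤ 2 + 2 * x ^ 2 := by nlinarith [sq_nonneg (|x| - 1), sq_abs x]
    nlinarith [mul_le_mul_of_nonneg_left h6 (Real.exp_nonneg (-x ^ 2 / 4))]
  linarith

lemma integrable_of_decay {a K : ℝ} (ha : 0 < a) {g : ℝ → ℂ} (hg : Continuous g)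
    (hK : ∀ x, ‖g x‖ ≤ K * (1 + |x|) ^ (-(1 + a))) : Integrable g volume := by
  have h : Integrable (fun x : ℝ => (1 + ‖x‖) ^ (-(1 + a))) volume :=
    integrable_one_add_norm (by simp; exact ha)
  exact (h.const_mul K).mono' hg.aestronglyMeasurable (Eventually.of_forall hK)

lemma memLp_of_decay {a K : ℝ} (ha : 0 ≤ a) {g : ℝ → ℂ} (hg : Continuous g)
    (hK : ∀ x, ‖g x‖ ≤ K * (1 + |x|) ^ (-(1 + a))) : MemLp g 2 volume := by
  have hK0 : 0 ≤ K := by simpa using (norm_nonneg _).trans (hK 0)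
  refine ((memLp_inv_wt le_rfl).const_mul K).of_le hg.aestronglyMeasurable
    (Eventually.of_forall fun x => (hK x).trans ((mul_le_mul_of_nonneg_left ?_ hK0).trans
      (le_abs_self _)))
  rw [wt_zero, ← Real.rpow_neg_one]
  exact Real.rpow_le_rpow_of_exponent_le (by linarith [abs_nonneg x]) (by linarith)

/-- If `G / ξ` is square integrable, the continuous function `G` vanishes at `0`. -/
lemma eq_zero_of_memLp_div {G H : ℝ → ℂ} (hG : Continuous G) (hH : MemLp H 2 volume)
    (h : ∀ᵐ ξ : ℝ, G ξ = 2 * Real.pi * Complex.I * ξ * H ξ) : G 0 = 0 := by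
  by_contra hne
  have hc : 0 < ‖G 0‖ := norm_pos_iff.2 hne
  have hev : ∀ᶠ ξ in 𝓝 (0 : ℝ), ‖G 0‖ / 2 < ‖G ξ‖ :=
    (hG.norm.tendsto 0).eventually_const_lt (by linarith)
  obtain ⟨η, hη, hball⟩ := Metric.eventually_nhds_iff_ball.1 hev
  have hint : IntegrableOn (fun ξ => ‖H ξ‖ ^ 2) (Set.Ioo 0 η) :=
    ((memLp_two_iff_integrable_sq_norm hH.1).1 hH).integrableOn
  have hcontra : IntegrableOn (fun ξ : ℝ => ξ ^ (-2 : ℝ)) (Set.Ioo 0 η) := by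
    refine (hint.const_mul ((4 * Real.pi / ‖G 0‖) ^ 2)).mono' (by fun_prop) ?_
    filter_upwards [ae_restrict_of_ae h, ae_restrict_mem measurableSet_Ioo] with ξ h1 h2
    have h3 := hball ξ (by simp [abs_of_pos h2.1, h2.2])
    rw [h1, norm_two_pi_I_mul_mul, abs_of_pos h2.1] at h3
    have h0 := h2.1
    rw [Real.norm_of_nonneg (by positivity), Real.rpow_neg h0.le, Real.rpow_two, ← mul_pow,
      ← inv_pow]
    refine pow_le_pow_left₀ (by positivity) ?_ 2
    rw [inv_le_iff_one_le_mul₀ h0, div_mul_eq_mul_div, div_mul_eq_mul_div, le_div_iff₀ hc]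
    linarith
  rw [intervalIntegral.integrableOn_Ioo_rpow_iff hη] at hcontra
  norm_num at hcontra

/-- The constant `∫ e^(-ξ²) |ξ|^(a-1) dξ`. -/
def lowConst (a : ℝ) : ℝ := ∫ ξ : ℝ, Real.exp (-|ξ| ^ (2 : ℝ)) * |ξ| ^ (a - 1)

lemma lowConst_nonneg (a : ℝ) : 0 ≤ lowConst a := integral_nonneg fun ξ => by positivity

lemma integrable_low {a : ℝ} (ha : 0 < a) :
    Integrable (fun ξ : ℝ => Real.exp (-|ξ| ^ (2 : ℝ)) * |ξ| ^ (a - 1)) volume := by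
  have := integrable_comp_abs (integrableOn_rpow_mul_exp_neg_rpow (p := 2) (s := a - 1)
    (by linarith) (by norm_num))
  exact this.congr (Eventually.of_forall fun ξ => mul_comm _ _)

section Antiderivative

variable {a H B : ℝ} {w : ℝ → ℂ}

/-- The two bounds for the antiderivative, at low and at high frequencies. -/
lemma norm_div_le_low_add_high (hlow : ∀ ξ, ‖w ξ‖ ≤ H * |ξ| ^ a) (ξ : ℝ) :
    ‖w ξ / (2 * Real.pi * Complex.I * ξ)‖
      ≤ 3 * H * (Real.exp (-|ξ| ^ (2 : ℝ)) * |ξ| ^ (a - 1)) + ‖w ξ‖ * (wt 0 ξ)⁻¹ := by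
  have hpi := Real.pi_gt_three
  have hH0 : 0 ≤ H := by simpa using (norm_nonneg _).trans (hlow 1)
  have hwt := wt_pos 0 ξ
  rcases eq_or_ne ξ 0 with rfl | hξ
  · simp only [Complex.ofReal_zero, mul_zero, div_zero, norm_zero]
    positivity
  have hξ' : 0 < |ξ| := abs_pos.2 hξ
  rw [norm_div, norm_two_pi_I_mul]
  rcases le_total |ξ| 1 with h | h
  · have h1 : 1 ≤ 3 * Real.exp (-|ξ| ^ (2 : ℝ)) := by
      have h2 : |ξ| ^ (2 : ℝ) ≤ 1 := Real.rpow_le_one hξ'.le h (by norm_num)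
      have h3 : Real.exp (-1) ≤ Real.exp (-|ξ| ^ (2 : ℝ)) := Real.exp_le_exp.2 (by linarith)
      have h4 := Real.exp_one_lt_d9
      have h5 : Real.exp (-1) * Real.exp 1 = 1 := by rw [← Real.exp_add]; simp
      nlinarith [Real.exp_pos (-1)]
    have e : |ξ| ^ a = |ξ| ^ (a - 1) * |ξ| := by
      rw [← Real.rpow_add_one hξ'.ne']; simp
    have h6 : ‖w ξ‖ / (2 * Real.pi * |ξ|) ≤ H * |ξ| ^ (a - 1) := by
      rw [div_le_iff₀ (by positivity)]
      have h7 : 0 ≤ H * |ξ| ^ (a - 1) * |ξ| := by positivity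
      have := hlow ξ
      rw [e] at this
      nlinarith
    have h8 : 0 ≤ ‖w ξ‖ * (wt 0 ξ)⁻¹ := by positivity
    have h9 := mul_le_mul_of_nonneg_left h1 (by positivity : 0 ≤ H * |ξ| ^ (a - 1))
    linarith
  · have h1 : ‖w ξ‖ / (2 * Real.pi * |ξ|) ≤ ‖w ξ‖ * (wt 0 ξ)⁻¹ := by
      rw [div_eq_mul_inv]
      refine mul_le_mul_of_nonneg_left (inv_anti₀ hwt ?_) (norm_nonneg _)
      rw [wt_zero]
      nlinarith
    have : 0 ≤ 3 * H * (Real.exp (-|ξ| ^ (2 : ℝ)) * |ξ| ^ (a - 1)) := by positivity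
    linarith

lemma measurable_div_two_pi_I (hw : Continuous w) :
    AEStronglyMeasurable (fun ξ : ℝ => w ξ / (2 * Real.pi * Complex.I * ξ)) volume :=
  (hw.measurable.div measurable_two_pi_I_mul).aestronglyMeasurable

lemma integrable_div_two_pi_I (ha : 0 < a) (hB : 0 ≤ B) (hw : Continuous w)
    (hlow : ∀ ξ, ‖w ξ‖ ≤ H * |ξ| ^ a) (hwB : L2Bd w B) :
    Integrable (fun ξ : ℝ => w ξ / (2 * Real.pi * Complex.I * ξ)) volume ∧
      ∫ ξ : ℝ, ‖w ξ / (2 * Real.pi * Complex.I * ξ)‖ ≤ 3 * H * lowConst a + 2 * B := by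
  have hinv : L2Bd (fun ξ => (((wt 0 ξ)⁻¹ : ℝ) : ℂ)) 2 := by
    simpa using l2Bd_inv_wt (t := 0) le_rfl
  have e : ∀ ξ, ‖(((wt 0 ξ)⁻¹ : ℝ) : ℂ)‖ = (wt 0 ξ)⁻¹ := fun ξ => by
    rw [Complex.norm_real, Real.norm_of_nonneg (inv_nonneg.2 (wt_pos 0 ξ).le)]
  have i1 := (integrable_low ha).const_mul (3 * H)
  have i2 := hwB.integrable_mul hinv
  have v2 := hwB.integral_mul_le hinv hB (by norm_num)
  simp only [e] at i2 v2
  have hi := (i1.add i2).mono' (measurable_div_two_pi_I hw)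
    (Eventually.of_forall (norm_div_le_low_add_high hlow))
  refine ⟨hi, (integral_mono hi.norm (i1.add i2) (norm_div_le_low_add_high hlow)).trans ?_⟩
  rw [integral_add' i1 i2, integral_const_mul]
  unfold lowConst
  linarith

lemma l2Bd_div_two_pi_I (ha : 1 / 2 < a) (hB : 0 ≤ B) (hw : Continuous w)
    (hlow : ∀ ξ, ‖w ξ‖ ≤ H * |ξ| ^ a) (hwB : L2Bd w B) :
    L2Bd (fun ξ : ℝ => w ξ / (2 * Real.pi * Complex.I * ξ))
      (3 * H * (√(Real.Gamma (a - 1 / 2)) * (((2 * Real.pi) ^ 2)⁻¹) ^ (1 / 4 - a / 2)) + B) := by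
  have hH0 : 0 ≤ H := by simpa using (norm_nonneg _).trans (hlow 1)
  have h0 := (l2Bd_heat_rpow ha (by positivity : 0 < ((2 * Real.pi) ^ 2)⁻¹)).const_mul
    ((3 * H : ℝ) : ℂ)
  rw [Complex.norm_real, Real.norm_of_nonneg (by positivity)] at h0
  refine h0.of_le_add hwB (by positivity) hB (measurable_div_two_pi_I hw) fun ξ => ?_
  refine (norm_div_le_low_add_high hlow ξ).trans (add_le_add (le_of_eq ?_) ?_)
  · rw [norm_mul, Complex.norm_real, Complex.norm_real, Real.norm_of_nonneg (by positivity),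
      Real.norm_of_nonneg (by positivity), mul_pow (2 * Real.pi) ξ 2,
      inv_mul_cancel_left₀ (by positivity),
      Real.rpow_two, sq_abs]
  · exact mul_le_of_le_one_right (norm_nonneg _) (inv_le_one_of_one_le₀ (one_le_wt 0 ξ))

end Antiderivative

section InitialDatum

variable {β M : ℝ}

/-- The decay constant of the Hopf–Cole transform of the antiderivative of the initial datum. -/
def initConst (a K B : ℝ) : ℝ :=
  2 * (√(Real.Gamma (a - 1 / 2))
      * (hoelderConst a * (68 * (3 * (hoelderConst a * K) * lowConst a + 2 * B) + 6 * K))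
    + 6 * (3 * (hoelderConst a * K) * (√(Real.Gamma (a - 1 / 2))
        * (((2 * Real.pi) ^ 2)⁻¹) ^ (1 / 4 - a / 2)) + B))

lemma norm_hcF1_zero_le (hM : |β * M| ≤ 2) (x : ℝ) :
    ‖hcF1 β M 0 x‖ ≤ Real.exp (-x ^ 2 / 4) := by
  have h := abs_hopfCole'_le hM x
  unfold hcF1
  simp only [add_zero, Real.sqrt_one, div_one]
  rw [Complex.norm_real, Real.norm_eq_abs]
  exact h.trans (mul_le_of_le_one_left (Real.exp_nonneg _) (by linarith))

/-- After the Hopf–Cole transformation, the antiderivative of a localized datum of mean zero decays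
under the heat semigroup: its derivative is localized and of mean zero. -/
lemma norm_heat_hopfCole_init_le (hM : |β * M| ≤ 2) {a K B : ℝ} (ha : 1 / 2 < a) (ha1 : a < 1)
    (hB : 0 ≤ B) {g : ℝ → ℂ} (hg : Continuous g)
    (hK : ∀ x, ‖g x‖ ≤ K * (1 + |x|) ^ (-(1 + a))) (hg0 : 𝓕 g 0 = 0) (hgB : L2Bd (𝓕 g) B)
    {t : ℝ} (ht : 0 ≤ t) :
    ‖mulL2 (heatSym t) (𝓕 (mulL2 (hcF β M 0)
        (𝓕⁻ (toL2C fun ξ => 𝓕 g ξ / (2 * Real.pi * Complex.I * ξ)))))‖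
      ≤ initConst a K B * (1 + t) ^ (1 / 4 - a / 2) := by
  have ha0 : 0 < a := by linarith
  have hK0 : 0 ≤ K := by simpa using (norm_nonneg _).trans (hK 0)
  have hHc := hoelderConst_nonneg a
  have hLc := lowConst_nonneg a
  have gi := integrable_of_decay ha0 hg hK
  have g2 := memLp_of_decay ha0.le hg hK
  have hgc := continuous_fourier gi
  have hlow : ∀ ξ, ‖𝓕 g ξ‖ ≤ hoelderConst a * K * |ξ| ^ a := fun ξ => by
    have := norm_fourier_sub_le ha0 ha1 gi hK ξ
    rwa [hg0, sub_zero] at this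
  obtain ⟨vi, vb⟩ := integrable_div_two_pi_I ha0 hB hgc hlow hgB
  have v2 := l2Bd_div_two_pi_I ha hB hgc hlow hgB
  set V : ℝ → ℂ := fun ξ => 𝓕 g ξ / (2 * Real.pi * Complex.I * ξ) with hV
  set S := 3 * (hoelderConst a * K) * lowConst a + 2 * B with hS
  set R := 3 * (hoelderConst a * K) * (√(Real.Gamma (a - 1 / 2))
        * (((2 * Real.pi) ^ 2)⁻¹) ^ (1 / 4 - a / 2)) + B with hR
  have hS0 : 0 ≤ S := by positivity
  have hR0 : 0 ≤ R := by positivity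
  have m0 := aestronglyMeasurable_hcF β M 0
  have m1 := aestronglyMeasurable_hcF1 β M 0
  have c0 := norm_hcF_le hM 0
  have c1 := norm_hcF1_le hM le_rfl
  set W : L2C := 𝓕⁻ (toL2C V) with hW
  set ω : ℝ → ℂ := fun x => hcF1 β M 0 x * 𝓕⁻ V x + hcF β M 0 x * g x with hω
  have hωc : Continuous ω :=
    ((contDiff_hcF1 β M 0).continuous.mul (continuous_fourierInv vi)).add
      ((contDiff_hcF β M 0).continuous.mul hg)
  have hωK : ∀ x, ‖ω x‖ ≤ (68 * S + 6 * K) * (1 + |x|) ^ (-(1 + a)) := fun x => by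
    have p0 : 0 ≤ (1 + |x|) ^ (-(1 + a)) := by positivity
    have b1 := (norm_hcF1_zero_le hM x).trans (exp_neg_sq_le (by linarith : 1 + a ≤ 2) x)
    have b2 := (norm_fourierInv_le (f := V) x).trans vb
    refine (norm_add_le _ _).trans ?_
    rw [norm_mul, norm_mul]
    calc _ ≤ 68 * (1 + |x|) ^ (-(1 + a)) * S + 6 * (K * (1 + |x|) ^ (-(1 + a))) := by
          gcongr
          · exact c0 x
          · exact hK x
      _ = _ := by ring
  have ωi := integrable_of_decay ha0 hωc hωK
  have ω2 := memLp_of_decay ha0.le hωc hωK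
  have egf : toL2C g = 𝓕⁻ (toL2C (𝓕 g)) := by
    rw [toL2C_fourier gi g2]
    exact ((Lp.fourierTransformₗᵢ ℝ ℂ).symm_apply_apply _).symm
  have hrel : ∀ᵐ ξ, (𝓕 (toL2C g) : L2C) ξ = 2 * Real.pi * Complex.I * ξ * (𝓕 W : L2C) ξ := by
    rw [egf]
    refine fourier_relation v2.memLp hgB.memLp ?_
    filter_upwards [Measure.ae_ne volume (0 : ℝ)] with ξ hξ
    have hk : (2 * Real.pi * Complex.I * ξ : ℂ) ≠ 0 := by
      simp [hξ, Real.pi_ne_zero, Complex.I_ne_zero]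
    exact (mul_div_cancel₀ _ hk).symm
  have eω : mulL2 (hcF1 β M 0) W + mulL2 (hcF β M 0) (toL2C g) = toL2C ω := by
    refine Lp.ext ?_
    filter_upwards [Lp.coeFn_add (mulL2 (hcF1 β M 0) W) (mulL2 (hcF β M 0) (toL2C g)),
      coeFn_mulL2 m1 c1 W, coeFn_mulL2 m0 c0 (toL2C g), coeFn_toL2C g2, coeFn_toL2C ω2,
      fourierInv_toL2C vi v2.memLp] with x e1 e2 e3 e4 e5 e6
    rw [e1, Pi.add_apply, e2, e3, e4, e5, hω, e6]
  have hder := fourier_mulL2_deriv hrel (contDiff_hcF β M 0) (hasDerivAt_hcF β M 0) m1 c0 c1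
  rw [eω] at hder
  set H : L2C := 𝓕 (mulL2 (hcF β M 0) W) with hH
  have hωH : ∀ᵐ ξ, 𝓕 ω ξ = 2 * Real.pi * Complex.I * ξ * H ξ := by
    filter_upwards [hder, fourier_toL2C ωi ω2] with ξ h1 h2
    rw [← h2, h1]
  have hω0 := eq_zero_of_memLp_div (continuous_fourier ωi) (Lp.memLp H) hωH
  have hHle : ∀ᵐ ξ, ‖H ξ‖ ≤ hoelderConst a * (68 * S + 6 * K) * |ξ| ^ (a - 1) := by
    filter_upwards [hωH, Measure.ae_ne volume (0 : ℝ)] with ξ h1 hξ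
    have hξ' : 0 < |ξ| := abs_pos.2 hξ
    have h2 := norm_fourier_sub_le ha0 ha1 ωi hωK ξ
    rw [hω0, sub_zero, h1, norm_two_pi_I_mul_mul] at h2
    have e : |ξ| ^ a = |ξ| ^ (a - 1) * |ξ| := by
      rw [← Real.rpow_add_one hξ'.ne']; simp
    rw [e] at h2
    refine le_of_mul_le_mul_right ?_ hξ'
    have h3 : 0 ≤ |ξ| * ‖H ξ‖ := by positivity
    nlinarith [Real.pi_gt_three]
  have hHB : L2Bd H (6 * R) := by
    refine (l2Bd_coeC H).le ?_
    calc ‖H‖ = ‖mulL2 (hcF β M 0) W‖ := (Lp.fourierTransformₗᵢ ℝ ℂ).norm_map _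
      _ ≤ 6 * ‖W‖ := norm_mulL2_le m0 c0 W
      _ ≤ 6 * R := by
        rw [hW, norm_fourierInv_eq]
        exact mul_le_mul_of_nonneg_left (v2.norm_toL2C_le hR0) (by norm_num)
  have hfin := l2Bd_heat ha ha1 ht (by positivity) (by positivity) hHB hHle
  exact hfin.norm_toL2C_le (by positivity)

end InitialDatum

/-- Decay of the difference between solution and diffusion wave, in the weighted `L²` norm of the
Fourier side. -/
theorem Setting.exists_l2Bd_wdiff (β γ : ℝ) (s : ℕ) (Λ m Ce : ℝ) {a K B : ℝ} (ha0 : 0 < a)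
    (ha1 : a < 1) (hB : 0 ≤ B) : ∃ C, 0 ≤ C ∧ ∀ (M : ℝ) (f₀ : ℝ → ℂ) (f : ℝ → ℝ → ℂ) (g : ℝ → ℂ),
      Setting β γ M s f₀ Λ m Ce f →
      (∃ D : ℝ → ℝ, MemLp D 2 volume ∧ ∀ t ξ, ‖(((1 + |ξ|) ^ s : ℝ) : ℂ) * f t ξ‖ ≤ D ξ) →
      Continuous g → (∀ x, ‖g x‖ ≤ K * (1 + |x|) ^ (-(1 + a))) → 𝓕 g 0 = 0 →
      wdiff β M f 0 = 𝓕 g →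
      L2Bd (fun ξ => ((wt 0 ξ ^ s : ℝ) : ℂ) * wdiff β M f 0 ξ) B →
      ∀ t, 0 ≤ t → L2Bd (fun ξ => ((wt t ξ ^ s : ℝ) : ℂ) * wdiff β M f t ξ)
        (C * (1 + t) ^ (-(1 / 4 + a / 2))) := by
  have hHc := hoelderConst_nonneg a
  have hCl := (Clin_pos s).le
  have hCd := (Cduh_pos s).le
  have low : ∀ (f : ℝ → ℝ → ℂ) (M : ℝ) (g : ℝ → ℂ), Continuous g →
      (∀ x, ‖g x‖ ≤ K * (1 + |x|) ^ (-(1 + a))) → 𝓕 g 0 = 0 → wdiff β M f 0 = 𝓕 g →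
      0 ≤ K ∧ ∀ ξ, ‖wdiff β M f 0 ξ‖ ≤ hoelderConst a * K * |ξ| ^ a := by
    intro f M g hg hK hg0 hfg
    refine ⟨by simpa using (norm_nonneg _).trans (hK 0), fun ξ => ?_⟩
    have := norm_fourier_sub_le ha0 ha1 (integrable_of_decay ha0 hg hK) hK ξ
    rwa [hg0, sub_zero, ← hfg] at this
  set A := 3 * (Clin s * (2 * (hoelderConst a * K) + B) + 2 * Cduh s * Ce + 1) with hA
  rcases le_or_gt a (1 / 2) with ha | ha
  · refine ⟨max A 0, le_max_right _ _, fun M f₀ f g S hdom hg hK hg0 hfg hw t ht => ?_⟩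
    obtain ⟨hK0, hlow⟩ := low f M g hg hK hg0 hfg
    refine (S.l2Bd_wdiff_of_le_half ha0.le ha (by positivity) hB (fun ξ _ => hlow ξ) hw ht).le ?_
    exact mul_le_mul_of_nonneg_right (le_max_left _ _) (Real.rpow_nonneg (by linarith) _)
  · set D := 2 * Real.pi * (3 * (initConst a K B
      + hopfConst β a (fluxConst β γ Λ) (|β| / 2 * A ^ 2) m)) with hD
    refine ⟨max (3 * (Clin s * (2 * D + A) + 2 * Cduh s * Ce + 1)) 0, le_max_right _ _,
      fun M f₀ f g S hdom hg hK hg0 hfg hw t ht => ?_⟩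
    obtain ⟨hK0, hlow⟩ := low f M g hg hK hg0 hfg
    have hCe := S.Ce0
    have hA0 : 0 ≤ A := by positivity
    have hpre : ∀ t, 0 ≤ t → L2Bd (fun ξ => ((wt t ξ ^ s : ℝ) : ℂ) * wdiff β M f t ξ)
        (A * (1 + t) ^ (-(1 / 2) : ℝ)) := fun t ht => by
      have := S.l2Bd_wdiff_of_le_half (a := 1 / 2) (by norm_num) le_rfl
        (by positivity : 0 ≤ hoelderConst a * K) hB (fun ξ hξ => (hlow ξ).trans ?_) hw ht
      · rwa [show (1 / 4 + 1 / 2 / 2 : ℝ) = 1 / 2 by norm_num] at this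
      · exact mul_le_mul_of_nonneg_left (Real.rpow_le_rpow_of_exponent_ge' (abs_nonneg _) hξ
          (by norm_num) ha.le) (by positivity)
    have hgB : L2Bd (𝓕 g) B := by
      rw [← hfg]
      exact hw.of_wt (S.continuous_wdiff_apply 0).aestronglyMeasurable
    have hant : antid β M f 0 = fun ξ : ℝ => 𝓕 g ξ / (2 * Real.pi * Complex.I * ξ) := by
      funext ξ
      rw [antid, hfg]
    have gi := integrable_of_decay ha0 hg hK
    have hlow' : ∀ ξ, ‖𝓕 g ξ‖ ≤ hoelderConst a * K * |ξ| ^ a := fun ξ => by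
      rw [← hfg]; exact hlow ξ
    have hV0 : MemLp (antid β M f 0) 2 volume := by
      rw [hant]
      exact (l2Bd_div_two_pi_I ha hB (continuous_fourier gi) hlow' hgB).memLp
    have hV : ∀ t, 0 ≤ t → ‖toL2C (antid β M f t)‖ ≤ 3 * (initConst a K B
        + hopfConst β a (fluxConst β γ Λ) (|β| / 2 * A ^ 2) m) * (1 + t) ^ (1 / 4 - a / 2) :=
      fun t ht => S.norm_antid_le hdom hV0 ha0.le ha1 hA0 hpre
        (fun t ht => by
          rw [hant]
          exact norm_heat_hopfCole_init_le S.hM ha ha1 hB hg hK hg0 hgB ht) ht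
    have hD0 : 0 ≤ D := by
      have h1 := (norm_nonneg _).trans (hV 0 le_rfl)
      rw [add_zero, Real.one_rpow, mul_one] at h1
      exact mul_nonneg (by positivity) h1
    have hVb : ∀ t, 0 ≤ t → L2Bd (fun ξ => ((2 * Real.pi : ℝ) : ℂ) * antid β M f t ξ)
        (D * (1 + t) ^ (1 / 4 - a / 2)) := fun t ht => by
      have h1 := (l2Bd_coeC (toL2C (antid β M f t))).le (hV t ht)
      have h2 : L2Bd (antid β M f t) (3 * (initConst a K B
          + hopfConst β a (fluxConst β γ Λ) (|β| / 2 * A ^ 2) m) * (1 + t) ^ (1 / 4 - a / 2)) := by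
        refine ⟨S.aestronglyMeasurable_antid t, ?_⟩
        rw [← eLpNorm_congr_ae (coeFn_toL2C (S.memLp_antid hdom hV0 ht))]
        exact h1.2
      refine (h2.const_mul _).le (le_of_eq ?_)
      rw [Complex.norm_real, Real.norm_of_nonneg (by positivity), hD]
      ring
    have hw0 : ∀ t, 0 ≤ t → wdiff β M f t 0 = 0 := fun t ht => by
      have h1 := (wdiff_eq S.hβ S.hM S.hM1 S.sol S.convc le_rfl ht 0).2
      have h2 : ∀ τ ∈ Set.uIcc 0 t, asym γ (t - τ) 0 * wsrc β γ M f τ 0 = 0 := fun τ hτ => by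
        rw [Set.uIcc_of_le ht] at hτ
        have h3 := S.norm_wsrc_le (b := 1 / 4) (ξ := 0) hτ.1 hA0 (by norm_num)
          (by rw [show (1 / 4 + 1 / 4 : ℝ) = 1 / 2 by norm_num]; exact hpre τ hτ.1)
        rw [abs_zero, zero_div, zero_mul, norm_le_zero_iff] at h3
        rw [h3, mul_zero]
      have h4 : wdiff β M f 0 0 = 0 := by rw [hfg, hg0]
      rw [h1, intervalIntegral.integral_congr h2, h4]
      simp
    refine (S.l2Bd_wdiff_of_antideriv (b := a / 2) (by linarith) (by linarith) hD0 hA0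
      (V := fun t ξ => ((2 * Real.pi : ℝ) : ℂ) * antid β M f t ξ) (fun t ht ξ => ?_) hVb
      (fun t ht => (hpre t ht).le ?_) ht).le ?_
    · rcases eq_or_ne ξ 0 with rfl | hξ
      · rw [hw0 t ht, norm_zero]
        positivity
      · have hξ' : 0 < |ξ| := abs_pos.2 hξ
        have hpi := Real.pi_pos
        rw [antid, norm_mul, norm_div, norm_two_pi_I_mul, Complex.norm_real,
          Real.norm_of_nonneg (by positivity)]
        refine le_of_eq ?_
        field_simp
    · exact mul_le_of_le_one_right hA0
        (Real.rpow_le_one_of_one_le_of_nonpos (by linarith) (by norm_num))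
    · exact mul_le_mul_of_nonneg_right (le_max_left _ _) (Real.rpow_nonneg (by linarith) _)

/-! ### Derivatives of the difference -/

/-- Each derivative up to the order `s` costs the factor `(1 + t)^(-1/2)`. -/
lemma norm_two_pi_I_mul_pow_mul_le {l n : ℕ} (hl : l ≤ n) {t : ℝ} (ht : 0 ≤ t) (ξ : ℝ) (z : ℂ) :
    ‖(2 * Real.pi * Complex.I * ξ) ^ l * z‖
      ≤ (2 * Real.pi) ^ n * (1 + t) ^ (-((l : ℝ) / 2)) * (wt t ξ ^ n * ‖z‖) := by
  have h1t : 0 < 1 + t := by linarith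
  have hr := Real.sqrt_pos.2 h1t
  have hpi : 1 ≤ 2 * Real.pi := by linarith [Real.pi_gt_three]
  have e : (1 + t) ^ (-((l : ℝ) / 2)) = (√(1 + t) ^ l)⁻¹ := by
    rw [Real.sqrt_eq_rpow, ← Real.rpow_natCast, ← Real.rpow_mul h1t.le, ← Real.rpow_neg h1t.le]
    congr 1
    ring
  have h1 : |ξ| ^ l ≤ (√(1 + t) ^ l)⁻¹ * wt t ξ ^ n := by
    rw [inv_mul_eq_div, le_div_iff₀ (by positivity), ← mul_pow]
    exact (pow_le_pow_left₀ (by positivity) (abs_mul_sqrt_le_wt t ξ) l).trans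
      (pow_le_pow_right₀ (one_le_wt t ξ) hl)
  rw [norm_mul, norm_two_pi_I_mul_pow, mul_pow, e]
  calc (2 * Real.pi) ^ l * |ξ| ^ l * ‖z‖
      ≤ (2 * Real.pi) ^ n * ((√(1 + t) ^ l)⁻¹ * wt t ξ ^ n) * ‖z‖ := by
        gcongr
    _ = _ := by ring

section Difference

variable {β M t A b : ℝ} {s : ℕ} {f : ℝ → ℝ → ℂ} {u : L2}

lemma fourier_cplx_sub_chi (hβ : β ≠ 0) (h : |β * M| ≤ 2) (h1 : |M| ≤ 1) (ht : 0 ≤ t)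
    (hu : (𝓕 (cplx u) : L2C) =ᵐ[volume] f t) :
    (𝓕 (cplx fun x => u x - chi β M t x) : L2C) =ᵐ[volume] wdiff β M f t := by
  have hχ := memLp_chi hβ h h1 ht
  have e : cplx (fun x => u x - chi β M t x) = cplx u - cplx (chi β M t) := by
    unfold cplx
    rw [← toL2C_sub (memLp_ofReal (Lp.memLp u)) (memLp_ofReal hχ)]
    push_cast
    rfl
  have e' : (𝓕 (cplx u - cplx (chi β M t)) : L2C) = 𝓕 (cplx u) - 𝓕 (cplx (chi β M t)) :=
    (Lp.fourierTransformₗᵢ ℝ ℂ).map_sub _ _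
  rw [e, e']
  filter_upwards [Lp.coeFn_sub (𝓕 (cplx u) : L2C) (𝓕 (cplx (chi β M t))), hu,
    fourier_cplx_ae (integrable_chi hβ h h1 ht) hχ] with ξ h1 h2 h3
  rw [h1, Pi.sub_apply, h2, h3, fourier_chi ht]
  rfl

lemma l2Bd_deriv_wdiff (hm : AEStronglyMeasurable (wdiff β M f t) volume) (ht : 0 ≤ t) {c : ℝ}
    (hw : L2Bd (fun ξ => ((wt t ξ ^ s : ℝ) : ℂ) * wdiff β M f t ξ) c) {l : ℕ} (hl : l ≤ s) :
    L2Bd (fun ξ : ℝ => (2 * Real.pi * Complex.I * ξ) ^ l * wdiff β M f t ξ)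
      ((2 * Real.pi) ^ s * (1 + t) ^ (-((l : ℝ) / 2)) * c) := by
  have hpi := Real.pi_pos
  have h1t : 0 < 1 + t := by linarith
  refine hw.mono_mul (by positivity) ((Continuous.aestronglyMeasurable (by fun_prop)).mul hm)
    fun ξ => ?_
  rw [norm_mul ((wt t ξ ^ s : ℝ) : ℂ), norm_wt_pow]
  exact norm_two_pi_I_mul_pow_mul_le hl ht ξ _

lemma derivNorm_two_sub_chi_le (hβ : β ≠ 0) (h : |β * M| ≤ 2) (h1 : |M| ≤ 1) (ht : 0 ≤ t)
    (hu : (𝓕 (cplx u) : L2C) =ᵐ[volume] f t)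
    (hw : L2Bd (fun ξ => ((wt t ξ ^ s : ℝ) : ℂ) * wdiff β M f t ξ) (A * (1 + t) ^ (-(1 / 4 + b))))
    {l : ℕ} (hl : l ≤ s) : derivNorm l 2 (fun x => u x - chi β M t x)
      ≤ ENNReal.ofReal ((2 * Real.pi) ^ s * A * (1 + t) ^ (-(1 / 4 + b) - (l : ℝ) / 2)) := by
  have e := fourier_cplx_sub_chi hβ h h1 ht hu
  have e' : (fun ξ : ℝ => (2 * Real.pi * Complex.I * ξ) ^ l
      * (𝓕 (cplx fun x => u x - chi β M t x) : L2C) ξ)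
      =ᵐ[volume] fun ξ : ℝ => (2 * Real.pi * Complex.I * ξ) ^ l * wdiff β M f t ξ := by
    filter_upwards [e] with ξ hξ
    rw [hξ]
  have hb := l2Bd_deriv_wdiff ((Lp.aestronglyMeasurable _).congr e) ht hw hl
  refine (derivNorm_two_le ((Lp.memLp u).sub (memLp_chi hβ h h1 ht)) l
    ((memLp_congr_ae e').2 hb.memLp)).trans ?_
  refine (eLpNorm_congr_ae e').trans_le (hb.2.trans (ENNReal.ofReal_le_ofReal (le_of_eq ?_)))
  rw [sub_eq_add_neg, Real.rpow_add (by linarith)]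
  ring

lemma derivNorm_top_sub_chi_le (hs : 1 ≤ s) (hβ : β ≠ 0) (h : |β * M| ≤ 2) (h1 : |M| ≤ 1)
    (ht : 0 ≤ t) (hA : 0 ≤ A) (hu : (𝓕 (cplx u) : L2C) =ᵐ[volume] f t)
    (hw : L2Bd (fun ξ => ((wt t ξ ^ s : ℝ) : ℂ) * wdiff β M f t ξ) (A * (1 + t) ^ (-(1 / 4 + b))))
    {l : ℕ} (hl : l ≤ s - 1) : derivNorm l ∞ (fun x => u x - chi β M t x)
      ≤ ENNReal.ofReal (2 * (2 * Real.pi) ^ s * A * (1 + t) ^ (-(1 / 2 + b) - (l : ℝ) / 2)) := by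
  have h1t : 0 < 1 + t := by linarith
  have hpi := Real.pi_gt_three
  have e := fourier_cplx_sub_chi hβ h h1 ht hu
  have hm : AEStronglyMeasurable (wdiff β M f t) volume := (Lp.aestronglyMeasurable _).congr e
  have e' : (fun ξ : ℝ => (2 * Real.pi * Complex.I * ξ) ^ l
      * (𝓕 (cplx fun x => u x - chi β M t x) : L2C) ξ)
      =ᵐ[volume] fun ξ : ℝ => (2 * Real.pi * Complex.I * ξ) ^ l * wdiff β M f t ξ := by
    filter_upwards [e] with ξ hξ
    rw [hξ]
  have hb := l2Bd_deriv_wdiff hm ht hw (hl.trans (Nat.sub_le s 1))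
  set c : ℝ := (2 * Real.pi) ^ (s - 1) * (1 + t) ^ (-((l : ℝ) / 2)) with hc
  -- one power of the weight is spent on the Cauchy–Schwarz inequality
  have hle : ∀ ξ : ℝ, ‖(2 * Real.pi * Complex.I * ξ) ^ l * wdiff β M f t ξ‖
      ≤ c * (‖(((wt t ξ)⁻¹ : ℝ) : ℂ)‖ * ‖((wt t ξ ^ s : ℝ) : ℂ) * wdiff β M f t ξ‖) := fun ξ => by
    have hp := wt_pos t ξ
    refine (norm_two_pi_I_mul_pow_mul_le hl ht ξ _).trans_eq ?_
    rw [norm_mul ((wt t ξ ^ s : ℝ) : ℂ), norm_wt_pow, Complex.norm_real,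
      Real.norm_of_nonneg (inv_nonneg.2 hp.le), ← mul_assoc _ (wt t ξ ^ s),
      show wt t ξ ^ s = wt t ξ * wt t ξ ^ (s - 1) by
        rw [← pow_succ', Nat.sub_add_cancel hs], inv_mul_cancel_left₀ hp.ne']
  have hi := ((l2Bd_inv_wt ht).integrable_mul hw).const_mul c
  have hi' : Integrable (fun ξ : ℝ => (2 * Real.pi * Complex.I * ξ) ^ l * wdiff β M f t ξ)
      volume := hi.mono' hb.1 (Eventually.of_forall hle)
  refine (derivNorm_top_le ((Lp.memLp u).sub (memLp_chi hβ h h1 ht)) l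
    ((memLp_congr_ae e').2 hb.memLp) (hi'.congr e'.symm)).trans (ENNReal.ofReal_le_ofReal ?_)
  refine (integral_congr_ae (e'.fun_comp norm)).trans_le ((integral_mono hi'.norm hi hle).trans ?_)
  rw [integral_const_mul]
  have hc0 : c ≤ (2 * Real.pi) ^ s * (1 + t) ^ (-((l : ℝ) / 2)) := by
    rw [hc]
    gcongr
    · linarith
    · omega
  refine (mul_le_mul hc0 ((l2Bd_inv_wt ht).integral_mul_le hw (by positivity) (by positivity))
    (integral_nonneg fun ξ => by positivity) (by positivity)).trans_eq ?_
  rw [show -(1 / 2 + b) - (l : ℝ) / 2 = -((l : ℝ) / 2) + (-(1 / 4) + -(1 / 4 + b)) by ring,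
    Real.rpow_add h1t, Real.rpow_add h1t]
  ring

end Difference

/-! ### Small data -/

/-- Data that are small in `Hˢ ∩ L¹` launch a solution on the Fourier side which fits the
decay estimates; the constants do not depend on the datum. -/
theorem exists_setting {s : ℕ} (hs : 1 ≤ s) {β : ℝ} (γ : ℝ) (hβ : β ≠ 0) :
    ∃ δ κ Ce : ℝ, 0 < δ ∧ 0 ≤ κ ∧ ∀ u₀ : ℝ → ℝ, Continuous u₀ → MemH s u₀ →
      sobolevNorm s u₀ ≤ ENNReal.ofReal δ → eLpNorm u₀ 1 volume ≤ ENNReal.ofReal δ →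
      ∃ f, Setting β γ (∫ y, u₀ y) s (𝓕 fun x => (u₀ x : ℂ)) κ κ Ce f := by
  obtain ⟨Cχ, hCχ, hχ⟩ := exists_norm_chiHat_le hβ (s + 1)
  obtain ⟨Ce, hCe, herr⟩ := exists_norm_chiErr_le hβ γ s
  have hCl := Clin_pos s
  have hCd := Cduh_pos s
  have hb : 0 < |β| := abs_pos.2 hβ
  have hpi := Real.pi_pos
  -- `κ` makes the map a contraction, `δ` makes the linear evolution fit into the ball
  set κ : ℝ := 1 / (8 * Real.pi * |β| * Cduh s) with hκ
  have hκ0 : 0 < κ := by positivity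
  have hκ1 : Real.pi * |β| * Cduh s * κ = 1 / 8 := by rw [hκ]; field_simp
  set δ : ℝ := min (min 1 (2 / |β|))
    (min (κ / (2 * Clin s * (2 + 2 ^ (s + 1)))) (κ / (2 * Cχ + 1))) with hδ
  have hδ0 : 0 < δ := by positivity
  have d1 : δ ≤ 1 := (min_le_left _ _).trans (min_le_left _ _)
  have d2 : δ * |β| ≤ 2 := (le_div_iff₀ hb).1 ((min_le_left _ _).trans (min_le_right _ _))
  have d3 : δ * (2 * Clin s * (2 + 2 ^ (s + 1))) ≤ κ :=
    (le_div_iff₀ (by positivity)).1 ((min_le_right _ _).trans (min_le_left _ _))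
  have d4 : δ * (2 * Cχ + 1) ≤ κ :=
    (le_div_iff₀ (by positivity)).1 ((min_le_right _ _).trans (min_le_right _ _))
  refine ⟨δ, κ, Ce, hδ0, hκ0.le, fun u₀ hc hH hS hL => ?_⟩
  have hi := integrable_of_eLpNorm hc hL
  have hlow := norm_fourier_le_of_eLpNorm hc hδ0.le hL
  have hwt := l2Bd_weight_fourier hi hH hS
  have hw : MemLp (fun ξ : ℝ => (((1 + |ξ|) ^ s : ℝ) : ℂ) * 𝓕 (fun x => (u₀ x : ℂ)) ξ) 2 volume := by
    simpa only [wt_zero] using hwt.memLp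
  have hf₀c : Continuous (𝓕 fun x => (u₀ x : ℂ)) := continuous_fourier hi.ofReal
  have hf₀i := integrable_of_weight hs hf₀c.aestronglyMeasurable hw
  obtain ⟨f, hf⟩ := exists_isFourierSol (β := β) (γ := γ) (r := κ / 8) (Λ := κ) hs hf₀c hf₀i
    (herm_fourier u₀) hδ0.le (by positivity) hlow hwt (by positivity) (by nlinarith)
    (by nlinarith) (by nlinarith)
  have hM : |∫ y, u₀ y| ≤ δ := by
    have h0 := hlow 0
    rw [Real.fourier_eq] at h0
    simp only [inner_zero_right, neg_zero, AddChar.map_zero_eq_one, one_smul] at h0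
    rwa [integral_complex_ofReal, Complex.norm_real, Real.norm_eq_abs] at h0
  have hβM : |β * ∫ y, u₀ y| ≤ 2 := by
    rw [abs_mul]; nlinarith
  have hM1 : |∫ y, u₀ y| ≤ 1 := hM.trans d1
  refine ⟨f, hs, hβ, hβM, hM1, hf, hκ0.le, hκ0.le, hCe, ?_, hf.integrable hs hw,
    hf.continuous_conv hs hf₀i hlow, fun t ht => ?_, fun t ht ξ => herr _ hβM hM1 t ht ξ,
    by nlinarith⟩
  · obtain ⟨r, hr, hd⟩ := hf.dom
    exact ⟨δ + r, fun t ξ => (hd t ξ).trans ((le_domF hs hr ξ).trans (domF_le hr hlow ξ))⟩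
  · refine (l2Bd_of_le_wt le_rfl ht (by positivity)
      (continuous_chiHat_right hβ hβM hM1 t).aestronglyMeasurable
      (hχ _ hβM hM1 t)).le (mul_le_mul_of_nonneg_right ?_ (by positivity))
    nlinarith

/-- The solution on the Fourier side converges to the diffusion wave at the rate given by the
decay `(1 + |x|)^(-α)` of the datum. -/
theorem exists_rate {s : ℕ} {β γ κ Ce δ : ℝ} (hκ : 0 ≤ κ) (hδ : 0 ≤ δ) {α K : ℝ} (hα1 : 1 < α)
    (hα2 : α < 2) : ∃ C, 0 ≤ C ∧ ∀ (u₀ : ℝ → ℝ) (f : ℝ → ℝ → ℂ), Continuous u₀ → MemH s u₀ →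
      sobolevNorm s u₀ ≤ ENNReal.ofReal δ → eLpNorm u₀ 1 volume ≤ ENNReal.ofReal δ →
      (∀ x, |u₀ x| ≤ K * (1 + |x|) ^ (-α)) →
      Setting β γ (∫ y, u₀ y) s (𝓕 fun x => (u₀ x : ℂ)) κ κ Ce f →
      ∀ t, 0 ≤ t → L2Bd (fun ξ => ((wt t ξ ^ s : ℝ) : ℂ) * wdiff β (∫ y, u₀ y) f t ξ)
        (C * (1 + t) ^ (-(1 / 4 + (α - 1) / 2))) := by
  obtain ⟨C, hC, hb⟩ := Setting.exists_l2Bd_wdiff β γ s κ κ Ce (a := α - 1) (K := K + 204)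
    (B := 2 ^ (s + 1) * δ + κ) (by linarith) (by linarith) (by positivity)
  refine ⟨C, hC, fun u₀ f hc hH hS hL hK S => ?_⟩
  have hi := integrable_of_eLpNorm hc hL
  have hwt := l2Bd_weight_fourier hi hH hS
  have hw : MemLp (fun ξ : ℝ => (((1 + |ξ|) ^ s : ℝ) : ℂ) * 𝓕 (fun x => (u₀ x : ℂ)) ξ) 2 volume := by
    simpa only [wt_zero] using hwt.memLp
  set M := ∫ y, u₀ y
  have hχi := integrable_chi S.hβ S.hM S.hM1 (le_refl 0)
  have hχ0 : ∀ x, chi β M 0 x = chiStar β M x := fun x => by simp [chi]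
  have hf0 : f 0 = 𝓕 fun x => (u₀ x : ℂ) := by
    funext ξ
    rw [S.sol.eq 0 le_rfl ξ, asym_zero, duh, intervalIntegral.integral_same]
    simp
  have hfg : wdiff β M f 0 = 𝓕 fun x => ((u₀ x - chi β M 0 x : ℝ) : ℂ) := by
    funext ξ
    rw [wdiff, hf0, ← fourier_chi le_rfl, Real.fourier_eq, Real.fourier_eq, Real.fourier_eq,
      ← integral_sub ((Real.fourierIntegral_convergent_iff ξ).2 hi.ofReal)
        ((Real.fourierIntegral_convergent_iff ξ).2 hχi.ofReal)]
    simp only [Complex.ofReal_sub, smul_sub]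
  refine hb M _ f (fun x => ((u₀ x - chi β M 0 x : ℝ) : ℂ)) S (S.sol.exists_dom hw)
    (Complex.continuous_ofReal.comp (hc.sub (continuous_chi S.hβ S.hM 0))) (fun x => ?_) ?_ hfg ?_
  · rw [Complex.norm_real, Real.norm_eq_abs, add_sub_cancel, add_mul]
    refine (abs_sub _ _).trans (add_le_add (hK x) ?_)
    rw [hχ0]
    refine (abs_chiStar_le S.hβ S.hM x).trans ?_
    have h1 := exp_neg_sq_le hα2.le x
    have h2 := S.hM1
    have h3 : 0 ≤ (1 + |x|) ^ (-α) := by positivity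
    calc 3 * |M| * Real.exp (-x ^ 2 / 4) ≤ 3 * 1 * (68 * (1 + |x|) ^ (-α)) := by gcongr
      _ = _ := by ring
  · rw [← hfg, wdiff, hf0, chiHat, zero_mul, chiFT_zero S.hβ S.hM S.hM1, Real.fourier_eq]
    simp only [inner_zero_right, neg_zero, AddChar.map_zero_eq_one, one_smul]
    rw [integral_complex_ofReal, sub_self]
  · have h1 := S.wave 0 le_rfl
    rw [add_zero, Real.one_rpow, mul_one] at h1
    refine hwt.of_le_add h1 (by positivity) hκ ((continuous_wt_pow 0 s).mul
      ((S.sol.continuous_apply 0).sub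
        (continuous_chiHat_right S.hβ S.hM S.hM1 0))).aestronglyMeasurable fun ξ => ?_
    rw [wdiff, hf0, mul_sub]
    exact norm_sub_le _ _

/-- Global existence and uniqueness for small data, and convergence to the diffusion wave for data
that decay at a rate `1 < α < 2`. -/
theorem exists_mild_decay {s : ℕ} (hs : 1 ≤ s) {β : ℝ} (γ : ℝ) (hβ : β ≠ 0) :
    ∃ δ : ℝ, 0 < δ ∧ ∃ C : ℝ → ℝ → ℝ, ∀ u₀ : ℝ → ℝ, Continuous u₀ → MemH s u₀ →
      sobolevNorm s u₀ + eLpNorm u₀ 1 volume ≤ ENNReal.ofReal δ →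
      ∃ u : ℝ → L2, IsGlobalMildSolution β γ s u₀ u ∧ ∀ α K, 1 < α → α < 2 →
        (∀ x, |u₀ x| ≤ K * (1 + |x|) ^ (-α)) → 0 ≤ C α K ∧ ∀ t, 0 ≤ t →
        (∀ l ≤ s, derivNorm l 2 (fun x => u t x - chi β (∫ y, u₀ y) t x)
          ≤ ENNReal.ofReal (C α K * (1 + t) ^ (-α / 2 + 1 / 4 - (l : ℝ) / 2))) ∧
        (∀ l ≤ s - 1, derivNorm l ∞ (fun x => u t x - chi β (∫ y, u₀ y) t x)
          ≤ ENNReal.ofReal (C α K * (1 + t) ^ (-α / 2 - (l : ℝ) / 2))) := by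
  obtain ⟨δ, κ, Ce, hδ, hκ, hex⟩ := exists_setting hs γ hβ
  have hrate := fun (α K : ℝ) (h : 1 < α ∧ α < 2) =>
    exists_rate (s := s) (β := β) (γ := γ) (Ce := Ce) (K := K) hκ hδ.le h.1 h.2
  choose! C hC hb using hrate
  refine ⟨δ, hδ, fun α K => 2 * (2 * Real.pi) ^ s * C α K, fun u₀ hc hH hsmall => ?_⟩
  have hS := (le_self_add).trans hsmall
  have hL := (le_add_self).trans hsmall
  obtain ⟨f, S⟩ := hex u₀ hc hH hS hL
  have hi := integrable_of_eLpNorm hc hL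
  obtain ⟨u, hu, hf⟩ := exists_mild hs hi hH.1 rfl hκ S.sol
    (by simpa only [wt_zero] using (l2Bd_weight_fourier hi hH hS).memLp)
  have hpi := Real.pi_pos
  refine ⟨u, hu, fun α K h1 h2 hK => ⟨?_, fun t ht => ?_⟩⟩
  · have := hC α K ⟨h1, h2⟩
    positivity
  have h0 := hC α K ⟨h1, h2⟩
  have hw := hb α K ⟨h1, h2⟩ u₀ f hc hH hS hL hK S t ht
  have h1t : 0 < 1 + t := by linarith
  refine ⟨fun l hl => (derivNorm_two_sub_chi_le hβ S.hM S.hM1 ht (hf t) hw hl).trans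
    (ENNReal.ofReal_le_ofReal ?_), fun l hl => (derivNorm_top_sub_chi_le hs hβ S.hM S.hM1 ht h0
    (hf t) hw hl).trans_eq (congrArg _ (congrArg _ (congrArg _ (by ring))))⟩
  rw [show -(1 / 4 + (α - 1) / 2) - (l : ℝ) / 2 = -α / 2 + 1 / 4 - (l : ℝ) / 2 by ring]
  refine mul_le_mul_of_nonneg_right ?_ (by positivity)
  have : 0 ≤ (2 * Real.pi) ^ s * C α K := by positivity
  linarith

end BBMBurgers

end

theorem theorem1p1 (s : ℕ) (hs : 1 ≤ s) (β γ : ℝ) (hβ : β ≠ 0) :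
    ∃ δ : ℝ, 0 < δ ∧ ∃ C : ℝ → ℝ → ℝ → ℝ,
      ∀ (α K : ℝ) (u₀ : ℝ → ℝ), 1 < α → Continuous u₀ →
        (∀ x : ℝ, |u₀ x| ≤ K * (1 + |x|) ^ (-α)) →
        BBMBurgers.MemH s u₀ →
        BBMBurgers.sobolevNorm s u₀ + eLpNorm u₀ 1 volume ≤ ENNReal.ofReal δ →
        ∃ u : ℝ → BBMBurgers.L2,
          BBMBurgers.IsGlobalMildSolution β γ s u₀ u ∧
          (∀ v : ℝ → BBMBurgers.L2, BBMBurgers.IsGlobalMildSolution β γ s u₀ v →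
            ∀ t : ℝ, 0 ≤ t → v t = u t) ∧
          ∀ ε : ℝ, 0 < ε → ∀ t : ℝ, 0 ≤ t →
            (∀ l : ℕ, l ≤ s →
              BBMBurgers.derivNorm l 2 (fun x => u t x - BBMBurgers.chi β (∫ y, u₀ y) t x) ≤
                ENNReal.ofReal (C α K ε *
                  if α < 2 then (1 + t) ^ (-α / 2 + 1 / 4 - (l : ℝ) / 2)
                  else (1 + t) ^ (-(3 / 4 : ℝ) - (l : ℝ) / 2 + ε))) ∧
            (∀ l : ℕ, l ≤ s - 1 →
              BBMBurgers.derivNorm l ∞ (fun x => u t x - BBMBurgers.chi β (∫ y, u₀ y) t x) ≤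
                ENNReal.ofReal (C α K ε *
                  if α < 2 then (1 + t) ^ (-α / 2 - (l : ℝ) / 2)
                  else (1 + t) ^ (-1 - (l : ℝ) / 2 + ε))) := by
  obtain ⟨δ, hδ, C, h⟩ := BBMBurgers.exists_mild_decay hs γ hβ
  -- a datum with `α ≥ 2` is treated with a decay rate slightly below `2`
  refine ⟨δ, hδ, fun α K ε => if α < 2 then C α K else C (2 - 2 * min ε (1 / 4)) K,
    fun α K u₀ hα hc hK hH hsmall => ?_⟩
  obtain ⟨u, hu, hd⟩ := h u₀ hc hH hsmall
  refine ⟨u, hu, fun v hv t ht => BBMBurgers.mild_unique hs hu hv ht, fun ε hε t ht => ?_⟩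
  by_cases hα2 : α < 2
  · simp only [if_pos hα2]
    exact (hd α K hα hα2 hK).2 t ht
  simp only [if_neg hα2]
  have hm0 : 0 < min ε (1 / 4) := lt_min hε (by norm_num)
  have hm1 : min ε (1 / 4) ≤ 1 / 4 := min_le_right _ _
  have hm2 : min ε (1 / 4) ≤ ε := min_le_left _ _
  set m := min ε (1 / 4)
  have hK0 : 0 ≤ K := by simpa using (abs_nonneg _).trans (hK 0)
  obtain ⟨hC, hb⟩ := hd (2 - 2 * m) K (by linarith) (by linarith) fun x =>
    (hK x).trans (mul_le_mul_of_nonneg_left (Real.rpow_le_rpow_of_exponent_le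
      (by linarith [abs_nonneg x]) (by linarith)) hK0)
  have hrpow : ∀ p q : ℝ, p ≤ q → ENNReal.ofReal (C (2 - 2 * m) K * (1 + t) ^ p)
      ≤ ENNReal.ofReal (C (2 - 2 * m) K * (1 + t) ^ q) := fun p q hpq =>
    ENNReal.ofReal_le_ofReal (mul_le_mul_of_nonneg_left
      (Real.rpow_le_rpow_of_exponent_le (by linarith) hpq) hC)
  exact ⟨fun l hl => ((hb t ht).1 l hl).trans (hrpow _ _ (by linarith)),
    fun l hl => ((hb t ht).2 l hl).trans (hrpow _ _ (by linarith))⟩
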